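/- **Notation.** Let $d,r,\lambda\in\mathbb N$ with $d,r\ge1$, $\lambda\ge2$, and $m\in\mathbb N_0$. Let $l_0^{s\times t}$ be the space of finitely supported $u:\mathbb Z^d\to\mathbb C^{s\times t}$, and put $\hat u(\xi)=\sum_k u(k)e^{-ik\cdot\xi}$, $[v*w](k)=\sum_z v(z)w(k-z)$ and $[S_av](k)=\lambda^d\sum_z v(z)a(k-\lambda z)$. Let $\delta(0)=1$ and $\delta(k)=0$ for $k\ne0$. Norms of matrix-valued objects are sums of the norms of the entries. For smooth $f,g$, $f(\xi)=g(\xi)+O(\|\xi\|^N)$ as $\xi\to0$ means $\partial^\mu f(0)=\partial^\mu g(0)$ for all $|\mu|<N$. An *order $N$ matching filter* of $a\in l_0^{r\times r}$ is $y\in l_0^{1\times r}$ with $\hat y(0)\neq0$ and $\hat y(\lambda\xi)\hat a(\xi+2\pi\omega)=\delta(\omega)\hat y(\xi)+O(\|\xi\|^N)$ as $\xi\to0$ for all $\omega\in\lambda^{-1}\mathbb Z^d\cap[0,1)^d$. The Fourier transform is $\hat f(\xi)=\int f(x)e^{-ix\cdot\xi}\,dx$, extended to compactly supported distributions by $\hat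 f(\xi)=\langle f,e^{-ix\cdot\xi}\rangle$. The *smoothness exponent* is $\mathrm{sm}_\infty(a,\lambda I_d)=-\log_\lambda\rho$ (equal to $+\infty$ if $\rho=0$), where $\rho$ is the infimum, over all $N\in\mathbb N_0$ and all order $N$ matching filters $y$ of $a$, of $$\sup\Big\{\limsup_{n\to\infty}\big\|[S_a^n(\delta I_r)]*w\big\|_{\ell_\infty}^{1/n}:\ w\in l_0^{r\times1},\ \hat y(\xi)\hat w(\xi)=O(\|\xi\|^N)\ (\xi\to0)\Big\}.$$ For $\upsilon\in l_0^{1\times r}$ and $\mu\in\mathbb N_0^d$, put $\beta_{\upsilon,u,\mu}=\partial^\mu[\hat\upsilon\hat u](0)/(i^{|\mu|}\mu!)$ and let $\mathcal M_{\upsilon,\mu}$ be the space of $u\in l_0^{r\times1}$ with $\hat\upsilon(\xi)\hat u(\xi)=\beta_{\upsilon,u,\mu}(i\xi)^\mu+O(\|\xi\|^{|\mu|+1})$ as $\xi\to0$. A set $G\subseteq\mathcal M_{\upsilon,\mu}$ *generates* $\mathcal M_{\upsilon,\mu}$ if each $w\in\mathcal M_{\upsilon,\mu}$ is a finite sum $\sum_jw_j*c_j$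 with $w_j\in G$ and $c_j\in l_0^{1\times1}$. **Theorem 1.2.** Let $a\in l_0^{r\times r}$ have an order $m+1$ matching filter $\upsilon_a$. Assume that $1$ is a simple eigenvalue of $\hat a(0)$ and that all other eigenvalues of $\hat a(0)$ have modulus smaller than $\lambda^{-m}$. Then there is a unique $r\times1$ vector $\phi$ of compactly supported distributions on $\mathbb R^d$ with $\hat\phi(\lambda\xi)=\hat a(\xi)\hat\phi(\xi)$ for all $\xi\in\mathbb R^d$ and $\hat\upsilon_a(0)\hat\phi(0)=1$. For each $\mu$ with $|\mu|\le m$ let $G_\mu$ be any set that generates $\mathcal M_{\upsilon_a,\mu}$, and for each $\mu$ with $|\mu|=m$ let $H_\mu$ be any set that generates $\mathcal M_{\upsilon_a,\mu}$. For $\phi\in (C^m(\mathbb R^d))^{r\times1}$, $|\mu|\le m$ and $u\in\mathcal M_{\upsilon_a,\mu}$ consider $$\lim_{n\to\infty}\big\|\lambda^{|\mu|n}(S_a^n(\delta I_r))*u-\beta_{\upsilon_a,u,\mu}\,\partial^\mu\phi(\lambda^{-n}\cdot)\big\|_{\ell_\infty(\mathbb Z^d)}=0.\tag{$*$}$$ The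 following are equivalent: 1. $\mathrm{sm}_\infty(a,\lambda I_d)>m$. 2. $\phi\in (C^m(\mathbb R^d))^{r\times1}$, and $(*)$ holds for all $|\mu|\le m$ and all $u\in\mathcal M_{\upsilon_a,\mu}$. 3. $\phi\in (C^m(\mathbb R^d))^{r\times1}$, and $(*)$ holds for all $|\mu|\le m$ and all $u\in G_\mu$. 4. $\phi\in (C^m(\mathbb R^d))^{r\times1}$, and for some $\mu$ with $|\mu|=m$, $(*)$ holds for all $u\in H_\mu$. 5. The vector subdivision scheme of $a$ is $C^m$-convergent: for every $v\in l_0^{1\times r}$ there is $\eta_v\in C^m(\mathbb R^d)$ such that for all $|\mu|\le m$ and all $u\in\mathcal M_{\upsilon_a,\mu}$, $\lim_{n\to\infty}\|\lambda^{|\mu|n}(S_a^nv)*u-\beta_{\upsilon_a,u,\mu}\,\partial^\mu\eta_v(\lambda^{-n}\cdot)\|_{\ell_\infty(\mathbb Z^d)}=0$. If 1 holds, then the vector cascade algorithm is $C^m$-convergent: $\phi\in (C^m(\mathbb R^d))^{r\times1}$ and $R_a^n\psi\to\phi$ in $(W_\infty^m(\mathbb R^d))^{r\times1}$, where $[R_a\psi](x)=\lambda^d\sum_ka(k)\psi(\lambda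 x-k)$, for every compactly supported $\psi\in (W_\infty^m(\mathbb R^d))^{r\times1}$ with $\hat\upsilon_a(0)\hat\psi(0)=1$ and $\hat\upsilon_a(\xi)\hat\psi(\xi+2\pi k)=O(\|\xi\|^{m+1})$ as $\xi\to0$ for all $k\in\mathbb Z^d\setminus\{0\}$. If $\phi\in (C^m(\mathbb R^d))^{r\times1}$ and $\phi$ has stable integer shifts, i.e. $\mathrm{span}\{\hat\phi(\xi+2\pi k):k\in\mathbb Z^d\}=\mathbb C^{r\times1}$ for all $\xi\in\mathbb R^d$, then 1–5 all hold. -/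

import Mathlib

noncomputable section

namespace VectorSubdivision

open Filter Topology MeasureTheory
open scoped ENNReal ContDiff

/-! ### Multi-indices, partial derivatives, Taylor agreement at the origin -/

/-- The degree `|μ| = μ₁ + ⋯ + μ_d` of a multi-index. -/
def deg {d : ℕ} (μ : Fin d → ℕ) : ℕ := ∑ i, μ i

/-- The partial derivative `∂_j f`. -/
def pderiv {d : ℕ} (j : Fin d) (f : (Fin d → ℝ) → ℂ) : (Fin d → ℝ) → ℂ :=
  fun x => lineDeriv ℝ f x (Pi.single j 1)

/-- `∂^μ f = ∂_1^{μ_1} ⋯ ∂_d^{μ_d} f`. -/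
def mderiv {d : ℕ} (μ : Fin d → ℕ) (f : (Fin d → ℝ) → ℂ) : (Fin d → ℝ) → ℂ :=
  (List.finRange d).foldr (fun j h => (pderiv j)^[μ j] h) f

/-- `f(ξ) = g(ξ) + O(‖ξ‖^N)` as `ξ → 0`, in the sense that the entries of the matrices `f` and `g`
have the same partial derivatives at `0` of all orders `< N`. -/
def AgreeToOrder {d s t : ℕ} (N : ℕ) (f g : (Fin d → ℝ) → Matrix (Fin s) (Fin t) ℂ) : Prop :=
  ∀ μ : Fin d → ℕ, deg μ < N → ∀ i j,
    mderiv μ (fun ξ => f ξ i j) 0 = mderiv μ (fun ξ => g ξ i j) 0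

/-! ### Filters, convolution, subdivision -/

/-- Finitely supported `s × t` matrix-valued filters on `ℤ^d`. -/
abbrev Filt (d s t : ℕ) : Type := (Fin d → ℤ) →₀ Matrix (Fin s) (Fin t) ℂ

theorem finite_support_aux {d s r t : ℕ} (c : ℂ) (L : ℕ) (v : Filt d s r) (w : Filt d r t) :
    (Function.support fun k : Fin d → ℤ =>
      c • v.sum fun z A => A * w (k - L • z)).Finite := by
  refine Set.Finite.subset (Set.Finite.biUnion (v.support.finite_toSet)
    (t := fun z => (fun k : Fin d → ℤ => k - L • z) ⁻¹' (w.support : Set (Fin d → ℤ)))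
    (fun z _ => Set.Finite.preimage (fun x _ y _ h => by simpa using h)
      w.support.finite_toSet)) ?_
  intro k hk
  by_contra hcon
  simp only [Set.mem_iUnion, Set.mem_preimage, Finset.mem_coe, Finsupp.mem_support_iff,
    not_exists, not_not] at hcon
  apply hk
  have h0 : (v.sum fun z A => A * w (k - L • z)) = 0 := by
    refine Finset.sum_eq_zero fun z hz => ?_
    change v z * w (k - L • z) = 0
    rw [hcon z (by simpa using hz), Matrix.mul_zero]
  simp only [h0, smul_zero]

/-- The convolution `[v * w](k) = ∑_z v(z) w(k - z)`. -/
def conv {d s r t : ℕ} (v : Filt d s r) (w : Filt d r t) : Filt d s t :=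
  Finsupp.ofSupportFinite (fun k => v.sum fun z A => A * w (k - z))
    (by simpa using finite_support_aux 1 1 v w)

/-- The vector subdivision operator `[S_a v](k) = λ^d ∑_z v(z) a(k - λ z)`. -/
def subdiv {d s r : ℕ} (lam : ℕ) (a : Filt d r r) (v : Filt d s r) : Filt d s r :=
  Finsupp.ofSupportFinite
    (fun k => ((lam : ℂ) ^ d) • v.sum fun z A => A * a (k - lam • z))
    (finite_support_aux _ lam v a)

/-- The filter `δ I_r`. -/
def deltaI (d r : ℕ) : Filt d r r := Finsupp.single 0 1

/-- The norm `∑_{i,j} ‖f_{ij}‖_{ℓ^∞(ℤ^d)}`, with values in `[0, ∞]`. -/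
def supNorm {d s t : ℕ} (f : (Fin d → ℤ) → Matrix (Fin s) (Fin t) ℂ) : ℝ≥0∞ :=
  ∑ i, ∑ j, ⨆ k, ‖f k i j‖ₑ

/-- The character `e^{-i x·ξ}`. -/
def expo {d : ℕ} (x ξ : Fin d → ℝ) : ℂ :=
  Complex.exp (-Complex.I * ((∑ i, x i * ξ i : ℝ) : ℂ))

/-- An integer vector as a real vector. -/
def toR {d : ℕ} (k : Fin d → ℤ) : Fin d → ℝ := fun i => (k i : ℝ)

/-- The Fourier series `û(ξ) = ∑_k u(k) e^{-i k·ξ}`. -/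
def fourierSeries {d s t : ℕ} (u : Filt d s t) (ξ : Fin d → ℝ) : Matrix (Fin s) (Fin t) ℂ :=
  u.sum fun k A => expo (toR k) ξ • A

/-! ### Matching filters and moment spaces -/

/-- `Ω = (λ⁻¹ ℤ^d) ∩ [0,1)^d`. -/
def cosetReps (d lam : ℕ) : Set (Fin d → ℝ) :=
  {w | (∃ k : Fin d → ℤ, w = (lam : ℝ)⁻¹ • toR k) ∧ ∀ i, 0 ≤ w i ∧ w i < 1}

open Classical in
/-- `y` is an order `N` matching filter of `a`: `ŷ(0) ≠ 0` and, for every `w ∈ Ω`,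
`ŷ(λξ) â(ξ + 2πw) = δ(w) ŷ(ξ) + O(‖ξ‖^N)` as `ξ → 0`. -/
def IsMatchingFilter {d r : ℕ} (lam N : ℕ) (a : Filt d r r) (y : Filt d 1 r) : Prop :=
  fourierSeries y 0 ≠ 0 ∧ ∀ w ∈ cosetReps d lam,
    AgreeToOrder N
      (fun ξ => fourierSeries y ((lam : ℝ) • ξ) * fourierSeries a (ξ + (2 * Real.pi) • w))
      (fun ξ => if w = 0 then fourierSeries y ξ else 0)

/-- `1` is an (algebraically) simple eigenvalue of `â(0)` and all its other eigenvalues have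
modulus smaller than `λ^{-m}`. -/
def EigenCondition {d r : ℕ} (lam m : ℕ) (a : Filt d r r) : Prop :=
  (fourierSeries a 0).charpoly.rootMultiplicity 1 = 1 ∧
    ∀ z : ℂ, (fourierSeries a 0).charpoly.IsRoot z → z ≠ 1 → ‖z‖ < ((lam : ℝ) ^ m)⁻¹

/-- `β_{υ,u,μ} = ∂^μ[υ̂ û](0) / (i^{|μ|} μ!)`. -/
def beta {d r : ℕ} (υ : Filt d 1 r) (u : Filt d r 1) (μ : Fin d → ℕ) : ℂ :=
  mderiv μ (fun ξ => (fourierSeries υ ξ * fourierSeries u ξ) 0 0) 0 /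
    (Complex.I ^ deg μ * ((∏ i, (μ i).factorial : ℕ) : ℂ))

/-- The moment space of all `u` with
`υ̂(ξ) û(ξ) = β_{υ,u,μ} (iξ)^μ + O(‖ξ‖^{|μ|+1})` as `ξ → 0`. -/
def momentSpace {d r : ℕ} (υ : Filt d 1 r) (μ : Fin d → ℕ) : Set (Filt d r 1) :=
  {u | AgreeToOrder (deg μ + 1) (fun ξ => fourierSeries υ ξ * fourierSeries u ξ)
    (fun ξ => Matrix.of fun _ _ => beta υ u μ * ∏ i, (Complex.I * (ξ i : ℂ)) ^ μ i)}

/-- `G` generates the moment space: `G` is a subset of it, and each of its elements is a finite sum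
`w₁ * c₁ + ⋯ + w_t * c_t` with `w_j ∈ G` and scalar filters `c_j`. -/
def Generates {d r : ℕ} (υ : Filt d 1 r) (μ : Fin d → ℕ) (G : Set (Filt d r 1)) : Prop :=
  G ⊆ momentSpace υ μ ∧ ∀ w ∈ momentSpace υ μ,
    ∃ (t : ℕ) (ws : Fin t → Filt d r 1) (cs : Fin t → Filt d 1 1),
      (∀ j, ws j ∈ G) ∧ w = ∑ j, conv (ws j) (cs j)

/-! ### The smoothness exponent -/

/-- The filters `w` with `ŷ(ξ) ŵ(ξ) = O(‖ξ‖^N)` as `ξ → 0` (all filters if `N = 0`);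
usually written `V_{N-1,y}`. -/
def vanishingSpace {d r : ℕ} (N : ℕ) (y : Filt d 1 r) : Set (Filt d r 1) :=
  {w | AgreeToOrder N (fun ξ => fourierSeries y ξ * fourierSeries w ξ) 0}

/-- `ρ_N(a, λI_d, y)_∞ = sup_w limsup_n ‖[S_a^n(δI_r)] * w‖_∞^{1/n}` over `w ∈ V_{N-1,y}`. -/
def rhoOrder {d r : ℕ} (lam N : ℕ) (a : Filt d r r) (y : Filt d 1 r) : ℝ≥0∞ :=
  ⨆ w ∈ vanishingSpace N y,
    limsup (fun n : ℕ =>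
      supNorm (⇑(conv ((subdiv lam a)^[n] (deltaI d r)) w)) ^ (1 / (n : ℝ))) atTop

/-- `ρ(a, λI_d)_∞`: the infimum of `ρ_N(a, λI_d, y)_∞` over all orders `N` and all order `N`
matching filters `y` of `a`. -/
def rho {d r : ℕ} (lam : ℕ) (a : Filt d r r) : ℝ≥0∞ :=
  ⨅ (N : ℕ) (y : Filt d 1 r) (_ : IsMatchingFilter lam N a y), rhoOrder lam N a y

/-- The `L_∞`-smoothness exponent `sm_∞(a, λI_d) = - log_λ ρ(a, λI_d)_∞`. -/
def smInfty {d r : ℕ} (lam : ℕ) (a : Filt d r r) : EReal :=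
  -(ENNReal.log (rho lam a) / ((Real.log lam : ℝ) : EReal))

/-! ### Compactly supported distributions and the standard refinable vector function -/

/-- The space `C^∞(ℝ^d)` of smooth complex-valued functions. -/
def smoothSpace (d : ℕ) : Submodule ℂ ((Fin d → ℝ) → ℂ) where
  carrier := {f | ContDiff ℝ ∞ f}
  add_mem' {f g} hf hg := by
    have hf' : ContDiff ℝ ∞ f := hf
    have hg' : ContDiff ℝ ∞ g := hg
    exact hf'.add hg'
  zero_mem' := by
    have h : ContDiff ℝ ∞ fun _ : Fin d → ℝ => (0 : ℂ) := contDiff_const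
    exact h
  smul_mem' c f hf := by
    have hf' : ContDiff ℝ ∞ f := hf
    exact hf'.const_smul c

/-- Compactly supported distributions on `ℝ^d`, that is, continuous linear functionals on
`C^∞(ℝ^d)`; continuity means a bound by finitely many derivatives on some compact set. -/
@[ext]
structure CompactDistribution (d : ℕ) where
  /-- the functional -/
  toLin : smoothSpace d →ₗ[ℂ] ℂ
  bound' : ∃ (C : ℝ) (N : ℕ) (K : Set (Fin d → ℝ)), IsCompact K ∧
    ∀ (f : smoothSpace d) (B : ℝ),
      (∀ n ≤ N, ∀ x ∈ K, ‖iteratedFDeriv ℝ n (f : (Fin d → ℝ) → ℂ) x‖ ≤ B) →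
        ‖toLin f‖ ≤ C * B

/-- The smooth function `x ↦ e^{-i x·ξ}`. -/
def expoSmooth {d : ℕ} (ξ : Fin d → ℝ) : smoothSpace d :=
  ⟨fun x => expo x ξ, by
    change ContDiff ℝ ∞ fun x : Fin d → ℝ =>
      Complex.exp (-Complex.I * ((∑ i, x i * ξ i : ℝ) : ℂ))
    have h0 : ContDiff ℝ ∞ fun x : Fin d → ℝ => ∑ i, x i * ξ i :=
      ContDiff.sum fun i _ => (contDiff_apply ℝ ℝ i).mul contDiff_const
    have h : ContDiff ℝ ∞ fun x : Fin d → ℝ => ((∑ i, x i * ξ i : ℝ) : ℂ) :=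
      Complex.ofRealCLM.contDiff.comp h0
    exact (contDiff_const.mul h).cexp⟩

/-- The Fourier transform `φ̂(ξ) = ⟨φ, e^{-i x·ξ}⟩` of a vector of compactly supported
distributions, as a column vector. -/
def distFourier {d r : ℕ} (φ : Fin r → CompactDistribution d) (ξ : Fin d → ℝ) :
    Matrix (Fin r) (Fin 1) ℂ :=
  Matrix.of fun j _ => (φ j).toLin (expoSmooth ξ)

/-- `φ` satisfies `φ̂(λξ) = â(ξ) φ̂(ξ)` for all `ξ`, and `υ̂(0) φ̂(0) = 1`. -/
def IsStandardRefinable {d r : ℕ} (lam : ℕ) (a : Filt d r r) (υ : Filt d 1 r)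
    (φ : Fin r → CompactDistribution d) : Prop :=
  (∀ ξ : Fin d → ℝ, distFourier φ ((lam : ℝ) • ξ) = fourierSeries a ξ * distFourier φ ξ) ∧
    fourierSeries υ 0 * distFourier φ 0 = 1

/-- The distributions `φ_j` are given by the `C^m` functions `g_j`. -/
def IsCmRepresentative {d r : ℕ} (m : ℕ) (φ : Fin r → CompactDistribution d)
    (g : Fin r → (Fin d → ℝ) → ℂ) : Prop :=
  ∀ j, ContDiff ℝ m (g j) ∧
    ∀ θ : smoothSpace d, HasCompactSupport (θ : (Fin d → ℝ) → ℂ) →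
      (φ j).toLin θ = ∫ x, (θ : (Fin d → ℝ) → ℂ) x * g j x

/-- Stable integer shifts: `span {φ̂(ξ + 2πk) : k ∈ ℤ^d} = ℂ^r` for every `ξ ∈ ℝ^d`. -/
def HasStableShifts {d r : ℕ} (φ : Fin r → CompactDistribution d) : Prop :=
  ∀ ξ : Fin d → ℝ, Submodule.span ℂ
    (Set.range fun k : Fin d → ℤ => distFourier φ (ξ + (2 * Real.pi) • toR k)) = ⊤

/-! ### Convergence of subdivision schemes -/

/-- `‖λ^{|μ|n} (S_a^n(δI_r)) * u - β_{υ,u,μ} ∂^μ g(λ^{-n}·)‖_{ℓ^∞(ℤ^d)} → 0`. -/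
def FilterConverges {d r : ℕ} (lam : ℕ) (a : Filt d r r) (υ : Filt d 1 r)
    (g : Fin r → (Fin d → ℝ) → ℂ) (μ : Fin d → ℕ) (u : Filt d r 1) : Prop :=
  Tendsto (fun n : ℕ => supNorm fun k =>
      (lam : ℂ) ^ (deg μ * n) • conv ((subdiv lam a)^[n] (deltaI d r)) u k -
        beta υ u μ • Matrix.of fun j (_ : Fin 1) => mderiv μ (g j) (((lam : ℝ) ^ n)⁻¹ • toR k))
    atTop (𝓝 0)

/-- `φ ∈ (C^m)^r`, and the convergence holds for all `|μ| ≤ m` and all `u ∈ U μ`. -/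
def ConvergesAllOrders {d r : ℕ} (lam m : ℕ) (a : Filt d r r) (υ : Filt d 1 r)
    (φ : Fin r → CompactDistribution d) (U : (Fin d → ℕ) → Set (Filt d r 1)) : Prop :=
  ∃ g, IsCmRepresentative m φ g ∧
    ∀ μ : Fin d → ℕ, deg μ ≤ m → ∀ u ∈ U μ, FilterConverges lam a υ g μ u

/-- `φ ∈ (C^m)^r`, and for some `μ` with `|μ| = m` the convergence holds for all `u ∈ U μ`. -/
def ConvergesTopOrder {d r : ℕ} (lam m : ℕ) (a : Filt d r r) (υ : Filt d 1 r)
    (φ : Fin r → CompactDistribution d) (U : (Fin d → ℕ) → Set (Filt d r 1)) : Prop :=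
  ∃ g, IsCmRepresentative m φ g ∧
    ∃ μ : Fin d → ℕ, deg μ = m ∧ ∀ u ∈ U μ, FilterConverges lam a υ g μ u

/-- `C^m`-convergence of the vector subdivision scheme: for every initial data `v` there is
`η ∈ C^m(ℝ^d)` with `‖λ^{|μ|n} (S_a^n v) * u - β_{υ,u,μ} ∂^μ η(λ^{-n}·)‖_{ℓ^∞(ℤ^d)} → 0` for all
`|μ| ≤ m` and all `u` in the moment space of `μ`. -/
def SubdivisionCmConvergent {d r : ℕ} (lam m : ℕ) (a : Filt d r r) (υ : Filt d 1 r) : Prop :=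
  ∀ v : Filt d 1 r, ∃ η : (Fin d → ℝ) → ℂ, ContDiff ℝ m η ∧
    ∀ μ : Fin d → ℕ, deg μ ≤ m → ∀ u ∈ momentSpace υ μ,
      Tendsto (fun n : ℕ => supNorm fun k =>
          (lam : ℂ) ^ (deg μ * n) • conv ((subdiv lam a)^[n] v) u k -
            beta υ u μ • Matrix.of fun (_ _ : Fin 1) =>
              mderiv μ η (((lam : ℝ) ^ n)⁻¹ • toR k))
        atTop (𝓝 0)

/-! ### Convergence of the cascade algorithm in `W_∞^m` -/

/-- `h` is the weak derivative `∂^μ f` of `f` on `ℝ^d`. -/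
def IsWeakDeriv {d : ℕ} (μ : Fin d → ℕ) (f h : (Fin d → ℝ) → ℂ) : Prop :=
  ∀ θ : (Fin d → ℝ) → ℂ, ContDiff ℝ ∞ θ → HasCompactSupport θ →
    ∫ x, f x * mderiv μ θ x = (-1) ^ deg μ * ∫ x, h x * θ x

/-- `f ∈ W_∞^m(ℝ^d)`: `f` and its weak derivatives of order at most `m` are in `L_∞`. -/
def MemSobolev {d : ℕ} (m : ℕ) (f : (Fin d → ℝ) → ℂ) : Prop :=
  MemLp f ⊤ volume ∧
    ∀ μ : Fin d → ℕ, deg μ ≤ m → ∃ h, MemLp h ⊤ volume ∧ IsWeakDeriv μ f h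

/-- `‖f‖_{W_∞^m} = ∑_{|μ| ≤ m} ‖∂^μ f‖_{L_∞}`, with weak derivatives (which are unique up to null
sets); the value is `∞` if some of them is not in `L_∞`. -/
def sobolevNorm {d : ℕ} (m : ℕ) (f : (Fin d → ℝ) → ℂ) : ℝ≥0∞ :=
  ∑ q ∈ Finset.range (m + 1), ∑ μ ∈ Finset.piAntidiag (Finset.univ : Finset (Fin d)) q,
    ⨅ (h : (Fin d → ℝ) → ℂ) (_ : MemLp h ⊤ volume ∧ IsWeakDeriv μ f h), eLpNorm h ⊤ volume

/-- The cascade operator `[R_a ψ](x) = λ^d ∑_k a(k) ψ(λx - k)`. -/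
def cascade {d r : ℕ} (lam : ℕ) (a : Filt d r r) (ψ : Fin r → (Fin d → ℝ) → ℂ) :
    Fin r → (Fin d → ℝ) → ℂ :=
  fun i x => (lam : ℂ) ^ d * a.sum fun k A => ∑ j, A i j * ψ j ((lam : ℝ) • x - toR k)

/-- The Fourier transform `ψ̂(ξ) = ∫ ψ(x) e^{-i x·ξ} dx` of a vector function, as a column. -/
def vecFourier {d r : ℕ} (ψ : Fin r → (Fin d → ℝ) → ℂ) (ξ : Fin d → ℝ) :
    Matrix (Fin r) (Fin 1) ℂ :=
  Matrix.of fun j _ => ∫ x, ψ j x * expo x ξ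

/-- Order `N` admissibility: `υ̂(0) ψ̂(0) = 1`, and `υ̂(ξ) ψ̂(ξ + 2πk) = O(‖ξ‖^N)` as `ξ → 0`
for all `k ∈ ℤ^d \ {0}`. -/
def Admissible {d r : ℕ} (N : ℕ) (υ : Filt d 1 r) (ψ : Fin r → (Fin d → ℝ) → ℂ) : Prop :=
  fourierSeries υ 0 * vecFourier ψ 0 = 1 ∧
    ∀ k : Fin d → ℤ, k ≠ 0 →
      AgreeToOrder N (fun ξ => fourierSeries υ ξ * vecFourier ψ (ξ + (2 * Real.pi) • toR k)) 0

/-- `φ` is given by a `C^m` vector function `g`, and `R_a^n ψ → g` in `W_∞^m` for every compactly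
supported `ψ ∈ (W_∞^m)^r` that satisfies the order `m + 1` admissibility condition. -/
def CascadeCmConvergent {d r : ℕ} (lam m : ℕ) (a : Filt d r r) (υ : Filt d 1 r)
    (φ : Fin r → CompactDistribution d) : Prop :=
  ∃ g, IsCmRepresentative m φ g ∧
    ∀ ψ : Fin r → (Fin d → ℝ) → ℂ,
      (∀ j, HasCompactSupport (ψ j) ∧ MemSobolev m (ψ j)) → Admissible (m + 1) υ ψ →
        Tendsto (fun n : ℕ => ∑ j, sobolevNorm m ((cascade lam a)^[n] ψ j - g j)) atTop (𝓝 0)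

end VectorSubdivision

end

open VectorSubdivision

noncomputable section

namespace VectorSubdivision

open Filter Topology MeasureTheory
open Complex (I)
open Metric (ball closedBall)
open Submodule (span span_induction subset_span)
open Finset (univ mem_univ mul_sum single_le_sum smul_sum sum_add_distrib sum_comm sum_congr
  sum_eq_single sum_eq_zero sum_le_sum sum_mul sum_nonneg sum_product sum_sub_distrib)
open scoped ENNReal ContDiff Real

local notation:max "ℝ^" d:max => Fin d → ℝ
local notation:max "ℤ^" d:max => Fin d → ℤ
local notation "Mat" s:max t:max => Matrix (Fin s) (Fin t) ℂ

section

/-! ### Pairings of filters with matrix sequences -/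

variable {d r q s t R : ℕ} {v w : Filt d s r} {k : ℤ^d}

/-- The pairing `∑_z v(z) g(z)` of a filter with an arbitrary matrix sequence. -/
def pairing {d s r t : ℕ} (v : Filt d s r) (g : ℤ^d → Mat r t) : Mat s t :=
  v.sum fun z M => M * g z

theorem pairing_eq_sum (v : Filt d s r) (g : ℤ^d → Mat r t) {F : Finset ℤ^d}
    (hF : ∀ z, v z ≠ 0 → z ∈ F) : pairing v g = ∑ z ∈ F, v z * g z :=
  Finsupp.sum_of_support_subset _ (fun z hz => hF z (by simpa using hz)) _ (by simp)

theorem pairing_def (v : Filt d s r) (g : ℤ^d → Mat r t) : pairing v g = ∑ z ∈ v.support,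
      v z * g z := rfl

theorem pairing_add (v : Filt d s r) (g h : ℤ^d → Mat r t) : pairing v (fun z => g z + h z) =
      pairing v g + pairing v h := by
  simp [pairing_def, Matrix.mul_add, sum_add_distrib]

theorem pairing_sub (v : Filt d s r) (g h : ℤ^d → Mat r t) : pairing v (fun z => g z - h z) =
      pairing v g - pairing v h := by
  simp [pairing_def, Matrix.mul_sub, sum_sub_distrib]

theorem pairing_smul (c : ℂ) (v : Filt d s r) (g : ℤ^d → Mat r t) : pairing v (fun z => c • g z) =
      c • pairing v g := by
  simp [pairing_def, smul_sum]

theorem pairing_zero (v : Filt d s r) : pairing v (fun _ => (0 : Mat r t)) = 0 := by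
  simp [pairing_def]

theorem pairing_sum {ι : Type*} (S : Finset ι) (v : Filt d s r) (g : ι → ℤ^d → Mat r t) :
    pairing v (fun z => ∑ i ∈ S, g i z) = ∑ i ∈ S, pairing v (g i) := by
  simp only [pairing_def, Matrix.mul_sum]
  exact sum_comm

theorem pairing_mul (v : Filt d s r) (g : ℤ^d → Mat r t) (B : Mat t q) :
    pairing v (fun z => g z * B) = pairing v g * B := by
  simp [pairing_def, Matrix.sum_mul, Matrix.mul_assoc]

theorem pairing_add_left (v w : Filt d s r) (g : ℤ^d → Mat r t) : pairing (v + w) g =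
      pairing v g + pairing w g :=
  Finsupp.sum_add_index' (by simp) (by simp [Matrix.add_mul])

theorem pairing_smul_left (c : ℂ) (v : Filt d s r) (g : ℤ^d → Mat r t) : pairing (c • v) g =
      c • pairing v g := by
  unfold pairing
  rw [Finsupp.sum_smul_index' (by simp), Finsupp.smul_sum]
  simp

theorem pairing_neg_left (v : Filt d s r) (g : ℤ^d → Mat r t) : pairing (-v) g = - pairing v g := by
  have := pairing_smul_left (-1) v g
  simpa using this

theorem pairing_sub_left (v w : Filt d s r) (g : ℤ^d → Mat r t) : pairing (v - w) g =
      pairing v g - pairing w g := by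
  rw [sub_eq_add_neg, pairing_add_left, pairing_neg_left, sub_eq_add_neg]

theorem pairing_zero_left (g : ℤ^d → Mat r t) : pairing (0 : Filt d s r) g = 0 := by
  simp [pairing]

theorem pairing_single (z : ℤ^d) (M : Mat s r) (g : ℤ^d → Mat r t) :
    pairing (Finsupp.single z M) g = M * g z :=
  Finsupp.sum_single_index (by simp)

theorem pairing_pi_single (v : Filt d s r) (k : ℤ^d) : pairing v (Pi.single k 1) = v k := by
  classical
  rw [pairing_eq_sum v _ (F := insert k v.support) (fun z hz => by simp [hz]),
    sum_eq_single k]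
  · simp
  · intro b _ hb
    simp [Pi.single_eq_of_ne hb]
  · simp

theorem filt_ext (h : ∀ g : ℤ^d → Mat r r, pairing v g = pairing w g) : v = w := by
  ext1 k
  rw [← pairing_pi_single v, ← pairing_pi_single w, h]

theorem pairing_of_apply_eq (c : ℂ) (L : ℕ) (u : Filt d s r) (v : Filt d s q) (w : Filt d q r)
    (hu : ∀ k, u k = c • v.sum fun z A => A * w (k - L • z)) (g : ℤ^d → Mat r t) : pairing u g =
      c • pairing v fun z => pairing w fun k => g (L • z + k) := by
  classical
  set F : Finset ℤ^d := (v.support ×ˢ w.support).image fun x => L • x.1 + x.2 with hF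
  have hz : ∀ z ∈ v.support, pairing w (fun k => g (L • z + k)) =
      ∑ k ∈ F, w (k - L • z) * g k := fun z hz => by
    rw [pairing_def, ← Finset.sum_subset (s₁ := w.support.map (addLeftEmbedding (L • z))) (s₂ := F)]
    · simp [Finset.sum_map, -nsmul_eq_mul]
    · intro k hk
      simp only [Finset.mem_map, addLeftEmbedding_apply] at hk
      obtain ⟨j, hj, rfl⟩ := hk
      exact Finset.mem_image.2 ⟨(z, j), Finset.mem_product.2 ⟨hz, hj⟩, rfl⟩
    · intro k _ hk
      have : w (k - L • z) = 0 := by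
        by_contra hne
        exact hk (Finset.mem_map.2 ⟨k - L • z, by simpa using hne, by simp⟩)
      rw [this, Matrix.zero_mul]
  have hsupp : ∀ k, u k ≠ 0 → k ∈ F := fun k hk => by
    by_contra hcon
    apply hk
    rw [hu, Finsupp.sum, sum_eq_zero, smul_zero]
    intro z hz
    have : w (k - L • z) = 0 := by
      by_contra hne
      exact hcon (Finset.mem_image.2 ⟨(z, k - L • z),
        Finset.mem_product.2 ⟨hz, by simpa using hne⟩, by simp⟩)
    simp only [this, Matrix.mul_zero]
  rw [pairing_eq_sum u g hsupp, pairing_def v, smul_sum]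
  have h1 : ∀ z ∈ v.support, c • (v z * pairing w fun k => g (L • z + k)) =
      ∑ k ∈ F, c • (v z * (w (k - L • z) * g k)) := fun z hz' => by
    rw [hz z hz', Matrix.mul_sum, smul_sum]
  rw [sum_congr rfl h1, sum_comm]
  refine sum_congr rfl fun k _ => ?_
  rw [hu, Finsupp.sum, smul_sum, Matrix.sum_mul]
  refine sum_congr rfl fun z _ => ?_
  simp [Matrix.mul_assoc]

theorem pairing_conv (v : Filt d s q) (w : Filt d q r) (g : ℤ^d → Mat r t) : pairing (conv v w) g =
      pairing v fun z => pairing w fun k => g (z + k) := by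
  have := pairing_of_apply_eq 1 1 (conv v w) v w (fun k => by
    simp only [one_smul]
    rfl) g
  simpa using this

theorem conv_apply (v : Filt d s q) (w : Filt d q r) (k : ℤ^d) : conv v w k = pairing v fun z =>
      w (k - z) := rfl

theorem pairing_subdiv (lam : ℕ) (a : Filt d r r) (v : Filt d s r) (g : ℤ^d → Mat r t) :
    pairing (subdiv lam a v) g = ((lam : ℂ) ^ d) • pairing v fun z => pairing a fun k =>
      g (lam • z + k) :=
  pairing_of_apply_eq _ lam _ v a (fun _ => rfl) g

theorem pairing_swap (v : Filt d s q) (w : Filt d q r) (f : ℤ^d → ℤ^d → ℂ) :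
    pairing v (fun z => pairing w fun k => f z k • (1 : Mat r r)) = ∑ k ∈ w.support,
      pairing v (fun z => f z k • (1 : Mat q q)) * w k := by
  simp only [pairing_def w, pairing_sum]
  refine sum_congr rfl fun k _ => ?_
  rw [← pairing_mul]
  simp

theorem conv_add_right (v : Filt d s q) (w w' : Filt d q r) : conv v (w + w') =
      conv v w + conv v w' := by
  ext1 k
  simp [conv_apply, pairing_add]

theorem conv_sub_right (v : Filt d s q) (w w' : Filt d q r) : conv v (w - w') =
      conv v w - conv v w' := by
  ext1 k
  simp [conv_apply, pairing_sub]

theorem conv_smul_right (c : ℂ) (v : Filt d s q) (w : Filt d q r) : conv v (c • w) =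
      c • conv v w := by
  ext1 k
  simp [conv_apply, pairing_smul]

theorem conv_zero_right (v : Filt d s q) : conv v (0 : Filt d q r) = 0 := by
  ext1 k
  simp [conv_apply, pairing_zero]

theorem conv_sum_right {ι : Type*} (S : Finset ι) (v : Filt d s q) (w : ι → Filt d q r) :
    conv v (∑ i ∈ S, w i) = ∑ i ∈ S, conv v (w i) := by
  ext1 k
  simp [conv_apply, Finsupp.finsetSum_apply, pairing_sum]

theorem conv_assoc {p : ℕ} (u : Filt d p s) (v : Filt d s q) (w : Filt d q r) : conv (conv u v) w =
      conv u (conv v w) :=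
  filt_ext fun g => by simp [pairing_conv, add_assoc]

/-- The shifted filter `w(· - z)`. -/
def shift (z : ℤ^d) (w : Filt d s r) : Filt d s r := Finsupp.embDomain (addLeftEmbedding z) w

theorem shift_apply (z : ℤ^d) (w : Filt d s r) (k : ℤ^d) : shift z w k = w (k - z) := by
  have : k = addLeftEmbedding z (k - z) := by simp
  rw [shift]
  conv_lhs => rw [this]
  rw [Finsupp.embDomain_apply_self]

theorem pairing_shift (z : ℤ^d) (w : Filt d s r) (g : ℤ^d → Mat r t) : pairing (shift z w) g =
      pairing w fun k => g (z + k) := by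
  simp [pairing, shift, Finsupp.sum_embDomain]

theorem conv_shift (z : ℤ^d) (v : Filt d s q) (w : Filt d q r) : conv v (shift z w) =
      shift z (conv v w) := by
  ext1 k
  simp only [conv_apply, shift_apply]
  congr 1
  funext j
  congr 1
  abel

/-! ### Iterated masks and transition operators -/

/-- The iterated mask `S_a^n(δ I_r)`. -/
def mask (lam : ℕ) (a : Filt d r r) (n : ℕ) : Filt d r r := (subdiv lam a)^[n] (deltaI d r)

theorem pairing_mask_zero (lam : ℕ) (a : Filt d r r) (g : ℤ^d → Mat r t) :
    pairing (mask lam a 0) g = g 0 := by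
  simp [mask, deltaI, pairing_single]

theorem pairing_subdiv_iterate (lam : ℕ) (a : Filt d r r) (n : ℕ) (v : Filt d s r)
    (g : ℤ^d → Mat r t) : pairing ((subdiv lam a)^[n] v) g = pairing v fun z =>
      pairing (mask lam a n) fun k => g (lam ^ n • z + k) := by
  induction n generalizing g with
  | zero => simp [pairing_mask_zero]
  | succ n ih =>
    simp only [mask, Function.iterate_succ_apply', pairing_subdiv]
    rw [ih, ← pairing_smul]
    simp only [mask, smul_add, smul_smul, pow_succ', add_assoc]

theorem pairing_mask_add (lam : ℕ) (a : Filt d r r) (n q : ℕ) (g : ℤ^d → Mat r t) :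
    pairing (mask lam a (n + q)) g = pairing (mask lam a n) fun z => pairing (mask lam a q) fun k =>
      g (lam ^ q • z + k) := by
  rw [← pairing_subdiv_iterate lam a q (mask lam a n) g, mask, mask, add_comm n q,
    Function.iterate_add_apply]

theorem mask_one (lam : ℕ) (a : Filt d r r) : mask lam a 1 = ((lam : ℂ) ^ d) • a := by
  refine filt_ext fun g => ?_
  have := pairing_subdiv lam a (deltaI d r) g
  simpa [mask, pairing_smul_left, deltaI, pairing_single] using this

theorem pairing_mask_succ (lam : ℕ) (a : Filt d r r) (n : ℕ) (g : ℤ^d → Mat r t) :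
    pairing (mask lam a (n + 1)) g = ((lam : ℂ) ^ d) • pairing (mask lam a n) fun z =>
      pairing a fun k => g (lam • z + k) := by
  rw [pairing_mask_add, ← pairing_smul]
  simp [mask_one, pairing_smul_left]

theorem smul_add_injective {L : ℕ} (hL : L ≠ 0) (γ : ℤ^d) : Function.Injective fun k : ℤ^d => L •
      k + γ := fun x y h => by
  have h' : L • x = L • y := by simpa using h
  funext i
  have := congrFun h' i
  simpa [hL] using this

/-- The sequence `k ↦ u(L k + γ)`. -/
def down (L : ℕ) [NeZero L] (γ : ℤ^d) (u : Filt d s r) : Filt d s r :=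
  Finsupp.comapDomain (fun k => L • k + γ) u (smul_add_injective (NeZero.ne L) γ).injOn

theorem down_apply (L : ℕ) [NeZero L] (γ : ℤ^d) (u : Filt d s r) (k : ℤ^d) : down L γ u k =
      u (L • k + γ) := rfl

theorem pairing_down (L : ℕ) [NeZero L] (γ : ℤ^d) (u : Filt d s r) (g : ℤ^d → Mat r t) :
    pairing (down L γ u) g = pairing u (Function.extend (fun k => L • k + γ) g 0) := by
  have hinj := smul_add_injective (d := d) (NeZero.ne L) γ
  rw [pairing_def u, pairing_eq_sum (down L γ u) g
    (F := u.support.preimage (fun k => L • k + γ) hinj.injOn)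
    (fun z hz => by simpa [down_apply] using hz)]
  rw [← Finset.sum_preimage (fun k => L • k + γ) u.support hinj.injOn]
  · refine sum_congr rfl fun k _ => ?_
    rw [hinj.extend_apply]
    rfl
  · intro x _ hx
    have : ¬ ∃ k, L • k + γ = x := hx
    rw [Function.extend_apply' _ _ _ this]
    simp

/-- The transition operator `w ↦ λ^d [a * w](λ · + γ)`. -/
def trans (lam : ℕ) [NeZero lam] (a : Filt d r r) (γ : ℤ^d) (w : Filt d r t) : Filt d r t :=
  down lam γ (((lam : ℂ) ^ d) • conv a w)

theorem trans_apply (lam : ℕ) [NeZero lam] (a : Filt d r r) (γ : ℤ^d) (w : Filt d r t) (k : ℤ^d) :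
    trans lam a γ w k = ((lam : ℂ) ^ d) • conv a w (lam • k + γ) := rfl

theorem conv_mask_zero (lam : ℕ) (a : Filt d r r) (w : Filt d r t) : conv (mask lam a 0) w = w := by
  ext1 k
  rw [conv_apply, pairing_mask_zero, sub_zero]

theorem conv_mask_succ_apply (lam : ℕ) [NeZero lam] (a : Filt d r r) (n : ℕ) (γ : ℤ^d)
    (w : Filt d r t) (k : ℤ^d) : conv (mask lam a (n + 1)) w (lam • k + γ) =
      conv (mask lam a n) (trans lam a γ w) k := by
  simp only [conv_apply, trans_apply, pairing_mask_succ]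
  rw [← pairing_smul]
  congr 1
  funext z
  congr 2
  funext j
  congr 1
  rw [smul_sub]
  abel

theorem exists_eq_smul_add (L : ℕ) [NeZero L] (l : ℤ^d) : ∃ (k : ℤ^d) (γ : Fin d → Fin L), l =
      L • k + fun i => ((γ i : ℕ) : ℤ) := by
  have hL : (0 : ℤ) < L := by exact_mod_cast NeZero.pos L
  refine ⟨fun i => l i / L, fun i => ⟨(l i % L).toNat, ?_⟩, ?_⟩
  · have := Int.emod_lt_of_pos (l i) hL
    have := Int.emod_nonneg (l i) hL.ne'
    omega
  · funext i
    have := Int.emod_nonneg (l i) hL.ne'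
    simp only [Pi.add_apply, Pi.smul_apply, Int.toNat_of_nonneg this]
    rw [nsmul_eq_mul]
    exact (Int.mul_ediv_add_emod (l i) L).symm

/-! ### Supports in boxes -/

/-- The filter vanishes outside of the cube `[-R, R]^d`. -/
def SuppIn (R : ℕ) (w : Filt d s r) : Prop := ∀ k, w k ≠ 0 → ∀ i, |k i| ≤ R

theorem exists_suppIn (w : Filt d s r) : ∃ R : ℕ, SuppIn R w := by
  refine ⟨∑ k ∈ w.support, ∑ i, (k i).natAbs, fun k hk i => ?_⟩
  have h1 : (k i).natAbs ≤ ∑ i, (k i).natAbs :=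
    single_le_sum (f := fun i => (k i).natAbs) (fun _ _ => Nat.zero_le _) (mem_univ i)
  have h2 : ∑ i, (k i).natAbs ≤ ∑ k ∈ w.support, ∑ i, (k i).natAbs :=
    single_le_sum (f := fun k : ℤ^d => ∑ i, (k i).natAbs)
      (fun _ _ => Nat.zero_le _) (by simpa using hk)
  have h3 := h1.trans h2
  rw [Int.abs_eq_natAbs]
  exact_mod_cast h3

theorem SuppIn.mono {R' : ℕ} (h : R ≤ R') (hw : SuppIn R w) : SuppIn R' w :=
  fun k hk i => (hw k hk i).trans (by exact_mod_cast h)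

/-- The integer points of the cube `[-R, R]^d`. -/
def box (d R : ℕ) : Finset ℤ^d := Fintype.piFinset fun _ => Finset.Icc (-(R : ℤ)) R

theorem mem_box : k ∈ box d R ↔ ∀ i, |k i| ≤ R := by simp [box, abs_le]

theorem exists_of_pairing_ne_zero {g : ℤ^d → Mat r t} (h : pairing v g ≠ 0) : ∃ z, v z ≠ 0 ∧
      g z ≠ 0 := by
  by_contra hcon
  push Not at hcon
  apply h
  rw [pairing_def]
  refine sum_eq_zero fun z hz => ?_
  rw [hcon z (by simpa using hz), Matrix.mul_zero]

theorem SuppIn.trans {lam : ℕ} [NeZero lam] {a : Filt d r r} {A : ℕ} (ha : SuppIn A a)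
    {w : Filt d r t} (hw : SuppIn R w) (γ : Fin d → Fin lam)
    (hk : trans lam a (fun i => ((γ i : ℕ) : ℤ)) w k ≠ 0) (i : Fin d) : lam * |k i| ≤
      A + R + lam := by
  rw [trans_apply] at hk
  have h1 : conv a w (lam • k + fun i => ((γ i : ℕ) : ℤ)) ≠ 0 := fun h => hk (by rw [h, smul_zero])
  rw [conv_apply] at h1
  obtain ⟨z, hz, hz'⟩ := exists_of_pairing_ne_zero h1
  have h2 := ha z hz i
  have h3 := hw _ hz' i
  simp only [Pi.sub_apply, Pi.add_apply, Pi.smul_apply] at h3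
  rw [nsmul_eq_mul] at h3
  have h4 : ((γ i : ℕ) : ℤ) < lam := by exact_mod_cast (γ i).2
  have h5 : (0 : ℤ) ≤ ((γ i : ℕ) : ℤ) := by positivity
  have h6 : (lam : ℤ) * |k i| = |(lam : ℤ) * k i| := by rw [abs_mul, Nat.abs_cast]
  rw [h6]
  rw [abs_le] at h2 h3 ⊢
  constructor <;> linarith

/-! ### The supremum norm -/

theorem enorm_le_supNorm (f : ℤ^d → Mat s t) (k : ℤ^d) (i : Fin s) (j : Fin t) : ‖f k i j‖ₑ ≤
      supNorm f := by
  unfold supNorm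
  calc ‖f k i j‖ₑ ≤ ⨆ k, ‖f k i j‖ₑ := le_iSup (fun k => ‖f k i j‖ₑ) k
    _ ≤ ∑ j, ⨆ k, ‖f k i j‖ₑ :=
      single_le_sum (f := fun j => ⨆ k, ‖f k i j‖ₑ) (fun _ _ => zero_le) (mem_univ j)
    _ ≤ _ := single_le_sum (f := fun i => ∑ j, ⨆ k, ‖f k i j‖ₑ) (fun _ _ => zero_le) (mem_univ i)

theorem supNorm_le (f : ℤ^d → Mat s t) {C : ℝ} (h : ∀ k i j, ‖f k i j‖ ≤ C) : supNorm f ≤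
      (s * t : ℕ) * ENNReal.ofReal C := by
  unfold supNorm
  calc ∑ i : Fin s, ∑ j : Fin t, ⨆ k, ‖f k i j‖ₑ
      ≤ ∑ i : Fin s, ∑ j : Fin t, ENNReal.ofReal C := by
        refine sum_le_sum fun i _ => sum_le_sum fun j _ => iSup_le fun k => ?_
        rw [← ofReal_norm]
        exact ENNReal.ofReal_le_ofReal (h k i j)
    _ = _ := by simp [mul_assoc]

theorem tendsto_supNorm_iff (F : ℕ → ℤ^d → Mat s t) : Tendsto (fun n => supNorm (F n)) atTop (𝓝 0) ↔
      ∀ ε > 0, ∀ᶠ n in atTop, ∀ k i j, ‖F n k i j‖ ≤ ε := by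
  constructor
  · intro h ε hε
    filter_upwards [h.eventually_le_const (u := ENNReal.ofReal ε) (by simpa using hε)]
      with n hn k i j
    have := (enorm_le_supNorm (F n) k i j).trans hn
    rw [← ofReal_norm] at this
    exact (ENNReal.ofReal_le_ofReal_iff hε.le).1 this
  · intro h
    rw [ENNReal.tendsto_nhds_zero]
    intro ε hε
    obtain ⟨δ, hδ, hδε⟩ : ∃ δ : ℝ, 0 < δ ∧ (s * t : ℕ) * ENNReal.ofReal δ ≤ ε := by
      rcases eq_or_ne ε ⊤ with rfl | hε'
      · exact ⟨1, one_pos, le_top⟩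
      · have hpos : 0 < ε.toReal := ENNReal.toReal_pos hε.ne' hε'
        refine ⟨ε.toReal / ((s * t : ℕ) + 1), by positivity, ?_⟩
        rw [← ENNReal.ofReal_natCast, ← ENNReal.ofReal_mul (by positivity)]
        rw [ENNReal.ofReal_le_iff_le_toReal hε', mul_div_assoc', div_le_iff₀ (by positivity)]
        nlinarith
    filter_upwards [h δ hδ] with n hn
    exact (supNorm_le _ hn).trans hδε

/-! ### Orthogonality of characters -/

theorem sum_character (M : ℕ) [NeZero M] (l : ℤ) : ∑ x : Fin M,
      Complex.exp (2 * π * I * ((x : ℕ) * l / M)) = if (M : ℤ) ∣ l then (M : ℂ) else 0 := by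
  have hM : (M : ℂ) ≠ 0 := by exact_mod_cast NeZero.ne M
  set ζ : ℂ := Complex.exp (2 * π * I * (l / M)) with hζ
  have h1 : ∀ x : Fin M, Complex.exp (2 * π * I * ((x : ℕ) * l / M)) =
      ζ ^ (x : ℕ) := fun x => by
    rw [hζ, ← Complex.exp_nat_mul]
    congr 1
    ring
  have hζM : ζ ^ M = 1 := by
    rw [hζ, ← Complex.exp_nat_mul, Complex.exp_eq_one_iff]
    exact ⟨l, by field_simp⟩
  rw [sum_congr rfl fun x _ => h1 x, Fin.sum_univ_eq_sum_range (fun x => ζ ^ x) M]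
  split_ifs with hl
  · obtain ⟨c, rfl⟩ := hl
    have : ζ = 1 := by
      rw [hζ, Complex.exp_eq_one_iff]
      exact ⟨c, by push_cast; field_simp⟩
    simp [this]
  · have hne : ζ ≠ 1 := fun h => by
      rw [hζ, Complex.exp_eq_one_iff] at h
      obtain ⟨c, hc⟩ := h
      apply hl
      refine ⟨c, ?_⟩
      have h2 : (2 * π * I : ℂ) ≠ 0 := Complex.two_pi_I_ne_zero
      have h3 : (l : ℂ) / M = c := by
        apply mul_left_cancel₀ h2
        rw [hc]
        ring
      rw [div_eq_iff hM] at h3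
      have h4 : ((l : ℤ) : ℂ) = ((c * M : ℤ) : ℂ) := by rw [h3]; push_cast; ring
      rw [mul_comm]
      exact_mod_cast h4
    rw [geom_sum_eq hne, hζM]
    simp

theorem sum_character_pi {d : ℕ} (M : ℕ) [NeZero M] (l : ℤ^d) : ∑ x : Fin d → Fin M,
      Complex.exp (2 * π * I * ((∑ i, (x i : ℕ) * l i) / M)) = if ∀ i,
      (M : ℤ) ∣ l i then (M : ℂ) ^ d else 0 := by
  classical
  have h1 : ∀ x : Fin d → Fin M,
      Complex.exp (2 * π * I * ((∑ i, (x i : ℕ) * l i) / M)) =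
        ∏ i, Complex.exp (2 * π * I * ((x i : ℕ) * l i / M)) := fun x => by
    rw [← Complex.exp_sum]
    congr 1
    push_cast
    rw [Finset.sum_div, mul_sum]
  rw [sum_congr rfl fun x _ => h1 x]
  have h2 := (Finset.prod_univ_sum (fun _ : Fin d => (univ : Finset (Fin M)))
    (fun i y => Complex.exp (2 * π * I * ((y : ℕ) * l i / M)))).symm
  rw [Fintype.piFinset_univ] at h2
  rw [h2, Finset.prod_congr rfl fun i _ => sum_character M (l i)]
  split_ifs with h
  · simp [h]
  · push Not at h
    obtain ⟨i, hi⟩ := h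
    exact Finset.prod_eq_zero (mem_univ i) (if_neg hi)

end

section

/-! ### Multi-index derivatives -/

variable {d r s t N : ℕ} {f p : ℝ^d → ℂ} {μ : Fin d → ℕ} {υ y : Filt d 1 r} {w : Filt d r 1}

theorem mderiv_eq_of_multiplier {X : Type*} (c : Fin d → X → ℂ) (T : (X → ℂ) → ℝ^d → ℂ)
    {Q : Set (X → ℂ)} (hQ : ∀ q ∈ Q, ∀ j, (fun x => c j x * q x) ∈ Q)
    (hT : ∀ q ∈ Q, ∀ j, pderiv j (T q) = T fun x => c j x * q x) (μ : Fin d → ℕ) {q : X → ℂ}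
    (hq : q ∈ Q) : mderiv μ (T q) = T fun x => (∏ j, c j x ^ μ j) * q x := by
  have hit : ∀ (n : ℕ) (j : Fin d) (q : X → ℂ), q ∈ Q →
      (fun x => c j x ^ n * q x) ∈ Q ∧
        (pderiv j)^[n] (T q) = T fun x => c j x ^ n * q x := fun n j q hq => by
    induction n with
    | zero => simpa using hq
    | succ n ih =>
      have h1 : (fun x => c j x ^ (n + 1) * q x) = fun x => c j x * (c j x ^ n * q x) := by
        funext x
        ring
      refine ⟨by rw [h1]; exact hQ _ ih.1 j, ?_⟩
      rw [Function.iterate_succ_apply', ih.2, hT _ ih.1, h1]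
  have hl : ∀ l : List (Fin d), (fun x => (l.map fun j => c j x ^ μ j).prod * q x) ∈ Q ∧
      l.foldr (fun j h => (pderiv j)^[μ j] h) (T q) =
        T fun x => (l.map fun j => c j x ^ μ j).prod * q x := fun l => by
    induction l with
    | nil => simpa using hq
    | cons j l ih =>
      have := hit (μ j) j _ ih.1
      simp only [List.foldr_cons, List.map_cons, List.prod_cons, mul_assoc]
      exact ⟨this.1, by rw [ih.2, this.2]⟩
  have := (hl (List.finRange d)).2
  simp only [mderiv, this, Fin.prod_univ_def]

theorem expo_contDiff (x : ℝ^d) : ContDiff ℝ ∞ (expo x) := by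
  have h0 : ContDiff ℝ ∞ fun ξ : ℝ^d => ∑ i, x i * ξ i :=
    ContDiff.sum fun i _ => contDiff_const.mul (contDiff_apply ℝ ℝ i)
  exact (contDiff_const.mul (Complex.ofRealCLM.contDiff.comp h0)).cexp

theorem hasLineDerivAt_expo (x ξ : ℝ^d) (j : Fin d) :
    HasLineDerivAt ℝ (expo x) (-I * x j * expo x ξ) ξ (Pi.single j 1) := by
  unfold HasLineDerivAt
  have h1 : ∀ t : ℝ, expo x (ξ + t • Pi.single j 1) =
      Complex.exp (-I * (((∑ i, x i * ξ i) + t * x j : ℝ) : ℂ)) := fun t => by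
    simp only [expo]
    congr 3
    simp [mul_add, sum_add_distrib, Pi.single_apply, mul_comm]
  simp only [h1]
  have h2 : HasDerivAt (fun t : ℝ => -I * (((∑ i, x i * ξ i) + t * x j : ℝ) : ℂ))
      (-I * x j) 0 := by
    have : HasDerivAt (fun t : ℝ => (∑ i, x i * ξ i) + t * x j) (x j) 0 := by
      simpa using ((hasDerivAt_id (0 : ℝ)).mul_const (x j)).const_add (∑ i, x i * ξ i)
    exact this.ofReal_comp.const_mul _
  have h3 := h2.cexp
  simp only [zero_mul, add_zero] at h3
  rw [mul_comm] 
  exact h3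

theorem pairing_smul_one_apply {s t : ℕ} (v : Filt d s t) (f : ℤ^d → ℂ) (i : Fin s) (j : Fin t) :
    pairing v (fun k => f k • (1 : Mat t t)) i j = ∑ k ∈ v.support, f k * v k i j := by
  simp [pairing_def, Matrix.sum_apply]

theorem mderiv_pairing_expo {s t : ℕ} (v : Filt d s t) (q : ℤ^d → ℂ) (i : Fin s) (j : Fin t)
    (μ : Fin d → ℕ) : mderiv μ (fun ξ => pairing v (fun k => (q k * expo (toR k) ξ) •
      (1 : Matrix (Fin t) (Fin t) ℂ)) i j) = fun ξ =>
      pairing v (fun k => ((∏ l, (-I * (k l : ℂ)) ^ μ l) * q k * expo (toR k) ξ) • (1 : Mat t t)) i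
      j := by
  refine mderiv_eq_of_multiplier (X := ℤ^d) (fun l k => -I * (k l : ℂ))
    (fun q ξ => pairing v (fun k => (q k * expo (toR k) ξ) • (1 : Mat t t)) i j)
    (Q := Set.univ) (fun _ _ _ => trivial) ?_ μ trivial
  intro q _ l
  funext ξ
  simp only [pairing_smul_one_apply]
  refine HasLineDerivAt.lineDeriv ?_
  have h : ∀ k ∈ v.support, HasLineDerivAt ℝ (fun ξ => q k * expo (toR k) ξ * v k i j)
      ((-I * (k l : ℂ)) * q k * expo (toR k) ξ * v k i j) ξ (Pi.single l 1) := fun k _ => by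
    have h1 := hasLineDerivAt_expo (toR k) ξ l
    unfold HasLineDerivAt at h1 ⊢
    have h2 := (h1.const_mul (q k)).mul_const (v k i j)
    refine h2.congr_deriv ?_
    simp only [toR, Complex.ofReal_intCast]
    ring
  have := HasDerivAt.fun_sum (u := v.support) (fun k hk => (h k hk))
  exact this

/-- The monomial `x ↦ x^μ`. -/
def mono (μ : Fin d → ℕ) (x : ℝ^d) : ℂ := ∏ i, (x i : ℂ) ^ μ i

theorem mderiv_prod (f : Fin d → ℝ → ℂ) (hf : ∀ i, ContDiff ℝ ∞ (f i)) (μ : Fin d → ℕ) :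
    mderiv μ (fun x => ∏ i, f i (x i)) = fun x => ∏ i, deriv^[μ i] (f i) (x i) := by
  classical
  have h1 : ∀ (f : Fin d → ℝ → ℂ), (∀ i, ContDiff ℝ ∞ (f i)) → ∀ j,
      pderiv j (fun x => ∏ i, f i (x i)) =
        fun x => ∏ i, (Function.update f j (deriv (f j))) i (x i) := fun f hf j => by
    funext x
    refine HasLineDerivAt.lineDeriv ?_
    unfold HasLineDerivAt
    have h2 : ∀ t : ℝ, ∏ i, f i ((x + t • (Pi.single j 1 : ℝ^d)) i) =
        f j (x j + t) * ∏ i ∈ Finset.univ.erase j, f i (x i) := fun t => by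
      rw [← Finset.mul_prod_erase _ _ (mem_univ j)]
      congr 1
      · simp
      · refine Finset.prod_congr rfl fun i hi => ?_
        simp [Finset.ne_of_mem_erase hi]
    simp only [h2]
    have h3 : ∏ i, (Function.update f j (deriv (f j))) i (x i) =
        deriv (f j) (x j) * ∏ i ∈ Finset.univ.erase j, f i (x i) := by
      rw [← Finset.mul_prod_erase _ _ (mem_univ j)]
      congr 1
      · simp
      · refine Finset.prod_congr rfl fun i hi => ?_
        rw [Function.update_of_ne (Finset.ne_of_mem_erase hi)]
    rw [h3]
    have h4 : HasDerivAt (f j) (deriv (f j) (x j + 0)) (x j + 0) :=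
      (((hf j).differentiable (by simp)) _).hasDerivAt
    have h5 := (h4.comp_const_add (x j) 0).mul_const (∏ i ∈ Finset.univ.erase j, f i (x i))
    simpa using h5
  have hsm : ∀ (n : ℕ) (g : ℝ → ℂ), ContDiff ℝ ∞ g → ContDiff ℝ ∞ (deriv^[n] g) :=
    fun n g hg => hg.iterate_deriv n
  have h2 : ∀ (n : ℕ) (j : Fin d) (f : Fin d → ℝ → ℂ), (∀ i, ContDiff ℝ ∞ (f i)) →
      (pderiv j)^[n] (fun x => ∏ i, f i (x i)) =
        fun x => ∏ i, (Function.update f j (deriv^[n] (f j))) i (x i) := fun n j f hf => by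
    induction n with
    | zero => simp
    | succ n ih =>
      rw [Function.iterate_succ_apply', ih, h1]
      · simp [Function.iterate_succ_apply']
      · intro i
        by_cases hij : i = j
        · subst hij
          simpa using hsm n _ (hf i)
        · simpa [hij] using hf i
  have h3 : ∀ l : List (Fin d), l.Nodup →
      l.foldr (fun j h => (pderiv j)^[μ j] h) (fun x => ∏ i, f i (x i)) =
        fun x => ∏ i, (if i ∈ l then deriv^[μ i] (f i) else f i) (x i) := fun l hl => by
    induction l with
    | nil => simp
    | cons j l ih =>
      rw [List.nodup_cons] at hl
      rw [List.foldr_cons, ih hl.2, h2]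
      · funext x
        refine Finset.prod_congr rfl fun i _ => ?_
        by_cases hij : i = j
        · subst hij
          simp [hl.1]
        · simp [hij]
      · intro i
        split_ifs
        · exact hsm _ _ (hf i)
        · exact hf i
  have := h3 (List.finRange d) (List.nodup_finRange d)
  simpa [mderiv] using this

theorem iterate_deriv_pow (n k : ℕ) : deriv^[k] (fun t : ℝ => (t : ℂ) ^ n) =
      fun t : ℝ => (n.descFactorial k : ℂ) * (t : ℂ) ^ (n - k) := by
  induction k with
  | zero => simp
  | succ k ih =>
    rw [Function.iterate_succ_apply', ih]
    funext t
    have h1 : HasDerivAt (fun t : ℝ => (t : ℂ) ^ (n - k))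
        (((n - k : ℕ) : ℂ) * (t : ℂ) ^ (n - k - 1))
        t := by
      simpa using ((hasDerivAt_pow (n - k) (t : ℂ)).comp_ofReal)
    rw [(h1.const_mul _).deriv, Nat.descFactorial_succ, Nat.sub_sub]
    push_cast
    ring

theorem contDiff_ofReal_pow (n : ℕ) : ContDiff ℝ ∞ fun t : ℝ => (t : ℂ) ^ n :=
  Complex.ofRealCLM.contDiff.pow n

theorem mderiv_mono_zero (μ ν : Fin d → ℕ) : mderiv μ (mono ν) 0 = if ν =
      μ then ((∏ i, (μ i).factorial : ℕ) : ℂ) else 0 := by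
  have h := mderiv_prod (fun i t => (t : ℂ) ^ ν i) (fun i => contDiff_ofReal_pow (ν i)) μ
  have h' : mono ν = fun x : ℝ^d => ∏ i, (x i : ℂ) ^ ν i := rfl
  rw [h', h]
  simp only [iterate_deriv_pow]
  split_ifs with hν
  · subst hν
    simp [Nat.descFactorial_self]
  · obtain ⟨i, hi⟩ := Function.ne_iff.1 hν
    refine Finset.prod_eq_zero (mem_univ i) ?_
    rcases lt_or_gt_of_ne hi with h1 | h1
    · simp [Nat.descFactorial_eq_zero_iff_lt.2 h1]
    · have : ν i - μ i ≠ 0 := by omega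
      simp [this]

theorem mderiv_const_mul_mono (c : ℂ) (μ ν : Fin d → ℕ) : mderiv μ (fun x => c * mono ν x) 0 =
      if ν = μ then c * ((∏ i, (μ i).factorial : ℕ) : ℂ) else 0 := by
  have hlin : ∀ (j : Fin d) (f : ℝ^d → ℂ),
      pderiv j (fun x => c * f x) = fun x => c * pderiv j f x := fun j f => by
    funext x
    simp only [pderiv, lineDeriv]
    exact deriv_const_mul_field c
  have h1 : ∀ (n : ℕ) (j : Fin d) (f : ℝ^d → ℂ),
      (pderiv j)^[n] (fun x => c * f x) = fun x => c * (pderiv j)^[n] f x := fun n j f => by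
    induction n with
    | zero => simp
    | succ n ih => rw [Function.iterate_succ_apply', ih, hlin, Function.iterate_succ_apply']
  have h2 : ∀ l : List (Fin d),
      l.foldr (fun j h => (pderiv j)^[μ j] h) (fun x => c * mono ν x) =
        fun x => c * l.foldr (fun j h => (pderiv j)^[μ j] h) (mono ν) x := fun l => by
    induction l with
    | nil => simp
    | cons j l ih => rw [List.foldr_cons, ih, h1, List.foldr_cons]
  have h3 : mderiv μ (fun x => c * mono ν x) = fun x => c * mderiv μ (mono ν) x := h2 _
  rw [h3]
  simp [mderiv_mono_zero]

theorem pderiv_iteratedFDeriv_apply {k : ℕ} (v : Fin k → ℝ^d) (j : Fin d)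
    (hf : ContDiff ℝ (k + 1 : ℕ) f) : pderiv j (fun x => iteratedFDeriv ℝ k f x v) =
      fun x => iteratedFDeriv ℝ (k + 1) f x (Fin.cons (Pi.single j 1) v) := by
  funext x
  have h1 : DifferentiableAt ℝ (iteratedFDeriv ℝ k f) x :=
    (hf.differentiable_iteratedFDeriv (by exact_mod_cast Nat.lt_succ_self k)) x
  have h2 : DifferentiableAt ℝ (fun x => iteratedFDeriv ℝ k f x v) x :=
    ((ContinuousMultilinearMap.apply ℝ (fun _ : Fin k => ℝ^d) ℂ v).differentiableAt).comp x h1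
  rw [pderiv, h2.lineDeriv_eq_fderiv, iteratedFDeriv_succ_apply_left]
  have h3 := (ContinuousMultilinearMap.apply ℝ (fun _ : Fin k => ℝ^d) ℂ v).hasFDerivAt.comp
    x h1.hasFDerivAt
  have h4 : fderiv ℝ (fun x => iteratedFDeriv ℝ k f x v) x =
    (ContinuousMultilinearMap.apply ℝ (fun _ : Fin k => ℝ^d) ℂ v).comp
      (fderiv ℝ (iteratedFDeriv ℝ k f) x) := h3.fderiv
  rw [h4]
  simp [Fin.tail_def]

theorem exists_mderiv_eq (μ : Fin d → ℕ) : ∃ v : Fin (deg μ) → ℝ^d, (∀ i, ‖v i‖ ≤ 1) ∧ ∀ f : ℝ^d →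
      ℂ, ContDiff ℝ (deg μ : ℕ) f → mderiv μ f = fun x => iteratedFDeriv ℝ (deg μ) f x v := by
  have hcons : ∀ (k : ℕ) (v : Fin k → ℝ^d) (j : Fin d), (∀ i, ‖v i‖ ≤ 1) →
      ∀ i, ‖(Fin.cons (Pi.single j 1) v : Fin (k + 1) → ℝ^d) i‖ ≤ 1 := fun k v j hv i => by
    refine Fin.cases ?_ (fun i => ?_) i
    · simp [Pi.norm_single]
    · simpa using hv i
  have hit : ∀ (n : ℕ) (j : Fin d) (k : ℕ) (v : Fin k → ℝ^d), (∀ i, ‖v i‖ ≤ 1) →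
      ∃ v' : Fin (n + k) → ℝ^d, (∀ i, ‖v' i‖ ≤ 1) ∧ ∀ f : ℝ^d → ℂ,
      ContDiff ℝ (n + k : ℕ) f → (pderiv j)^[n] (fun x => iteratedFDeriv ℝ k f x v) =
        fun x => iteratedFDeriv ℝ (n + k) f x v' := fun n j k v hv => by
    induction n with
    | zero =>
      have e : 0 + k = k := zero_add k
      rw [e]
      exact ⟨v, hv, fun f _ => rfl⟩
    | succ n ih =>
      obtain ⟨v', hv', h'⟩ := ih
      have e : n + 1 + k = n + k + 1 := by omega
      rw [e]
      refine ⟨Fin.cons (Pi.single j 1) v', hcons _ _ _ hv', fun f hf => ?_⟩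
      rw [Function.iterate_succ_apply', h' f (hf.of_le (by exact_mod_cast Nat.le_succ _)),
        pderiv_iteratedFDeriv_apply _ _ hf]
  have hl : ∀ l : List (Fin d), ∃ v : Fin (l.map μ).sum → ℝ^d, (∀ i, ‖v i‖ ≤ 1) ∧
      ∀ f : ℝ^d → ℂ, ContDiff ℝ ((l.map μ).sum : ℕ) f →
        l.foldr (fun j h => (pderiv j)^[μ j] h) f =
          fun x => iteratedFDeriv ℝ (l.map μ).sum f x v := fun l => by
    induction l with
    | nil =>
      exact ⟨fun _ => 0, by simp, fun f _ => by funext x; exact (iteratedFDeriv_zero_apply _).symm⟩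
    | cons j l ih =>
      obtain ⟨v, hv, h⟩ := ih
      obtain ⟨v', hv', h'⟩ := hit (μ j) j _ v hv
      rw [List.map_cons, List.sum_cons]
      refine ⟨v', hv', fun f hf => ?_⟩
      rw [List.foldr_cons, h f (hf.of_le (by exact_mod_cast Nat.le_add_left _ _)), h' f hf]
  have := hl (List.finRange d)
  have e : ((List.finRange d).map μ).sum = deg μ := by rw [deg, Fin.sum_univ_def]
  rw [e] at this
  exact this

/-- A tuple of vectors of norm at most one that computes `∂^μ` from the `|μ|`-th derivative. -/
def dirs (μ : Fin d → ℕ) : Fin (deg μ) → ℝ^d := (exists_mderiv_eq μ).choose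

theorem norm_dirs_le (μ : Fin d → ℕ) (i : Fin (deg μ)) : ‖dirs μ i‖ ≤ 1 :=
  (exists_mderiv_eq μ).choose_spec.1 i

theorem mderiv_eq_iteratedFDeriv (hf : ContDiff ℝ (deg μ : ℕ) f) (x : ℝ^d) : mderiv μ f x =
      iteratedFDeriv ℝ (deg μ) f x (dirs μ) :=
  congrFun ((exists_mderiv_eq μ).choose_spec.2 f hf) x

/-! ### Polynomials of bounded degree -/

/-- The complex polynomial functions on `ℝ^d` of degree less than `N`. -/
def polySpace (d N : ℕ) : Submodule ℂ (ℝ^d → ℂ) :=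
  span ℂ {p | ∃ μ : Fin d → ℕ, deg μ < N ∧ p = mono μ}

theorem mono_mem (h : deg μ < N) : mono μ ∈ polySpace d N := subset_span ⟨μ, h, rfl⟩

theorem polySpace_mono {N' : ℕ} (h : N ≤ N') : polySpace d N ≤ polySpace d N' := by
  refine Submodule.span_le.2 ?_
  rintro _ ⟨μ, hμ, rfl⟩
  exact mono_mem (hμ.trans_le h)

theorem polySpace_zero : polySpace d 0 = ⊥ := by
  rw [polySpace, Submodule.span_eq_bot]
  rintro _ ⟨μ, hμ, rfl⟩
  exact absurd hμ (Nat.not_lt_zero _)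

theorem polySpace_le {W : Submodule ℂ (ℝ^d → ℂ)} (h : ∀ μ : Fin d → ℕ, deg μ < N → mono μ ∈ W) :
    polySpace d N ≤ W := by
  refine Submodule.span_le.2 ?_
  rintro _ ⟨μ, hμ, rfl⟩
  exact h μ hμ

theorem finite_deg_lt (N : ℕ) : {μ : Fin d → ℕ | deg μ < N}.Finite := by
  refine (Set.Finite.pi' (fun _ : Fin d => Set.finite_Iio N)).subset ?_
  intro μ hμ i
  have h1 : μ i ≤ deg μ := single_le_sum (f := μ) (fun _ _ => Nat.zero_le _) (mem_univ i)
  exact lt_of_le_of_lt h1 hμ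

instance finiteDimensional_polySpace (N : ℕ) : FiniteDimensional ℂ (polySpace d N) := by
  refine FiniteDimensional.span_of_finite ℂ (((finite_deg_lt (d := d) N).image mono).subset ?_)
  rintro _ ⟨μ, hμ, rfl⟩
  exact ⟨μ, hμ, rfl⟩

theorem mono_zero_index : mono (0 : Fin d → ℕ) = fun _ => 1 := by
  funext x
  simp [mono]

theorem mono_add_single (μ : Fin d → ℕ) (i : Fin d) (x : ℝ^d) : mono (μ + Pi.single i 1) x =
      x i * mono μ x := by
  simp only [mono, Pi.add_apply, pow_add, Finset.prod_mul_distrib]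
  rw [mul_comm]
  congr 1
  rw [Finset.prod_eq_single i]
  · simp
  · intro j _ hj
    simp [hj]
  · simp

theorem deg_add_single (μ : Fin d → ℕ) (i : Fin d) : deg (μ + Pi.single i 1) = deg μ + 1 := by
  simp [deg, sum_add_distrib]

theorem exists_eq_add_single {n : ℕ} (h : deg μ = n + 1) : ∃ ν i, μ = ν + Pi.single i 1 ∧ deg ν =
      n := by
  have : ∃ i, μ i ≠ 0 := by
    by_contra hcon
    push Not at hcon
    simp [deg, hcon] at h
  obtain ⟨i, hi⟩ := this
  have e : μ = (fun j => μ j - (Pi.single i 1 : Fin d → ℕ) j) + Pi.single i 1 := by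
    funext j
    by_cases hj : j = i
    · subst hj
      simp
      omega
    · simp [hj]
  refine ⟨_, i, e, ?_⟩
  have h2 := deg_add_single (fun j => μ j - (Pi.single i 1 : Fin d → ℕ) j) i
  rw [← e] at h2
  omega

theorem mul_coord_mem (hp : p ∈ polySpace d N) (i : Fin d) : (fun x => (x i : ℂ) * p x) ∈
      polySpace d (N + 1) := by
  refine span_induction (p := fun p _ => (fun x => (x i : ℂ) * p x) ∈ polySpace d (N + 1))
    ?_ ?_ ?_ ?_ hp
  · rintro _ ⟨μ, hμ, rfl⟩
    have : (fun x : ℝ^d => (x i : ℂ) * mono μ x) = mono (μ + Pi.single i 1) := by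
      funext x
      rw [mono_add_single]
    rw [this]
    exact mono_mem (by rw [deg_add_single]; omega)
  · simp only [Pi.zero_apply, mul_zero]
    exact (polySpace d (N + 1)).zero_mem
  · intro p q _ _ hp hq
    simpa [mul_add, Pi.add_def] using (polySpace d (N + 1)).add_mem hp hq
  · intro c p _ hp
    have := (polySpace d (N + 1)).smul_mem c hp
    convert this using 1
    funext x
    simp
    ring

theorem translate_mono_sub_mem (t : ℝ^d) (μ : Fin d → ℕ) : (fun x => mono μ (x + t) - mono μ x) ∈
      polySpace d (deg μ) := by
  induction hn : deg μ generalizing μ with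
  | zero =>
    have : μ = 0 := by
      funext i
      have := Finset.sum_eq_zero_iff.1 hn i (mem_univ i)
      simpa using this
    subst this
    simp only [mono_zero_index, sub_self]
    exact (polySpace d 0).zero_mem
  | succ n ih =>
    obtain ⟨ν, i, rfl, hν⟩ := exists_eq_add_single hn
    have h1 := mul_coord_mem (ih ν hν) i
    have h2 : (fun x => (t i : ℂ) * (mono ν (x + t) - mono ν x)) ∈ polySpace d (n + 1) :=
      polySpace_mono (Nat.le_succ n) ((polySpace d n).smul_mem (t i : ℂ) (ih ν hν))
    have h3 : (fun x => (t i : ℂ) * mono ν x) ∈ polySpace d (n + 1) :=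
      (polySpace d (n + 1)).smul_mem (t i : ℂ) (mono_mem (by omega))
    convert (polySpace d (n + 1)).add_mem ((polySpace d (n + 1)).add_mem h1 h2) h3 using 1
    funext x
    simp only [mono_add_single, Pi.add_apply]
    push_cast
    ring

theorem translate_sub_mem (hp : p ∈ polySpace d (N + 1)) (t : ℝ^d) : (fun x => p (x + t) - p x) ∈
      polySpace d N := by
  refine span_induction (p := fun p _ => (fun x => p (x + t) - p x) ∈ polySpace d N) ?_ ?_ ?_ ?_ hp
  · rintro _ ⟨μ, hμ, rfl⟩
    exact polySpace_mono (by omega) (translate_mono_sub_mem t μ)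
  · simp only [Pi.zero_apply, sub_zero]
    exact (polySpace d N).zero_mem
  · intro p q _ _ hp hq
    convert (polySpace d N).add_mem hp hq using 1
    funext x
    simp
    ring
  · intro c p _ hp
    convert (polySpace d N).smul_mem c hp using 1
    funext x
    simp [mul_sub]

theorem translate_mem (hp : p ∈ polySpace d N) (t : ℝ^d) :
    (fun x => p (x + t)) ∈ polySpace d N := by
  cases N with
  | zero =>
    rw [polySpace_zero, Submodule.mem_bot] at hp ⊢
    rw [hp]
    rfl
  | succ N =>
    have h := polySpace_mono (Nat.le_succ N) (translate_sub_mem hp t)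
    convert (polySpace d (N + 1)).add_mem h hp using 1
    funext x
    simp

theorem mono_smul (c : ℝ) (μ : Fin d → ℕ) (x : ℝ^d) : mono μ (c • x) = (c : ℂ) ^ deg μ *
      mono μ x := by
  simp [mono, mul_pow, Finset.prod_mul_distrib, deg, Finset.prod_pow_eq_pow_sum]

theorem dilate_mem (hp : p ∈ polySpace d N) (c : ℝ) : (fun x => p (c • x)) ∈ polySpace d N := by
  refine span_induction (p := fun p _ => (fun x => p (c • x)) ∈ polySpace d N) ?_ ?_ ?_ ?_ hp
  · rintro _ ⟨μ, hμ, rfl⟩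
    simp only [mono_smul]
    exact (polySpace d N).smul_mem _ (mono_mem hμ)
  · exact (polySpace d N).zero_mem
  · intro p q _ _ hp hq
    exact (polySpace d N).add_mem hp hq
  · intro a p _ hp
    exact (polySpace d N).smul_mem a hp

theorem continuous_of_mem_polySpace (hp : p ∈ polySpace d N) : Continuous p := by
  refine span_induction (p := fun p _ => Continuous p) ?_ ?_ ?_ ?_ hp
  · rintro _ ⟨μ, _, rfl⟩
    unfold mono
    fun_prop
  · exact continuous_const
  · intro p q _ _ hp hq
    exact hp.add hq
  · intro a p _ hp
    exact continuous_const.mul hp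

/-! ### Moments -/

theorem toR_add (j k : ℤ^d) : toR (j + k) = toR j + toR k := by
  funext i
  simp [toR]

theorem toR_sub (j k : ℤ^d) : toR (j - k) = toR j - toR k := by
  funext i
  simp [toR]

theorem toR_nsmul (L : ℕ) (k : ℤ^d) : toR (L • k) = (L : ℝ) • toR k := by
  funext i
  simp [toR]

theorem toR_neg (k : ℤ^d) : toR (-k) = - toR k := by
  funext i
  simp [toR]

theorem toR_zero : toR (0 : ℤ^d) = 0 := by
  funext i
  simp [toR]

/-- The moment `∑_k p(k) [υ * w](k)`. -/
def moment (υ : Filt d 1 r) (w : Filt d r 1) (p : ℝ^d → ℂ) : ℂ :=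
  pairing (conv υ w) (fun k => p (toR k) • (1 : Mat 1 1)) 0 0

theorem expo_zero_right (x : ℝ^d) : expo x 0 = 1 := by simp [expo]

theorem expo_add_left (x y ξ : ℝ^d) : expo (x + y) ξ = expo x ξ * expo y ξ := by
  simp only [expo, ← Complex.exp_add, Pi.add_apply, add_mul, sum_add_distrib]
  congr 1
  push_cast
  ring

theorem expo_add_right (x ξ η : ℝ^d) : expo x (ξ + η) = expo x ξ * expo x η := by
  simp only [expo, ← Complex.exp_add, Pi.add_apply, mul_add, sum_add_distrib]
  congr 1
  push_cast
  ring

theorem expo_smul (c : ℝ) (x ξ : ℝ^d) : expo (c • x) ξ = expo x (c • ξ) := by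
  simp only [expo, Pi.smul_apply, smul_eq_mul]
  congr 4
  funext i
  ring

theorem fourierSeries_eq_pairing (v : Filt d s t) (ξ : ℝ^d) : fourierSeries v ξ = pairing v fun k =>
      expo (toR k) ξ • (1 : Mat t t) := by
  simp [fourierSeries, pairing]

theorem fourierSeries_conv {q : ℕ} (v : Filt d s q) (w : Filt d q t) (ξ : ℝ^d) :
    fourierSeries (conv v w) ξ = fourierSeries v ξ * fourierSeries w ξ := by
  simp only [fourierSeries_eq_pairing, pairing_conv]
  rw [← pairing_mul]
  congr 1
  funext z
  rw [Matrix.smul_mul, Matrix.one_mul, ← pairing_smul]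
  simp only [toR_add, expo_add_left, smul_smul]

theorem prod_neg_I_mul (μ : Fin d → ℕ) (k : ℤ^d) : ∏ l, (-I * (k l : ℂ)) ^ μ l =
      (-I) ^ deg μ * mono μ (toR k) := by
  simp only [mul_pow, Finset.prod_mul_distrib, deg, Finset.prod_pow_eq_pow_sum, mono, toR,
    Complex.ofReal_intCast]

theorem mderiv_fourierSeries_zero (v : Filt d s t) (i : Fin s) (j : Fin t) (μ : Fin d → ℕ) :
    mderiv μ (fun ξ => fourierSeries v ξ i j) 0 =
      (-I) ^ deg μ * pairing v (fun k => mono μ (toR k) • (1 : Mat t t)) i j := by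
  have h := mderiv_pairing_expo v (fun _ => 1) i j μ
  simp only [one_mul] at h
  simp only [fourierSeries_eq_pairing, h, expo_zero_right, prod_neg_I_mul, mul_one, mul_smul]
  rw [pairing_smul]
  simp

theorem neg_I_pow_ne_zero (n : ℕ) : (-I) ^ n ≠ 0 := pow_ne_zero _ (neg_ne_zero.2 Complex.I_ne_zero)

theorem mderiv_zero_fun (μ : Fin d → ℕ) : mderiv μ (fun _ => (0 : ℂ)) 0 = 0 := by
  have := mderiv_const_mul_mono 0 μ (0 : Fin d → ℕ)
  simp only [zero_mul, ite_self] at this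
  exact this

theorem moment_add (υ : Filt d 1 r) (w : Filt d r 1) (p q : ℝ^d → ℂ) : moment υ w (p + q) =
      moment υ w p + moment υ w q := by
  simp [moment, add_smul, pairing_add]

theorem moment_smul (υ : Filt d 1 r) (w : Filt d r 1) (c : ℂ) (p : ℝ^d → ℂ) : moment υ w (c • p) =
      c * moment υ w p := by
  simp [moment, mul_smul, pairing_smul]

/-- The moments as a linear functional of the test function. -/
def momentLin (υ : Filt d 1 r) (w : Filt d r 1) : (ℝ^d → ℂ) →ₗ[ℂ] ℂ where
  toFun := moment υ w
  map_add' := moment_add υ w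
  map_smul' := moment_smul υ w

theorem moment_eq_zero_of_mono (h : ∀ μ : Fin d → ℕ, deg μ < N → moment υ w (mono μ) = 0)
    (hp : p ∈ polySpace d N) : moment υ w p = 0 :=
  polySpace_le (W := LinearMap.ker (momentLin υ w)) h hp

theorem mem_vanishingSpace_iff_mono : w ∈ vanishingSpace N y ↔ ∀ μ : Fin d → ℕ, deg μ < N →
      moment y w (mono μ) = 0 := by
  simp only [vanishingSpace, AgreeToOrder, Set.mem_ofPred_eq, ← fourierSeries_conv,
    Pi.zero_apply, Matrix.zero_apply, mderiv_fourierSeries_zero, mderiv_zero_fun]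
  refine forall₂_congr fun μ _ => ?_
  simp [moment]

theorem mem_vanishingSpace_iff : w ∈ vanishingSpace N y ↔ ∀ p ∈ polySpace d N, moment y w p =
      0 := by
  rw [mem_vanishingSpace_iff_mono]
  exact ⟨fun h p hp => moment_eq_zero_of_mono h hp, fun h μ hμ => h _ (mono_mem hμ)⟩

theorem beta_eq (υ : Filt d 1 r) (u : Filt d r 1) (μ : Fin d → ℕ) : beta υ u μ =
      (-1) ^ deg μ * moment υ u (mono μ) / ((∏ i, (μ i).factorial : ℕ) : ℂ) := by
  simp only [beta, ← fourierSeries_conv, mderiv_fourierSeries_zero, moment]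
  rw [neg_pow I, mul_assoc, mul_left_comm, mul_div_mul_left _ _ (pow_ne_zero _ Complex.I_ne_zero)]

theorem prod_I_mul (μ : Fin d → ℕ) (ξ : ℝ^d) : ∏ i, (I * (ξ i : ℂ)) ^ μ i =
      I ^ deg μ * mono μ ξ := by
  simp [mul_pow, Finset.prod_mul_distrib, deg, Finset.prod_pow_eq_pow_sum, mono]

theorem factorial_prod_ne_zero (μ : Fin d → ℕ) : ((∏ i, (μ i).factorial : ℕ) : ℂ) ≠ 0 := by
  exact_mod_cast Finset.prod_ne_zero_iff.2 fun i _ => Nat.factorial_ne_zero (μ i)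

theorem mem_momentSpace_iff {u : Filt d r 1} : u ∈ momentSpace υ μ ↔ ∀ ν : Fin d → ℕ, deg ν ≤
      deg μ → ν ≠ μ → moment υ u (mono ν) = 0 := by
  have hI : I ^ deg μ ≠ 0 := pow_ne_zero _ Complex.I_ne_zero
  have h1 : ∀ ν : Fin d → ℕ, (∀ i j : Fin 1,
      mderiv ν (fun ξ => fourierSeries (conv υ u) ξ i j) 0 =
        mderiv ν (fun ξ => beta υ u μ * ∏ i, (I * (ξ i : ℂ)) ^ μ i) 0) ↔
      (ν ≠ μ → moment υ u (mono ν) = 0) := fun ν => by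
    simp only [Fin.forall_fin_one, mderiv_fourierSeries_zero, prod_I_mul, ← mul_assoc]
    rw [mderiv_const_mul_mono]
    change (-I) ^ deg ν * moment υ u (mono ν) = _ ↔ _
    by_cases hν : ν = μ
    · subst hν
      simp only [if_true, ne_eq, not_true, false_imp_iff, iff_true]
      rw [beta_eq, neg_pow]
      have := factorial_prod_ne_zero ν
      field_simp
    · rw [if_neg (Ne.symm hν)]
      simp [hν]
  simp only [momentSpace, AgreeToOrder, Set.mem_ofPred_eq, ← fourierSeries_conv, Matrix.of_apply,
    Nat.lt_succ_iff, h1]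

theorem moment_add_right (υ : Filt d 1 r) (w w' : Filt d r 1) (p : ℝ^d → ℂ) : moment υ (w + w') p =
      moment υ w p + moment υ w' p := by
  simp [moment, conv_add_right, pairing_add_left]

theorem moment_sub_right (υ : Filt d 1 r) (w w' : Filt d r 1) (p : ℝ^d → ℂ) : moment υ (w - w') p =
      moment υ w p - moment υ w' p := by
  simp [moment, conv_sub_right, pairing_sub_left]

theorem moment_smul_right (υ : Filt d 1 r) (w : Filt d r 1) (c : ℂ) (p : ℝ^d → ℂ) :
    moment υ (c • w) p = c * moment υ w p := by
  simp [moment, conv_smul_right, pairing_smul_left]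

theorem moment_eq_pairing (υ : Filt d 1 r) (w : Filt d r 1) (p : ℝ^d → ℂ) : moment υ w p =
      pairing υ (fun z => pairing w fun k => p (toR z + toR k) • (1 : Mat 1 1)) 0 0 := by
  simp [moment, pairing_conv, toR_add]

theorem moment_eq_sum (υ : Filt d 1 r) (w : Filt d r 1) (p : ℝ^d → ℂ) : moment υ w p =
      ∑ k ∈ w.support, (pairing υ (fun z => p (toR z + toR k) • (1 : Mat r r)) * w k) 0 0 := by
  rw [moment_eq_pairing, pairing_swap υ w fun z k => p (toR z + toR k), Matrix.sum_apply]

end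

section

/-! ### Matching filters and invariance under the transition operators -/

variable {d r lam N s N' : ℕ} {a : Filt d r r} {y : Filt d 1 r} {p : ℝ^d → ℂ} {w : Filt d r 1}
  {ρ ρ' : ℝ}

theorem expo_toR_pi_mul_toR (lam : ℕ) [NeZero lam] (l x : ℤ^d) :
    expo (toR l) ((2 * π) • ((lam : ℝ)⁻¹ • toR x)) =
      Complex.exp (2 * π * I * ((∑ i, x i * (-l) i : ℤ) / lam)) := by
  simp only [expo]
  congr 1
  have hl : (lam : ℂ) ≠ 0 := by exact_mod_cast NeZero.ne lam
  push_cast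
  simp only [toR, Pi.smul_apply, smul_eq_mul, Finset.sum_div, mul_sum]
  refine sum_congr rfl fun i _ => ?_
  push_cast
  simp only [Pi.neg_apply]
  push_cast
  field_simp

theorem expo_lattice_eq_one (lam : ℕ) [NeZero lam] (z x : ℤ^d) :
    expo (toR (lam • z)) ((2 * π) • ((lam : ℝ)⁻¹ • toR x)) = 1 := by
  rw [expo_toR_pi_mul_toR, Complex.exp_eq_one_iff]
  have hl : (lam : ℂ) ≠ 0 := by exact_mod_cast NeZero.ne lam
  refine ⟨∑ i, x i * (-z) i, ?_⟩
  have : (∑ i, x i * (-(lam • z)) i : ℤ) = lam * ∑ i, x i * (-z) i := by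
    rw [mul_sum]
    refine sum_congr rfl fun i _ => ?_
    simp only [Pi.neg_apply, Pi.smul_apply]
    rw [nsmul_eq_mul]
    ring
  rw [this]
  push_cast
  field_simp

theorem fourierSeries_smul_mul (lam : ℕ) [NeZero lam] (a : Filt d r r) (y : Filt d 1 r) (x : ℤ^d)
    (ξ : ℝ^d) : ((lam : ℂ) ^ d) • (fourierSeries y ((lam : ℝ) • ξ) * fourierSeries a (ξ + (2 * π) •
      ((lam : ℝ)⁻¹ • toR x))) = pairing (subdiv lam a y) fun l =>
      (expo (toR l) ((2 * π) • ((lam : ℝ)⁻¹ • toR x)) * expo (toR l) ξ) • (1 : Mat r r) := by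
  rw [pairing_subdiv, fourierSeries_eq_pairing y, ← pairing_mul]
  congr 2
  funext z
  rw [Matrix.smul_mul, Matrix.one_mul, fourierSeries_eq_pairing, ← pairing_smul]
  congr 1
  funext k
  rw [smul_smul, toR_add, expo_add_left, expo_add_left, expo_lattice_eq_one, one_mul,
    expo_add_right, ← expo_smul, ← toR_nsmul]
  congr 1
  ring

theorem IsMatchingFilter.pairing_character [NeZero lam] (h : IsMatchingFilter lam N a y)
    {μ : Fin d → ℕ} (hμ : deg μ < N) (x : Fin d → Fin lam) (j : Fin r) :
    pairing (subdiv lam a y) (fun l => (mono μ (toR l) * expo (toR l) ((2 * π) •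
      ((lam : ℝ)⁻¹ • toR fun i => ((x i : ℕ) : ℤ)))) • (1 : Mat r r)) 0 j = if x =
      0 then (lam : ℂ) ^ d * pairing y (fun k => mono μ (toR k) • (1 : Mat r r)) 0 j else 0 := by
  have hl0 : (0 : ℝ) < lam := by exact_mod_cast NeZero.pos lam
  have hlc : (lam : ℂ) ^ d ≠ 0 := pow_ne_zero _ (by exact_mod_cast NeZero.ne lam)
  set w : ℝ^d := (lam : ℝ)⁻¹ • toR fun i => ((x i : ℕ) : ℤ) with hw
  have hmem : w ∈ cosetReps d lam := by
    refine ⟨⟨_, rfl⟩, fun i => ?_⟩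
    have h1 : ((x i : ℕ) : ℝ) < lam := by exact_mod_cast (x i).2
    simp only [hw, Pi.smul_apply, toR, smul_eq_mul, Int.cast_natCast]
    refine ⟨by positivity, ?_⟩
    rw [inv_mul_lt_iff₀ hl0]
    linarith
  have hw0 : w = 0 ↔ x = 0 := by
    constructor
    · intro h
      funext i
      have h2 := congrFun h i
      simp only [hw, Pi.smul_apply, toR, smul_eq_mul, Int.cast_natCast, Pi.zero_apply,
        mul_eq_zero, inv_eq_zero, hl0.ne', false_or] at h2
      ext
      simpa using h2
    · rintro rfl
      funext i
      simp [hw, toR]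
  have h1 := h.2 w hmem μ hμ 0 j
  have h2 : (fun ξ => (fourierSeries y ((lam : ℝ) • ξ) *
      fourierSeries a (ξ + (2 * π) • w)) 0 j) = fun ξ => pairing (subdiv lam a y) (fun l =>
        ((((lam : ℂ) ^ d)⁻¹ * expo (toR l) ((2 * π) • w)) * expo (toR l) ξ) •
          (1 : Mat r r)) 0 j := by
    funext ξ
    have h3 := fourierSeries_smul_mul lam a y (fun i => ((x i : ℕ) : ℤ)) ξ
    rw [← hw] at h3
    simp only [mul_assoc, mul_smul (((lam : ℂ) ^ d)⁻¹)]
    rw [pairing_smul, ← h3, inv_smul_smul₀ hlc]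
  clear_value w
  rw [h2, mderiv_pairing_expo] at h1
  simp only [expo_zero_right, mul_one, prod_neg_I_mul] at h1
  have h4 : ∀ l : ℤ^d, ((-I) ^ deg μ * mono μ (toR l) *
      (((lam : ℂ) ^ d)⁻¹ * expo (toR l) ((2 * π) • w))) •
        (1 : Mat r r) = ((-I) ^ deg μ * ((lam : ℂ) ^ d)⁻¹) •
      ((mono μ (toR l) * expo (toR l) ((2 * π) • w)) • (1 : Mat r r)) := fun l => by
    rw [smul_smul]
    congr 1
    ring
  simp only [h4] at h1
  rw [pairing_smul] at h1
  have hI := neg_I_pow_ne_zero (deg μ)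
  by_cases hx : x = 0
  · have hwz := hw0.2 hx
    simp only [hwz, if_true, mderiv_fourierSeries_zero] at h1
    rw [if_pos hx, hwz]
    rw [Matrix.smul_apply, smul_eq_mul, mul_assoc] at h1
    have h5 := mul_left_cancel₀ hI h1
    rw [← h5, mul_inv_cancel_left₀ hlc]
  · rw [if_neg hx]
    simp only [mt hw0.1 hx, if_false, Matrix.zero_apply, mderiv_zero_fun] at h1
    rw [Matrix.smul_apply, smul_eq_mul] at h1
    exact (mul_eq_zero.1 h1).resolve_left (mul_ne_zero hI (inv_ne_zero hlc))

theorem pairing_eq_of_mono (v v' : Filt d s r) (χ : ℤ^d → ℂ)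
    (h : ∀ μ : Fin d → ℕ, deg μ < N → pairing v (fun k => (χ k * mono μ (toR k)) • (1 : Mat r r)) =
    pairing v' (fun k => mono μ (toR k) • (1 : Mat r r))) (hp : p ∈ polySpace d N) :
    pairing v (fun k => (χ k * p (toR k)) • (1 : Mat r r)) =
      pairing v' (fun k => p (toR k) • (1 : Mat r r)) := by
  let W : Submodule ℂ (ℝ^d → ℂ) :=
    { carrier := {p | pairing v (fun k => (χ k * p (toR k)) • (1 : Mat r r)) =
        pairing v' (fun k => p (toR k) • (1 : Mat r r))}
      zero_mem' := by simp [pairing_zero]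
      add_mem' := fun hp hq => by
        simp only [Set.mem_ofPred_eq, Pi.add_apply, mul_add, add_smul, pairing_add] at hp hq ⊢
        rw [hp, hq]
      smul_mem' := fun c p hp => by
        simp only [Set.mem_ofPred_eq, Pi.smul_apply, smul_eq_mul, mul_left_comm _ c, mul_smul c,
          pairing_smul] at hp ⊢
        rw [hp] }
  exact polySpace_le (W := W) h hp

open Classical in
theorem IsMatchingFilter.pairing_coset [NeZero lam] (h : IsMatchingFilter lam N a y) (γ : ℤ^d)
    (hp : p ∈ polySpace d N) : pairing (subdiv lam a y) (fun l =>
      ((if ∀ i, (lam : ℤ) ∣ γ i - l i then 1 else 0) * p (toR l)) • (1 : Mat r r)) =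
      pairing y (fun k => p (toR k) • (1 : Mat r r)) := by
  have hlc : (lam : ℂ) ^ d ≠ 0 := pow_ne_zero _ (by exact_mod_cast NeZero.ne lam)
  refine pairing_eq_of_mono _ _ _ (fun μ hμ => ?_) hp
  have e0 : ∀ i : Fin 1, i = 0 := fun i => Subsingleton.elim _ _
  ext i j
  rw [e0 i]
  have hchar : ∀ l : ℤ^d, ((if ∀ i, (lam : ℤ) ∣ γ i - l i then (1 : ℂ) else 0) *
      mono μ (toR l)) = ∑ x : Fin d → Fin lam, (((lam : ℂ) ^ d)⁻¹ *
        Complex.exp (2 * π * I * ((∑ i, ((x i : ℕ) : ℤ) * γ i : ℤ) / lam))) *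
        (mono μ (toR l) * expo (toR l) ((2 * π) •
        ((lam : ℝ)⁻¹ • toR fun i => ((x i : ℕ) : ℤ)))) := fun l => by
    have h1 := sum_character_pi lam fun i => γ i - l i
    have h2 : ∀ x : Fin d → Fin lam, (((lam : ℂ) ^ d)⁻¹ *
        Complex.exp (2 * π * I * ((∑ i, ((x i : ℕ) : ℤ) * γ i : ℤ) / lam))) *
        (mono μ (toR l) * expo (toR l) ((2 * π) •
        ((lam : ℝ)⁻¹ • toR fun i => ((x i : ℕ) : ℤ)))) = (((lam : ℂ) ^ d)⁻¹ * mono μ (toR l)) *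
        Complex.exp (2 * π * I * ((∑ i, ((x i : ℕ) : ℤ) * (γ i - l i) : ℤ) / lam)) := fun x => by
      have e1 : (∑ i, ((x i : ℕ) : ℤ) * (γ i - l i)) =
          (∑ i, ((x i : ℕ) : ℤ) * γ i) + ∑ i, ((x i : ℕ) : ℤ) * (-l) i := by
        rw [← sum_add_distrib]
        refine sum_congr rfl fun i _ => ?_
        simp only [Pi.neg_apply]
        ring
      rw [expo_toR_pi_mul_toR, e1, Int.cast_add, add_div, mul_add, Complex.exp_add]
      ring
    simp only [h2]
    rw [← mul_sum]
    push_cast at h1 ⊢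
    rw [h1]
    split_ifs
    · rw [mul_comm (((lam : ℂ) ^ d)⁻¹), mul_assoc, inv_mul_cancel₀ hlc]
      ring
    · ring
  simp only [hchar, Finset.sum_smul]
  rw [pairing_sum, Matrix.sum_apply]
  simp only [mul_smul (((lam : ℂ) ^ d)⁻¹ * _)]
  simp only [pairing_smul, Matrix.smul_apply, smul_eq_mul]
  rw [sum_congr rfl fun x _ => by rw [h.pairing_character hμ x j], sum_eq_single 0]
  · simp [inv_mul_cancel_left₀ hlc]
  · intro x _ hx
    simp [hx]
  · simp

theorem IsMatchingFilter.pairing_subdiv_eq [NeZero lam] (h : IsMatchingFilter lam N a y)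
    (hp : p ∈ polySpace d N) : pairing y (fun z => pairing a fun k => p (toR (lam • z + k)) •
      (1 : Mat r r)) = pairing y (fun k => p (toR k) • (1 : Mat r r)) := by
  have hlc : (lam : ℂ) ^ d ≠ 0 := pow_ne_zero _ (by exact_mod_cast NeZero.ne lam)
  have h1 : pairing (((lam : ℂ) ^ d)⁻¹ • subdiv lam a y) (fun l => ((1 : ℂ) * p (toR l)) •
      (1 : Mat r r)) =
      pairing y (fun k => p (toR k) • (1 : Mat r r)) := by
    refine pairing_eq_of_mono _ _ (fun _ => 1) (fun μ hμ => ?_) hp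
    have e0 : ∀ i : Fin 1, i = 0 := fun i => Subsingleton.elim _ _
    ext i j
    rw [e0 i]
    have h2 := h.pairing_character hμ 0 j
    have h3 : (toR fun i : Fin d => (((0 : Fin d → Fin lam) i : ℕ) : ℤ)) = 0 := by
      funext i
      simp [toR]
    rw [h3] at h2
    simp only [smul_zero, expo_zero_right, mul_one, if_true] at h2
    simp only [one_mul, pairing_smul_left, Matrix.smul_apply, smul_eq_mul, h2]
    rw [inv_mul_cancel_left₀ hlc]
  simp only [one_mul, pairing_smul_left, pairing_subdiv] at h1
  rwa [inv_smul_smul₀ hlc] at h1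

theorem IsMatchingFilter.mono_order (h : IsMatchingFilter lam N a y) (hN : N' ≤ N) :
    IsMatchingFilter lam N' a y :=
  ⟨h.1, fun w hw μ hμ => h.2 w hw μ (hμ.trans_le hN)⟩

theorem moment_trans [NeZero lam] (h : IsMatchingFilter lam N a y) (γ : ℤ^d) (w : Filt d r 1)
    (hp : p ∈ polySpace d N) : moment y (trans lam a γ w) p = moment y w fun x =>
      p ((lam : ℝ)⁻¹ • (x - toR γ)) := by
  classical
  have hl0 : (lam : ℝ) ≠ 0 := by exact_mod_cast NeZero.ne lam
  set Φ : ℤ^d → ℂ := fun l => (if ∀ i, (lam : ℤ) ∣ γ i - l i then 1 else 0) *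
    p ((lam : ℝ)⁻¹ • (toR l - toR γ)) with hΦ
  have hext : ∀ z l : ℤ^d, Function.extend (fun k => lam • k + γ)
      (fun k => p (toR z + toR k) • (1 : Mat 1 1)) 0 l =
        Φ (lam • z + l) • (1 : Mat 1 1) := fun z l => by
    by_cases hl : ∃ k, lam • k + γ = l
    · obtain ⟨k, rfl⟩ := hl
      rw [(smul_add_injective (NeZero.ne lam) γ).extend_apply]
      have h1 : ∀ i, (lam : ℤ) ∣ γ i - (lam • z + (lam • k + γ)) i := fun i => by
        refine ⟨-(z i + k i), ?_⟩
        simp only [Pi.add_apply, Pi.smul_apply]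
        rw [nsmul_eq_mul, nsmul_eq_mul]
        ring
      simp only [hΦ]
      rw [if_pos h1, one_mul]
      congr 2
      rw [toR_add, toR_add, toR_nsmul, toR_nsmul, ← add_assoc, add_sub_cancel_right, smul_add,
        inv_smul_smul₀ hl0, inv_smul_smul₀ hl0]
    · have h1 : ¬ ∀ i, (lam : ℤ) ∣ γ i - (lam • z + l) i := fun hcon => by
        apply hl
        choose c hc using hcon
        refine ⟨fun i => -c i - z i, ?_⟩
        funext i
        have := hc i
        simp only [Pi.add_apply, Pi.smul_apply] at this ⊢
        rw [nsmul_eq_mul] at this ⊢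
        linarith
      rw [Function.extend_apply' _ _ _ hl]
      simp only [hΦ]
      rw [if_neg h1]
      simp
  have hl1 : ∀ i : ℤ^d, pairing (subdiv lam a y)
      (fun l => Φ (l + i) • (1 : Mat r r)) =
      pairing y fun k => p ((lam : ℝ)⁻¹ • (toR k + toR i - toR γ)) • (1 : Mat r r) := fun i => by
    have hq : (fun x => p ((lam : ℝ)⁻¹ • (x + (toR i - toR γ)))) ∈ polySpace d N :=
      translate_mem (dilate_mem hp (lam : ℝ)⁻¹) (toR i - toR γ)
    have := h.pairing_coset (γ - i) hq
    simp only [Pi.sub_apply, sub_sub, ← add_sub_assoc] at this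
    simp only [hΦ, toR_add]
    rw [← this]
    congr 1
    funext l
    simp only [Pi.add_apply, add_comm (l _) (i _)]
  rw [moment_eq_pairing, moment_eq_sum]
  simp only [trans, pairing_down, pairing_smul_left, pairing_conv, hext]
  have key : pairing (subdiv lam a y) (fun l => pairing w fun k =>
      Φ (l + k) • (1 : Mat 1 1)) = ((lam : ℂ) ^ d) • pairing y fun z =>
        pairing a fun j => pairing w fun k => Φ (lam • z + (j + k)) • (1 : Mat 1 1) := by
    rw [pairing_subdiv]
    simp only [add_assoc]
  rw [pairing_smul, ← key, pairing_swap _ _ fun l k => Φ (l + k), Matrix.sum_apply]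
  simp only [hl1]

theorem trans_mem_vanishingSpace [NeZero lam] (h : IsMatchingFilter lam N a y) (γ : ℤ^d)
    (hw : w ∈ vanishingSpace N y) : trans lam a γ w ∈ vanishingSpace N y := by
  rw [mem_vanishingSpace_iff] at hw ⊢
  intro p hp
  rw [moment_trans h γ w hp]
  have := translate_mem (dilate_mem hp (lam : ℝ)⁻¹) (-toR γ)
  simp only [← sub_eq_add_neg] at this
  exact hw _ this

theorem trans_sub_mem_vanishingSpace [NeZero lam] (h : IsMatchingFilter lam (N + 1) a y) (γ : ℤ^d)
    (hw : w ∈ vanishingSpace N y) : trans lam a γ w - (((lam : ℂ)⁻¹) ^ N) • w ∈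
      vanishingSpace (N + 1) y := by
  rw [mem_vanishingSpace_iff] at hw
  rw [mem_vanishingSpace_iff_mono]
  intro μ hμ
  rw [moment_sub_right, moment_smul_right, moment_trans h γ w (mono_mem hμ)]
  have h1 : (fun x => mono μ ((lam : ℝ)⁻¹ • (x - toR γ))) =
      (((lam : ℂ)⁻¹) ^ deg μ) • ((fun x => mono μ (x + -toR γ) - mono μ x) + mono μ) := by
    funext x
    simp only [mono_smul, Pi.smul_apply, Pi.add_apply, sub_add_cancel, smul_eq_mul,
      sub_eq_add_neg x]
    push_cast
    rfl
  have h2 := hw _ (polySpace_mono (Nat.lt_succ_iff.1 hμ) (translate_mono_sub_mem (-toR γ) μ))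
  rw [h1, moment_smul, moment_add, h2, zero_add]
  rcases (Nat.lt_succ_iff.1 hμ).lt_or_eq with h3 | h3
  · rw [hw _ (mono_mem h3)]
    simp
  · rw [h3, sub_self]

theorem vanishingSpace_add {w' : Filt d r 1} (hw : w ∈ vanishingSpace N y)
    (hw' : w' ∈ vanishingSpace N y) : w + w' ∈ vanishingSpace N y := by
  rw [mem_vanishingSpace_iff] at *
  intro p hp
  rw [moment_add_right, hw p hp, hw' p hp, add_zero]

theorem vanishingSpace_smul (c : ℂ) (hw : w ∈ vanishingSpace N y) : c • w ∈ vanishingSpace N y := by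
  rw [mem_vanishingSpace_iff] at *
  intro p hp
  rw [moment_smul_right, hw p hp, mul_zero]

theorem vanishingSpace_zero_mem : (0 : Filt d r 1) ∈ vanishingSpace N y := by
  rw [mem_vanishingSpace_iff]
  intro p _
  simpa using moment_smul_right y 0 0 p

theorem vanishingSpace_mono (h : N ≤ N') : vanishingSpace N' y ⊆ vanishingSpace N y :=
  fun _ hw μ hμ => hw μ (hμ.trans_le h)

theorem moment_shift (y : Filt d 1 r) (z : ℤ^d) (w : Filt d r 1) (p : ℝ^d → ℂ) :
    moment y (shift z w) p = moment y w fun x => p (x + toR z) := by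
  simp only [moment_eq_pairing, pairing_shift, toR_add]
  congr 2
  funext k
  congr 1
  funext l
  congr 2
  abel

/-! ### Decay rates -/

/-- The sequences `S_a^n(δ I_r) * w` with `w ∈ W` decay like `ρ^n`. -/
def Decays (lam : ℕ) (a : Filt d r r) (W : Set (Filt d r 1)) (ρ : ℝ) : Prop :=
  ∀ w ∈ W, ∃ C : ℝ, ∀ n k i, ‖conv (mask lam a n) w k i 0‖ ≤ C * ρ ^ n

theorem exists_bound {t : ℕ} (u : Filt d s t) : ∃ C : ℝ, 0 ≤ C ∧ ∀ k i j, ‖u k i j‖ ≤ C := by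
  refine ⟨∑ k ∈ u.support, ∑ i, ∑ j, ‖u k i j‖, by positivity, fun k i j => ?_⟩
  by_cases hk : u k = 0
  · rw [hk]
    simp only [Matrix.zero_apply, norm_zero]
    positivity
  · have hmem : k ∈ u.support := by simpa using hk
    calc ‖u k i j‖ ≤ ∑ j, ‖u k i j‖ :=
          single_le_sum (f := fun j => ‖u k i j‖) (fun _ _ => norm_nonneg _) (mem_univ j)
      _ ≤ ∑ i, ∑ j, ‖u k i j‖ :=
          single_le_sum (f := fun i => ∑ j, ‖u k i j‖) (fun _ _ => by positivity)
            (mem_univ i)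
      _ ≤ _ := single_le_sum (f := fun k => ∑ i, ∑ j, ‖u k i j‖) (fun _ _ => by positivity) hmem

theorem Decays.descend [NeZero lam] (hy : IsMatchingFilter lam (N + 1) a y) (hρ : 0 ≤ ρ)
    (hρ' : ρ ≤ ρ') (hN : ((lam : ℝ)⁻¹) ^ N < ρ') (h : Decays lam a (vanishingSpace (N + 1) y) ρ) :
    Decays lam a (vanishingSpace N y) ρ' := fun w hw => by
  have hγ := fun γ : Fin d → Fin lam => h _ (trans_sub_mem_vanishingSpace hy
    (fun i => ((γ i : ℕ) : ℤ)) hw)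
  choose C hC using hγ
  obtain ⟨C0, hC0, hw0⟩ := exists_bound w
  have hρ'0 : 0 < ρ' := lt_of_le_of_lt (by positivity) hN
  set C1 : ℝ := ∑ γ, |C γ| with hC1
  have hC1γ : ∀ γ, C γ ≤ C1 := fun γ => (le_abs_self _).trans
    (single_le_sum (f := fun γ => |C γ|) (fun _ _ => abs_nonneg _) (mem_univ γ))
  have hC1nn : 0 ≤ C1 := sum_nonneg fun _ _ => abs_nonneg _
  set θ : ℝ := ((lam : ℝ)⁻¹) ^ N with hθ
  have hθ0 : 0 ≤ θ := by positivity
  have hgap : 0 < ρ' - θ := sub_pos.2 hN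
  refine ⟨C0 + C1 / (ρ' - θ), fun n => ?_⟩
  have hCC : C1 ≤ (C0 + C1 / (ρ' - θ)) * (ρ' - θ) := by
    rw [add_mul, div_mul_cancel₀ _ hgap.ne']
    nlinarith
  induction n with
  | zero =>
    intro k i
    rw [conv_mask_zero, pow_zero, mul_one]
    have : 0 ≤ C1 / (ρ' - θ) := by positivity
    linarith [hw0 k i 0]
  | succ n ih =>
    intro l i
    obtain ⟨k, γ, rfl⟩ := exists_eq_smul_add lam l
    rw [conv_mask_succ_apply]
    have e : trans lam a (fun i => ((γ i : ℕ) : ℤ)) w = (((lam : ℂ)⁻¹) ^ N) • w +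
        (trans lam a (fun i => ((γ i : ℕ) : ℤ)) w - (((lam : ℂ)⁻¹) ^ N) • w) := by abel
    rw [e, conv_add_right, conv_smul_right]
    have h1 := ih k i
    have h2 := hC γ n k i
    have h3 : C γ * ρ ^ n ≤ C1 * ρ' ^ n :=
      mul_le_mul (hC1γ γ) (pow_le_pow_left₀ hρ hρ' n) (by positivity) hC1nn
    have h4 : ‖((lam : ℂ)⁻¹) ^ N‖ = θ := by simp [hθ]
    calc _ ≤ ‖((lam : ℂ)⁻¹) ^ N‖ * ‖conv (mask lam a n) w k i 0‖ + C γ * ρ ^ n := by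
          rw [← norm_mul]
          exact (norm_add_le _ _).trans (add_le_add le_rfl h2)
      _ ≤ θ * ((C0 + C1 / (ρ' - θ)) * ρ' ^ n) + C1 * ρ' ^ n := by
          rw [h4]
          gcongr
      _ ≤ θ * ((C0 + C1 / (ρ' - θ)) * ρ' ^ n) +
            ((C0 + C1 / (ρ' - θ)) * (ρ' - θ)) * ρ' ^ n := by
          gcongr
      _ = _ := by ring

theorem Decays.mono_rate {W : Set (Filt d r 1)} (hρ : 0 ≤ ρ) (hρ' : ρ ≤ ρ') (h : Decays lam a W ρ) :
    Decays lam a W ρ' := fun w hw => by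
  obtain ⟨C, hC⟩ := h w hw
  refine ⟨|C|, fun n k i => (hC n k i).trans ?_⟩
  exact mul_le_mul (le_abs_self C) (pow_le_pow_left₀ hρ hρ' n) (by positivity) (abs_nonneg C)

/-- Successive descent: decay on the filters with `N` vanishing moments gives decay with fewer
vanishing moments, at a rate that is only limited by the order. -/
theorem Decays.descend_le [NeZero lam] (hlam : 2 ≤ lam) {M : ℕ} (hMN : M ≤ N)
    (hy : IsMatchingFilter lam N a y) (hρ : 0 ≤ ρ) (hρ' : ρ ≤ ρ') (hM : ((lam : ℝ)⁻¹) ^ M < ρ')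
    (h : Decays lam a (vanishingSpace N y) ρ) : Decays lam a (vanishingSpace M y) ρ' := by
  induction N, hMN using Nat.le_induction with
  | base => exact h.mono_rate hρ hρ'
  | succ N hN ih =>
    have h1 : ((lam : ℝ)⁻¹) ^ N ≤ ((lam : ℝ)⁻¹) ^ M :=
      pow_le_pow_of_le_one (by positivity) (inv_le_one_of_one_le₀ (by exact_mod_cast (by omega)))
        hN
    have h2 : Decays lam a (vanishingSpace N y) ρ' := h.descend hy hρ hρ' (h1.trans_lt hM)
    clear ih
    have h3 : ∀ K, M ≤ K → K ≤ N → Decays lam a (vanishingSpace K y) ρ' := fun K hMK hKN => by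
      induction hj : N - K generalizing K with
      | zero =>
        have : K = N := by omega
        exact this ▸ h2
      | succ j ihj =>
        have h4 := ihj (K + 1) (by omega) (by omega) (by omega)
        refine h4.descend (hy.mono_order (by omega)) (hρ.trans hρ') le_rfl (lt_of_le_of_lt ?_ hM)
        exact pow_le_pow_of_le_one (by positivity)
          (inv_le_one_of_one_le₀ (by exact_mod_cast (by omega))) hMK
    exact h3 M le_rfl hN

end

section

/-! ### Consequences of the eigenvalue condition -/

variable {d r t lam m s N R : ℕ} {ρ : ℝ} {B : Mat r r} {x z : Fin r → ℂ} {c : ℂ}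
  {y υ : Filt d 1 r} {a : Filt d r r} {w : Filt d r 1}

theorem exists_const_of_eventually_le_pow {f : ℕ → ℝ} (hρ : 0 < ρ)
    (h : ∀ᶠ n in atTop, f n ≤ ρ ^ n) : ∃ C : ℝ, 0 ≤ C ∧ ∀ n, f n ≤ C * ρ ^ n := by
  obtain ⟨N, hN⟩ := eventually_atTop.1 h
  refine ⟨1 + ∑ n ∈ Finset.range N, |f n| / ρ ^ n, by positivity, fun n => ?_⟩
  have hpos : 0 < ρ ^ n := pow_pos hρ n
  have hs : 0 ≤ ∑ n ∈ Finset.range N, |f n| / ρ ^ n := by positivity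
  rcases le_or_gt N n with hn | hn
  · have := hN n hn
    nlinarith
  · have h1 : |f n| / ρ ^ n ≤ ∑ n ∈ Finset.range N, |f n| / ρ ^ n :=
      single_le_sum (f := fun n => |f n| / ρ ^ n) (fun _ _ => by positivity)
        (Finset.mem_range.2 hn)
    have h2 : f n ≤ |f n| / ρ ^ n * ρ ^ n := by
      rw [div_mul_cancel₀ _ hpos.ne']
      exact le_abs_self _
    nlinarith

theorem exists_norm_pow_le (hB : ∀ z : ℂ, B.charpoly.IsRoot z → ‖z‖ ≤ 1) {t : ℝ} (ht : 1 < t) :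
    ∃ C : ℝ, 0 ≤ C ∧ ∀ n i j, ‖(B ^ n) i j‖ ≤ C * t ^ n := by
  let _ : NormedRing (Mat r r) := Matrix.linftyOpNormedRing
  let _ : NormedAlgebra ℂ (Mat r r) := Matrix.linftyOpNormedAlgebra
  have : CompleteSpace (Mat r r) := FiniteDimensional.complete ℂ _
  have h1 := spectrum.pow_nnnorm_pow_one_div_tendsto_nhds_spectralRadius B
  have h2 : spectralRadius ℂ B ≤ 1 := by
    refine iSup₂_le fun z hz => ?_
    rw [Matrix.mem_spectrum_iff_isRoot_charpoly] at hz
    have := hB z hz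
    exact_mod_cast this
  have h3 : spectralRadius ℂ B < ENNReal.ofReal t :=
    h2.trans_lt (by rwa [← ENNReal.ofReal_one, ENNReal.ofReal_lt_ofReal_iff (by linarith)])
  have h4 : ∀ᶠ n : ℕ in atTop, ‖B ^ n‖ ≤ t ^ n := by
    filter_upwards [h1.eventually (gt_mem_nhds h3), eventually_gt_atTop 0] with n hn hn0
    have hn0' : (0 : ℝ) < n := by exact_mod_cast hn0
    have h5 := ENNReal.rpow_le_rpow hn.le hn0'.le
    rw [← ENNReal.rpow_mul, one_div, inv_mul_cancel₀ hn0'.ne', ENNReal.rpow_one,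
      ENNReal.rpow_natCast, ← ENNReal.ofReal_pow (by linarith)] at h5
    rw [← enorm_eq_nnnorm, ← ofReal_norm] at h5
    exact (ENNReal.ofReal_le_ofReal_iff (by positivity)).1 h5
  obtain ⟨C, hC0, hC⟩ := exists_const_of_eventually_le_pow (by linarith) h4
  refine ⟨C, hC0, fun n i j => le_trans ?_ (hC n)⟩
  have h6 : ∑ j, ‖(B ^ n) i j‖₊ ≤ ‖B ^ n‖₊ := by
    rw [Matrix.linfty_opNNNorm_def]
    exact Finset.le_sup (f := fun i => ∑ j, ‖(B ^ n) i j‖₊) (mem_univ i)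
  have h7 : ‖(B ^ n) i j‖₊ ≤ ∑ j, ‖(B ^ n) i j‖₊ :=
    single_le_sum (f := fun j => ‖(B ^ n) i j‖₊) (fun _ _ => zero_le) (mem_univ j)
  exact_mod_cast h7.trans h6

theorem isRoot_charpoly_of_mulVec (hx : x ≠ 0) (h : B.mulVec x = c • x) : B.charpoly.IsRoot c := by
  rw [Polynomial.IsRoot, Matrix.eval_charpoly, ← Matrix.exists_mulVec_eq_zero_iff]
  refine ⟨x, hx, ?_⟩
  rw [Matrix.sub_mulVec, h]
  simp [Matrix.scalar_apply, ← Matrix.smul_one_eq_diagonal, Matrix.smul_mulVec]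

theorem isRoot_charpoly_of_vecMul (hx : x ≠ 0) (h : Matrix.vecMul x B = c • x) :
    B.charpoly.IsRoot c := by
  rw [← Matrix.charpoly_transpose]
  exact isRoot_charpoly_of_mulVec hx (by rw [Matrix.mulVec_transpose, h])

theorem mulVec_eq_smul_of_simple (hB : B.charpoly.rootMultiplicity 1 = 1) (hx : x ≠ 0)
    (h : B.mulVec x = x) (hz : ∃ k : ℕ, ((Matrix.toLin' B - 1) ^ k) z = 0) : ∃ c : ℂ, z =
      c • x := by
  have h1 := LinearMap.finrank_maxGenEigenspace_eq (Matrix.toLin' B) 1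
  rw [Matrix.charpoly_toLin', hB] at h1
  have hmem : ∀ v, v ∈ Module.End.maxGenEigenspace (Matrix.toLin' B) 1 ↔
      ∃ k : ℕ, ((Matrix.toLin' B - 1) ^ k) v = 0 := fun v => by
    rw [Module.End.mem_maxGenEigenspace, one_smul]
  have hx' : x ∈ Module.End.maxGenEigenspace (Matrix.toLin' B) 1 := by
    rw [hmem]
    exact ⟨1, by simp [h]⟩
  obtain ⟨c, hc⟩ := (finrank_eq_one_iff_of_nonzero' (⟨x, hx'⟩ :
    Module.End.maxGenEigenspace (Matrix.toLin' B) 1) (by simpa using hx)).1 h1 ⟨z, (hmem z).2 hz⟩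
  exact ⟨c, by simpa using (congrArg Subtype.val hc).symm⟩

theorem vecMul_eq_smul_of_simple (hB : B.charpoly.rootMultiplicity 1 = 1) (hx : x ≠ 0)
    (h : Matrix.vecMul x B = x) (hz : Matrix.vecMul z B = z) : ∃ c : ℂ, z = c • x := by
  rw [← Matrix.charpoly_transpose] at hB
  refine mulVec_eq_smul_of_simple hB hx (by rwa [Matrix.mulVec_transpose]) ⟨1, ?_⟩
  simp [Matrix.mulVec_transpose, hz]

/-- Left and right eigenvectors of a simple eigenvalue are not orthogonal. -/
theorem exists_right_eigenvector (hB : B.charpoly.rootMultiplicity 1 = 1) {y : Fin r → ℂ}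
    (hy : y ≠ 0) (h : Matrix.vecMul y B = y) : ∃ x : Fin r → ℂ, B.mulVec x = x ∧ y ⬝ᵥ x = 1 := by
  have hroot : B.charpoly.IsRoot 1 := isRoot_charpoly_of_vecMul hy (by rw [h, one_smul])
  rw [Polynomial.IsRoot, Matrix.eval_charpoly, ← Matrix.exists_mulVec_eq_zero_iff] at hroot
  obtain ⟨x, hx, hx0⟩ := hroot
  have hBx : B.mulVec x = x := by
    rw [Matrix.sub_mulVec, sub_eq_zero] at hx0
    rw [← hx0]
    simp
  set L : (Fin r → ℂ) →ₗ[ℂ] (Fin r → ℂ) := Matrix.toLin' B - 1 with hL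
  have hLv : ∀ v, L v = B.mulVec v - v := fun v => by simp [hL]
  let φ : (Fin r → ℂ) →ₗ[ℂ] ℂ := dotProductBilin ℂ ℂ y
  have hφ : ∀ v, φ v = y ⬝ᵥ v := fun v => rfl
  have hyx : y ⬝ᵥ x ≠ 0 := fun hyx => by
    have hker : Module.finrank ℂ (LinearMap.ker L) = 1 := by
      refine finrank_eq_one_iff_of_nonzero' (⟨x, by simp [hLv, hBx]⟩ : LinearMap.ker L)
        (by simpa using hx) |>.2 ?_
      rintro ⟨z, hz⟩
      obtain ⟨c, rfl⟩ := mulVec_eq_smul_of_simple hB hx hBx ⟨1, by rw [pow_one]; exact hz⟩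
      exact ⟨c, rfl⟩
    have hrank := L.finrank_range_add_finrank_ker
    have hφ0 : φ ≠ 0 := fun h0 => by
      apply hy
      funext i
      have := LinearMap.congr_fun h0 (Pi.single i 1)
      rw [hφ] at this
      simpa using this
    have hφr := φ.finrank_range_add_finrank_ker
    have hφ1 : Module.finrank ℂ (LinearMap.range φ) = 1 := by
      rw [LinearMap.range_eq_top.2 (LinearMap.surjective hφ0)]
      simp
    have hle : LinearMap.range L ≤ LinearMap.ker φ := by
      rintro _ ⟨v, rfl⟩
      rw [LinearMap.mem_ker, hφ, hLv, dotProduct_sub, Matrix.dotProduct_mulVec, h, sub_self]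
    have heq : LinearMap.range L = LinearMap.ker φ :=
      Submodule.eq_of_le_of_finrank_eq hle (by omega)
    have hxr : x ∈ LinearMap.range L := by rw [heq, LinearMap.mem_ker, hφ, hyx]
    obtain ⟨z, hz⟩ := hxr
    obtain ⟨c, rfl⟩ := mulVec_eq_smul_of_simple hB hx hBx (z := z) ⟨2, by
      rw [pow_two, Module.End.mul_apply]
      change L (L z) = 0
      rw [hz, hLv, hBx, sub_self]⟩
    rw [map_smul, hLv, hBx, sub_self, smul_zero] at hz
    exact hx hz.symm
  refine ⟨(y ⬝ᵥ x)⁻¹ • x, by rw [Matrix.mulVec_smul, hBx], ?_⟩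
  rw [dotProduct_smul, smul_eq_mul, inv_mul_cancel₀ hyx]

theorem eq_zero_of_fixed_of_dotProduct (hB : B.charpoly.rootMultiplicity 1 = 1) {y : Fin r → ℂ}
    (hy : y ≠ 0) (h : Matrix.vecMul y B = y) (hx : B.mulVec x = x) (hyx : y ⬝ᵥ x = 0) : x = 0 := by
  by_contra hx0
  obtain ⟨z, hz, hyz⟩ := exists_right_eigenvector hB hy h
  obtain ⟨c, rfl⟩ := mulVec_eq_smul_of_simple hB hx0 hx (z := z) ⟨1, by simp [hz]⟩
  rw [dotProduct_smul, hyx, smul_zero] at hyz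
  exact zero_ne_one hyz

/-! ### Uniqueness of the moments of matching filters -/

theorem row_mul_eq_vecMul (y : Mat 1 r) (B : Mat r r) : (y * B) 0 = Matrix.vecMul (y 0) B := rfl

theorem EigenCondition.row_eq_zero (ha : EigenCondition lam m a) (hlam : 2 ≤ lam) {j : ℕ}
    (hj : 1 ≤ j) (hjm : j ≤ m) {x : Mat 1 r} (hx : ((lam : ℂ) ^ j) • (x * fourierSeries a 0) = x) :
    x = 0 := by
  have hl : (lam : ℂ) ^ j ≠ 0 := pow_ne_zero _ (by exact_mod_cast (by omega : lam ≠ 0))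
  have hl1 : (1 : ℝ) < lam := by exact_mod_cast hlam
  by_contra hx0
  have hx0' : x 0 ≠ 0 := fun h => by
    apply hx0
    ext i k
    rw [Subsingleton.elim i 0, h]
    rfl
  have h1 : Matrix.vecMul (x 0) (fourierSeries a 0) = ((lam : ℂ) ^ j)⁻¹ • x 0 := by
    rw [← row_mul_eq_vecMul]
    conv_rhs => rw [← hx]
    funext k
    simp [inv_mul_cancel_left₀ hl]
  have hnorm : ‖((lam : ℂ) ^ j)⁻¹‖ = ((lam : ℝ) ^ j)⁻¹ := by simp
  have h2 := ha.2 _ (isRoot_charpoly_of_vecMul hx0' h1) (by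
    intro h
    rw [h] at hnorm
    have : ((lam : ℝ) ^ j)⁻¹ < 1 := inv_lt_one_of_one_lt₀ (one_lt_pow₀ hl1 (by omega))
    rw [norm_one] at hnorm
    linarith)
  rw [hnorm] at h2
  have h3 : ((lam : ℝ) ^ m)⁻¹ ≤ ((lam : ℝ) ^ j)⁻¹ :=
    inv_anti₀ (by positivity) (pow_le_pow_right₀ hl1.le hjm)
  linarith

theorem EigenCondition.norm_le_one (ha : EigenCondition lam m a) (hlam : 2 ≤ lam) (z : ℂ)
    (hz : (fourierSeries a 0).charpoly.IsRoot z) : ‖z‖ ≤ 1 := by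
  by_cases h : z = 1
  · simp [h]
  · have h1 := ha.2 z hz h
    have h2 : ((lam : ℝ) ^ m)⁻¹ ≤ 1 :=
      inv_le_one_of_one_le₀ (one_le_pow₀ (by exact_mod_cast (by omega : 1 ≤ lam)))
    linarith

theorem fourierSeries_zero_eq (v : Filt d s t) : fourierSeries v 0 = pairing v fun _ =>
      (1 : Mat t t) := by
  simp [fourierSeries_eq_pairing, expo_zero_right]

theorem fourierSeries_sub (v w : Filt d s t) (ξ : ℝ^d) : fourierSeries (v - w) ξ =
      fourierSeries v ξ - fourierSeries w ξ := by
  simp only [fourierSeries_eq_pairing, pairing_sub_left]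

theorem fourierSeries_smul (c : ℂ) (v : Filt d s t) (ξ : ℝ^d) : fourierSeries (c • v) ξ =
      c • fourierSeries v ξ := by
  simp only [fourierSeries_eq_pairing, pairing_smul_left]

/-- A row filter with the dilation property of matching filters whose sum vanishes has vanishing
moments. -/
theorem EigenCondition.moments_eq_zero (ha : EigenCondition lam m a) (hlam : 2 ≤ lam)
    {D : Filt d 1 r} (hN : N ≤ m + 1) (hD : ∀ p ∈ polySpace d N, pairing D (fun z => pairing a fun k
    => p (toR (lam • z + k)) • (1 : Mat r r)) = pairing D (fun k => p (toR k) • (1 : Mat r r)))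
    (h0 : fourierSeries D 0 = 0) : ∀ p ∈ polySpace d N,
      pairing D (fun k => p (toR k) • (1 : Mat r r)) = 0 := by
  have hl : (lam : ℝ) ≠ 0 := by exact_mod_cast (by omega : lam ≠ 0)
  have key : ∀ M ≤ N, ∀ p ∈ polySpace d M,
      pairing D (fun k => p (toR k) • (1 : Mat r r)) = 0 := fun M => by
    induction M with
    | zero =>
      intro _ p hp
      rw [polySpace_zero, Submodule.mem_bot] at hp
      simp [hp, pairing_zero]
    | succ M ih =>
      intro hM p hp
      have ih' := ih (by omega)
      have h1 := pairing_eq_of_mono D (0 : Filt d 1 r) (fun _ => 1) (N := M + 1) ?_ hp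
      · simpa [pairing_zero_left] using h1
      intro μ hμ
      simp only [one_mul, pairing_zero_left]
      rcases Nat.lt_or_ge (deg μ) M with h2 | h2
      · exact ih' _ (mono_mem h2)
      have hdeg : deg μ = M := by omega
      rcases Nat.eq_zero_or_pos M with h3 | h3
      · have : μ = 0 := by
          funext i
          have := Finset.sum_eq_zero_iff.1 (hdeg.trans h3) i (mem_univ i)
          simpa using this
        subst this
        rw [fourierSeries_zero_eq] at h0
        simpa [mono_zero_index] using h0
      refine ha.row_eq_zero hlam (j := M) h3 (by omega) ?_
      have h4 := hD (mono μ) (mono_mem (by omega))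
      have h5 : ∀ z k : ℤ^d, mono μ (toR (lam • z + k)) = (lam : ℂ) ^ M *
          (mono μ (toR z) + (mono μ (toR z + (lam : ℝ)⁻¹ • toR k) - mono μ (toR z))) := by
        intro z k
        have e : toR (lam • z + k) = (lam : ℝ) • (toR z + (lam : ℝ)⁻¹ • toR k) := by
          rw [toR_add, toR_nsmul, smul_add, smul_inv_smul₀ hl]
        rw [e, mono_smul, hdeg]
        push_cast
        ring
      simp only [h5, mul_smul, pairing_smul, add_smul, pairing_add] at h4
      rw [pairing_swap D a fun z k => mono μ (toR z + (lam : ℝ)⁻¹ • toR k) - mono μ (toR z)] at h4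
      have h6 : ∑ k ∈ a.support, pairing D (fun z =>
          (mono μ (toR z + (lam : ℝ)⁻¹ • toR k) - mono μ (toR z)) • (1 : Mat r r)) * a k = 0 := by
        refine sum_eq_zero fun k _ => ?_
        have := translate_mono_sub_mem ((lam : ℝ)⁻¹ • toR k) μ
        rw [hdeg] at this
        have h7 := ih' _ this
        rw [h7, Matrix.zero_mul]
      rw [h6, add_zero] at h4
      have h8 : pairing D (fun z => mono μ (toR z) • pairing a fun _ =>
          (1 : Mat r r)) =
          pairing D (fun z => mono μ (toR z) • (1 : Mat r r)) * fourierSeries a 0 := by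
        rw [← pairing_mul, fourierSeries_zero_eq]
        simp
      rw [h8] at h4
      exact h4
  exact key N le_rfl

theorem IsMatchingFilter.vecMul_eq [NeZero lam] (hy : IsMatchingFilter lam N a y) (hN : 0 < N) :
    Matrix.vecMul (fourierSeries y 0 0) (fourierSeries a 0) = fourierSeries y 0 0 := by
  have h1 : (fun _ => 1 : ℝ^d → ℂ) ∈ polySpace d N := by
    rw [← mono_zero_index]
    exact mono_mem (by simpa [deg] using hN)
  have := hy.pairing_subdiv_eq h1
  simp only [one_smul, ← fourierSeries_zero_eq] at this
  have h2 : pairing y (fun _ => fourierSeries a 0) = fourierSeries y 0 * fourierSeries a 0 := by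
    rw [fourierSeries_zero_eq y, ← pairing_mul]
    simp
  rw [← row_mul_eq_vecMul, ← h2, this]

theorem IsMatchingFilter.row_ne_zero (hy : IsMatchingFilter lam N a y) :
    fourierSeries y 0 0 ≠ 0 := by
  intro h
  apply hy.1
  ext i k
  rw [Subsingleton.elim i 0, h]
  rfl

theorem EigenCondition.vanishingSpace_eq [NeZero lam] (ha : EigenCondition lam m a) (hlam : 2 ≤ lam)
    (hN : N ≤ m + 1) (hy : IsMatchingFilter lam N a y) (hυ : IsMatchingFilter lam N a υ) :
    vanishingSpace N y ⊆ vanishingSpace N υ := by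
  rcases Nat.eq_zero_or_pos N with h0 | hpos
  · subst h0
    intro w _ μ hμ
    exact absurd hμ (Nat.not_lt_zero _)
  obtain ⟨c, hc⟩ := vecMul_eq_smul_of_simple ha.1 hy.row_ne_zero (hy.vecMul_eq hpos)
    (hυ.vecMul_eq hpos)
  have hD := ha.moments_eq_zero hlam hN (D := υ - c • y) (fun p hp => by
    simp only [pairing_sub_left, pairing_smul_left, hy.pairing_subdiv_eq hp,
      hυ.pairing_subdiv_eq hp]) (by
    ext i k
    rw [Subsingleton.elim i 0, fourierSeries_sub, fourierSeries_smul]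
    have := congrFun hc k
    simp only [Pi.smul_apply] at this
    simp [this])
  intro w hw
  rw [mem_vanishingSpace_iff] at hw ⊢
  intro p hp
  have h1 : ∀ k : ℤ^d, pairing υ (fun z => p (toR z + toR k) •
      (1 : Mat r r)) = c • pairing y (fun z => p (toR z + toR k) •
      (1 : Mat r r)) := fun k => by
    have := hD _ (translate_mem hp (toR k))
    rwa [pairing_sub_left, pairing_smul_left, sub_eq_zero] at this
  have h2 := hw p hp
  rw [moment_eq_sum] at h2 ⊢
  simp only [h1, Matrix.smul_mul, Matrix.smul_apply]
  rw [← smul_sum, h2, smul_zero]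

/-! ### Decay and the smoothness exponent -/

theorem supNorm_ne_top (u : Filt d s t) : supNorm (⇑u) ≠ ⊤ := by
  obtain ⟨C, _, hC⟩ := exists_bound u
  exact ne_top_of_le_ne_top
    (ENNReal.mul_ne_top (ENNReal.natCast_ne_top _) ENNReal.ofReal_ne_top) (supNorm_le _ hC)

theorem decays_of_rhoOrder_lt (hρ : 0 < ρ) (h : rhoOrder lam N a y < ENNReal.ofReal ρ) :
    Decays lam a (vanishingSpace N y) ρ := fun w hw => by
  have h1 : limsup (fun n : ℕ => supNorm (⇑(conv (mask lam a n) w)) ^ (1 / (n : ℝ))) atTop <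
      ENNReal.ofReal ρ := lt_of_le_of_lt (le_iSup₂ (f := fun w (_ : w ∈ vanishingSpace N y) =>
        limsup (fun n : ℕ => supNorm (⇑(conv ((subdiv lam a)^[n] (deltaI d r)) w)) ^ (1 / (n : ℝ)))
          atTop) w hw) h
  have h2 : ∀ᶠ n : ℕ in atTop, (supNorm (⇑(conv (mask lam a n) w))).toReal ≤ ρ ^ n := by
    filter_upwards [eventually_lt_of_limsup_lt h1, eventually_gt_atTop 0] with n hn hn0
    have hn0' : (0 : ℝ) < n := by exact_mod_cast hn0
    have h5 := ENNReal.rpow_le_rpow hn.le hn0'.le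
    rw [← ENNReal.rpow_mul, one_div, inv_mul_cancel₀ hn0'.ne', ENNReal.rpow_one,
      ENNReal.rpow_natCast, ← ENNReal.ofReal_pow hρ.le] at h5
    exact ENNReal.toReal_le_of_le_ofReal (by positivity) h5
  obtain ⟨C, _, hC⟩ := exists_const_of_eventually_le_pow hρ h2
  refine ⟨C, fun n k i => le_trans ?_ (hC n)⟩
  have := enorm_le_supNorm (⇑(conv (mask lam a n) w)) k i 0
  rw [← ofReal_norm] at this
  exact (ENNReal.ofReal_le_iff_le_toReal (supNorm_ne_top _)).1 this

theorem rhoOrder_le_of_decays (hρ : 0 < ρ) (h : Decays lam a (vanishingSpace N y) ρ) :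
    rhoOrder lam N a y ≤ ENNReal.ofReal ρ := by
  refine iSup₂_le fun w hw => ?_
  obtain ⟨C, hC⟩ := h w hw
  set C' : ℝ := (r * 1 : ℕ) * |C| + 1 with hC'
  have hC'0 : 0 < C' := by positivity
  have h1 : ∀ n : ℕ, supNorm (⇑(conv (mask lam a n) w)) ≤ ENNReal.ofReal (C' * ρ ^ n) := fun n => by
    have h2 := supNorm_le (⇑(conv (mask lam a n) w)) (C := |C| * ρ ^ n) (fun k i j => by
      rw [Subsingleton.elim j 0]
      refine (hC n k i).trans ?_
      gcongr
      exact le_abs_self C)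
    refine h2.trans ?_
    rw [← ENNReal.ofReal_natCast, ← ENNReal.ofReal_mul (by positivity)]
    refine ENNReal.ofReal_le_ofReal ?_
    rw [hC']
    have : 0 < ρ ^ n := pow_pos hρ n
    nlinarith
  have h3 : Tendsto (fun n : ℕ => ENNReal.ofReal (C' ^ (1 / (n : ℝ)) * ρ)) atTop
      (𝓝 (ENNReal.ofReal ρ)) := by
    refine ENNReal.tendsto_ofReal ?_
    have h4 : Tendsto (fun n : ℕ => C' ^ (1 / (n : ℝ))) atTop (𝓝 1) := by
      have := (tendsto_const_nhds (x := C')).rpow tendsto_one_div_atTop_nhds_zero_nat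
        (Or.inl hC'0.ne')
      simpa using this
    simpa using h4.mul_const ρ
  rw [← h3.limsup_eq]
  refine limsup_le_limsup ?_
  filter_upwards [eventually_gt_atTop 0] with n hn0
  have hn0' : (0 : ℝ) < n := by exact_mod_cast hn0
  have h5 := ENNReal.rpow_le_rpow (h1 n) (z := 1 / (n : ℝ)) (by positivity)
  refine h5.trans ?_
  rw [ENNReal.ofReal_rpow_of_nonneg (by positivity) (by positivity),
    Real.mul_rpow hC'0.le (by positivity), ← Real.rpow_natCast ρ n, ← Real.rpow_mul hρ.le,
    mul_one_div_cancel hn0'.ne', Real.rpow_one]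

theorem lt_smInfty_iff (hlam : 2 ≤ lam) (a : Filt d r r) : (m : EReal) < smInfty lam a ↔ rho lam a <
      ENNReal.ofReal ((lam : ℝ) ^ m)⁻¹ := by
  have hl1 : (1 : ℝ) < lam := by exact_mod_cast hlam
  have hlog : 0 < Real.log lam := Real.log_pos hl1
  have hpos : (0 : ℝ) < ((lam : ℝ) ^ m)⁻¹ := by positivity
  rw [smInfty, EReal.lt_neg_comm, EReal.div_lt_iff (by exact_mod_cast hlog) (by simp),
    ← ENNReal.log_lt_log_iff, ENNReal.log_ofReal_of_pos hpos, Real.log_inv, Real.log_pow]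
  have : -(m : EReal) * ((Real.log lam : ℝ) : EReal) = ((-(m * Real.log lam) : ℝ) : EReal) := by
    rw [EReal.neg_mul, EReal.coe_neg, EReal.coe_mul]
    rfl
  rw [this]

/-- The smoothness exponent exceeds `m` exactly if the iterated masks decay faster than `λ^{-mn}` on
the filters with `m + 1` vanishing moments. -/
theorem lt_smInfty_iff_decays [NeZero lam] (hlam : 2 ≤ lam) (ha : EigenCondition lam m a)
    (hυ : IsMatchingFilter lam (m + 1) a υ) : (m : EReal) < smInfty lam a ↔ ∃ ρ : ℝ, 0 < ρ ∧ ρ <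
      ((lam : ℝ) ^ m)⁻¹ ∧ Decays lam a (vanishingSpace (m + 1) υ) ρ := by
  have hl1 : (1 : ℝ) < lam := by exact_mod_cast hlam
  have hpos : (0 : ℝ) < ((lam : ℝ) ^ m)⁻¹ := by positivity
  rw [lt_smInfty_iff hlam]
  constructor
  · intro h
    simp only [rho, iInf_lt_iff] at h
    obtain ⟨N, y, hy, h⟩ := h
    obtain ⟨c, hc1, hc2⟩ := exists_between h
    have hcne : c ≠ ⊤ := ne_top_of_lt hc2
    have hc0 : c ≠ 0 := fun h0 => by simp [h0] at hc1
    have hρ : 0 < c.toReal := ENNReal.toReal_pos hc0 hcne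
    have hρ1 : c.toReal < ((lam : ℝ) ^ m)⁻¹ := by
      rwa [← ENNReal.ofReal_toReal hcne, ENNReal.ofReal_lt_ofReal_iff hpos] at hc2
    have hdec := decays_of_rhoOrder_lt hρ (hc1.trans_eq (ENNReal.ofReal_toReal hcne).symm)
    rcases Nat.lt_or_ge (m + 1) N with hN | hN
    · have hlt : ((lam : ℝ)⁻¹) ^ (m + 1) < ((lam : ℝ) ^ m)⁻¹ := by
        rw [inv_pow]
        exact inv_strictAnti₀ (by positivity) (pow_lt_pow_right₀ hl1 (Nat.lt_succ_self m))
      obtain ⟨ρ', h1, h2⟩ := exists_between (max_lt hρ1 hlt)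
      rw [max_lt_iff] at h1
      refine ⟨ρ', hρ.trans h1.1, h2, ?_⟩
      have hdec' := hdec.descend_le hlam hN.le hy hρ.le h1.1.le h1.2
      intro w hw
      exact hdec' w (ha.vanishingSpace_eq hlam le_rfl hυ (hy.mono_order hN.le) hw)
    · refine ⟨c.toReal, hρ, hρ1, fun w hw => hdec w ?_⟩
      exact ha.vanishingSpace_eq hlam hN (hυ.mono_order hN) hy (vanishingSpace_mono hN hw)
  · rintro ⟨ρ, hρ, hρ1, h⟩
    have h1 : rho lam a ≤ ENNReal.ofReal ρ :=
      (iInf_le_of_le (m + 1) (iInf_le_of_le υ (iInf_le _ hυ))).trans (rhoOrder_le_of_decays hρ h)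
    exact h1.trans_lt ((ENNReal.ofReal_lt_ofReal_iff hpos).2 hρ1)

/-! ### Finite-dimensional reductions -/

/-- The filters of `vanishingSpace N y` that are supported in a cube. -/
def vanishingIn (N : ℕ) (y : Filt d 1 r) (R : ℕ) : Submodule ℂ (Filt d r 1) where
  carrier := {w | w ∈ vanishingSpace N y ∧ SuppIn R w}
  zero_mem' := ⟨vanishingSpace_zero_mem, fun k hk => absurd rfl hk⟩
  add_mem' {v w} hv hw := by
    refine ⟨vanishingSpace_add hv.1 hw.1, fun k hk i => ?_⟩
    by_cases h : v k = 0
    · refine hw.2 k (fun h' => hk ?_) i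
      rw [Finsupp.add_apply, h, h', add_zero]
    · exact hv.2 k h i
  smul_mem' c w hw := by
    refine ⟨vanishingSpace_smul c hw.1, fun k hk i => hw.2 k (fun h' => hk ?_) i⟩
    rw [Finsupp.smul_apply, h', smul_zero]

/-- The filter supported in `box d R` with the given values there. -/
def boxFilt (R : ℕ) (x : box d R → Fin r → ℂ) : Filt d r 1 :=
  ∑ k : box d R, Finsupp.single k.1 (Matrix.of fun i _ => x k i)

theorem boxFilt_add (x y : box d R → Fin r → ℂ) : boxFilt R (x + y) =
      boxFilt R x + boxFilt R y := by
  rw [boxFilt, boxFilt, boxFilt, ← sum_add_distrib]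
  refine sum_congr rfl fun k _ => ?_
  rw [← Finsupp.single_add]
  rfl

theorem boxFilt_smul (c : ℂ) (x : box d R → Fin r → ℂ) : boxFilt R (c • x) = c • boxFilt R x := by
  rw [boxFilt, boxFilt, smul_sum]
  refine sum_congr rfl fun k _ => ?_
  rw [Finsupp.smul_single]
  rfl

theorem boxFilt_values (hw : SuppIn R w) : boxFilt R (fun k i => w k.1 i 0) = w := by
  have h1 : ∀ k : box d R, (Matrix.of fun i (_ : Fin 1) => w k.1 i 0) = w k.1 := fun k => by
    ext i j
    rw [Subsingleton.elim j 0]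
    rfl
  rw [boxFilt]
  simp only [h1]
  rw [Finset.sum_coe_sort (box d R) (fun k => Finsupp.single k (w k))]
  ext1 l
  rw [Finsupp.finsetSum_apply]
  simp only [Finsupp.single_apply, Finset.sum_ite_eq']
  split_ifs with h
  · rfl
  · by_contra hne
    exact h (mem_box.2 (hw l fun h0 => hne h0.symm))

theorem exists_controlled_coordinates (E : Submodule ℂ (Filt d r 1)) (hE : ∀ w ∈ E, SuppIn R w) :
    ∃ (q : ℕ) (b : Fin q → Filt d r 1) (C : ℝ), (∀ i, b i ∈ E) ∧ 0 ≤ C ∧ ∀ w ∈ E, ∀ M : ℝ, 0 ≤ M →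
      (∀ k i, ‖w k i 0‖ ≤ M) → ∃ c : Fin q → ℂ, w = ∑ i, c i • b i ∧ ∀ i, ‖c i‖ ≤ C * M := by
  let W : Submodule ℂ (box d R → Fin r → ℂ) :=
    { carrier := {x | boxFilt R x ∈ E}
      add_mem' := fun {x y} hx hy => by
        change boxFilt R (x + y) ∈ E
        rw [boxFilt_add]
        exact E.add_mem hx hy
      zero_mem' := by
        change boxFilt R 0 ∈ E
        have : boxFilt (d := d) (r := r) R 0 = 0 := by
          have := boxFilt_smul (d := d) (r := r) (R := R) 0 0
          rwa [zero_smul, zero_smul] at this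
        rw [this]
        exact E.zero_mem
      smul_mem' := fun c x hx => by
        change boxFilt R (c • x) ∈ E
        rw [boxFilt_smul]
        exact E.smul_mem c hx }
  let B := Module.finBasis ℂ W
  let L := fun i => LinearMap.toContinuousLinearMap (B.coord i)
  let mk : W →ₗ[ℂ] Filt d r 1 :=
    { toFun := fun x => boxFilt R x.1
      map_add' := fun x y => boxFilt_add x.1 y.1
      map_smul' := fun c x => boxFilt_smul c x.1 }
  refine ⟨Module.finrank ℂ W, fun i => mk (B i), ∑ i, ‖L i‖, fun i => (B i).2,
    sum_nonneg fun i _ => (L i).opNorm_nonneg, fun w hw M hM hwM => ?_⟩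
  have hx : (fun k i => w k.1 i 0) ∈ W := by
    change boxFilt R _ ∈ E
    rw [boxFilt_values (hE w hw)]
    exact hw
  let x : W := ⟨fun k i => w k.1 i 0, hx⟩
  refine ⟨fun i => B.coord i x, ?_, fun i => ?_⟩
  · have h1 := congrArg mk (B.sum_repr x)
    rw [map_sum] at h1
    simp only [map_smul] at h1
    exact ((h1.trans (boxFilt_values (hE w hw)))).symm
  · refine ((L i).le_opNorm x).trans ?_
    have h3 : ‖x‖ ≤ M := by
      change ‖(fun k i => w k.1 i 0 : box d R → Fin r → ℂ)‖ ≤ M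
      rw [pi_norm_le_iff_of_nonneg hM]
      intro k
      rw [pi_norm_le_iff_of_nonneg hM]
      exact fun i => hwM _ _
    refine mul_le_mul ?_ h3 (norm_nonneg _) (sum_nonneg fun i _ => (L i).opNorm_nonneg)
    exact single_le_sum (f := fun i => ‖L i‖) (fun i _ => (L i).opNorm_nonneg) (mem_univ i)

theorem conv_sum_smul_norm_le {q : ℕ} (A : Filt d r r) (b : Fin q → Filt d r 1) (c : Fin q → ℂ)
    {K L : ℝ} (hK : 0 ≤ K) (hc : ∀ i, ‖c i‖ ≤ K) (hb : ∀ j k i, ‖conv A (b j) k i 0‖ ≤ L) (k : ℤ^d)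
    (i : Fin r) : ‖conv A (∑ j, c j • b j) k i 0‖ ≤ q * (K * L) := by
  rw [conv_sum_right, Finsupp.finsetSum_apply, Matrix.sum_apply]
  refine (norm_sum_le _ _).trans ?_
  have : ∀ j ∈ univ, ‖conv A (c j • b j) k i 0‖ ≤ K * L := fun j _ => by
    rw [conv_smul_right, Finsupp.smul_apply, Matrix.smul_apply, norm_smul]
    exact mul_le_mul (hc j) (hb j k i) (norm_nonneg _) hK
  simpa using Finset.sum_le_card_nsmul _ _ _ this

/-- Decay is uniform on bounded sets of filters with a common support. -/
theorem Decays.uniform (hρ : 0 ≤ ρ) (h : Decays lam a (vanishingSpace N y) ρ) (R : ℕ) : ∃ C : ℝ, 0 ≤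
      C ∧ ∀ w ∈ vanishingSpace N y, SuppIn R w → ∀ M : ℝ, 0 ≤ M → (∀ k i, ‖w k i 0‖ ≤ M) → ∀ n k i,
      ‖conv (mask lam a n) w k i 0‖ ≤ C * M * ρ ^ n := by
  obtain ⟨q, b, C, hb, hC, hw⟩ :=
    exists_controlled_coordinates (vanishingIn N y R) (R := R) (fun w hw => hw.2)
  choose D hD using fun j => h (b j) (hb j).1
  have hD1 : ∀ j n k i, ‖conv (mask lam a n) (b j) k i 0‖ ≤ (∑ j, |D j|) * ρ ^ n := by
    intro j n k i
    refine (hD j n k i).trans ?_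
    gcongr
    exact (le_abs_self _).trans (single_le_sum (f := fun j => |D j|)
      (fun _ _ => abs_nonneg _) (mem_univ j))
  refine ⟨q * (C * ∑ j, |D j|), by positivity, fun w hw1 hw2 M hM hwM n k i => ?_⟩
  obtain ⟨c, rfl, hc⟩ := hw w ⟨hw1, hw2⟩ M hM hwM
  have := conv_sum_smul_norm_le (mask lam a n) b c (by positivity) hc (fun j => hD1 j n) k i
  refine this.trans_eq ?_
  ring

theorem exists_trans_iterate [NeZero lam] {E : Set (Filt d r 1)}
    (hE : ∀ w ∈ E, ∀ γ : Fin d → Fin lam, trans lam a (fun i => ((γ i : ℕ) : ℤ)) w ∈ E) (n : ℕ) :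
    ∀ w ∈ E, ∀ l : ℤ^d, ∃ w' ∈ E, ∃ k : ℤ^d, (∀ n', conv (mask lam a (n' + n)) w l =
      conv (mask lam a n') w' k) ∧ ∀ j, ∃ l', w' j = conv (mask lam a n) w l' := by
  induction n with
  | zero =>
    intro w hw l
    exact ⟨w, hw, l, fun n' => rfl, fun j => ⟨j, by rw [conv_mask_zero]⟩⟩
  | succ n ih =>
    intro w hw l
    obtain ⟨k, γ, rfl⟩ := exists_eq_smul_add lam l
    obtain ⟨w', hw', k', h1, h2⟩ := ih _ (hE w hw γ) k
    refine ⟨w', hw', k', fun n' => ?_, fun j => ?_⟩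
    · rw [← add_assoc, conv_mask_succ_apply, h1]
    · obtain ⟨l', hl'⟩ := h2 j
      exact ⟨lam • l' + fun i => ((γ i : ℕ) : ℤ), by rw [hl', conv_mask_succ_apply]⟩

theorem trans_mem_vanishingIn [NeZero lam] (hlam : 2 ≤ lam) (h : IsMatchingFilter lam N a y)
    {A R' : ℕ} (hA : SuppIn A a) (hR : A + R + lam ≤ 2 * R' + 1) (hw : w ∈ vanishingIn N y R)
    (γ : Fin d → Fin lam) : trans lam a (fun i => ((γ i : ℕ) : ℤ)) w ∈ vanishingIn N y R' := by
  refine ⟨trans_mem_vanishingSpace h _ hw.1, fun k hk i => ?_⟩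
  have h1 := hA.trans hw.2 γ hk i
  have h2 : (2 : ℤ) ≤ lam := by exact_mod_cast hlam
  have h3 : (2 : ℤ) * |k i| ≤ lam * |k i| := mul_le_mul_of_nonneg_right h2 (abs_nonneg _)
  have h4 : ((A + R + lam : ℕ) : ℤ) ≤ ((2 * R' + 1 : ℕ) : ℤ) := by exact_mod_cast hR
  push_cast at h4
  omega

/-- If `λ^{mn} S_a^n(δ I_r) * w → 0` for all filters with enough vanishing moments, then the decay
is exponentially faster than `λ^{-mn}`. -/
theorem decays_of_tendsto [NeZero lam] (hlam : 2 ≤ lam) (hy : IsMatchingFilter lam N a y)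
    (h : ∀ w ∈ vanishingSpace N y, ∀ ε > 0, ∀ᶠ n in atTop, ∀ k i, ((lam : ℝ) ^ (m * n)) * ‖conv
    (mask lam a n) w k i 0‖ ≤ ε) : ∃ ρ : ℝ, 0 < ρ ∧ ρ < ((lam : ℝ) ^ m)⁻¹ ∧
      Decays lam a (vanishingSpace N y) ρ := by
  have hl1 : (1 : ℝ) < lam := by exact_mod_cast hlam
  have hl0 : (0 : ℝ) < lam := by linarith
  obtain ⟨A, hA⟩ := exists_suppIn a
  set R0 : ℕ := A + lam with hR0
  obtain ⟨q, b, C, hb, hC, hw⟩ :=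
    exists_controlled_coordinates (vanishingIn N y R0) (R := R0) (fun w hw => hw.2)
  have hE : ∀ w ∈ (vanishingIn N y R0 : Set (Filt d r 1)), ∀ γ : Fin d → Fin lam,
      trans lam a (fun i => ((γ i : ℕ) : ℤ)) w ∈ (vanishingIn N y R0 : Set (Filt d r 1)) :=
    fun w hw γ => trans_mem_vanishingIn hlam hy hA (by omega) hw γ
  set ε : ℝ := (2 * (q * C + 1))⁻¹ with hε
  have hε0 : 0 < ε := by positivity
  have hev : ∀ᶠ n in atTop, ∀ j k i,
      ((lam : ℝ) ^ (m * n)) * ‖conv (mask lam a n) (b j) k i 0‖ ≤ ε := by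
    rw [eventually_all]
    exact fun j => h (b j) (hb j).1 ε hε0
  obtain ⟨n0, hn0, hn0pos⟩ := (hev.and (eventually_gt_atTop 0)).exists
  set θ : ℝ := ((lam : ℝ) ^ (m * n0))⁻¹ / 2 with hθ
  have hθ0 : 0 < θ := by positivity
  have hstep : ∀ w ∈ vanishingIn N y R0, ∀ M : ℝ, 0 ≤ M → (∀ k i, ‖w k i 0‖ ≤ M) →
      ∀ k i, ‖conv (mask lam a n0) w k i 0‖ ≤ M * θ := fun w hw1 M hM hwM k i => by
    obtain ⟨c, rfl, hc⟩ := hw w hw1 M hM hwM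
    have h1 : ∀ j k i, ‖conv (mask lam a n0) (b j) k i 0‖ ≤ ((lam : ℝ) ^ (m * n0))⁻¹ * ε := by
      intro j k i
      rw [le_inv_mul_iff₀ (by positivity)]
      exact hn0 j k i
    refine (conv_sum_smul_norm_le (mask lam a n0) b c (by positivity) hc h1 k i).trans ?_
    have h2 : q * C * ε ≤ 1 / 2 := by
      rw [hε, mul_inv_le_iff₀ (by positivity)]
      linarith
    calc q * (C * M * (((lam : ℝ) ^ (m * n0))⁻¹ * ε))
        = (q * C * ε) * (M * ((lam : ℝ) ^ (m * n0))⁻¹) := by ring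
      _ ≤ 1 / 2 * (M * ((lam : ℝ) ^ (m * n0))⁻¹) := by gcongr
      _ = M * θ := by rw [hθ]; ring
  have hpow : ∀ s : ℕ, ∀ w ∈ vanishingIn N y R0, ∀ M : ℝ, 0 ≤ M → (∀ k i, ‖w k i 0‖ ≤ M) →
      ∀ k i, ‖conv (mask lam a (n0 * s)) w k i 0‖ ≤ M * θ ^ s := fun s => by
    induction s with
    | zero =>
      intro w _ M _ hwM k i
      simpa [conv_mask_zero] using hwM k i
    | succ s ih =>
      intro w hw1 M hM hwM l i
      obtain ⟨w', hw', k, h1, h2⟩ := exists_trans_iterate hE (n0 * s) w hw1 l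
      have h3 : ∀ k i, ‖w' k i 0‖ ≤ M * θ ^ s := fun k i => by
        obtain ⟨l', hl'⟩ := h2 k
        rw [hl']
        exact ih w hw1 M hM hwM l' i
      have h4 : n0 * (s + 1) = n0 + n0 * s := by ring
      rw [h4, h1]
      refine (hstep w' hw' _ (by positivity) h3 k i).trans_eq ?_
      ring
  set σ : ℝ := (1 / 2 : ℝ) ^ (1 / (n0 : ℝ)) with hσ
  have hn0r : (0 : ℝ) < n0 := by exact_mod_cast hn0pos
  have hσ0 : 0 < σ := by positivity
  have hσ1 : σ < 1 := Real.rpow_lt_one (by norm_num) (by norm_num) (by positivity)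
  have hσn : σ ^ n0 = 1 / 2 := by
    rw [hσ, ← Real.rpow_natCast, ← Real.rpow_mul (by norm_num), one_div_mul_cancel hn0r.ne',
      Real.rpow_one]
  set ρ : ℝ := ((lam : ℝ) ^ m)⁻¹ * σ with hρ
  have hlm : ((lam : ℝ) ^ m)⁻¹ ≤ 1 := inv_le_one_of_one_le₀ (one_le_pow₀ hl1.le)
  have hlm0 : 0 < ((lam : ℝ) ^ m)⁻¹ := by positivity
  have hρ0 : 0 < ρ := by positivity
  have hρlt : ρ < ((lam : ℝ) ^ m)⁻¹ := mul_lt_of_lt_one_right hlm0 hσ1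
  have hρ1 : ρ ≤ 1 := (hρlt.trans_le hlm).le
  have hρn : ρ ^ n0 = θ := by
    rw [hρ, mul_pow, hσn, hθ, inv_pow, ← pow_mul]
    ring
  refine ⟨ρ, hρ0, hρlt, ?_⟩
  have hbd : ∀ (s : ℕ) (j : Fin q), ∃ K : ℝ, 0 ≤ K ∧
      ∀ k i j', ‖conv (mask lam a s) (b j) k i j'‖ ≤ K := fun s j => exists_bound _
  choose K hK0 hK using hbd
  set K1 : ℝ := ∑ s ∈ Finset.range n0, ∑ j, K s j with hK1
  have hK1nn : 0 ≤ K1 := sum_nonneg fun s _ => sum_nonneg fun j _ => hK0 s j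
  have hKle : ∀ s < n0, ∀ j, K s j ≤ K1 := fun s hs j => by
    have h1 : K s j ≤ ∑ j, K s j := single_le_sum (f := fun j => K s j)
      (fun j _ => hK0 s j) (mem_univ j)
    exact h1.trans (single_le_sum (f := fun s => ∑ j, K s j)
      (fun s _ => sum_nonneg fun j _ => hK0 s j) (Finset.mem_range.2 hs))
  have hbase : ∀ w ∈ vanishingIn N y R0, ∃ C : ℝ, ∀ n k i,
      ‖conv (mask lam a n) w k i 0‖ ≤ C * ρ ^ n := fun w hw1 => by
    obtain ⟨M, hM, hwM⟩ := exists_bound w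
    refine ⟨q * (C * M * K1) / ρ ^ n0, fun n l i => ?_⟩
    obtain ⟨w', hw', k, h1, h2⟩ := exists_trans_iterate hE (n0 * (n / n0)) w hw1 l
    have h3 : ∀ k i, ‖w' k i 0‖ ≤ M * θ ^ (n / n0) := fun k i => by
      obtain ⟨l', hl'⟩ := h2 k
      rw [hl']
      exact hpow _ w hw1 M hM (fun k i => hwM k i 0) l' i
    have h4 : n % n0 + n0 * (n / n0) = n := Nat.mod_add_div n n0
    obtain ⟨c, hwc, hc⟩ := hw w' hw' _ (by positivity) h3
    have h5 := conv_sum_smul_norm_le (mask lam a (n % n0)) b c (by positivity) hc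
      (fun j k i => (hK (n % n0) j k i 0).trans (hKle _ (Nat.mod_lt _ hn0pos) j)) k i
    have h6 := h1 (n % n0)
    rw [h4] at h6
    rw [h6, hwc]
    refine h5.trans ?_
    have h7 : θ ^ (n / n0) ≤ ρ ^ n / ρ ^ n0 := by
      rw [← hρn, ← pow_mul, le_div_iff₀ (by positivity), ← pow_add]
      refine pow_le_pow_of_le_one hρ0.le hρ1 ?_
      have := Nat.mod_lt n hn0pos
      omega
    calc q * (C * (M * θ ^ (n / n0)) * K1) = q * (C * M * K1) * θ ^ (n / n0) := by ring
      _ ≤ q * (C * M * K1) * (ρ ^ n / ρ ^ n0) := by gcongr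
      _ = _ := by ring
  have hall : ∀ R : ℕ, ∀ w ∈ vanishingIn N y (R0 + R), ∃ C : ℝ, ∀ n k i,
      ‖conv (mask lam a n) w k i 0‖ ≤ C * ρ ^ n := fun R => by
    induction R with
    | zero => exact hbase
    | succ R ih =>
      intro w hw1
      have hT := fun γ : Fin d → Fin lam => ih _ (trans_mem_vanishingIn hlam hy hA
        (R' := R0 + R) (by omega) hw1 γ)
      choose D hD using hT
      obtain ⟨M, hM, hwM⟩ := exists_bound w
      have hDs : ∀ γ, D γ ≤ ∑ γ, |D γ| := fun γ => (le_abs_self _).trans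
        (single_le_sum (f := fun γ => |D γ|) (fun _ _ => abs_nonneg _) (mem_univ γ))
      have hDnn : 0 ≤ ∑ γ, |D γ| := sum_nonneg fun _ _ => abs_nonneg _
      refine ⟨M + (∑ γ, |D γ|) / ρ, fun n l i => ?_⟩
      cases n with
      | zero =>
        rw [conv_mask_zero, pow_zero, mul_one]
        have : 0 ≤ (∑ γ, |D γ|) / ρ := by positivity
        linarith [hwM l i 0]
      | succ n =>
        obtain ⟨k, γ, rfl⟩ := exists_eq_smul_add lam l
        rw [conv_mask_succ_apply]
        have hp : 0 ≤ ρ ^ n := by positivity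
        calc _ ≤ D γ * ρ ^ n := hD γ n k i
          _ ≤ (∑ γ, |D γ|) * ρ ^ n := by gcongr; exact hDs γ
          _ = (∑ γ, |D γ|) / ρ * ρ ^ (n + 1) := by
              rw [pow_succ]
              field_simp
          _ ≤ _ := by
              gcongr
              linarith
  intro w hw1
  obtain ⟨R, hR⟩ := exists_suppIn w
  exact hall R w ⟨hw1, hR.mono (by omega)⟩

end

section

/-! ### A compactly supported smooth function that reproduces polynomials -/

variable {d r m j N : ℕ} {x : ℝ^d} {p : ℝ^d → ℂ} {F : Finset ℤ^d} {s : ℤ^d → ℂ}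

/-- A smooth function supported in `[0, 2]` whose integer translates sum to one. -/
def hat (x : ℝ) : ℝ := Real.smoothTransition x - Real.smoothTransition (x - 1)

theorem contDiff_hat : ContDiff ℝ ∞ hat :=
  Real.smoothTransition.contDiff.sub
    (Real.smoothTransition.contDiff.comp (contDiff_id.sub contDiff_const))

theorem hat_eq_zero {x : ℝ} (h : x ≤ 0 ∨ 2 ≤ x) : hat x = 0 := by
  unfold hat
  rcases h with h | h
  · rw [Real.smoothTransition.zero_of_nonpos h, Real.smoothTransition.zero_of_nonpos (by linarith),
      sub_zero]
  · rw [Real.smoothTransition.one_of_one_le (by linarith),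
      Real.smoothTransition.one_of_one_le (by linarith), sub_self]

theorem hat_add_eq_zero (x : ℝ) {k : ℤ} (hk : k ∉ ({-⌊x⌋, -⌊x⌋ + 1} : Finset ℤ)) : hat (x + k) =
      0 := by
  simp only [Finset.mem_insert, Finset.mem_singleton, not_or] at hk
  apply hat_eq_zero
  rcases lt_or_gt_of_ne hk.1 with h | h
  · left
    have h1 : (k : ℝ) ≤ -⌊x⌋ - 1 := by exact_mod_cast (by omega : k ≤ -⌊x⌋ - 1)
    linarith [Int.lt_floor_add_one x]
  · right
    have h1 : (-⌊x⌋ + 2 : ℝ) ≤ k := by exact_mod_cast (by omega : -⌊x⌋ + 2 ≤ k)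
    linarith [Int.floor_le x]

theorem hasSum_hat (x : ℝ) : HasSum (fun k : ℤ => (hat (x + k) : ℂ)) 1 := by
  have h : HasSum (fun k : ℤ => (hat (x + k) : ℂ))
      (∑ k ∈ ({-⌊x⌋, -⌊x⌋ + 1} : Finset ℤ), (hat (x + k) : ℂ)) :=
    hasSum_sum_of_ne_finset_zero fun k hk => by rw [hat_add_eq_zero x hk, Complex.ofReal_zero]
  rw [Finset.sum_pair (by omega)] at h
  convert h using 1
  have h0 := Int.floor_le x
  have h1 := Int.lt_floor_add_one x
  push_cast
  unfold hat
  rw [show x + (-(⌊x⌋ : ℝ) + 1) - 1 = x + -(⌊x⌋ : ℝ) by ring,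
    Real.smoothTransition.zero_of_nonpos (x := x + -(⌊x⌋ : ℝ) - 1) (by linarith),
    Real.smoothTransition.one_of_one_le (x := x + (-(⌊x⌋ : ℝ) + 1)) (by linarith)]
  push_cast
  ring

/-- Lagrange basis polynomials at the nodes `0, …, m`, as functions on the line. -/
def lagrange (m i : ℕ) (y : ℝ) : ℂ :=
  (Lagrange.basis (Finset.range (m + 1)) (fun n : ℕ => (n : ℂ)) i).eval (y : ℂ)

theorem sum_lagrange (hj : j ≤ m) (c : ℂ) (y : ℝ) : ∑ i ∈ Finset.range (m + 1), ((i : ℂ) + c) ^ j *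
      lagrange m i y = ((y : ℂ) + c) ^ j := by
  have h := Lagrange.eq_interpolate (F := ℂ) (s := Finset.range (m + 1))
    (v := fun n : ℕ => (n : ℂ)) (f := (Polynomial.X + Polynomial.C c) ^ j)
    (fun a _ b _ hab => Nat.cast_injective (R := ℂ) hab) (by
      rw [Finset.card_range, Polynomial.degree_pow, Polynomial.degree_X_add_C, nsmul_one]
      exact_mod_cast Nat.lt_succ_of_le hj)
  have h2 := congrArg (Polynomial.eval (y : ℂ)) h
  rw [Lagrange.interpolate_apply, Polynomial.eval_finsetSum] at h2
  simp only [Polynomial.eval_mul, Polynomial.eval_C, Polynomial.eval_pow, Polynomial.eval_add,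
    Polynomial.eval_X] at h2
  exact h2.symm

theorem contDiff_lagrange (m i : ℕ) : ContDiff ℝ ∞ (lagrange m i) := by
  have h : ContDiff ℝ ∞ fun z : ℂ =>
      (Lagrange.basis (Finset.range (m + 1)) (fun n : ℕ => (n : ℂ)) i).eval z :=
    ((Polynomial.contDiff_aeval (𝕜 := ℂ) _ ∞).restrict_scalars ℝ)
  exact h.comp Complex.ofRealCLM.contDiff

/-- A one-dimensional function reproducing polynomials of degree at most `m`. -/
def spline (m : ℕ) (x : ℝ) : ℂ :=
  ∑ i ∈ Finset.range (m + 1), (hat (x - i) : ℂ) * lagrange m i (i - x)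

theorem contDiff_spline (m : ℕ) : ContDiff ℝ ∞ (spline m) := by
  refine ContDiff.sum fun i _ => ?_
  have h1 : ContDiff ℝ ∞ fun x : ℝ => (hat (x - i) : ℂ) :=
    Complex.ofRealCLM.contDiff.comp (contDiff_hat.comp (contDiff_id.sub contDiff_const))
  exact h1.mul ((contDiff_lagrange m i).comp (contDiff_const.sub contDiff_id))

theorem spline_eq_zero {x : ℝ} (h : (m : ℝ) + 2 < |x|) : spline m x = 0 := by
  refine sum_eq_zero fun i hi => ?_
  have hi' : (i : ℝ) ≤ m := by exact_mod_cast Nat.lt_succ_iff.1 (Finset.mem_range.1 hi)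
  have hi0 : (0 : ℝ) ≤ i := Nat.cast_nonneg i
  rw [hat_eq_zero, Complex.ofReal_zero, zero_mul]
  rcases lt_abs.1 h with h | h
  · right; linarith
  · left; linarith

theorem hasSum_spline (hj : j ≤ m) (x : ℝ) : HasSum (fun k : ℤ => (k : ℂ) ^ j * spline m (x + k))
      ((-x : ℂ) ^ j) := by
  let T : ℕ → ℤ → ℂ := fun i k => (hat (x + k) : ℂ) * (((i : ℂ) + k) ^ j * lagrange m i (-x - k))
  have hT : ∀ i, Summable (T i) := fun i =>
    summable_of_ne_finset_zero (s := {-⌊x⌋, -⌊x⌋ + 1}) fun k hk => by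
      simp only [T, hat_add_eq_zero x hk, Complex.ofReal_zero, zero_mul]
  have h1 : HasSum (fun k => ∑ i ∈ Finset.range (m + 1), T i k)
      (∑ i ∈ Finset.range (m + 1), ∑' k, T i k) := hasSum_sum fun i _ => (hT i).hasSum
  have h2 : (fun k => ∑ i ∈ Finset.range (m + 1), T i k) =
      fun k : ℤ => (hat (x + k) : ℂ) * (-x : ℂ) ^ j := by
    funext k
    simp only [T]
    rw [← mul_sum, sum_lagrange hj]
    congr 2
    push_cast
    ring
  have h3 : HasSum (fun k => ∑ i ∈ Finset.range (m + 1), T i k) ((-x : ℂ) ^ j) := by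
    rw [h2]
    simpa using (hasSum_hat x).mul_right ((-x : ℂ) ^ j)
  rw [h1.unique h3 |>.symm]
  have h4 : ∀ i : ℕ, HasSum (fun k : ℤ => T i (k - i)) (∑' k, T i k) := fun i =>
    (Equiv.hasSum_iff (Equiv.subRight (i : ℤ))).2 (hT i).hasSum
  have h5 := hasSum_sum (s := Finset.range (m + 1)) fun i _ => h4 i
  convert h5 using 1
  funext k
  rw [spline, mul_sum]
  refine sum_congr rfl fun i _ => ?_
  simp only [T]
  push_cast
  rw [show x + ((k : ℝ) - i) = x + k - i by ring, show -x - ((k : ℝ) - i) = i - (x + k) by ring,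
    show (i : ℂ) + ((k : ℂ) - i) = k by ring]
  ring

/-- The tensor product of the functions `spline m`. -/
def tensorSpline (d m : ℕ) (x : ℝ^d) : ℂ := ∏ i, spline m (x i)

theorem contDiff_tensorSpline (m : ℕ) : ContDiff ℝ ∞ (tensorSpline d m) :=
  contDiff_prod fun i _ => (contDiff_spline m).comp (contDiff_apply ℝ ℝ i)

theorem tensorSpline_eq_zero (i : Fin d) (h : (m : ℝ) + 2 < |x i|) : tensorSpline d m x = 0 :=
  Finset.prod_eq_zero (mem_univ i) (spline_eq_zero h)

theorem sum_box_tensorSpline {R : ℕ} (hx : ∀ i, |x i| + (m + 2) ≤ R)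
    (hp : p ∈ polySpace d (m + 1)) : ∑ k ∈ box d R, p (toR k) * tensorSpline d m (x + toR k) =
      p (-x) := by
  let W : Submodule ℂ (ℝ^d → ℂ) :=
    { carrier := {p | ∑ k ∈ box d R, p (toR k) * tensorSpline d m (x + toR k) = p (-x)}
      add_mem' := fun {p q} hp hq => by
        simp only [Set.mem_ofPred_eq] at hp hq ⊢
        simp only [Pi.add_apply, add_mul, sum_add_distrib, hp, hq]
      zero_mem' := by simp
      smul_mem' := fun c p hp => by
        simp only [Set.mem_ofPred_eq] at hp ⊢
        simp only [Pi.smul_apply, smul_eq_mul, mul_assoc, ← mul_sum, hp] }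
  refine polySpace_le (W := W) (fun μ hμ => ?_) hp
  change ∑ k ∈ box d R, mono μ (toR k) * tensorSpline d m (x + toR k) = mono μ (-x)
  have h1 : ∀ i, ∑ k ∈ Finset.Icc (-(R : ℤ)) R, (k : ℂ) ^ μ i * spline m (x i + k) =
      (-x i : ℂ) ^ μ i := fun i => by
    have hj : μ i ≤ m :=
      (single_le_sum (f := μ) (fun _ _ => Nat.zero_le _) (mem_univ i)).trans (Nat.lt_succ_iff.1 hμ)
    refine HasSum.unique (hasSum_sum_of_ne_finset_zero fun k hk => ?_) (hasSum_spline hj (x i))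
    rw [spline_eq_zero, mul_zero]
    rw [Finset.mem_Icc, ← abs_le, not_le] at hk
    have h2 : (R : ℝ) < |(k : ℝ)| := by exact_mod_cast hk
    have h3 := abs_sub_abs_le_abs_sub (k : ℝ) (-x i)
    rw [abs_neg, sub_neg_eq_add, add_comm (k : ℝ)] at h3
    linarith [hx i]
  have h2 := Finset.prod_univ_sum (fun _ : Fin d => Finset.Icc (-(R : ℤ)) R)
    (fun i k => (k : ℂ) ^ μ i * spline m (x i + k))
  simp only [h1] at h2
  unfold mono box
  simp only [Pi.neg_apply, Complex.ofReal_neg]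
  rw [h2]
  refine sum_congr rfl fun k _ => ?_
  rw [Finset.prod_mul_distrib]
  rfl

theorem sum_tensorSpline (hF : ∀ k, tensorSpline d m (x + toR k) ≠ 0 → k ∈ F)
    (hp : p ∈ polySpace d (m + 1)) : ∑ k ∈ F, p (toR k) * tensorSpline d m (x + toR k) =
      p (-x) := by
  obtain ⟨R, hR⟩ := exists_nat_ge (‖x‖ + (m + 2))
  have hx : ∀ i, |x i| + (m + 2) ≤ R := fun i => by
    have := norm_le_pi_norm x i
    rw [Real.norm_eq_abs] at this
    linarith
  rw [← sum_box_tensorSpline hx hp]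
  rw [Finset.sum_subset (Finset.subset_union_left (s₁ := F) (s₂ := box d R)),
    Finset.sum_subset (Finset.subset_union_right (s₁ := F) (s₂ := box d R))]
  · intro k _ hk
    rw [mem_box] at hk
    push Not at hk
    obtain ⟨i, hi⟩ := hk
    rw [tensorSpline_eq_zero i, mul_zero]
    have h2 : (R : ℝ) < |(k i : ℝ)| := by exact_mod_cast hi
    have h3 := abs_sub_abs_le_abs_sub (k i : ℝ) (-x i)
    rw [abs_neg, sub_neg_eq_add, add_comm (k i : ℝ)] at h3
    have h4 : |(x + toR k) i| = |x i + k i| := rfl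
    rw [h4]
    linarith [hx i]
  · intro k _ hk
    have := not_imp_comm.1 (hF k) hk
    rw [this, mul_zero]

/-- Functionals on a finite dimensional space are combinations of the members of any separating
family of functionals. -/
theorem exists_eq_sum_of_separating {V X : Type*} [AddCommGroup V] [Module ℂ V]
    [FiniteDimensional ℂ V] (e : X → Module.Dual ℂ V) (he : ∀ q, (∀ x, e x q = 0) → q = 0)
    (Λ : Module.Dual ℂ V) : ∃ (n : ℕ) (c : Fin n → ℂ) (x : Fin n → X), Λ = ∑ i, c i • e (x i) := by
  have hΛ : Λ ∈ span ℂ (Set.range e) := by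
    by_contra hcon
    obtain ⟨f, hf, hf2⟩ := Submodule.exists_le_ker_of_lt_top (span ℂ (Set.range e))
      (lt_top_iff_ne_top.2 fun h => hcon (h ▸ Submodule.mem_top))
    apply hf
    obtain ⟨q, rfl⟩ := (Module.evalEquiv ℂ V).surjective f
    have : q = 0 := he q fun x => by
      have := hf2 (subset_span ⟨x, rfl⟩)
      simpa using this
    rw [this, map_zero]
  induction hΛ using span_induction with
  | mem v hv =>
    obtain ⟨x, rfl⟩ := hv
    exact ⟨1, fun _ => 1, fun _ => x, by simp⟩
  | zero => exact ⟨0, fun _ => 0, fun i => i.elim0, by simp⟩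
  | add v w _ _ hv hw =>
    obtain ⟨n, c, x, rfl⟩ := hv
    obtain ⟨n', c', x', rfl⟩ := hw
    exact ⟨n + n', Fin.append c c', Fin.append x x', by simp [Fin.sum_univ_add]⟩
  | smul z v _ hv =>
    obtain ⟨n, c, x, rfl⟩ := hv
    exact ⟨n, fun i => z * c i, x, by simp [smul_sum, mul_smul]⟩

theorem exists_eval_combination (Λ : polySpace d N →ₗ[ℂ] ℂ) : ∃ (n : ℕ) (c : Fin n → ℂ) (t : Fin n →
      ℝ^d), ∀ q : polySpace d N, Λ q = ∑ i, c i * (q : ℝ^d → ℂ) (t i) := by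
  have := finiteDimensional_polySpace (d := d) N
  obtain ⟨n, c, t, h⟩ := exists_eq_sum_of_separating
    (fun x : ℝ^d => (LinearMap.proj x).comp (polySpace d N).subtype)
    (fun q hq => Subtype.ext (funext fun x => hq x)) Λ
  refine ⟨n, c, t, fun q => ?_⟩
  rw [h]
  simp

/-- A finite scalar filter of total mass one acts injectively on polynomials. -/
theorem eq_zero_of_averages (hs : ∑ z ∈ F, s z = 1) {q : ℝ^d → ℂ} (hq : q ∈ polySpace d N)
    (h : ∀ x, ∑ z ∈ F, s z * q (toR z + x) = 0) : q = 0 := by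
  induction N with
  | zero => simpa [polySpace_zero] using hq
  | succ N ih =>
    apply ih
    have h1 : q = -∑ z ∈ F, s z • fun x => q (x + toR z) - q x := by
      funext x
      have h2 := h x
      simp only [Pi.neg_apply, Finset.sum_apply, Pi.smul_apply, smul_eq_mul, mul_sub,
        sum_sub_distrib, ← sum_mul, hs, one_mul]
      simp only [add_comm (toR _) x] at h2
      rw [h2]
      ring
    rw [h1]
    exact neg_mem (Submodule.sum_mem _ fun z _ => Submodule.smul_mem _ _
      (translate_sub_mem hq (toR z)))

theorem exists_average_combination (hs : ∑ z ∈ F, s z = 1) : ∃ (n : ℕ) (c : Fin n → ℂ) (t : Fin n →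
      ℝ^d), ∀ q ∈ polySpace d N, q 0 = ∑ i, c i * ∑ z ∈ F, s z * q (toR z + t i) := by
  have := finiteDimensional_polySpace (d := d) N
  let ev : ℝ^d → Module.Dual ℂ (polySpace d N) := fun x =>
    (LinearMap.proj x).comp (polySpace d N).subtype
  obtain ⟨n, c, t, h⟩ := exists_eq_sum_of_separating
    (fun x : ℝ^d => ∑ z ∈ F, s z • ev (toR z + x))
    (fun q hq => Subtype.ext (eq_zero_of_averages hs q.2 fun x => by simpa [ev] using hq x)) (ev 0)
  refine ⟨n, c, t, fun q hq => ?_⟩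
  have h2 := LinearMap.congr_fun h ⟨q, hq⟩
  simpa [ev] using h2

end

section

/-! ### Samples of functions and the cascade operator -/

variable {d r R R' N lam A : ℕ} {f g : Fin r → ℝ^d → ℂ} {x : ℝ^d} {F : Finset ℤ^d} {a : Filt d r r}
  {υ : Filt d 1 r}

/-- The values of a vector function as columns. -/
def col (f : Fin r → ℝ^d → ℂ) (x : ℝ^d) : Mat r 1 := Matrix.of fun j _ => f j x

/-- The vector function `f` is supported in the cube `[-R, R]^d`. -/
def SuppCube (R : ℕ) (f : Fin r → ℝ^d → ℂ) : Prop := ∀ j x i, (R : ℝ) < |x i| → f j x = 0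

theorem SuppCube.mono (h : R ≤ R') (hf : SuppCube R f) : SuppCube R' f :=
  fun j x i hx =>
  hf j x i (lt_of_le_of_lt (by exact_mod_cast h) hx)

theorem SuppCube.mem_box {S : ℕ} (hf : SuppCube R f) (hx : ∀ i, |x i| + R ≤ S) {k : ℤ^d} {j : Fin r}
    (hk : f j (x + toR k) ≠ 0) : k ∈ box d S := by
  rw [VectorSubdivision.mem_box]
  intro i
  by_contra hcon
  apply hk
  apply hf j _ i
  have h2 : (S : ℝ) < |(k i : ℝ)| := by exact_mod_cast not_le.1 hcon
  have h3 := abs_sub_abs_le_abs_sub (k i : ℝ) (-x i)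
  rw [abs_neg, sub_neg_eq_add, add_comm (k i : ℝ)] at h3
  have h4 : |(x + toR k) i| = |x i + k i| := rfl
  rw [h4]
  linarith [hx i]

theorem exists_abs_add_le (x : ℝ^d) (R : ℕ) : ∃ S : ℕ, ∀ i, |x i| + R ≤ S := by
  obtain ⟨S, hS⟩ := exists_nat_ge (‖x‖ + R)
  refine ⟨S, fun i => ?_⟩
  have := norm_le_pi_norm x i
  rw [Real.norm_eq_abs] at this
  linarith

theorem col_eq_zero_iff : col f x = 0 ↔ ∀ j, f j x = 0 := by
  constructor
  · intro h j
    exact congrFun (congrFun h j) 0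
  · intro h
    ext j l
    exact h j

theorem SuppCube.finite_support (hf : SuppCube R f) (x : ℝ^d) :
    (Function.support fun k : ℤ^d => col f (x + toR k)).Finite := by
  obtain ⟨S, hS⟩ := exists_abs_add_le x R
  refine (box d S).finite_toSet.subset fun k hk => ?_
  have : ¬ ∀ j, f j (x + toR k) = 0 := fun h => hk (col_eq_zero_iff.2 h)
  push Not at this
  obtain ⟨j, hj⟩ := this
  exact hf.mem_box hS hj

open Classical in
/-- The samples `k ↦ f(x + k)` of a compactly supported vector function. -/
def samp (f : Fin r → ℝ^d → ℂ) (x : ℝ^d) : Filt d r 1 :=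
  if h : (Function.support fun k : ℤ^d => col f (x + toR k)).Finite then
    Finsupp.ofSupportFinite _ h else 0

theorem samp_apply (hf : SuppCube R f) (x : ℝ^d) (k : ℤ^d) : samp f x k = col f (x + toR k) := by
  rw [samp, dif_pos (hf.finite_support x)]
  rfl

theorem moment_eq_sum_sum (υ : Filt d 1 r) (w : Filt d r 1) (hF : ∀ k, w k ≠ 0 → k ∈ F)
    (p : ℝ^d → ℂ) : moment υ w p = ∑ z ∈ υ.support, ∑ j, ∑ k ∈ F, (υ z 0 j * p (toR z + toR k)) *
      w k j 0 := by
  rw [moment_eq_pairing, pairing_def, Matrix.sum_apply]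
  refine sum_congr rfl fun z _ => ?_
  rw [Matrix.mul_apply]
  refine sum_congr rfl fun j _ => ?_
  rw [pairing_eq_sum _ _ hF, Matrix.sum_apply, mul_sum]
  refine sum_congr rfl fun k _ => ?_
  rw [Matrix.mul_smul, Matrix.mul_one, Matrix.smul_apply, smul_eq_mul, ← mul_assoc]

theorem moment_samp (hf : SuppCube R f) (υ : Filt d 1 r) (x : ℝ^d)
    (hF : ∀ j k, f j (x + toR k) ≠ 0 → k ∈ F) (p : ℝ^d → ℂ) : moment υ (samp f x) p =
      ∑ z ∈ υ.support, ∑ j, ∑ k ∈ F, (υ z 0 j * p (toR z + toR k)) * f j (x + toR k) := by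
  rw [moment_eq_sum_sum υ (F := F) _ fun k hk => ?_]
  · simp only [samp_apply hf]
    rfl
  · rw [samp_apply hf, Ne, col_eq_zero_iff] at hk
    push Not at hk
    obtain ⟨j, hj⟩ := hk
    exact hF j k hj

theorem samp_add_toR (hf : SuppCube R f) (x : ℝ^d) (l : ℤ^d) : samp f (x + toR l) =
      shift (-l) (samp f x) := by
  ext1 k
  rw [shift_apply, samp_apply hf, samp_apply hf, toR_sub, toR_neg, sub_neg_eq_add, add_assoc,
    add_comm (toR l)]

theorem shift_mem_vanishingSpace {y : Filt d 1 r} (z : ℤ^d) {w : Filt d r 1}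
    (hw : w ∈ vanishingSpace N y) : shift z w ∈ vanishingSpace N y := by
  rw [mem_vanishingSpace_iff] at hw ⊢
  intro p hp
  rw [moment_shift]
  exact hw _ (translate_mem hp _)

theorem col_cascade (lam : ℕ) (a : Filt d r r) (f : Fin r → ℝ^d → ℂ) (x : ℝ^d) :
    col (cascade lam a f) x = ((lam : ℂ) ^ d) • pairing a fun k =>
      col f ((lam : ℝ) • x - toR k) := by
  ext i l
  rw [Matrix.smul_apply, pairing_def, Matrix.sum_apply]
  rfl

theorem col_cascade_iterate (lam : ℕ) (a : Filt d r r) (f : Fin r → ℝ^d → ℂ) (n : ℕ) (x : ℝ^d) :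
    col ((cascade lam a)^[n] f) x = pairing (mask lam a n) fun k => col f (((lam : ℝ) ^ n) • x -
      toR k) := by
  induction n generalizing f with
  | zero => simp [pairing_mask_zero, toR_zero]
  | succ n ih =>
    rw [Function.iterate_succ_apply, ih, pairing_mask_succ]
    simp only [col_cascade]
    rw [pairing_smul]
    congr 2
    funext z
    congr 1
    funext k
    rw [toR_add, toR_nsmul, smul_sub, smul_smul, ← pow_succ', sub_sub]

theorem conv_mask_samp [NeZero lam] (a : Filt d r r) (hf : SuppCube R f) (n : ℕ) (y : ℝ^d)
    (l : ℤ^d) : conv (mask lam a n) (samp f y) l = col ((cascade lam a)^[n] f) (((lam : ℝ) ^ n)⁻¹ •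
      (y + toR l)) := by
  have h0 : (lam : ℝ) ^ n ≠ 0 := pow_ne_zero _ (by exact_mod_cast NeZero.ne lam)
  rw [col_cascade_iterate, conv_apply, smul_smul, mul_inv_cancel₀ h0, one_smul]
  simp only [samp_apply hf, toR_sub, add_sub_assoc]

theorem SuppCube.cascade (hlam : 2 ≤ lam) (ha : SuppIn A a) (hA : A ≤ R) (hf : SuppCube R f) :
    SuppCube R (cascade lam a f) := fun j x i hx => by
  have h0 : col (VectorSubdivision.cascade lam a f) x = 0 := by
    rw [col_cascade]
    by_contra hne
    obtain ⟨k, hk, hk'⟩ := exists_of_pairing_ne_zero fun h => hne (by rw [h, smul_zero])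
    rw [Ne, col_eq_zero_iff] at hk'
    apply hk'
    intro j
    apply hf j _ i
    have h1 : |(k i : ℝ)| ≤ A := by exact_mod_cast ha k hk i
    have h2 : (A : ℝ) ≤ R := by exact_mod_cast hA
    have h3 : (2 : ℝ) ≤ lam := by exact_mod_cast hlam
    have h4 : |((lam : ℝ) • x - toR k) i| = |lam * x i - k i| := rfl
    have h5 := abs_sub_abs_le_abs_sub (lam * x i) (k i : ℝ)
    rw [abs_mul, Nat.abs_cast] at h5
    rw [h4]
    have h6 : 2 * |x i| ≤ lam * |x i| := mul_le_mul_of_nonneg_right h3 (abs_nonneg _)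
    linarith
  exact col_eq_zero_iff.1 h0 j

theorem SuppCube.cascade_iterate (hlam : 2 ≤ lam) (ha : SuppIn A a) (hA : A ≤ R) (hf : SuppCube R f)
    (n : ℕ) : SuppCube R ((VectorSubdivision.cascade lam a)^[n] f) := by
  induction n with
  | zero => exact hf
  | succ n ih =>
    rw [Function.iterate_succ_apply']
    exact ih.cascade hlam ha hA

theorem samp_cascade [NeZero lam] (hf : SuppCube R f) (hf' : SuppCube R' (cascade lam a f))
    (x : ℝ^d) : samp (cascade lam a f) x = trans lam a 0 (samp f ((lam : ℝ) • x)) := by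
  ext1 k
  rw [samp_apply hf', trans_apply, conv_apply, col_cascade, add_zero]
  simp only [samp_apply hf, toR_sub, toR_nsmul, smul_add, add_sub_assoc]

theorem cascade_add (lam : ℕ) (a : Filt d r r) (f g : Fin r → ℝ^d → ℂ) : cascade lam a (f + g) =
      cascade lam a f + cascade lam a g := by
  funext i x
  simp only [cascade, Pi.add_apply, mul_add, sum_add_distrib, Finsupp.sum]

theorem cascade_smul (lam : ℕ) (a : Filt d r r) (c : ℂ) (f : Fin r → ℝ^d → ℂ) :
    cascade lam a (c • f) = c • cascade lam a f := by
  funext i x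
  simp only [cascade, Pi.smul_apply, smul_eq_mul, mul_sum, Finsupp.sum]
  refine sum_congr rfl fun k _ => sum_congr rfl fun j _ => ?_
  ring

theorem cascade_sub (lam : ℕ) (a : Filt d r r) (f g : Fin r → ℝ^d → ℂ) : cascade lam a (f - g) =
      cascade lam a f - cascade lam a g := by
  rw [sub_eq_add_neg, cascade_add, sub_eq_add_neg, ← neg_one_smul ℂ g, cascade_smul, neg_one_smul]

theorem cascade_iterate_sub (lam : ℕ) (a : Filt d r r) (n : ℕ) (f g : Fin r → ℝ^d → ℂ) :
    (cascade lam a)^[n] (f - g) = (cascade lam a)^[n] f - (cascade lam a)^[n] g := by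
  induction n with
  | zero => rfl
  | succ n ih => simp only [Function.iterate_succ_apply', ih, cascade_sub]

/-- The samples of `f` reproduce polynomials of degree less than `N` with respect to `υ`. -/
def Reproduces (N : ℕ) (υ : Filt d 1 r) (f : Fin r → ℝ^d → ℂ) : Prop :=
  ∀ x, ∀ p ∈ polySpace d N, moment υ (samp f x) p = p (-x)

/-- All samples of `f` lie in the space `vanishingSpace N υ`. -/
def NullMoments (N : ℕ) (υ : Filt d 1 r) (f : Fin r → ℝ^d → ℂ) : Prop :=
  ∀ x, samp f x ∈ vanishingSpace N υ

theorem samp_sub (hf : SuppCube R f) (hg : SuppCube R g) (x : ℝ^d) : samp (f - g) x =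
      samp f x - samp g x := by
  have h : SuppCube R (f - g) := fun j x i hx => by
    rw [Pi.sub_apply, Pi.sub_apply, hf j x i hx, hg j x i hx, sub_zero]
  ext1 k
  rw [samp_apply h, Finsupp.sub_apply, samp_apply hf, samp_apply hg]
  rfl

theorem Reproduces.cascade [NeZero lam] (hυ : IsMatchingFilter lam N a υ) (hf : SuppCube R f)
    (hf' : SuppCube R' (cascade lam a f)) (h : Reproduces N υ f) :
    Reproduces N υ (cascade lam a f) := fun x p hp => by
  have h0 : (lam : ℝ) ≠ 0 := by exact_mod_cast NeZero.ne lam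
  rw [samp_cascade hf hf', moment_trans hυ _ _ hp]
  have h1 : (fun x => p ((lam : ℝ)⁻¹ • (x - toR 0))) = fun x => p ((lam : ℝ)⁻¹ • x) := by
    simp only [toR_zero, sub_zero]
  rw [h1, h _ _ (dilate_mem hp _), ← smul_neg, smul_smul, inv_mul_cancel₀ h0, one_smul]

theorem Reproduces.sub (hf : SuppCube R f) (hg : SuppCube R g) (hf' : Reproduces N υ f)
    (hg' : Reproduces N υ g) : NullMoments N υ (f - g) := fun x => by
  rw [mem_vanishingSpace_iff]
  intro p hp
  rw [samp_sub hf hg, moment_sub_right, hf' x p hp, hg' x p hp, sub_self]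

theorem exists_reproducing (m : ℕ) (hυ : fourierSeries υ 0 ≠ 0) : ∃ (R : ℕ) (f : Fin r → ℝ^d → ℂ),
      SuppCube R f ∧ (∀ j, ContDiff ℝ ∞ (f j)) ∧ Reproduces (m + 1) υ f := by
  have h0 : ∃ j, fourierSeries υ 0 0 j ≠ 0 := by
    by_contra hcon
    push Not at hcon
    apply hυ
    ext i j
    rw [Subsingleton.elim i 0, hcon j]
    rfl
  obtain ⟨j₀, hj₀⟩ := h0
  set c₀ := (fourierSeries υ 0 0 j₀)⁻¹ with hc₀
  have hs : ∑ z ∈ υ.support, υ z 0 j₀ * c₀ = 1 := by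
    rw [← sum_mul, hc₀]
    have : fourierSeries υ 0 0 j₀ = ∑ z ∈ υ.support, υ z 0 j₀ := by
      rw [fourierSeries_zero_eq, pairing_def, Matrix.sum_apply]
      simp
    rw [← this, mul_inv_cancel₀ hj₀]
  obtain ⟨n, c, t, hct⟩ := exists_average_combination (N := m + 1) hs
  obtain ⟨T, hT⟩ := exists_nat_ge (∑ i, ‖t i‖)
  have ht : ∀ i l, |t i l| ≤ T := fun i l =>
    (norm_le_pi_norm (t i) l).trans ((single_le_sum (f := fun i => ‖t i‖)
      (fun _ _ => norm_nonneg _) (mem_univ i)).trans hT)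
  let f : Fin r → ℝ^d → ℂ := fun j x =>
    if j = j₀ then c₀ * ∑ i, c i * tensorSpline d m (x - t i) else 0
  have hf : SuppCube (T + (m + 2)) f := fun j x l hx => by
    simp only [f]
    split_ifs
    · rw [sum_eq_zero, mul_zero]
      intro i _
      rw [tensorSpline_eq_zero l, mul_zero]
      have h1 := abs_sub_abs_le_abs_sub (x l) (t i l)
      have h2 : |(x - t i) l| = |x l - t i l| := rfl
      push_cast at hx
      rw [h2]
      linarith [ht i l]
    · rfl
  refine ⟨T + (m + 2), f, hf, fun j => ?_, fun x p hp => ?_⟩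
  · simp only [f]
    split_ifs
    · exact contDiff_const.mul (ContDiff.sum fun i _ => contDiff_const.mul
        ((contDiff_tensorSpline m).comp (contDiff_id.sub contDiff_const)))
    · exact contDiff_const
  · obtain ⟨S, hS⟩ := exists_abs_add_le x (T + (m + 2))
    rw [moment_samp hf υ x (F := box d S) (fun j k hk => hf.mem_box hS hk)]
    have hq : (fun y => p (y - x)) ∈ polySpace d (m + 1) := by
      simpa only [sub_eq_add_neg] using translate_mem hp (-x)
    have h3 := hct _ hq
    simp only [zero_sub] at h3
    rw [h3]
    have h4 : ∀ i z, ∑ k ∈ box d S, p (toR z + toR k) * tensorSpline d m (x - t i + toR k) =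
        p (toR z + t i - x) := fun i z => by
      have h5 : (fun y => p (toR z + y)) ∈ polySpace d (m + 1) := by
        simpa only [add_comm (toR z)] using translate_mem hp (toR z)
      have := sum_tensorSpline (x := x - t i) (F := box d S) (m := m) (fun k hk => by
        rw [VectorSubdivision.mem_box]
        intro l
        by_contra hcon
        apply hk
        apply tensorSpline_eq_zero l
        have h6 : (S : ℝ) < |(k l : ℝ)| := by exact_mod_cast not_le.1 hcon
        have h7 := abs_sub_abs_le_abs_sub (k l : ℝ) (t i l - x l)
        have h8 := abs_sub (t i l) (x l)
        have h9 : |(x - t i + toR k) l| = |(k l : ℝ) - (t i l - x l)| := by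
          change |x l - t i l + k l| = _
          congr 1
          ring
        have h10 := hS l
        push_cast at h10
        rw [h9]
        linarith [ht i l]) h5
      rw [this]
      congr 1
      abel
    have h5 : ∀ z, ∑ j, ∑ k ∈ box d S, (υ z 0 j * p (toR z + toR k)) * f j (x + toR k) =
        ∑ i, c i * (υ z 0 j₀ * c₀ * p (toR z + t i - x)) := fun z => by
      rw [sum_eq_single j₀ (fun j _ hj => sum_eq_zero fun k _ => by
        simp only [f, if_neg hj, mul_zero]) (fun h => absurd (mem_univ _) h)]
      simp only [f, if_true, ← h4, mul_sum]
      rw [sum_comm]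
      refine sum_congr rfl fun i _ => sum_congr rfl fun k _ => ?_
      rw [sub_add_eq_add_sub]
      ring
    simp only [h5, mul_sum]
    exact sum_comm

end

section

/-! ### Smooth limits of the cascade iteration -/

variable {d r lam N R q : ℕ} {a : Filt d r r} {ρ : ℝ} {f : Fin r → ℝ^d → ℂ} {n : ℕ∞ω}
  {υ : Filt d 1 r}

theorem Decays.cascade_le [NeZero lam] {y : Filt d 1 r} (hρ : 0 ≤ ρ)
    (h : Decays lam a (vanishingSpace N y) ρ) (R : ℕ) : ∃ C : ℝ, 0 ≤ C ∧ ∀ f : Fin r → ℝ^d → ℂ,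
      SuppCube R f → ∀ x, samp f x ∈ vanishingSpace N y → ∀ M : ℝ, 0 ≤ M →
      (∀ j k, ‖f j (x + toR k)‖ ≤ M) → ∀ n j, ‖(cascade lam a)^[n] f j (((lam : ℝ) ^ n)⁻¹ • x)‖ ≤
      C * M * ρ ^ n := by
  obtain ⟨C, hC, H⟩ := h.uniform hρ (R + 1)
  refine ⟨C, hC, fun f hf x hx M hM hfM n j => ?_⟩
  let l : ℤ^d := fun i => ⌊x i⌋
  have h1 : samp f (x - toR l) ∈ vanishingSpace N y := by
    rw [sub_eq_add_neg, ← toR_neg, samp_add_toR hf]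
    exact shift_mem_vanishingSpace _ hx
  have h2 : SuppIn (R + 1) (samp f (x - toR l)) := fun k hk i => by
    rw [samp_apply hf, Ne, col_eq_zero_iff] at hk
    by_contra hcon
    apply hk
    intro j
    apply hf j _ i
    have h3 : ((R : ℝ) + 1) < |(k i : ℝ)| := by exact_mod_cast not_le.1 hcon
    have h4 : |(x - toR l + toR k) i| = |k i - (-Int.fract (x i))| := by
      change |x i - (⌊x i⌋ : ℝ) + k i| = _
      rw [← Int.self_sub_floor]
      congr 1
      ring
    have h5 := abs_sub_abs_le_abs_sub (k i : ℝ) (-Int.fract (x i))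
    rw [abs_neg, abs_of_nonneg (Int.fract_nonneg (x i))] at h5
    rw [h4]
    linarith [Int.fract_lt_one (x i)]
  have h3 : ∀ k i, ‖samp f (x - toR l) k i 0‖ ≤ M := fun k i => by
    rw [samp_apply hf, sub_add_eq_add_sub, add_sub_assoc, ← toR_sub]
    exact hfM i _
  have h4 := H _ h1 h2 M hM h3 n l j
  rwa [conv_mask_samp a hf, sub_add_cancel] at h4

/-- Directional derivatives of order `q` of a vector function. -/
def dirDeriv (q : ℕ) (v : Fin q → ℝ^d) (f : Fin r → ℝ^d → ℂ) : Fin r → ℝ^d → ℂ :=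
  fun j x => iteratedFDeriv ℝ q (f j) x v

theorem SuppCube.dirDeriv (hf : SuppCube R f) (q : ℕ) (v : Fin q → ℝ^d) :
    SuppCube R (dirDeriv q v f) := fun j x i hx => by
  have h1 : f j =ᶠ[𝓝 x] fun _ => 0 := by
    have : {y : ℝ^d | (R : ℝ) < |y i|} ∈ 𝓝 x :=
      (isOpen_lt continuous_const (continuous_apply i).abs).mem_nhds hx
    filter_upwards [this] with y hy using hf j y i hy
  have h2 := (h1.iteratedFDeriv ℝ q).eq_of_nhds
  rw [VectorSubdivision.dirDeriv, h2, iteratedFDeriv_fun_zero]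
  rfl

theorem SuppCube.hasCompactSupport (hf : SuppCube R f) (j : Fin r) : HasCompactSupport (f j) := by
  refine HasCompactSupport.intro (isCompact_closedBall (0 : ℝ^d) R) fun x hx => ?_
  rw [mem_closedBall_zero_iff, pi_norm_le_iff_of_nonneg (Nat.cast_nonneg R)] at hx
  push Not at hx
  obtain ⟨i, hi⟩ := hx
  exact hf j x i hi

theorem SuppCube.exists_iteratedFDeriv_le (hf : SuppCube R f) (hf' : ∀ j, ContDiff ℝ q (f j)) :
    ∃ M : ℝ, 0 ≤ M ∧ ∀ j x, ‖iteratedFDeriv ℝ q (f j) x‖ ≤ M := by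
  have h1 : ∀ j, ∃ C, ∀ x, ‖iteratedFDeriv ℝ q (f j) x‖ ≤ C := fun j =>
    ((hf' j).continuous_iteratedFDeriv le_rfl).bounded_above_of_compact_support
      ((hf.hasCompactSupport j).iteratedFDeriv q)
  choose C hC using h1
  refine ⟨∑ j, |C j|, sum_nonneg fun _ _ => abs_nonneg _, fun j x => ?_⟩
  exact (hC j x).trans ((le_abs_self _).trans (single_le_sum (f := fun j => |C j|)
    (fun _ _ => abs_nonneg _) (mem_univ j)))

theorem iteratedFDeriv_sum_mul {ι : Type*} (S : Finset ι) (c : ι → ℂ) {g : ι → ℝ^d → ℂ}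
    (hg : ∀ j ∈ S, ContDiff ℝ q (g j)) (x : ℝ^d) (v : Fin q → ℝ^d) :
    iteratedFDeriv ℝ q (fun y => ∑ j ∈ S, c j * g j y) x v = ∑ j ∈ S, c j * iteratedFDeriv ℝ q (g j)
      x v := by
  rw [iteratedFDeriv_fun_sum_apply (fun j hj => (contDiff_const.mul (hg j hj)).contDiffAt),
    sum_apply]
  refine sum_congr rfl fun j hj => ?_
  have := iteratedFDeriv_const_smul_apply' (a := c j) (hg j hj).contDiffAt (x := x)
  simp only [smul_eq_mul] at this
  rw [this]
  rfl

theorem iteratedFDeriv_comp_smul_sub {f : ℝ^d → ℂ} (hf : ContDiff ℝ q f) (c : ℝ) (t x : ℝ^d)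
    (v : Fin q → ℝ^d) : iteratedFDeriv ℝ q (fun y => f (c • y - t)) x v =
      (c : ℂ) ^ q * iteratedFDeriv ℝ q f (c • x - t) v := by
  have h1 := iteratedFDeriv_comp_const_smul (𝕜 := ℝ) (f := fun z => f (z - t)) (i := q) c
    (hf.comp (contDiff_id.sub contDiff_const))
  rw [h1]
  beta_reduce
  rw [iteratedFDeriv_comp_sub, smul_apply, Complex.real_smul]
  push_cast
  rfl

theorem cascade_apply_eq_sum (lam : ℕ) (a : Filt d r r) (f : Fin r → ℝ^d → ℂ) (i : Fin r) :
    cascade lam a f i = fun x => ∑ s ∈ a.support ×ˢ univ, ((lam : ℂ) ^ d * a s.1 i s.2) *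
      f s.2 ((lam : ℝ) • x - toR s.1) := by
  funext x
  rw [cascade, Finsupp.sum, mul_sum, sum_product]
  refine sum_congr rfl fun k _ => ?_
  rw [mul_sum]
  exact sum_congr rfl fun j _ => (mul_assoc _ _ _).symm

theorem contDiff_cascade (lam : ℕ) (a : Filt d r r) (hf : ∀ j, ContDiff ℝ n (f j)) (i : Fin r) :
    ContDiff ℝ n (cascade lam a f i) := by
  rw [cascade_apply_eq_sum]
  exact ContDiff.sum fun s _ => contDiff_const.mul
    ((hf s.2).comp ((contDiff_id.const_smul _).sub contDiff_const))

theorem contDiff_cascade_iterate (lam : ℕ) (a : Filt d r r) (hf : ∀ j, ContDiff ℝ n (f j)) (k : ℕ)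
    (i : Fin r) : ContDiff ℝ n ((cascade lam a)^[k] f i) := by
  induction k generalizing i with
  | zero => exact hf i
  | succ k ih =>
    rw [Function.iterate_succ_apply']
    exact contDiff_cascade lam a ih i

theorem dirDeriv_cascade (lam : ℕ) (a : Filt d r r) (hf : ∀ j, ContDiff ℝ q (f j))
    (v : Fin q → ℝ^d) : dirDeriv q v (cascade lam a f) = (lam : ℂ) ^ q •
      cascade lam a (dirDeriv q v f) := by
  funext i x
  rw [dirDeriv, cascade_apply_eq_sum, iteratedFDeriv_sum_mul _ _ (fun s _ =>
    (hf s.2).comp ((contDiff_id.const_smul _).sub contDiff_const)), Pi.smul_apply, Pi.smul_apply,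
    cascade_apply_eq_sum, smul_eq_mul, mul_sum]
  refine sum_congr rfl fun s _ => ?_
  rw [iteratedFDeriv_comp_smul_sub (hf s.2), dirDeriv]
  push_cast
  ring

theorem dirDeriv_cascade_iterate (lam : ℕ) (a : Filt d r r) (hf : ∀ j, ContDiff ℝ q (f j))
    (v : Fin q → ℝ^d) (n : ℕ) : dirDeriv q v ((cascade lam a)^[n] f) = (lam : ℂ) ^ (q * n) •
      (cascade lam a)^[n] (dirDeriv q v f) := by
  induction n with
  | zero => simp
  | succ n ih =>
    rw [Function.iterate_succ_apply', Function.iterate_succ_apply',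
      dirDeriv_cascade lam a (contDiff_cascade_iterate lam a hf n), ih, cascade_smul, smul_smul,
      ← pow_add, Nat.mul_succ, add_comm q]

theorem moment_samp_dirDeriv (hf : SuppCube R f) (hf' : ∀ j, ContDiff ℝ q (f j)) (v : Fin q → ℝ^d)
    (υ : Filt d 1 r) (p : ℝ^d → ℂ) (x : ℝ^d) : moment υ (samp (dirDeriv q v f) x) p =
      iteratedFDeriv ℝ q (fun y => moment υ (samp f y) p) x v := by
  obtain ⟨S, hS⟩ := exists_abs_add_le x (R + 1)
  have hS' : ∀ y ∈ ball x 1, ∀ i, |y i| + R ≤ S := fun y hy i => by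
    have h1 := hS i
    push_cast at h1
    have h2 : |y i - x i| ≤ 1 := (norm_le_pi_norm (y - x) i).trans
      (by rw [← dist_eq_norm]; exact (Metric.mem_ball.1 hy).le)
    have h3 := abs_sub_abs_le_abs_sub (y i) (x i)
    linarith
  let T := υ.support ×ˢ ((univ : Finset (Fin r)) ×ˢ box d S)
  have key : ∀ g : Fin r → ℝ^d → ℂ, SuppCube R g → ∀ y ∈ ball x 1,
      moment υ (samp g y) p = ∑ s ∈ T, (υ s.1 0 s.2.1 * p (toR s.1 + toR s.2.2)) *
        g s.2.1 (y + toR s.2.2) := fun g hg y hy => by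
    rw [moment_samp hg υ y (F := box d S) (fun j k hk => hg.mem_box (hS' y hy) hk)]
    simp only [T, sum_product]
  rw [key _ (hf.dirDeriv q v) x (Metric.mem_ball_self one_pos)]
  have h2 : (fun y => moment υ (samp f y) p) =ᶠ[𝓝 x] fun y => ∑ s ∈ T,
      (υ s.1 0 s.2.1 * p (toR s.1 + toR s.2.2)) * f s.2.1 (y + toR s.2.2) := by
    filter_upwards [Metric.ball_mem_nhds x one_pos] with y hy using key f hf y hy
  rw [(h2.iteratedFDeriv ℝ q).eq_of_nhds, iteratedFDeriv_sum_mul _ _ (fun s _ =>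
    (hf' s.2.1).comp (contDiff_id.add contDiff_const))]
  refine sum_congr rfl fun s _ => ?_
  rw [iteratedFDeriv_comp_add_right]
  rfl

theorem NullMoments.dirDeriv (hf : SuppCube R f) (hf' : ∀ j, ContDiff ℝ q (f j)) (v : Fin q → ℝ^d)
    (h : NullMoments N υ f) : NullMoments N υ (dirDeriv q v f) := fun x => by
  rw [mem_vanishingSpace_iff]
  intro p hp
  rw [moment_samp_dirDeriv hf hf']
  have : (fun y => moment υ (samp f y) p) = fun _ => 0 :=
    funext fun y => mem_vanishingSpace_iff.1 (h y) p hp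
  rw [this, iteratedFDeriv_fun_zero]
  rfl

theorem NullMoments.exists_iteratedFDeriv_cascade_le [NeZero lam] (hρ : 0 ≤ ρ)
    (hD : Decays lam a (vanishingSpace N υ) ρ) (hf : SuppCube R f) (hf' : ∀ j, ContDiff ℝ q (f j))
    (h : NullMoments N υ f) : ∃ C : ℝ, ∀ n j x, ‖iteratedFDeriv ℝ q ((cascade lam a)^[n] f j) x‖ ≤
      C * ((lam : ℝ) ^ q * ρ) ^ n := by
  obtain ⟨C, hC, H⟩ := hD.cascade_le hρ R
  obtain ⟨M, hM, hfM⟩ := hf.exists_iteratedFDeriv_le hf'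
  refine ⟨C * M, fun n j x => ?_⟩
  refine ContinuousMultilinearMap.opNorm_le_bound (by positivity) fun v => ?_
  have h0 : (lam : ℝ) ^ n ≠ 0 := pow_ne_zero _ (by exact_mod_cast NeZero.ne lam)
  have h1 := H _ (hf.dirDeriv q v) (((lam : ℝ) ^ n) • x)
    (h.dirDeriv hf hf' v _) (M * ∏ i, ‖v i‖) (by positivity)
    (fun j k => ((iteratedFDeriv ℝ q (f j) _).le_opNorm v).trans (by gcongr; exact hfM _ _)) n j
  rw [smul_smul, inv_mul_cancel₀ h0, one_smul] at h1
  have h2 : iteratedFDeriv ℝ q ((cascade lam a)^[n] f j) x v =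
      (lam : ℂ) ^ (q * n) * (cascade lam a)^[n] (VectorSubdivision.dirDeriv q v f) j x :=
    congrFun (congrFun (dirDeriv_cascade_iterate lam a hf' v n) j) x
  rw [h2, norm_mul, norm_pow, Complex.norm_natCast]
  calc (lam : ℝ) ^ (q * n) * ‖(cascade lam a)^[n] (VectorSubdivision.dirDeriv q v f) j x‖
      ≤ (lam : ℝ) ^ (q * n) * (C * (M * ∏ i, ‖v i‖) * ρ ^ n) := by gcongr
    _ = C * M * ((lam : ℝ) ^ q * ρ) ^ n * ∏ i, ‖v i‖ := by
      rw [mul_pow, ← pow_mul]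
      ring

theorem samp_tendsto_moment {f : ℕ → Fin r → ℝ^d → ℂ} {g : Fin r → ℝ^d → ℂ}
    (hf : ∀ n, SuppCube R (f n)) (hg : SuppCube R g)
    (h : ∀ j x, Tendsto (fun n => f n j x) atTop (𝓝 (g j x))) (υ : Filt d 1 r) (x : ℝ^d)
    (p : ℝ^d → ℂ) : Tendsto (fun n => moment υ (samp (f n) x) p) atTop
      (𝓝 (moment υ (samp g x) p)) := by
  obtain ⟨S, hS⟩ := exists_abs_add_le x R
  rw [moment_samp hg υ x (F := box d S) (fun j k hk => hg.mem_box hS hk)]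
  have : ∀ n, moment υ (samp (f n) x) p = _ := fun n =>
    moment_samp (hf n) υ x (F := box d S) (fun j k hk => (hf n).mem_box hS hk) p
  simp only [this]
  exact tendsto_finsetSum _ fun z _ => tendsto_finsetSum _ fun j _ => tendsto_finsetSum _
    fun k _ => (h _ _).const_mul _

theorem exists_cascade_limit {m : ℕ} [NeZero lam] (hlam : 2 ≤ lam)
    (hυ : IsMatchingFilter lam (m + 1) a υ) (hρ : 0 < ρ) (hρm : ρ < ((lam : ℝ) ^ m)⁻¹)
    (hD : Decays lam a (vanishingSpace (m + 1) υ) ρ) : ∃ (R : ℕ) (ψ g : Fin r → ℝ^d → ℂ),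
      SuppCube R ψ ∧ (∀ j, ContDiff ℝ ∞ (ψ j)) ∧ Reproduces (m + 1) υ ψ ∧ SuppCube R g ∧
      (∀ j, ContDiff ℝ m (g j)) ∧ cascade lam a g = g ∧ Reproduces (m + 1) υ g ∧ ∀ q ≤ m, ∀ ε > 0,
      ∀ᶠ n in atTop, ∀ j x, ‖iteratedFDeriv ℝ q ((cascade lam a)^[n] ψ j) x - iteratedFDeriv ℝ q
      (g j) x‖ ≤ ε := by
  obtain ⟨R₀, ψ, hψ0, hψs, hψr⟩ := exists_reproducing m hυ.1
  obtain ⟨A, hA⟩ := exists_suppIn a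
  set R := max R₀ A with hR
  have hψ : SuppCube R ψ := hψ0.mono (le_max_left _ _)
  have hAR : A ≤ R := le_max_right _ _
  have hψ1 : SuppCube R (cascade lam a ψ) := hψ.cascade hlam hA hAR
  set f := cascade lam a ψ - ψ with hfdef
  have hf : SuppCube R f := fun j x i hx => by
    rw [hfdef, Pi.sub_apply, Pi.sub_apply, hψ1 j x i hx, hψ j x i hx, sub_zero]
  have hfs : ∀ j, ContDiff ℝ ∞ (f j) := fun j => (contDiff_cascade lam a hψs j).sub (hψs j)
  have hfn : NullMoments (m + 1) υ f := Reproduces.sub hψ1 hψ (hψr.cascade hυ hψ hψ1) hψr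
  have hlam1 : (1 : ℝ) ≤ lam := by exact_mod_cast (by omega : 1 ≤ lam)
  have hlam0 : (0 : ℝ) < lam := by linarith
  have hq : ∀ q ≤ m, ∃ C : ℝ, ∀ n j x, ‖iteratedFDeriv ℝ q ((cascade lam a)^[n] f j) x‖ ≤
      C * ((lam : ℝ) ^ q * ρ) ^ n := fun q _ =>
    hfn.exists_iteratedFDeriv_cascade_le hρ.le hD hf
      (fun j => (hfs j).of_le (by exact_mod_cast le_top))
  choose! C hC using hq
  have hrate : ∀ q ≤ m, (lam : ℝ) ^ q * ρ < 1 := fun q hqm => by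
    calc (lam : ℝ) ^ q * ρ ≤ (lam : ℝ) ^ m * ρ := by gcongr
      _ < (lam : ℝ) ^ m * ((lam : ℝ) ^ m)⁻¹ := by gcongr
      _ = 1 := mul_inv_cancel₀ (by positivity)
  have hsum : ∀ q ≤ m, Summable fun n => C q * ((lam : ℝ) ^ q * ρ) ^ n := fun q hqm =>
    (summable_geometric_of_lt_one (by positivity) (hrate q hqm)).mul_left _
  let G : Fin r → ℝ^d → ℂ := fun j x => ∑' n, (cascade lam a)^[n] f j x
  have hFs : ∀ j n, ContDiff ℝ ((m : ℕ∞) : ℕ∞ω) ((cascade lam a)^[n] f j) := fun j n =>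
    (contDiff_cascade_iterate lam a hfs n j).of_le (by exact_mod_cast le_top)
  have hGs : ∀ j, ContDiff ℝ ((m : ℕ∞) : ℕ∞ω) (G j) := fun j =>
    contDiff_tsum (v := fun q n => C q * ((lam : ℝ) ^ q * ρ) ^ n) (hFs j)
      (fun k hk => hsum k (by exact_mod_cast hk))
      (fun k n x hk => hC k (by exact_mod_cast hk) n j x)
  have hGd : ∀ j, ∀ q ≤ m, ∀ x, iteratedFDeriv ℝ q (G j) x =
      ∑' n, iteratedFDeriv ℝ q ((cascade lam a)^[n] f j) x := fun j q hqm x =>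
    iteratedFDeriv_tsum_apply (v := fun q n => C q * ((lam : ℝ) ^ q * ρ) ^ n) (hFs j)
      (fun k hk => hsum k (by exact_mod_cast hk))
      (fun k n x hk => hC k (by exact_mod_cast hk) n j x) (by exact_mod_cast hqm) x
  have hpart : ∀ n, (cascade lam a)^[n] ψ = ψ + ∑ k ∈ Finset.range n, (cascade lam a)^[k] f := by
    intro n
    induction n with
    | zero => simp
    | succ n ih =>
      rw [Finset.sum_range_succ, ← add_assoc, ← ih, hfdef, cascade_iterate_sub,
        ← Function.iterate_succ_apply, add_sub_cancel]
  let g : Fin r → ℝ^d → ℂ := ψ + G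
  have hgs : ∀ j, ContDiff ℝ m (g j) := fun j =>
    ((hψs j).of_le (by exact_mod_cast le_top)).add (by exact_mod_cast hGs j)
  have hconv : ∀ q ≤ m, ∀ ε > 0, ∀ᶠ n in atTop, ∀ j x,
      ‖iteratedFDeriv ℝ q ((cascade lam a)^[n] ψ j) x - iteratedFDeriv ℝ q (g j) x‖ ≤ ε := by
    intro q hqm ε hε
    rw [eventually_all]
    intro j
    have h1 := Metric.tendstoUniformly_iff.1 (tendstoUniformly_tsum_nat (hsum q hqm)
      (fun n x => hC q hqm n j x)) ε hε
    filter_upwards [h1] with n hn x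
    have h2 := (hn x).le
    rw [dist_comm, dist_eq_norm, ← hGd j q hqm x] at h2
    refine le_trans (le_of_eq ?_) h2
    congr 1
    have hψq : ContDiffAt ℝ q (ψ j) x := ((hψs j).of_le (by exact_mod_cast le_top)).contDiffAt
    have h3 : iteratedFDeriv ℝ q (g j) x =
        iteratedFDeriv ℝ q (ψ j) x + iteratedFDeriv ℝ q (G j) x :=
      iteratedFDeriv_add_apply hψq ((hGs j).of_le (by exact_mod_cast hqm)).contDiffAt
    have h4 : iteratedFDeriv ℝ q ((cascade lam a)^[n] ψ j) x = iteratedFDeriv ℝ q (ψ j) x +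
        ∑ k ∈ Finset.range n, iteratedFDeriv ℝ q ((cascade lam a)^[k] f j) x := by
      have h5 : ∀ k ∈ Finset.range n, ContDiffAt ℝ q ((cascade lam a)^[k] f j) x := fun k _ =>
        ((hFs j k).of_le (by exact_mod_cast hqm)).contDiffAt
      rw [hpart, ← iteratedFDeriv_sum_apply h5, ← iteratedFDeriv_add_apply hψq
        (by convert ContDiffAt.sum h5 using 1; funext y; simp)]
      congr 1
      funext y
      simp
    rw [h3, h4]
    abel
  have hψn : ∀ n, SuppCube R ((cascade lam a)^[n] ψ) := hψ.cascade_iterate hlam hA hAR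
  have hlim : ∀ j x, Tendsto (fun n => (cascade lam a)^[n] ψ j x) atTop (𝓝 (g j x)) := fun j x => by
    rw [Metric.tendsto_atTop]
    intro ε hε
    obtain ⟨n₀, hn₀⟩ := eventually_atTop.1 (hconv 0 (Nat.zero_le m) (ε / 2) (by positivity))
    refine ⟨n₀, fun n hn => ?_⟩
    have h1 := (ContinuousMultilinearMap.le_opNorm _ (fun i : Fin 0 => (0 : ℝ^d))).trans
      (mul_le_mul_of_nonneg_right (hn₀ n hn j x)
        (Finset.prod_nonneg fun (i : Fin 0) _ => norm_nonneg (0 : ℝ^d)))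
    simp only [sub_apply, iteratedFDeriv_zero_apply, Finset.univ_eq_empty,
      Finset.prod_empty, mul_one] at h1
    rw [dist_eq_norm]
    linarith
  have hg : SuppCube R g := fun j x i hx =>
    tendsto_nhds_unique (hlim j x) (by simp only [hψn _ j x i hx]; exact tendsto_const_nhds)
  have hgc : cascade lam a g = g := by
    funext i x
    refine tendsto_nhds_unique (f := fun n => (cascade lam a)^[n + 1] ψ i x) ?_
      ((hlim i x).comp (tendsto_add_atTop_nat 1))
    simp only [Function.iterate_succ_apply', cascade_apply_eq_sum]
    exact tendsto_finsetSum _ fun s _ => (hlim _ _).const_mul _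
  have hψnr : ∀ n, Reproduces (m + 1) υ ((cascade lam a)^[n] ψ) := fun n => by
    induction n with
    | zero => exact hψr
    | succ n ih =>
      have := hψn (n + 1)
      rw [Function.iterate_succ_apply'] at this ⊢
      exact ih.cascade hυ (hψn n) this
  refine ⟨R, ψ, g, hψ, hψs, hψr, hg, hgs, hgc, fun x p hp => ?_, hconv⟩
  refine tendsto_nhds_unique (samp_tendsto_moment hψn hg hlim υ x p) ?_
  simp only [fun n => hψnr n x p hp]
  exact tendsto_const_nhds

end

section

/-! ### Words of partial derivatives -/

variable {d r : ℕ} {f g k : ℝ^d → ℂ} {x : ℝ^d} {F : smoothSpace d →ₗ[ℂ] ℂ} {ε : ℝ}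

/-- The iterated partial derivative along a list of coordinate directions. -/
def wderiv (l : List (Fin d)) (f : ℝ^d → ℂ) : ℝ^d → ℂ := l.foldr pderiv f

theorem wderiv_append_singleton (l : List (Fin d)) (j : Fin d) (f : ℝ^d → ℂ) : wderiv (l ++ [j]) f =
      wderiv l (pderiv j f) := by
  simp [wderiv]

theorem pderiv_eq_fderiv (hf : ContDiff ℝ ∞ f) (j : Fin d) : pderiv j f =
      fun x => fderiv ℝ f x (Pi.single j 1) :=
  funext fun x => ((hf.differentiable (by simp)) x).lineDeriv_eq_fderiv

theorem contDiff_pderiv (hf : ContDiff ℝ ∞ f) (j : Fin d) : ContDiff ℝ ∞ (pderiv j f) := by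
  rw [pderiv_eq_fderiv hf]
  exact (hf.fderiv_right (m := ∞) (by simp)).clm_apply contDiff_const

theorem contDiff_wderiv (hf : ContDiff ℝ ∞ f) (l : List (Fin d)) : ContDiff ℝ ∞ (wderiv l f) := by
  induction l with
  | nil => exact hf
  | cons j l ih => exact contDiff_pderiv ih j

theorem exists_wderiv_eq (l : List (Fin d)) : ∃ v : Fin l.length → ℝ^d, (∀ i, ‖v i‖ ≤ 1) ∧
      ∀ f : ℝ^d → ℂ, ContDiff ℝ ∞ f → wderiv l f = fun x => iteratedFDeriv ℝ l.length f x v := by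
  induction l with
  | nil =>
    exact ⟨fun _ => 0, by simp, fun f _ => funext fun x => (iteratedFDeriv_zero_apply _).symm⟩
  | cons j l ih =>
    obtain ⟨v, hv, h⟩ := ih
    refine ⟨Fin.cons (Pi.single j 1) v, fun i => ?_, fun f hf => ?_⟩
    · refine Fin.cases ?_ (fun i => ?_) i
      · simp [Pi.norm_single]
      · simpa using hv i
    · change pderiv j (wderiv l f) = _
      rw [h f hf, pderiv_iteratedFDeriv_apply _ _ (hf.of_le (by exact_mod_cast le_top))]
      rfl

theorem norm_wderiv_le (hf : ContDiff ℝ ∞ f) (l : List (Fin d)) (x : ℝ^d) : ‖wderiv l f x‖ ≤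
      ‖iteratedFDeriv ℝ l.length f x‖ := by
  obtain ⟨v, hv, h⟩ := exists_wderiv_eq l
  rw [h f hf]
  refine (ContinuousMultilinearMap.le_opNorm _ v).trans ?_
  refine mul_le_of_le_one_right (norm_nonneg _) ?_
  exact Finset.prod_le_one (fun _ _ => norm_nonneg _) fun i _ => hv i

theorem wderiv_eq_zero (hf : ContDiff ℝ ∞ f) (l : List (Fin d)) (h : f =ᶠ[𝓝 x] fun _ => 0) :
    wderiv l f x = 0 := by
  have h1 := norm_wderiv_le hf l x
  rw [(h.iteratedFDeriv ℝ _).eq_of_nhds, iteratedFDeriv_fun_zero] at h1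
  exact norm_le_zero_iff.1 (by simpa using h1)

theorem hasCompactSupport_wderiv (hf : ContDiff ℝ ∞ f) (hc : HasCompactSupport f)
    (l : List (Fin d)) : HasCompactSupport (wderiv l f) := by
  refine hc.mono' fun x hx => ?_
  by_contra hcon
  exact hx (wderiv_eq_zero hf l (notMem_tsupport_iff_eventuallyEq.1 hcon))

theorem wderiv_sub (hf : ContDiff ℝ ∞ f) (hg : ContDiff ℝ ∞ g) (l : List (Fin d)) (x : ℝ^d) :
    wderiv l (f - g) x = wderiv l f x - wderiv l g x := by
  obtain ⟨v, _, h⟩ := exists_wderiv_eq l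
  have hf' : ContDiffAt ℝ l.length f x := (hf.of_le (by exact_mod_cast le_top)).contDiffAt
  have hg' : ContDiffAt ℝ l.length g x := (hg.of_le (by exact_mod_cast le_top)).contDiffAt
  rw [h f hf, h g hg, h (f - g) (hf.sub hg)]
  beta_reduce
  rw [iteratedFDeriv_sub_apply hf' hg']
  rfl

theorem exists_norm_iteratedFDeriv_le (n : ℕ) : ∃ C : ℝ, 0 ≤ C ∧ ∀ f : ℝ^d → ℂ, ContDiff ℝ ∞ f →
      ∀ x (B : ℝ), (∀ l : List (Fin d), l.length = n → ‖wderiv l f x‖ ≤ B) →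
      ‖iteratedFDeriv ℝ n f x‖ ≤ C * B := by
  induction n with
  | zero =>
    refine ⟨1, zero_le_one, fun f hf x B h => ?_⟩
    rw [norm_iteratedFDeriv_zero, one_mul]
    exact h [] rfl
  | succ n ih =>
    obtain ⟨C, hC, ih⟩ := ih
    let L : Fin d → ℂ →L[ℝ] ℝ^d →L[ℝ] ℂ := fun j =>
      ContinuousLinearMap.smulRightL ℝ ℝ^d ℂ (ContinuousLinearMap.proj j)
    refine ⟨∑ j, ‖L j‖ * C, by positivity, fun f hf x B h => ?_⟩
    have h1 : fderiv ℝ f = fun y => ∑ j, L j (pderiv j f y) := by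
      funext y
      ext v
      have h2 : v = ∑ j, v j • (Pi.single j 1 : ℝ^d) := by
        ext i
        simp [Finset.sum_apply, Pi.single_apply]
      conv_lhs => rw [h2]
      simp [L, pderiv_eq_fderiv hf]
    rw [← norm_iteratedFDeriv_fderiv, h1, iteratedFDeriv_fun_sum_apply (f := fun j y =>
      L j (pderiv j f y)) fun j _ => ((L j).contDiff.comp
        ((contDiff_pderiv hf j).of_le (by exact_mod_cast le_top))).contDiffAt,
      sum_mul]
    refine (norm_sum_le _ _).trans (sum_le_sum fun j _ => ?_)
    have h2 := (L j).norm_iteratedFDeriv_comp_left (x := x)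
      ((contDiff_pderiv hf j).contDiffAt) (N := (∞ : ℕ∞ω)) (n := n) (by exact_mod_cast le_top)
    refine h2.trans ?_
    rw [mul_assoc]
    refine mul_le_mul_of_nonneg_left (ih _ (contDiff_pderiv hf j) x B fun l hl => ?_)
      (norm_nonneg _)
    rw [← wderiv_append_singleton]
    exact h _ (by simp [hl])

/-! ### Functionals bounded by finitely many derivatives -/

theorem contDiff_coe (f : smoothSpace d) : ContDiff ℝ ∞ (f : ℝ^d → ℂ) := f.2

theorem continuous_expo (ξ : ℝ^d) : Continuous fun x : ℝ^d => expo x ξ :=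
  (contDiff_coe (expoSmooth ξ)).continuous

/-- `F` is bounded by finitely many partial derivatives on a compact set. -/
def WordBounded (F : smoothSpace d →ₗ[ℂ] ℂ) : Prop :=
  ∃ (C : ℝ) (N : ℕ) (K : Set ℝ^d), IsCompact K ∧ 0 ≤ C ∧
    ∀ (f : smoothSpace d) (B : ℝ), 0 ≤ B →
      (∀ l : List (Fin d), l.length ≤ N → ∀ x ∈ K, ‖wderiv l (f : ℝ^d → ℂ) x‖ ≤ B) → ‖F f‖ ≤ C * B

theorem CompactDistribution.wordBounded (T : CompactDistribution d) : WordBounded T.toLin := by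
  obtain ⟨C, N, K, hK, h⟩ := T.bound'
  choose D hD0 hD using fun n => exists_norm_iteratedFDeriv_le (d := d) n
  have hS : 0 ≤ ∑ n ∈ Finset.range (N + 1), D n := sum_nonneg fun n _ => hD0 n
  refine ⟨|C| * ∑ n ∈ Finset.range (N + 1), D n, N, K, hK, by positivity, fun f B hB hf => ?_⟩
  have h1 := h f ((∑ n ∈ Finset.range (N + 1), D n) * B) fun n hn x hx => by
    refine (hD n _ f.2 x B fun l hl => hf l (by omega) x hx).trans ?_
    refine mul_le_mul_of_nonneg_right ?_ hB
    exact single_le_sum (fun n _ => hD0 n) (Finset.mem_range.2 (by omega))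
  refine h1.trans ?_
  rw [mul_assoc]
  exact mul_le_mul_of_nonneg_right (le_abs_self C) (by positivity)

theorem WordBounded.sub {G : smoothSpace d →ₗ[ℂ] ℂ} (hF : WordBounded F) (hG : WordBounded G) :
    WordBounded (F - G) := by
  obtain ⟨C, N, K, hK, hC, h⟩ := hF
  obtain ⟨C', N', K', hK', hC', h'⟩ := hG
  refine ⟨C + C', max N N', K ∪ K', hK.union hK', by positivity, fun f B hB hf => ?_⟩
  have h1 := h f B hB fun l hl x hx => hf l (hl.trans (le_max_left _ _)) x (Or.inl hx)
  have h2 := h' f B hB fun l hl x hx => hf l (hl.trans (le_max_right _ _)) x (Or.inr hx)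
  rw [LinearMap.sub_apply, add_mul]
  exact (norm_sub_le _ _).trans (add_le_add h1 h2)

/-- The convolution of two complex valued functions. -/
def smear (k f : ℝ^d → ℂ) : ℝ^d → ℂ := convolution k f (ContinuousLinearMap.mul ℝ ℂ) volume

theorem smear_apply (k f : ℝ^d → ℂ) (x : ℝ^d) : smear k f x = ∫ t, k t * f (x - t) := rfl

theorem contDiff_smear (hk : ContDiff ℝ ∞ k) (hkc : HasCompactSupport k) (hf : Continuous f) :
    ContDiff ℝ ∞ (smear k f) :=
  hkc.contDiff_convolution_left _ hk hf.locallyIntegrable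

theorem pderiv_smear_right (hk : Continuous k) (hf : ContDiff ℝ ∞ f) (hfc : HasCompactSupport f)
    (j : Fin d) : pderiv j (smear k f) = smear k (pderiv j f) := by
  funext x
  have h1 := hfc.hasFDerivAt_convolution_right (ContinuousLinearMap.mul ℝ ℂ)
    (hk.locallyIntegrable (μ := volume)) (hf.of_le (by simp)) x
  have h2 : pderiv j (smear k f) x = _ := h1.differentiableAt.lineDeriv_eq_fderiv
  rw [h2, h1.fderiv, convolution_precompR_apply _ hk.locallyIntegrable (hfc.fderiv ℝ)
    (hf.continuous_fderiv (by simp)), pderiv_eq_fderiv hf]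
  rfl

theorem pderiv_smear_left (hk : ContDiff ℝ ∞ k) (hkc : HasCompactSupport k) (hf : Continuous f)
    (j : Fin d) : pderiv j (smear k f) = smear (pderiv j k) f := by
  funext x
  have h1 := hkc.hasFDerivAt_convolution_right (ContinuousLinearMap.mul ℝ ℂ).flip
    (hf.locallyIntegrable (μ := volume)) (hk.of_le (by simp)) x
  have h2 : pderiv j (convolution f k (ContinuousLinearMap.mul ℝ ℂ).flip volume) x = _ :=
    h1.differentiableAt.lineDeriv_eq_fderiv
  rw [h1.fderiv, convolution_precompR_apply _ hf.locallyIntegrable (hkc.fderiv ℝ)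
    (hk.continuous_fderiv (by simp))] at h2
  rw [convolution_flip] at h2
  rw [smear, h2, pderiv_eq_fderiv hk, ← convolution_flip]
  rfl

theorem wderiv_smear_right (hk : Continuous k) (hf : ContDiff ℝ ∞ f) (hfc : HasCompactSupport f)
    (l : List (Fin d)) : wderiv l (smear k f) = smear k (wderiv l f) := by
  induction l with
  | nil => rfl
  | cons j l ih =>
    change pderiv j (wderiv l (smear k f)) = _
    rw [ih, pderiv_smear_right hk (contDiff_wderiv hf l) (hasCompactSupport_wderiv hf hfc l)]
    rfl

theorem wderiv_smear_left (hk : ContDiff ℝ ∞ k) (hkc : HasCompactSupport k) (hf : Continuous f)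
    (l : List (Fin d)) : wderiv l (smear k f) = smear (wderiv l k) f := by
  induction l with
  | nil => rfl
  | cons j l ih =>
    change pderiv j (wderiv l (smear k f)) = _
    rw [ih, pderiv_smear_left (contDiff_wderiv hk l) (hasCompactSupport_wderiv hk hkc l) hf]
    rfl

theorem norm_smear_le (hk : Continuous k) (hkc : HasCompactSupport k)
    (h : ∀ t ∈ tsupport k, ‖f (x - t)‖ ≤ ε) : ‖smear k f x‖ ≤ (∫ t, ‖k t‖) * ε := by
  rw [smear_apply, ← integral_mul_const]
  refine norm_integral_le_of_norm_le ((hk.integrable_of_hasCompactSupport hkc).norm.mul_const ε)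
    (ae_of_all _ fun t => ?_)
  rw [norm_mul]
  by_cases ht : t ∈ tsupport k
  · exact mul_le_mul_of_nonneg_left (h t ht) (norm_nonneg _)
  · rw [image_eq_zero_of_notMem_tsupport ht, norm_zero, zero_mul, zero_mul]

theorem smear_expo (k : ℝ^d → ℂ) (ξ : ℝ^d) : smear k (fun x => expo x ξ) =
      (∫ t, k t * expo (-t) ξ) • fun x => expo x ξ := by
  funext x
  rw [smear_apply, Pi.smul_apply, smul_eq_mul, ← integral_mul_const]
  congr 1
  funext t
  rw [sub_eq_add_neg, expo_add_left]
  ring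

theorem smear_sub (hk : Continuous k) (hkc : HasCompactSupport k) (hf : Continuous f)
    (hg : Continuous g) : smear k (f - g) = smear k f - smear k g := by
  have h : ∀ (h : ℝ^d → ℂ), Continuous h → ∀ x, Integrable fun t => k t * h (x - t) :=
    fun h hh x => (hk.mul
      (hh.comp (continuous_const.sub continuous_id))).integrable_of_hasCompactSupport
      hkc.mul_right
  funext x
  rw [Pi.sub_apply, smear_apply, smear_apply, smear_apply, ← integral_sub (h f hf x) (h g hg x)]
  simp only [Pi.sub_apply, mul_sub]

theorem exists_expo_approx {K : Set ℝ^d} (hK : IsCompact K) (hf : Continuous f) (hε : 0 < ε) :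
    ∃ p ∈ span ℂ (Set.range fun ξ : ℝ^d => fun x : ℝ^d => expo x ξ), ∀ x ∈ K, ‖f x - p x‖ ≤ ε := by
  have : CompactSpace K := isCompact_iff_compactSpace.1 hK
  have hec : ∀ ξ : ℝ^d, Continuous fun x : ℝ^d => expo x ξ := continuous_expo
  let e : ℝ^d → C(K, ℂ) := fun ξ => ⟨fun x => expo (x : ℝ^d) ξ, (hec ξ).comp continuous_subtype_val⟩
  let A : StarSubalgebra ℂ C(K, ℂ) :=
    { toSubalgebra := Algebra.adjoin ℂ (Set.range e)
      star_mem' := by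
        change Algebra.adjoin ℂ (Set.range e) ≤ star (Algebra.adjoin ℂ (Set.range e))
        refine Algebra.adjoin_le ?_
        rintro _ ⟨ξ, rfl⟩
        refine Algebra.subset_adjoin ⟨-ξ, ?_⟩
        ext x
        change expo x (-ξ) = starRingEnd ℂ (expo x ξ)
        rw [expo, expo, ← Complex.exp_conj]
        congr 1
        simp }
  have hA : A.toSubalgebra.toSubmodule = span ℂ (Set.range e) := by
    apply Algebra.adjoin_eq_span_of_subset
    refine .trans (fun x => Submonoid.closure_induction (fun _ => id) ⟨0, ?_⟩ ?_) subset_span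
    · ext x
      exact expo_zero_right _
    · rintro _ _ _ _ ⟨ξ, rfl⟩ ⟨η, rfl⟩
      refine ⟨ξ + η, ?_⟩
      ext x
      exact expo_add_right _ _ _
  have hsep : A.SeparatesPoints := fun x y hxy => by
    have : ∃ i, x.1 i ≠ y.1 i := by
      by_contra hcon
      push Not at hcon
      exact hxy (Subtype.ext (funext hcon))
    obtain ⟨i, hi⟩ := this
    set ξ : ℝ^d := Pi.single i (π / (x.1 i - y.1 i)) with hξ
    refine ⟨_, ⟨e ξ, Algebra.subset_adjoin ⟨ξ, rfl⟩, rfl⟩, ?_⟩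
    change expo x.1 ξ ≠ expo y.1 ξ
    have h1 : x.1 = (x.1 - y.1) + y.1 := by abel
    rw [h1, expo_add_left]
    have h2 : expo (x.1 - y.1) ξ = -1 := by
      rw [expo]
      have h3 : ∑ j, (x.1 - y.1) j * ξ j = π := by
        rw [sum_eq_single i (fun j _ hj => by simp [hξ, hj]) (by simp)]
        rw [hξ, Pi.single_eq_same, Pi.sub_apply, mul_div_cancel₀ _ (sub_ne_zero.2 hi)]
      rw [h3, show -I * (π : ℂ) = -(π * I) by ring, Complex.exp_neg,
        Complex.exp_pi_mul_I]
      norm_num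
    rw [h2]
    intro h
    have h3 : expo y.1 ξ = 0 := by linear_combination -(1 / 2 : ℂ) * h
    exact Complex.exp_ne_zero _ h3
  have hdense := ContinuousMap.starSubalgebra_topologicalClosure_eq_top_of_separatesPoints A hsep
  let F : C(K, ℂ) := ⟨fun x => f x, hf.comp continuous_subtype_val⟩
  have hF : F ∈ closure (A : Set C(K, ℂ)) := by
    have : F ∈ A.topologicalClosure := by rw [hdense]; trivial
    exact this
  obtain ⟨G, hG, hGF⟩ := Metric.mem_closure_iff.1 hF ε hε
  have hG' : G ∈ span ℂ (Set.range e) := by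
    rw [← hA]
    exact hG
  let res : (ℝ^d → ℂ) →ₗ[ℂ] (K → ℂ) :=
    { toFun := fun p x => p x
      map_add' := fun _ _ => rfl
      map_smul' := fun _ _ => rfl }
  have key : ∃ p ∈ span ℂ (Set.range fun ξ : ℝ^d => fun x : ℝ^d => expo x ξ),
      res p = G := by
    clear hGF hG
    induction hG' using span_induction with
    | mem v hv =>
      obtain ⟨ξ, rfl⟩ := hv
      exact ⟨_, subset_span ⟨ξ, rfl⟩, rfl⟩
    | zero => exact ⟨0, Submodule.zero_mem _, rfl⟩
    | add v w _ _ hv hw =>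
      obtain ⟨p, hp, hpv⟩ := hv
      obtain ⟨q, hq, hqw⟩ := hw
      exact ⟨p + q, Submodule.add_mem _ hp hq, by rw [map_add, hpv, hqw]; rfl⟩
    | smul c v _ hv =>
      obtain ⟨p, hp, hpv⟩ := hv
      exact ⟨c • p, Submodule.smul_mem _ c hp, by rw [map_smul, hpv]; rfl⟩
  obtain ⟨p, hp, hpG⟩ := key
  refine ⟨p, hp, fun x hx => ?_⟩
  have h1 := (ContinuousMap.dist_lt_iff hε).1 hGF ⟨x, hx⟩
  have h2 : G ⟨x, hx⟩ = p x := (congrFun hpG ⟨x, hx⟩).symm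
  rw [h2, dist_eq_norm] at h1
  exact h1.le

theorem WordBounded.smear_eq_zero (hF : WordBounded F) (h : ∀ ξ, F (expoSmooth ξ) = 0)
    (hk : ContDiff ℝ ∞ k) (hkc : HasCompactSupport k) (hf : Continuous f) :
    F ⟨smear k f, contDiff_smear hk hkc hf⟩ = 0 := by
  obtain ⟨C, N, K, hK, hC, hF⟩ := hF
  let W : Finset (List (Fin d)) := (List.finite_length_le (Fin d) N).toFinset
  set D : ℝ := ∑ l ∈ W, ∫ t, ‖wderiv l k t‖ with hD
  have hD0 : 0 ≤ D := sum_nonneg fun l _ => integral_nonneg fun t => norm_nonneg _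
  have hexp : ∀ p ∈ span ℂ (Set.range fun ξ : ℝ^d => fun x : ℝ^d => expo x ξ),
      ∃ hp : Continuous p, F ⟨smear k p, contDiff_smear hk hkc hp⟩ = 0 := fun p hp => by
    have hint : ∀ (h : ℝ^d → ℂ), Continuous h → ∀ x, Integrable fun t => k t * h (x - t) :=
      fun h hh x => (hk.continuous.mul (hh.comp
        (continuous_const.sub continuous_id))).integrable_of_hasCompactSupport hkc.mul_right
    induction hp using span_induction with
    | mem v hv =>
      obtain ⟨ξ, rfl⟩ := hv
      refine ⟨continuous_expo ξ, ?_⟩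
      have : (⟨smear k fun x => expo x ξ, contDiff_smear hk hkc (continuous_expo ξ)⟩ :
          smoothSpace d) = (∫ t, k t * expo (-t) ξ) • expoSmooth ξ :=
        Subtype.ext (smear_expo k ξ)
      rw [this, map_smul, h, smul_zero]
    | zero =>
      refine ⟨continuous_const, ?_⟩
      rw [← map_zero F]
      congr 1
      refine Subtype.ext (funext fun x => ?_)
      change smear k 0 x = 0
      rw [smear_apply]
      simp
    | add v w _ _ hv hw =>
      obtain ⟨hvc, hv⟩ := hv
      obtain ⟨hwc, hw⟩ := hw
      refine ⟨hvc.add hwc, ?_⟩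
      rw [← add_zero (0 : ℂ)]
      nth_rewrite 1 [← hv]
      rw [← hw, ← map_add]
      congr 1
      refine Subtype.ext (funext fun x => ?_)
      change smear k (v + w) x = smear k v x + smear k w x
      rw [smear_apply, smear_apply, smear_apply, ← integral_add (hint v hvc x) (hint w hwc x)]
      simp only [Pi.add_apply, mul_add]
    | smul c v _ hv =>
      obtain ⟨hvc, hv⟩ := hv
      refine ⟨hvc.const_smul c, ?_⟩
      rw [← smul_zero c, ← hv, ← map_smul]
      congr 1
      refine Subtype.ext (funext fun x => ?_)
      change smear k (c • v) x = c * smear k v x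
      rw [smear_apply, smear_apply, ← integral_const_mul]
      congr 1
      funext t
      simp only [Pi.smul_apply, smul_eq_mul]
      ring
  have hle : ∀ ε > 0, ‖F ⟨smear k f, contDiff_smear hk hkc hf⟩‖ ≤ C * (D * ε) := fun ε hε => by
    obtain ⟨p, hp, hpf⟩ := exists_expo_approx
      ((hK.prod (show IsCompact (tsupport k) from hkc)).image continuous_sub) hf hε
    obtain ⟨hpc, hp0⟩ := hexp p hp
    have h1 : F ⟨smear k f, contDiff_smear hk hkc hf⟩ =
        F ⟨smear k (f - p), contDiff_smear hk hkc (hf.sub hpc)⟩ := by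
      rw [← sub_zero (F ⟨smear k f, contDiff_smear hk hkc hf⟩), ← hp0, ← map_sub]
      congr 1
      exact Subtype.ext (smear_sub hk.continuous hkc hf hpc).symm
    rw [h1]
    refine hF _ _ (by positivity) fun l hl x hx => ?_
    change ‖wderiv l (smear k (f - p)) x‖ ≤ _
    rw [wderiv_smear_left hk hkc (hf.sub hpc)]
    refine (norm_smear_le (contDiff_wderiv hk l).continuous (hasCompactSupport_wderiv hk hkc l)
      (ε := ε) fun t ht => hpf _ ?_).trans ?_
    · refine ⟨(x, t), ⟨hx, ?_⟩, rfl⟩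
      refine closure_minimal (fun y hy => ?_) (isClosed_tsupport k) ht
      by_contra hcon
      exact hy (wderiv_eq_zero hk l (notMem_tsupport_iff_eventuallyEq.1 hcon))
    · refine mul_le_mul_of_nonneg_right ?_ hε.le
      exact single_le_sum (f := fun l => ∫ t, ‖wderiv l k t‖)
        (fun l _ => integral_nonneg fun t => norm_nonneg _) ((Set.Finite.mem_toFinset _).2 hl)
  by_contra hne
  have hpos : 0 < ‖F ⟨smear k f, contDiff_smear hk hkc hf⟩‖ := norm_pos_iff.2 hne
  set M := ‖F ⟨smear k f, contDiff_smear hk hkc hf⟩‖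
  have h2 := hle (M / (2 * (C * D + 1))) (by positivity)
  have h3 : C * (D * (M / (2 * (C * D + 1)))) = M * (C * D / (2 * (C * D + 1))) := by ring
  have h4 : C * D / (2 * (C * D + 1)) < 1 := by
    rw [div_lt_one (by positivity)]
    nlinarith [mul_nonneg hC hD0]
  rw [h3] at h2
  nlinarith

theorem WordBounded.eq_zero (hF : WordBounded F) (h : ∀ ξ, F (expoSmooth ξ) = 0) : F = 0 := by
  have hF' := hF
  obtain ⟨C, N, K, hK, hC, hF⟩ := hF
  ext f
  obtain ⟨S, hS⟩ := hK.isBounded.subset_closedBall (0 : ℝ^d)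
  have hSpos : 0 < |S| + 1 := by positivity
  let χ : ContDiffBump (0 : ℝ^d) := ⟨|S| + 1, |S| + 2, hSpos, by linarith⟩
  have hχs : ContDiff ℝ ∞ fun x => ((χ x : ℝ) : ℂ) := Complex.ofRealCLM.contDiff.comp χ.contDiff
  set g : ℝ^d → ℂ := fun x => ((χ x : ℝ) : ℂ) * (f : ℝ^d → ℂ) x with hg
  have hgs : ContDiff ℝ ∞ g := hχs.mul f.2
  have hgc : HasCompactSupport g :=
    HasCompactSupport.mul_right
      (χ.hasCompactSupport.comp_left (g := fun t : ℝ => (t : ℂ)) (by simp))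
  have hfg : F f = F ⟨g, hgs⟩ := by
    have h1 := hF (f - ⟨g, hgs⟩) 0 le_rfl fun l hl x hx => by
      have : (fun x => (f : ℝ^d → ℂ) x - g x) =ᶠ[𝓝 x] fun _ => 0 := by
        have hb : ball (0 : ℝ^d) (|S| + 1) ∈ 𝓝 x := by
          refine Metric.isOpen_ball.mem_nhds ?_
          have := hS hx
          rw [Metric.mem_closedBall] at this
          exact Metric.mem_ball.2 (by linarith [le_abs_self S])
        filter_upwards [hb] with y hy
        rw [hg]
        beta_reduce
        rw [χ.one_of_mem_closedBall (Metric.ball_subset_closedBall hy), Complex.ofReal_one, one_mul,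
          sub_self]
      exact (norm_eq_zero.2 (wderiv_eq_zero ((contDiff_coe f).sub hgs) l this)).le
    rw [mul_zero, map_sub, norm_le_zero_iff, sub_eq_zero] at h1
    exact h1
  have hle : ∀ ε > 0, ‖F ⟨g, hgs⟩‖ ≤ C * ε := fun ε hε => by
    have h1 : ∀ᶠ δ in 𝓝[>] (0 : ℝ), ∀ l ∈ {l : List (Fin d) | l.length ≤ N}, ∀ x y,
        dist y x < δ → dist (wderiv l g y) (wderiv l g x) ≤ ε := by
      rw [Filter.eventually_all_finite (List.finite_length_le (Fin d) N)]
      intro l _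
      have huc : UniformContinuous (wderiv l g) :=
        (contDiff_wderiv hgs l).continuous.uniformContinuous_of_tendsto_cocompact
          (hasCompactSupport_wderiv hgs hgc l).is_zero_at_infty
      obtain ⟨δ, hδ, H⟩ := Metric.uniformContinuous_iff.1 huc ε hε
      filter_upwards [Ioo_mem_nhdsGT hδ] with δ' hδ' x y hxy
      exact (H (hxy.trans hδ'.2)).le
    obtain ⟨δ, h1, hδ⟩ := (h1.and self_mem_nhdsWithin).exists
    have hδ' : 0 < δ := hδ
    let φ : ContDiffBump (0 : ℝ^d) := ⟨δ / 2, δ, by positivity, by linarith⟩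
    let k : ℝ^d → ℂ := fun x => ((φ.normed volume x : ℝ) : ℂ)
    have hk : ContDiff ℝ ∞ k := Complex.ofRealCLM.contDiff.comp φ.contDiff_normed
    have hkc : HasCompactSupport k :=
      φ.hasCompactSupport_normed.comp_left (g := fun t : ℝ => (t : ℂ)) (by simp)
    have h2 := hF'.smear_eq_zero h hk hkc hgs.continuous
    rw [← sub_zero (F ⟨g, hgs⟩), ← h2, ← map_sub]
    refine hF _ ε hε.le fun l hl x _ => ?_
    change ‖wderiv l (g - smear k g) x‖ ≤ ε
    rw [wderiv_sub hgs (contDiff_smear hk hkc hgs.continuous),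
      wderiv_smear_right hk.continuous hgs hgc]
    have h3 := φ.dist_normed_convolution_le (μ := volume) (g := wderiv l g) (x₀ := x) (ε := ε)
      (contDiff_wderiv hgs l).continuous.aestronglyMeasurable
      (fun y hy => h1 l hl x y (Metric.mem_ball.1 hy))
    rw [← dist_eq_norm, dist_comm]
    convert h3 using 2
    rw [smear_apply, convolution_def]
    exact integral_congr_ae (ae_of_all _ fun t => by simp [k])
  rw [hfg, LinearMap.zero_apply]
  by_contra hne
  have hpos : 0 < ‖F ⟨g, hgs⟩‖ := norm_pos_iff.2 hne
  have h2 := hle (‖F ⟨g, hgs⟩‖ / (2 * (C + 1))) (by positivity)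
  have h3 : C * (‖F ⟨g, hgs⟩‖ / (2 * (C + 1))) = ‖F ⟨g, hgs⟩‖ * (C / (2 * (C + 1))) := by ring
  have h4 : C / (2 * (C + 1)) < 1 := by
    rw [div_lt_one (by positivity)]
    linarith
  rw [h3] at h2
  nlinarith

theorem CompactDistribution.eq_of_expo {T T' : CompactDistribution d}
    (h : ∀ ξ, T.toLin (expoSmooth ξ) = T'.toLin (expoSmooth ξ)) : T = T' := by
  have h1 := (T.wordBounded.sub T'.wordBounded).eq_zero fun ξ => by
    rw [LinearMap.sub_apply, h ξ, sub_self]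
  exact CompactDistribution.ext (sub_eq_zero.1 h1)

end

section

/-! ### Refinement sums of smooth functions -/

variable {d r lam A N m : ℕ} {a : Filt d r r} {x : ℝ^d} {τ : ℝ}

attribute [local instance] Matrix.linftyOpNormedRing Matrix.linftyOpNormedAlgebra

/-- The sums `λ^{-dn} ∑_k A_n(k) θ(λ^{-n}(x + k))`, where `A_n = S_a^n (δ I_r)`. -/
def refSum (lam : ℕ) (a : Filt d r r) (n : ℕ) (θ : ℝ^d → ℂ) (x : ℝ^d) : Mat r r :=
  (((lam : ℂ) ^ d)⁻¹) ^ n • pairing (mask lam a n) fun k =>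
    θ (((lam : ℝ) ^ n)⁻¹ • (x + toR k)) • (1 : Mat r r)

theorem refSum_zero (lam : ℕ) (a : Filt d r r) (θ : ℝ^d → ℂ) (x : ℝ^d) : refSum lam a 0 θ x =
      θ x • 1 := by
  simp [refSum, pairing_mask_zero, toR_zero]

theorem refSum_succ [NeZero lam] (a : Filt d r r) (n : ℕ) (θ : ℝ^d → ℂ) (x : ℝ^d) :
    refSum lam a (n + 1) θ x = ∑ j ∈ a.support, refSum lam a n θ ((lam : ℝ)⁻¹ • (x + toR j)) *
      a j := by
  have h0 : (lam : ℝ) ≠ 0 := by exact_mod_cast NeZero.ne lam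
  have h0' : (lam : ℂ) ^ d ≠ 0 := pow_ne_zero _ (by exact_mod_cast NeZero.ne lam)
  rw [refSum, pairing_mask_succ]
  have h1 : ∀ z k : ℤ^d, ((lam : ℝ) ^ (n + 1))⁻¹ • (x + toR (lam • z + k)) =
      ((lam : ℝ) ^ n)⁻¹ • ((lam : ℝ)⁻¹ • (x + toR k) + toR z) := fun z k => by
    rw [toR_add, toR_nsmul]
    ext i
    simp only [Pi.smul_apply, Pi.add_apply, smul_eq_mul]
    field_simp
    ring
  simp only [h1]
  rw [pairing_swap, smul_smul, pow_succ, mul_assoc, inv_mul_cancel₀ h0', mul_one, smul_sum]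
  refine sum_congr rfl fun j _ => ?_
  rw [refSum, Matrix.smul_mul]

theorem refSum_expo [NeZero lam] (a : Filt d r r) (n : ℕ) (ξ : ℝ^d) :
    refSum lam a (n + 1) (fun x => expo x ((lam : ℝ) • ξ)) 0 = fourierSeries a ξ *
      refSum lam a n (fun x => expo x ξ) 0 := by
  have h0 : (lam : ℝ) ≠ 0 := by exact_mod_cast NeZero.ne lam
  have h0' : (lam : ℂ) ^ d ≠ 0 := pow_ne_zero _ (by exact_mod_cast NeZero.ne lam)
  rw [refSum, add_comm n 1, pairing_mask_add, mask_one, pairing_smul_left, fourierSeries_eq_pairing]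
  have h1 : ∀ z k : ℤ^d, expo (((lam : ℝ) ^ (1 + n))⁻¹ • (0 + toR (lam ^ n • z + k)))
      ((lam : ℝ) • ξ) = expo (toR z) ξ * expo (((lam : ℝ) ^ n)⁻¹ • (0 + toR k)) ξ := fun z k => by
    rw [← expo_smul, smul_smul, ← expo_add_left, zero_add, zero_add, toR_add, toR_nsmul, smul_add,
      smul_smul]
    congr 2
    · rw [pow_add, pow_one, mul_inv]
      push_cast
      rw [show (lam : ℝ) * ((lam : ℝ)⁻¹ * ((lam : ℝ) ^ n)⁻¹) * (lam : ℝ) ^ n =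
        (lam * (lam : ℝ)⁻¹) * (((lam : ℝ) ^ n)⁻¹ * (lam : ℝ) ^ n) by ring, mul_inv_cancel₀ h0,
        inv_mul_cancel₀ (pow_ne_zero _ h0), one_mul, one_smul]
    · rw [pow_add, pow_one, mul_inv, ← mul_assoc, mul_inv_cancel₀ h0, one_mul]
  have h2 : ∀ z, pairing (mask lam a n) (fun k => (expo (toR z) ξ *
      expo (((lam : ℝ) ^ n)⁻¹ • (0 + toR k)) ξ) • (1 : Mat r r)) =
      expo (toR z) ξ • pairing (mask lam a n) fun k =>
        expo (((lam : ℝ) ^ n)⁻¹ • (0 + toR k)) ξ • 1 := fun z => by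
    simp only [mul_smul]
    exact pairing_smul _ _ _
  simp only [h1, h2, smul_smul]
  rw [pow_add, pow_one, mul_assoc, mul_comm, mul_assoc, mul_inv_cancel₀ h0', mul_one, refSum,
    Matrix.mul_smul]
  congr 1
  rw [← pairing_mul]
  simp only [Matrix.smul_mul, Matrix.one_mul]

theorem refSum_add (lam : ℕ) (a : Filt d r r) (n : ℕ) (θ η : ℝ^d → ℂ) (x : ℝ^d) :
    refSum lam a n (θ + η) x = refSum lam a n θ x + refSum lam a n η x := by
  simp only [refSum, Pi.add_apply, add_smul, pairing_add, smul_add]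

theorem refSum_smul (lam : ℕ) (a : Filt d r r) (n : ℕ) (c : ℂ) (θ : ℝ^d → ℂ) (x : ℝ^d) :
    refSum lam a n (c • θ) x = c • refSum lam a n θ x := by
  simp only [refSum, Pi.smul_apply, smul_assoc, pairing_smul]
  rw [smul_comm]

theorem refSum_eq_sum (lam : ℕ) (a : Filt d r r) (n : ℕ) (θ : ℝ^d → ℂ) (x : ℝ^d) :
    refSum lam a n θ x = ∑ k ∈ (mask lam a n).support, θ (((lam : ℝ) ^ n)⁻¹ • (x + toR k)) •
      ((((lam : ℂ) ^ d)⁻¹) ^ n • mask lam a n k) := by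
  rw [refSum, pairing_def, smul_sum]
  refine sum_congr rfl fun k _ => ?_
  rw [Matrix.mul_smul, Matrix.mul_one, smul_comm]

theorem norm_refSum_sub_le {n : ℕ} {θ : ℝ^d → ℂ} (hθ : ContDiff ℝ ∞ θ) {R M : ℝ}
    (h : ∀ j, ∀ z ∈ closedBall (0 : ℝ^d) R, ‖refSum lam a n (pderiv j θ) z‖ ≤ M) {y : ℝ^d}
    (hx : x ∈ closedBall (0 : ℝ^d) R) (hy : y ∈ closedBall (0 : ℝ^d) R) :
    ‖refSum lam a n θ x - refSum lam a n θ y‖ ≤ ((lam : ℝ) ^ n)⁻¹ * (∑ j, |x j - y j|) * M := by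
  set c : ℝ := ((lam : ℝ) ^ n)⁻¹ with hc
  have hc0 : 0 ≤ c := by positivity
  let p : ℝ → ℝ^d := fun t => y + t • (x - y)
  have hderiv : ∀ t, HasDerivAt (fun t => refSum lam a n θ (p t))
      (∑ j, ((c * (x j - y j) : ℝ) : ℂ) • refSum lam a n (pderiv j θ) (p t)) t := fun t => by
    have h1 : ∀ k : ℤ^d, HasDerivAt (fun t => θ (c • (p t + toR k)))
        (∑ j, ((c * (x j - y j) : ℝ) : ℂ) * pderiv j θ (c • (p t + toR k))) t := fun k => by
      have h2 : HasDerivAt (fun t => c • (p t + toR k)) (c • (x - y)) t := by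
        have := ((((hasDerivAt_id t).smul_const (x - y)).const_add y).add_const (toR k)).const_smul
          c
        rw [one_smul] at this
        exact this
      have h3 := ((hθ.differentiable (by simp)) (c • (p t + toR k))).hasFDerivAt.comp_hasDerivAt
        t h2
      refine h3.congr_deriv ?_
      have h4 : c • (x - y) = ∑ j, (c * (x j - y j)) • (Pi.single j 1 : ℝ^d) := by
        ext i
        simp [Finset.sum_apply, Pi.single_apply]
      rw [h4, map_sum]
      refine sum_congr rfl fun j _ => ?_
      rw [map_smul, pderiv_eq_fderiv hθ, Complex.real_smul]
    have h5 := HasDerivAt.fun_sum (u := (mask lam a n).support) fun k _ =>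
      (h1 k).smul_const ((((lam : ℂ) ^ d)⁻¹) ^ n • mask lam a n k)
    have h6 : (fun t => refSum lam a n θ (p t)) = fun t => ∑ k ∈ (mask lam a n).support,
        θ (c • (p t + toR k)) • ((((lam : ℂ) ^ d)⁻¹) ^ n • mask lam a n k) :=
      funext fun t => refSum_eq_sum lam a n θ (p t)
    rw [h6]
    refine h5.congr_deriv ?_
    simp only [refSum_eq_sum, Finset.sum_smul, smul_sum]
    rw [sum_comm]
    refine sum_congr rfl fun k _ => sum_congr rfl fun j _ => ?_
    rw [mul_smul]
  have hp : ∀ t ∈ Set.Icc (0 : ℝ) 1, p t ∈ closedBall (0 : ℝ^d) R := fun t ht =>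
    (convex_closedBall (0 : ℝ^d) R).add_smul_sub_mem hy hx ht
  have h6 := norm_image_sub_le_of_norm_deriv_le_segment_01'
    (fun t _ => (hderiv t).hasDerivWithinAt)
    (C := c * (∑ j, |x j - y j|) * M) fun t ht => by
      refine (norm_sum_le _ _).trans ?_
      rw [mul_sum, sum_mul]
      refine sum_le_sum fun j _ => ?_
      rw [norm_smul, Complex.norm_real, Real.norm_eq_abs, abs_mul, abs_of_nonneg hc0]
      exact mul_le_mul_of_nonneg_left (h j _ (hp t ⟨ht.1, ht.2.le⟩)) (by positivity)
  simpa [p] using h6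

/-- The refinement sums of `a` grow at most like `τ^n`, with constants that involve at most `N`
derivatives on the ball of radius `R`. -/
def GrowthRate (lam : ℕ) (a : Filt d r r) (R : ℝ) (N : ℕ) (τ : ℝ) : Prop :=
  ∃ C : ℝ, 0 ≤ C ∧ ∀ θ : ℝ^d → ℂ, ContDiff ℝ ∞ θ → ∀ B : ℝ, 0 ≤ B →
    (∀ l : List (Fin d), l.length ≤ N → ∀ x ∈ closedBall (0 : ℝ^d) R, ‖wderiv l θ x‖ ≤ B) →
    ∀ n, ∀ x ∈ closedBall (0 : ℝ^d) R, ‖refSum lam a n θ x‖ ≤ C * B * τ ^ n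

theorem refine_mem_closedBall (hlam : 2 ≤ lam) (hA : SuppIn A a) (hx : x ∈ closedBall (0 : ℝ^d) A)
    {j : ℤ^d} (hj : j ∈ a.support) : (lam : ℝ)⁻¹ • (x + toR j) ∈ closedBall (0 : ℝ^d) A := by
  rw [mem_closedBall_zero_iff] at hx ⊢
  have h1 : ‖toR j‖ ≤ A := by
    rw [pi_norm_le_iff_of_nonneg (Nat.cast_nonneg A)]
    intro i
    have := hA j (Finsupp.mem_support_iff.1 hj) i
    rw [Real.norm_eq_abs]
    change |((j i : ℤ) : ℝ)| ≤ A
    exact_mod_cast this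
  have h2 : (2 : ℝ) ≤ lam := by exact_mod_cast hlam
  rw [norm_smul, norm_inv, Real.norm_natCast, inv_mul_le_iff₀ (by linarith)]
  have h3 := norm_add_le x (toR j)
  have h4 : (0 : ℝ) ≤ A := Nat.cast_nonneg A
  nlinarith

theorem growthRate_zero [NeZero lam] (hlam : 2 ≤ lam) (hA : SuppIn A a) :
    GrowthRate lam a A 0 (∑ j ∈ a.support, ‖a j‖) := by
  refine ⟨‖(1 : Mat r r)‖, norm_nonneg _, fun θ hθ B hB h n => ?_⟩
  induction n with
  | zero =>
    intro x hx
    rw [refSum_zero, norm_smul, pow_zero, mul_one, mul_comm]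
    exact mul_le_mul_of_nonneg_left (h [] (Nat.zero_le _) x hx) (norm_nonneg _)
  | succ n ih =>
    intro x hx
    rw [refSum_succ, pow_succ, ← mul_assoc, mul_sum]
    refine (norm_sum_le _ _).trans (sum_le_sum fun j hj => ?_)
    exact (norm_mul_le _ _).trans (mul_le_mul_of_nonneg_right
      (ih _ (refine_mem_closedBall hlam hA hx hj)) (norm_nonneg _))

theorem norm_refSum_succ_sub_le [NeZero lam] (hlam : 2 ≤ lam) (hA : SuppIn A a)
    (hg : GrowthRate lam a A N τ) : ∃ C : ℝ, 0 ≤ C ∧ ∀ θ : ℝ^d → ℂ, ContDiff ℝ ∞ θ → ∀ B : ℝ, 0 ≤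
      B → (∀ l : List (Fin d), l.length ≤ N + 1 → ∀ x ∈ closedBall (0 : ℝ^d) A, ‖wderiv l θ x‖ ≤
      B) → ∀ n, ∀ x ∈ closedBall (0 : ℝ^d) A, ‖refSum lam a (n + 1) θ x - refSum lam a n θ 0 *
      fourierSeries a 0‖ ≤ C * B * (τ / lam) ^ n := by
  obtain ⟨C, hC, hg⟩ := hg
  refine ⟨(d * A) * C * ∑ j ∈ a.support, ‖a j‖, by positivity, fun θ hθ B hB h n x hx => ?_⟩
  have h0 : (0 : ℝ^d) ∈ closedBall (0 : ℝ^d) A := Metric.mem_closedBall_self (Nat.cast_nonneg A)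
  have h1 : fourierSeries a 0 = ∑ j ∈ a.support, a j := by
    rw [fourierSeries_zero_eq, pairing_def]
    simp
  rw [refSum_succ, h1, mul_sum, ← sum_sub_distrib]
  simp only [← sub_mul]
  have h2 : ∀ j, ∀ z ∈ closedBall (0 : ℝ^d) A,
      ‖refSum lam a n (pderiv j θ) z‖ ≤ C * B * τ ^ n := fun j z hz =>
    hg _ (contDiff_pderiv hθ j) B hB (fun l hl x hx => by
      rw [← wderiv_append_singleton]
      exact h _ (by simpa using hl) x hx) n z hz
  rw [mul_sum, sum_mul, sum_mul]
  refine (norm_sum_le _ _).trans (sum_le_sum fun j hj => ?_)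
  have hz := refine_mem_closedBall hlam hA hx hj
  have hM : 0 ≤ C * B * τ ^ n ∨ d = 0 := by
    rcases Nat.eq_zero_or_pos d with hd | hd
    · exact Or.inr hd
    · exact Or.inl ((norm_nonneg _).trans (h2 ⟨0, hd⟩ 0 h0))
  have h3 := norm_refSum_sub_le hθ h2 hz h0
  have h4 : ∑ i, |((lam : ℝ)⁻¹ • (x + toR j)) i - (0 : ℝ^d) i| ≤ d * A := by
    refine (Finset.sum_le_card_nsmul _ _ (A : ℝ) fun i _ => ?_).trans_eq (by simp)
    rw [Pi.zero_apply, sub_zero]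
    exact (norm_le_pi_norm _ i).trans (mem_closedBall_zero_iff.1 hz)
  have h5 : ((lam : ℝ) ^ n)⁻¹ * (∑ i, |((lam : ℝ)⁻¹ • (x + toR j)) i - (0 : ℝ^d) i|) *
      (C * B * τ ^ n) ≤ (d * A) * C * B * (τ / lam) ^ n := by
    rcases hM with hM | hM
    · rw [div_pow, show (d * A : ℝ) * C * B * (τ ^ n / (lam : ℝ) ^ n) =
        ((lam : ℝ) ^ n)⁻¹ * (d * A) * (C * B * τ ^ n) by rw [div_eq_mul_inv]; ring]
      gcongr
    · subst hM
      simp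
  calc ‖(refSum lam a n θ ((lam : ℝ)⁻¹ • (x + toR j)) - refSum lam a n θ 0) * a j‖
      ≤ ((d * A) * C * B * (τ / lam) ^ n) * ‖a j‖ :=
        (norm_mul_le _ _).trans (mul_le_mul_of_nonneg_right (h3.trans h5) (norm_nonneg _))
    _ = _ := by ring

theorem GrowthRate.improve [NeZero lam] (hlam : 2 ≤ lam) (hA : SuppIn A a) {C₁ : ℝ}
    (hC₁ : ∀ i, ‖fourierSeries a 0 ^ i‖ ≤ C₁ * (5 / 4) ^ i) (hτ : 0 ≤ τ)
    (hg : GrowthRate lam a A N τ) : GrowthRate lam a A (N + 1) (max (τ / lam) (3 / 2)) := by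
  obtain ⟨C, hC, hg⟩ := norm_refSum_succ_sub_le hlam hA hg
  have hC₁0 : 0 ≤ C₁ := by
    have := (norm_nonneg _).trans (hC₁ 0)
    simpa using this
  set σ := max (τ / lam) (3 / 2) with hσ
  have hσ1 : (3 / 2 : ℝ) ≤ σ := le_max_right _ _
  refine ⟨‖(1 : Mat r r)‖ + C₁ * (1 + 4 * C) + C, by positivity,
    fun θ hθ B hB h => ?_⟩
  have h0 : (0 : ℝ^d) ∈ closedBall (0 : ℝ^d) A := Metric.mem_closedBall_self (Nat.cast_nonneg A)
  have hF : ∀ n, ∀ x ∈ closedBall (0 : ℝ^d) A,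
      ‖refSum lam a (n + 1) θ x - refSum lam a n θ 0 * fourierSeries a 0‖ ≤ C * B * σ ^ n := by
    intro n x hx
    refine (hg θ hθ B hB h n x hx).trans ?_
    gcongr
    exact le_max_left _ _
  have key : ∀ n i, ‖refSum lam a n θ 0 * fourierSeries a 0 ^ i‖ ≤
      C₁ * (5 / 4) ^ i * (B * (1 + 4 * C) * σ ^ n) := fun n => by
    induction n with
    | zero =>
      intro i
      rw [refSum_zero, smul_one_mul, norm_smul, pow_zero, mul_one, mul_comm]
      refine mul_le_mul (hC₁ i) ?_ (norm_nonneg _) (by positivity)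
      refine (h [] (Nat.zero_le _) 0 h0).trans ?_
      nlinarith
    | succ n ih =>
      intro i
      have h1 : refSum lam a (n + 1) θ 0 * fourierSeries a 0 ^ i =
          refSum lam a n θ 0 * fourierSeries a 0 ^ (i + 1) +
            (refSum lam a (n + 1) θ 0 - refSum lam a n θ 0 * fourierSeries a 0) *
              fourierSeries a 0 ^ i := by
        rw [sub_mul, pow_succ', mul_assoc]
        abel
      rw [h1]
      refine (norm_add_le _ _).trans ?_
      have h2 := ih (i + 1)
      have h3 := (norm_mul_le _ _).trans (mul_le_mul (hF n 0 h0) (hC₁ i) (norm_nonneg _)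
        (by positivity))
      refine (add_le_add h2 h3).trans ?_
      have h4 : C₁ * (5 / 4) ^ (i + 1) * (B * (1 + 4 * C) * σ ^ n) +
          C * B * σ ^ n * (C₁ * (5 / 4) ^ i) =
          C₁ * (5 / 4) ^ i * (B * σ ^ n * ((5 / 4) * (1 + 4 * C) + C)) := by ring
      have h5 : C₁ * (5 / 4) ^ i * (B * (1 + 4 * C) * σ ^ (n + 1)) =
          C₁ * (5 / 4) ^ i * (B * σ ^ n * ((1 + 4 * C) * σ)) := by ring
      rw [h4, h5]
      gcongr
      nlinarith
  intro n x hx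
  cases n with
  | zero =>
    rw [refSum_zero, norm_smul, pow_zero, mul_one, mul_comm]
    refine mul_le_mul ?_ (h [] (Nat.zero_le _) x hx) (norm_nonneg _) (by positivity)
    have : 0 ≤ C₁ * (1 + 4 * C) + C := by positivity
    linarith
  | succ n =>
    have h1 := key n 1
    have h2 := hF n x hx
    rw [pow_one] at h1
    have h3 : ‖refSum lam a (n + 1) θ x‖ ≤ C * B * σ ^ n +
        C₁ * (5 / 4) ^ 1 * (B * (1 + 4 * C) * σ ^ n) := by
      have := norm_add_le (refSum lam a (n + 1) θ x - refSum lam a n θ 0 * fourierSeries a 0)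
        (refSum lam a n θ 0 * fourierSeries a 0)
      rw [sub_add_cancel] at this
      linarith
    refine h3.trans ?_
    have h4 : C * B * σ ^ n + C₁ * (5 / 4) ^ 1 * (B * (1 + 4 * C) * σ ^ n) =
        B * σ ^ n * (C + C₁ * (1 + 4 * C) * (5 / 4)) := by ring
    have h5 : (‖(1 : Mat r r)‖ + C₁ * (1 + 4 * C) + C) * B * σ ^ (n + 1) =
        B * σ ^ n * ((‖(1 : Mat r r)‖ + C₁ * (1 + 4 * C) + C) * σ) := by ring
    rw [h4, h5]
    gcongr
    have h6 : 0 ≤ C₁ * (1 + 4 * C) := by positivity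
    nlinarith [norm_nonneg (1 : Mat r r)]

theorem EigenCondition.exists_norm_pow_le (ha : EigenCondition lam m a) (hlam : 2 ≤ lam) : ∃ C : ℝ,
      ∀ i, ‖fourierSeries a 0 ^ i‖ ≤ C * (5 / 4) ^ i := by
  obtain ⟨C, hC, h⟩ := VectorSubdivision.exists_norm_pow_le (ha.norm_le_one hlam)
    (t := 5 / 4) (by norm_num)
  refine ⟨r * C, fun i => ?_⟩
  have h0 : ‖fourierSeries a 0 ^ i‖ ≤ (((r * C * (5 / 4) ^ i).toNNReal : NNReal) : ℝ) := by
    rw [Matrix.linfty_opNorm_def, NNReal.coe_le_coe]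
    refine Finset.sup_le fun k _ => ?_
    rw [← NNReal.coe_le_coe, Real.coe_toNNReal _ (by positivity), NNReal.coe_sum]
    refine (Finset.sum_le_card_nsmul _ _ (C * (5 / 4) ^ i) fun j _ => ?_).trans_eq ?_
    · exact h i k j
    · simp
      ring
  rwa [Real.coe_toNNReal _ (by positivity)] at h0

theorem EigenCondition.exists_growthRate [NeZero lam] (hlam : 2 ≤ lam) (ha : EigenCondition lam m a)
    (hA : SuppIn A a) : ∃ N, GrowthRate lam a A N (3 / 2) := by
  obtain ⟨C₁, hC₁⟩ := ha.exists_norm_pow_le hlam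
  have hlam2 : (2 : ℝ) ≤ lam := by exact_mod_cast hlam
  set τ₀ : ℝ := max (∑ j ∈ a.support, ‖a j‖) (3 / 2) with hτ₀
  have hτ₀0 : 0 ≤ τ₀ := le_trans (by norm_num) (le_max_right _ _)
  have h0 : GrowthRate lam a A 0 τ₀ := by
    obtain ⟨C, hC, h⟩ := growthRate_zero hlam hA
    refine ⟨C, hC, fun θ hθ B hB hl n x hx => (h θ hθ B hB hl n x hx).trans ?_⟩
    gcongr
    exact le_max_left _ _
  have h1 : ∀ k, GrowthRate lam a A k (max (τ₀ / (lam : ℝ) ^ k) (3 / 2)) := fun k => by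
    induction k with
    | zero =>
      rw [pow_zero, div_one, max_eq_left (le_max_right _ _)]
      exact h0
    | succ k ih =>
      have := ih.improve hlam hA hC₁ (le_trans (by norm_num) (le_max_right _ _))
      convert this using 1
      have h2 : max (τ₀ / (lam : ℝ) ^ k) (3 / 2) / lam =
          max (τ₀ / (lam : ℝ) ^ (k + 1)) ((3 / 2) / lam) := by
        rw [pow_succ, ← div_div, max_div_div_right (by positivity)]
      have h3 : (3 / 2 : ℝ) / lam ≤ 3 / 2 := div_le_self (by norm_num) (by linarith)
      rw [h2, max_assoc, max_eq_right h3]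
  obtain ⟨k, hk⟩ : ∃ k, τ₀ / (lam : ℝ) ^ k ≤ 3 / 2 := by
    obtain ⟨k, hk⟩ := pow_unbounded_of_one_lt τ₀ (by linarith : (1 : ℝ) < lam)
    refine ⟨k, ?_⟩
    rw [div_le_iff₀ (by positivity)]
    linarith
  exact ⟨k, by have := h1 k; rwa [max_eq_right hk] at this⟩

end

section

/-! ### The standard refinable vector of distributions -/

variable {d r lam m : ℕ} {a : Filt d r r} {υ : Filt d 1 r}

section Existence

attribute [local instance] Matrix.linftyOpNormedRing Matrix.linftyOpNormedAlgebra

theorem exists_wderiv_bound (θ : smoothSpace d) (N : ℕ) (R : ℝ) : ∃ B : ℝ, 0 ≤ B ∧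
      ∀ l : List (Fin d), l.length ≤ N → ∀ x ∈ closedBall (0 : ℝ^d) R, ‖wderiv l (θ : ℝ^d → ℂ) x‖ ≤
      B := by
  have h : ∀ n : ℕ, ∃ B : ℝ, 0 ≤ B ∧ ∀ x ∈ closedBall (0 : ℝ^d) R,
      ‖iteratedFDeriv ℝ n (θ : ℝ^d → ℂ) x‖ ≤ B := fun n => by
    obtain ⟨B, hB⟩ := (isCompact_closedBall (0 : ℝ^d) R).exists_bound_of_continuousOn
      ((contDiff_coe θ).continuous_iteratedFDeriv (m := n) (by exact_mod_cast le_top)).continuousOn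
    exact ⟨max B 0, le_max_right _ _, fun x hx => (hB x hx).trans (le_max_left _ _)⟩
  choose B hB0 hB using h
  refine ⟨∑ n ∈ Finset.range (N + 1), B n, sum_nonneg fun n _ => hB0 n, fun l hl x hx => ?_⟩
  refine ((norm_wderiv_le (contDiff_coe θ) l x).trans (hB _ x hx)).trans ?_
  exact single_le_sum (f := B) (fun n _ => hB0 n) (Finset.mem_range.2 (by omega))

theorem exists_refSum_limit [NeZero lam] (hlam : 2 ≤ lam) (ha : EigenCondition lam m a)
    {x₀ : Fin r → ℂ} (hx₀ : (fourierSeries a 0).mulVec x₀ = x₀) : ∃ φ : Fin r →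
      CompactDistribution d, ∀ θ : smoothSpace d,
      Tendsto (fun n => (refSum lam a n (θ : ℝ^d → ℂ) 0).mulVec x₀) atTop (𝓝 fun i =>
      (φ i).toLin θ) := by
  obtain ⟨A, hA⟩ := exists_suppIn a
  obtain ⟨N, hN⟩ := ha.exists_growthRate hlam hA
  obtain ⟨C, hC, hstep⟩ := norm_refSum_succ_sub_le hlam hA hN
  have h0 : (0 : ℝ^d) ∈ closedBall (0 : ℝ^d) A := Metric.mem_closedBall_self (Nat.cast_nonneg A)
  have hlam2 : (2 : ℝ) ≤ lam := by exact_mod_cast hlam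
  let u : smoothSpace d → ℕ → Fin r → ℂ := fun θ n => (refSum lam a n (θ : ℝ^d → ℂ) 0).mulVec x₀
  have hu : ∀ (θ : smoothSpace d) (B : ℝ), 0 ≤ B →
      (∀ l : List (Fin d), l.length ≤ N + 1 → ∀ x ∈ closedBall (0 : ℝ^d) A,
        ‖wderiv l (θ : ℝ^d → ℂ) x‖ ≤ B) →
      ∀ n, dist (u θ n) (u θ (n + 1)) ≤ (C * B * ‖x₀‖) * (3 / 4) ^ n := fun θ B hB h n => by
    have h1 := hstep _ (contDiff_coe θ) B hB h n 0 h0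
    have h2 : u θ (n + 1) - u θ n = (refSum lam a (n + 1) (θ : ℝ^d → ℂ) 0 -
        refSum lam a n (θ : ℝ^d → ℂ) 0 * fourierSeries a 0).mulVec x₀ := by
      rw [Matrix.sub_mulVec, ← Matrix.mulVec_mulVec, hx₀]
    rw [dist_comm, dist_eq_norm, h2]
    refine (Matrix.linfty_opNorm_mulVec _ _).trans ?_
    have h3 : ((3 / 2 : ℝ) / lam) ^ n ≤ (3 / 4) ^ n := by
      refine pow_le_pow_left₀ (by positivity) ?_ n
      rw [div_le_iff₀ (by linarith)]
      linarith
    calc _ ≤ (C * B * (3 / 2 / lam) ^ n) * ‖x₀‖ := mul_le_mul_of_nonneg_right h1 (norm_nonneg _)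
      _ ≤ (C * B * (3 / 4) ^ n) * ‖x₀‖ := by gcongr
      _ = _ := by ring
  have hlim : ∀ θ, ∃ L, Tendsto (u θ) atTop (𝓝 L) := fun θ => by
    obtain ⟨B, hB, h⟩ := exists_wderiv_bound θ (N + 1) A
    exact cauchySeq_tendsto_of_complete (cauchySeq_of_le_geometric _ _ (by norm_num) (hu θ B hB h))
  choose L hL using hlim
  have hadd : ∀ θ η, L (θ + η) = L θ + L η := fun θ η => by
    refine tendsto_nhds_unique (hL (θ + η)) (((hL θ).add (hL η)).congr fun n => ?_)
    simp only [u, Submodule.coe_add, refSum_add, Matrix.add_mulVec]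
  have hsmul : ∀ (c : ℂ) θ, L (c • θ) = c • L θ := fun c θ => by
    refine tendsto_nhds_unique (hL (c • θ)) (((hL θ).const_smul c).congr fun n => ?_)
    simp only [u, Submodule.coe_smul, refSum_smul, Matrix.smul_mulVec]
  let ℓ : Fin r → smoothSpace d →ₗ[ℂ] ℂ := fun i =>
    { toFun := fun θ => L θ i
      map_add' := fun θ η => congrFun (hadd θ η) i
      map_smul' := fun c θ => congrFun (hsmul c θ) i }
  refine ⟨fun i => ⟨ℓ i, ?_⟩, fun θ => hL θ⟩
  refine ⟨‖x₀‖ + C * ‖x₀‖ * 4, N + 1, closedBall 0 A, isCompact_closedBall _ _, fun θ B h => ?_⟩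
  have hB : 0 ≤ B := (norm_nonneg _).trans (h 0 (Nat.zero_le _) 0 h0)
  have hw : ∀ l : List (Fin d), l.length ≤ N + 1 → ∀ x ∈ closedBall (0 : ℝ^d) A,
      ‖wderiv l (θ : ℝ^d → ℂ) x‖ ≤ B := fun l hl x hx =>
    (norm_wderiv_le (contDiff_coe θ) l x).trans (h _ hl x hx)
  have h1 := dist_le_of_le_geometric_of_tendsto₀ _ _ (by norm_num) (hu θ B hB hw) (hL θ)
  have h2 : ‖u θ 0‖ ≤ B * ‖x₀‖ := by
    simp only [u, refSum_zero, Matrix.smul_mulVec, Matrix.one_mulVec, norm_smul]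
    exact mul_le_mul_of_nonneg_right (hw [] (Nat.zero_le _) 0 h0) (norm_nonneg _)
  have h3 : ‖L θ‖ ≤ ‖u θ 0‖ + dist (u θ 0) (L θ) := by
    rw [dist_comm, dist_eq_norm]
    exact norm_le_insert' _ _
  calc ‖L θ i‖ ≤ ‖L θ‖ := norm_le_pi_norm _ i
    _ ≤ B * ‖x₀‖ + C * B * ‖x₀‖ / (1 - 3 / 4) := h3.trans (add_le_add h2 h1)
    _ = _ := by ring

theorem exists_isStandardRefinable [NeZero lam] (hlam : 2 ≤ lam) (ha : EigenCondition lam m a)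
    (hυ : IsMatchingFilter lam (m + 1) a υ) : ∃ φ : Fin r → CompactDistribution d,
      IsStandardRefinable lam a υ φ := by
  obtain ⟨x₀, hx₀, hυx⟩ := exists_right_eigenvector ha.1 hυ.row_ne_zero
    (hυ.vecMul_eq (Nat.succ_pos m))
  obtain ⟨φ, hφ⟩ := exists_refSum_limit hlam ha hx₀
  refine ⟨φ, fun ξ => ?_, ?_⟩
  · ext i j
    have h1 := (tendsto_add_atTop_iff_nat 1).2 (hφ (expoSmooth ((lam : ℝ) • ξ)))
    have h2 : Tendsto (fun n => (fourierSeries a ξ).mulVec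
        ((refSum lam a n (expoSmooth ξ : ℝ^d → ℂ) 0).mulVec x₀)) atTop
        (𝓝 ((fourierSeries a ξ).mulVec fun i => (φ i).toLin (expoSmooth ξ))) :=
      ((Continuous.matrix_mulVec continuous_const continuous_id).tendsto _).comp (hφ _)
    have h3 := tendsto_nhds_unique h1 (h2.congr fun n => by
      rw [Matrix.mulVec_mulVec]
      exact congrArg (fun M => Matrix.mulVec M x₀) (refSum_expo a n ξ).symm)
    exact congrFun h3 i
  · have h1 : ∀ n, (refSum lam a n (expoSmooth (0 : ℝ^d) : ℝ^d → ℂ) 0).mulVec x₀ =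
        x₀ := fun n => by
      induction n with
      | zero =>
        rw [refSum_zero]
        simp [expoSmooth, expo_zero_right]
      | succ n ih =>
        have := refSum_expo (lam := lam) a n (0 : ℝ^d)
        rw [smul_zero] at this
        have h2 : refSum lam a (n + 1) (expoSmooth (0 : ℝ^d) : ℝ^d → ℂ) 0 =
          fourierSeries a 0 * refSum lam a n (expoSmooth (0 : ℝ^d) : ℝ^d → ℂ) 0 :=
          this
        rw [h2, ← Matrix.mulVec_mulVec, ih, hx₀]
    have h2 := tendsto_nhds_unique (hφ (expoSmooth 0)) (by simp only [h1]; exact tendsto_const_nhds)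
    ext i j
    rw [Subsingleton.elim i 0, Subsingleton.elim j 0, Matrix.one_apply_eq, ← hυx, Matrix.mul_apply]
    exact sum_congr rfl fun k _ => by rw [← congrFun h2 k]; rfl

end Existence

section Uniqueness

attribute [local instance] Matrix.linftyOpNormedRing Matrix.linftyOpNormedAlgebra

theorem expo_comm (x ξ : ℝ^d) : expo x ξ = expo ξ x := by simp only [expo, mul_comm]

theorem pderiv_smul_expo (c : ℂ) (ξ : ℝ^d) (j : Fin d) : pderiv j (fun x => c * expo x ξ) =
      fun x => (-I * ξ j * c) * expo x ξ := by
  funext x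
  have h1 := (hasLineDerivAt_expo ξ x j).const_mul c
  simp only [expo_comm _ ξ]
  refine HasLineDerivAt.lineDeriv (h1.congr_deriv ?_)
  ring

theorem wderiv_expo (ξ : ℝ^d) (l : List (Fin d)) : wderiv l (fun x => expo x ξ) =
      fun x => (l.map fun j => -I * (ξ j : ℂ)).prod * expo x ξ := by
  induction l with
  | nil => simp [wderiv]
  | cons j l ih =>
    change pderiv j (wderiv l _) = _
    rw [ih, pderiv_smul_expo]
    simp

theorem norm_expo (x ξ : ℝ^d) : ‖expo x ξ‖ = 1 := by
  rw [expo, neg_mul, ← mul_neg, mul_comm, ← Complex.ofReal_neg]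
  exact Complex.norm_exp_ofReal_mul_I _

theorem norm_expo_sub_one_le (x ξ : ℝ^d) : ‖expo x ξ - 1‖ ≤ d * ‖x‖ * ‖ξ‖ := by
  rw [expo, neg_mul, ← mul_neg, ← Complex.ofReal_neg]
  refine (Real.norm_exp_I_mul_ofReal_sub_one_le).trans ?_
  rw [norm_neg]
  refine (norm_sum_le _ _).trans ((Finset.sum_le_card_nsmul _ _ (‖x‖ * ‖ξ‖) fun i _ => ?_).trans_eq
    (by simp [mul_assoc]))
  rw [norm_mul]
  exact mul_le_mul (norm_le_pi_norm _ i) (norm_le_pi_norm _ i) (norm_nonneg _) (norm_nonneg _)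

theorem norm_wderiv_expo_sub_le {K : Set ℝ^d} {ρ : ℝ} (hK : ∀ x ∈ K, ‖x‖ ≤ ρ) {η : ℝ^d}
    (hη : ‖η‖ ≤ 1) (l : List (Fin d)) {x : ℝ^d} (hx : x ∈ K) :
    ‖wderiv l ((fun x => expo x η) - fun x => expo x 0) x‖ ≤ (d * ρ + 1) * ‖η‖ := by
  have hρ : 0 ≤ ρ := (norm_nonneg _).trans (hK x hx)
  rw [wderiv_sub (f := fun x => expo x η) (g := fun x => expo x 0) (contDiff_coe (expoSmooth η))
    (contDiff_coe (expoSmooth 0)), wderiv_expo, wderiv_expo]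
  cases l with
  | nil =>
    simp only [List.map_nil, List.prod_nil, one_mul, expo_zero_right]
    refine (norm_expo_sub_one_le x η).trans ?_
    have := hK x hx
    have h2 : (d : ℝ) * ‖x‖ ≤ d * ρ + 1 := by
      have := mul_le_mul_of_nonneg_left this (Nat.cast_nonneg (α := ℝ) d)
      linarith
    exact mul_le_mul_of_nonneg_right h2 (norm_nonneg _)
  | cons j l =>
    simp only [List.map_cons, List.prod_cons, Pi.zero_apply, Complex.ofReal_zero, mul_zero,
      zero_mul, sub_zero]
    rw [norm_mul, norm_mul, norm_expo, mul_one]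
    have h1 : ‖-I * (η j : ℂ)‖ ≤ ‖η‖ := by
      rw [norm_mul, norm_neg, Complex.norm_I, one_mul, Complex.norm_real]
      exact norm_le_pi_norm _ j
    have h2 : ‖(l.map fun j => -I * (η j : ℂ)).prod‖ ≤ 1 := by
      induction l with
      | nil => simp
      | cons i l ih =>
        rw [List.map_cons, List.prod_cons, norm_mul]
        refine mul_le_one₀ ?_ (norm_nonneg _) ih
        rw [norm_mul, norm_neg, Complex.norm_I, one_mul, Complex.norm_real]
        exact (norm_le_pi_norm _ i).trans hη
    have h3 : 0 ≤ d * ρ * ‖η‖ := by positivity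
    calc _ ≤ ‖η‖ * 1 := mul_le_mul h1 h2 (norm_nonneg _) (norm_nonneg _)
      _ ≤ _ := by linarith

theorem WordBounded.exists_expo_sub_le {F : smoothSpace d →ₗ[ℂ] ℂ} (hF : WordBounded F) : ∃ C : ℝ,
      0 ≤ C ∧ ∀ η : ℝ^d, ‖η‖ ≤ 1 → ‖F (expoSmooth η) - F (expoSmooth 0)‖ ≤ C * ‖η‖ := by
  obtain ⟨C, N, K, hK, hC, h⟩ := hF
  obtain ⟨ρ, hρ⟩ := hK.isBounded.exists_norm_le
  refine ⟨C * (d * |ρ| + 1), by positivity, fun η hη => ?_⟩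
  rw [← map_sub, mul_assoc]
  exact h _ _ (by positivity) fun l _ x hx =>
    norm_wderiv_expo_sub_le (fun x hx => (hρ x hx).trans (le_abs_self ρ)) hη l hx

theorem IsStandardRefinable.unique [NeZero lam] (hlam : 2 ≤ lam) (ha : EigenCondition lam m a)
    (hυ : IsMatchingFilter lam (m + 1) a υ) {φ φ' : Fin r → CompactDistribution d}
    (hφ : IsStandardRefinable lam a υ φ) (hφ' : IsStandardRefinable lam a υ φ') : φ = φ' := by
  let v : ℝ^d → Fin r → ℂ := fun ξ i => (φ i).toLin (expoSmooth ξ) - (φ' i).toLin (expoSmooth ξ)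
  have hlam2 : (2 : ℝ) ≤ lam := by exact_mod_cast hlam
  have hlam0 : (lam : ℝ) ≠ 0 := by linarith
  have hv : ∀ ξ, v ((lam : ℝ) • ξ) = (fourierSeries a ξ).mulVec (v ξ) := fun ξ => by
    ext i
    have h1 := congrFun (congrFun (hφ.1 ξ) i) 0
    have h2 := congrFun (congrFun (hφ'.1 ξ) i) 0
    rw [Matrix.mul_apply] at h1 h2
    simp only [distFourier, Matrix.of_apply] at h1 h2
    simp only [v, h1, h2, Matrix.mulVec, dotProduct, mul_sub, sum_sub_distrib]
  have hv0 : v 0 = 0 := by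
    refine eq_zero_of_fixed_of_dotProduct ha.1 hυ.row_ne_zero (hυ.vecMul_eq (Nat.succ_pos m))
      (by have := hv 0; rw [smul_zero] at this; exact this.symm) ?_
    have h1 := congrFun (congrFun hφ.2 0) 0
    have h2 := congrFun (congrFun hφ'.2 0) 0
    rw [Matrix.mul_apply] at h1 h2
    simp only [distFourier, Matrix.of_apply] at h1 h2
    simp only [v, dotProduct, mul_sub, sum_sub_distrib, h1, h2, sub_self]
  have hiter : ∀ n ξ, v (((lam : ℝ) ^ n) • ξ) =
      (refSum lam a n (fun x => expo x (((lam : ℝ) ^ n) • ξ)) 0).mulVec (v ξ) := fun n => by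
    induction n with
    | zero =>
      intro ξ
      rw [refSum_zero, expo, pow_zero, one_smul]
      simp
    | succ n ih =>
      intro ξ
      rw [pow_succ', mul_smul, hv, ih, refSum_expo, Matrix.mulVec_mulVec]
  obtain ⟨A, hA⟩ := exists_suppIn a
  obtain ⟨N, C, hC, hgr⟩ := ha.exists_growthRate hlam hA
  have h0 : (0 : ℝ^d) ∈ closedBall (0 : ℝ^d) A := Metric.mem_closedBall_self (Nat.cast_nonneg A)
  choose D hD0 hD using fun i => ((φ i).wordBounded.sub (φ' i).wordBounded).exists_expo_sub_le
  have hvle : ∀ η : ℝ^d, ‖η‖ ≤ 1 → ‖v η‖ ≤ (∑ i, D i) * ‖η‖ := fun η hη => by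
    rw [pi_norm_le_iff_of_nonneg (mul_nonneg (sum_nonneg fun i _ => hD0 i) (norm_nonneg _))]
    intro i
    have h1 := hD i η hη
    have h2 : v η i - v 0 i = v η i := by rw [hv0]; simp
    have h3 : ‖v η i‖ ≤ D i * ‖η‖ := by rw [← h2]; exact h1
    exact h3.trans (mul_le_mul_of_nonneg_right
      (single_le_sum (fun i _ => hD0 i) (mem_univ i)) (norm_nonneg _))
  have hzero : ∀ ξ, v ξ = 0 := fun ξ => by
    obtain ⟨B, hB, hBl⟩ := exists_wderiv_bound (expoSmooth ξ) N A
    have hS : 0 ≤ ∑ i, D i := sum_nonneg fun i _ => hD0 i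
    have hsmall : ∀ᶠ n : ℕ in atTop, ‖((lam : ℝ) ^ n)⁻¹ • ξ‖ ≤ 1 := by
      have h1 : Tendsto (fun n : ℕ => (((lam : ℝ)⁻¹) ^ n) * ‖ξ‖) atTop (𝓝 (0 * ‖ξ‖)) :=
        (tendsto_pow_atTop_nhds_zero_of_lt_one (by positivity)
          (inv_lt_one_of_one_lt₀ (by linarith))).mul_const _
      rw [zero_mul] at h1
      filter_upwards [h1.eventually (eventually_le_nhds zero_lt_one)] with n hn
      rwa [norm_smul, norm_inv, norm_pow, Real.norm_natCast, ← inv_pow]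
    have hle : ∀ᶠ n : ℕ in atTop, ‖v ξ‖ ≤ (C * B * ((∑ i, D i) * ‖ξ‖)) * (3 / 4) ^ n := by
      filter_upwards [hsmall] with n hn
      have h1 := hiter n (((lam : ℝ) ^ n)⁻¹ • ξ)
      rw [smul_inv_smul₀ (pow_ne_zero _ hlam0)] at h1
      rw [h1]
      refine (Matrix.linfty_opNorm_mulVec _ _).trans ?_
      have h2 := hgr _ (contDiff_coe (expoSmooth ξ)) B hB hBl n 0 h0
      have h3 := hvle _ hn
      rw [norm_smul, norm_inv, norm_pow, Real.norm_natCast] at h3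
      refine (mul_le_mul h2 h3 (norm_nonneg _) (by positivity)).trans ?_
      have h4 : (3 / 2 : ℝ) ^ n * ((lam : ℝ) ^ n)⁻¹ ≤ (3 / 4) ^ n := by
        rw [← div_eq_mul_inv, ← div_pow]
        refine pow_le_pow_left₀ (by positivity) ?_ n
        rw [div_le_iff₀ (by linarith)]
        linarith
      calc C * B * (3 / 2) ^ n * ((∑ i, D i) * (((lam : ℝ) ^ n)⁻¹ * ‖ξ‖))
          = (C * B * ((∑ i, D i) * ‖ξ‖)) * ((3 / 2) ^ n * ((lam : ℝ) ^ n)⁻¹) := by ring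
        _ ≤ _ := mul_le_mul_of_nonneg_left h4 (by positivity)
    have hlim : Tendsto (fun n : ℕ => (C * B * ((∑ i, D i) * ‖ξ‖)) * (3 / 4 : ℝ) ^ n) atTop
        (𝓝 ((C * B * ((∑ i, D i) * ‖ξ‖)) * 0)) :=
      (tendsto_pow_atTop_nhds_zero_of_lt_one (by norm_num) (by norm_num)).const_mul _
    rw [mul_zero] at hlim
    exact norm_le_zero_iff.1 (ge_of_tendsto hlim hle)
  funext i
  exact CompactDistribution.eq_of_expo fun ξ => sub_eq_zero.1 (congrFun (hzero ξ) i)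

end Uniqueness

end

section

/-! ### Integer translates of the unit cube -/

variable {d r R lam m : ℕ} {x : ℝ^d} {f : ℝ^d → ℂ} {g : Fin r → ℝ^d → ℂ} {υ : Filt d 1 r}
  {a : Filt d r r} {φ : Fin r → CompactDistribution d}

/-- The unit cube `[0,1)^d`. -/
def unitCube (d : ℕ) : Set ℝ^d := Set.univ.pi fun _ => Set.Ico 0 1

theorem mem_unitCube : x ∈ unitCube d ↔ ∀ i, 0 ≤ x i ∧ x i < 1 := by simp [unitCube, Set.mem_pi]

theorem measurableSet_unitCube : MeasurableSet (unitCube d) :=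
  MeasurableSet.univ_pi fun _ => measurableSet_Ico

theorem volume_unitCube : volume (unitCube d) = 1 := by
  rw [unitCube, volume_pi_pi]
  simp

theorem sub_toR_mem_unitCube_iff {k : ℤ^d} : x - toR k ∈ unitCube d ↔ k = fun i => ⌊x i⌋ := by
  rw [mem_unitCube, funext_iff]
  refine forall_congr' fun i => ?_
  rw [eq_comm, Int.floor_eq_iff]
  simp only [Pi.sub_apply, toR]
  constructor <;> rintro ⟨h1, h2⟩ <;> constructor <;> linarith

theorem floor_mem_box (hx : ∀ i, |x i| ≤ R) : (fun i => ⌊x i⌋) ∈ box d (R + 1) := by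
  rw [mem_box]
  intro i
  have h := abs_le.1 (hx i)
  rw [abs_le]
  constructor
  · rw [Int.le_floor]
    push_cast
    linarith
  · rw [Int.floor_le_iff]
    push_cast
    linarith

/-- The integral over `ℝ^d` of a function supported in a cube, as an integral over the unit cube
of its periodization. -/
theorem integral_eq_setIntegral_unitCube (hf : Integrable f)
    (h : ∀ x i, (R : ℝ) < |x i| → f x = 0) : ∫ x, f x = ∫ x in unitCube d, ∑ k ∈ box d (R + 1),
      f (x + toR k) := by
  rw [integral_finsetSum _ fun k _ => (hf.comp_add_right (toR k)).integrableOn]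
  have h1 : ∀ k : ℤ^d, ∫ x in unitCube d, f (x + toR k) =
      ∫ x, {x | x - toR k ∈ unitCube d}.indicator f x := fun k => by
    rw [← integral_indicator measurableSet_unitCube,
      ← integral_add_right_eq_self ({x | x - toR k ∈ unitCube d}.indicator f) (toR k)]
    refine integral_congr_ae (Eventually.of_forall fun x => ?_)
    have h2 : x + toR k ∈ {x | x - toR k ∈ unitCube d} ↔ x ∈ unitCube d := by
      rw [Set.mem_ofPred_eq, add_sub_cancel_right]
    by_cases hx : x ∈ unitCube d
    · exact (Set.indicator_of_mem hx _).trans (Set.indicator_of_mem (h2.2 hx) f).symm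
    · exact (Set.indicator_of_notMem hx _).trans
        (Set.indicator_of_notMem (fun h => hx (h2.1 h)) f).symm
  simp only [h1]
  rw [← integral_finsetSum]
  · congr 1
    funext x
    by_cases hx : ∀ i, |x i| ≤ R
    · rw [sum_eq_single (fun i => ⌊x i⌋)]
      · rw [Set.indicator_of_mem]
        exact sub_toR_mem_unitCube_iff.2 rfl
      · intro k _ hk
        rw [Set.indicator_of_notMem]
        exact fun hm => hk (sub_toR_mem_unitCube_iff.1 hm)
      · exact fun hn => absurd (floor_mem_box hx) hn
    · push Not at hx
      obtain ⟨i, hi⟩ := hx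
      have : f x = 0 := h x i hi
      rw [this, sum_eq_zero fun k _ => Set.indicator_apply_eq_zero.2 fun _ => this]
  · intro k _
    refine hf.indicator ?_
    exact (measurable_id.sub_const (toR k)) measurableSet_unitCube

/-! ### Continuous functions as distributions -/

theorem integrable_smooth_mul (θ : smoothSpace d) {g : ℝ^d → ℂ} (hg : Continuous g)
    (hc : HasCompactSupport g) : Integrable fun x => (θ : ℝ^d → ℂ) x * g x :=
  ((contDiff_coe θ).continuous.mul hg).integrable_of_hasCompactSupport hc.mul_left

/-- The compactly supported distribution given by a continuous function. -/
def CompactDistribution.ofFun {g : ℝ^d → ℂ} (hg : Continuous g)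
    (hc : HasCompactSupport g) : CompactDistribution d where
  toLin :=
    { toFun := fun θ => ∫ x, (θ : ℝ^d → ℂ) x * g x
      map_add' := fun θ η => by
        rw [← integral_add (integrable_smooth_mul θ hg hc) (integrable_smooth_mul η hg hc)]
        simp only [Submodule.coe_add, Pi.add_apply, add_mul]
      map_smul' := fun c θ => by
        rw [RingHom.id_apply, smul_eq_mul, ← integral_const_mul]
        simp only [Submodule.coe_smul, Pi.smul_apply, smul_eq_mul, mul_assoc] }
  bound' := by
    refine ⟨∫ x, ‖g x‖, 0, tsupport g, hc, fun θ B h => ?_⟩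
    change ‖∫ x, (θ : ℝ^d → ℂ) x * g x‖ ≤ _
    have hi : Integrable fun x => ‖g x‖ := (hg.integrable_of_hasCompactSupport hc).norm
    rw [mul_comm, ← integral_const_mul]
    refine norm_integral_le_of_norm_le (hi.const_mul B) (Eventually.of_forall fun x => ?_)
    rw [norm_mul]
    by_cases hx : x ∈ tsupport g
    · refine mul_le_mul_of_nonneg_right ?_ (norm_nonneg _)
      simpa using h 0 le_rfl x hx
    · rw [image_eq_zero_of_notMem_tsupport hx]
      simp

theorem CompactDistribution.ofFun_apply {g : ℝ^d → ℂ} (hg : Continuous g) (hc : HasCompactSupport g)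
    (θ : smoothSpace d) : (CompactDistribution.ofFun hg hc).toLin θ = ∫ x, (θ : ℝ^d → ℂ) x * g x :=
  rfl

theorem CompactDistribution.exists_local (T : CompactDistribution d) : ∃ K : Set ℝ^d, IsCompact K ∧
      ∀ θ η : smoothSpace d, (∀ x ∈ K, (θ : ℝ^d → ℂ) =ᶠ[𝓝 x] (η : ℝ^d → ℂ)) → T.toLin θ =
      T.toLin η := by
  obtain ⟨C, N, K, hK, h⟩ := T.bound'
  refine ⟨K, hK, fun θ η hθη => ?_⟩
  have h1 := h (θ - η) 0 fun n _ x hx => by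
    have h2 : ((θ - η : smoothSpace d) : ℝ^d → ℂ) =ᶠ[𝓝 x] fun _ => 0 := by
      filter_upwards [hθη x hx] with y hy
      simp [hy]
    rw [(h2.iteratedFDeriv ℝ n).self_of_nhds]
    cases n with
    | zero => simp
    | succ n =>
      rw [iteratedFDeriv_const_of_ne (Nat.succ_ne_zero n)]
      simp
  rw [mul_zero, map_sub] at h1
  exact sub_eq_zero.1 (norm_le_zero_iff.1 h1)

/-- A real test function as an element of `smoothSpace d`. -/
def ofRealSmooth {χ : ℝ^d → ℝ} (hχ : ContDiff ℝ ∞ χ) : smoothSpace d :=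
  ⟨fun x => (χ x : ℂ), Complex.ofRealCLM.contDiff.comp hχ⟩

theorem hasCompactSupport_ofRealSmooth {χ : ℝ^d → ℝ} (hχ : ContDiff ℝ ∞ χ)
    (hc : HasCompactSupport χ) : HasCompactSupport (ofRealSmooth hχ : ℝ^d → ℂ) :=
  hc.comp_left (g := fun t : ℝ => (t : ℂ)) Complex.ofReal_zero

theorem eq_of_forall_integral_smooth_mul_eq {g : ℝ^d → ℂ} (hf : Continuous f) (hg : Continuous g)
    (h : ∀ θ : smoothSpace d, HasCompactSupport (θ : ℝ^d → ℂ) → ∫ x, (θ : ℝ^d → ℂ) x * f x = ∫ x,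
    (θ : ℝ^d → ℂ) x * g x) : f = g := by
  have h1 : ∀ᵐ x, f x - g x = 0 := by
    refine ae_eq_zero_of_integral_contDiff_smul_eq_zero (hf.sub hg).locallyIntegrable
      fun χ hχ hc => ?_
    have hc' := hasCompactSupport_ofRealSmooth hχ hc
    have h2 := h (ofRealSmooth hχ) hc'
    have hi : ∀ {f : ℝ^d → ℂ}, Continuous f →
        Integrable fun x => (ofRealSmooth hχ : ℝ^d → ℂ) x * f x := fun hf =>
      ((contDiff_coe _).continuous.mul hf).integrable_of_hasCompactSupport hc'.mul_right
    rw [← sub_eq_zero, ← integral_sub (hi hf) (hi hg)] at h2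
    rw [← h2]
    congr 1
    funext x
    rw [Complex.real_smul, mul_sub]
    rfl
  refine Measure.eq_of_ae_eq (μ := volume) ?_ hf hg
  filter_upwards [h1] with x hx
  exact sub_eq_zero.1 hx

theorem exists_cutoff (ρ : ℝ) : ∃ χ : smoothSpace d, HasCompactSupport (χ : ℝ^d → ℂ) ∧ ∀ x : ℝ^d,
      ‖x‖ ≤ ρ → (χ : ℝ^d → ℂ) =ᶠ[𝓝 x] fun _ => 1 := by
  let b : ContDiffBump (0 : ℝ^d) := ⟨|ρ| + 1, |ρ| + 2, by positivity, by linarith⟩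
  refine ⟨ofRealSmooth b.contDiff, hasCompactSupport_ofRealSmooth _ b.hasCompactSupport,
    fun x hx => ?_⟩
  have h1 : x ∈ ball (0 : ℝ^d) b.rIn := by
    rw [mem_ball_zero_iff]
    exact lt_of_le_of_lt (hx.trans (le_abs_self ρ)) (lt_add_one _)
  filter_upwards [Metric.isOpen_ball.mem_nhds h1] with y hy
  change ((b y : ℝ) : ℂ) = 1
  rw [b.one_of_mem_closedBall (Metric.ball_subset_closedBall hy), Complex.ofReal_one]

theorem CompactDistribution.eq_integral (T : CompactDistribution d) {g : ℝ^d → ℂ}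
    (hg : Continuous g) (h : ∀ θ : smoothSpace d, HasCompactSupport (θ : ℝ^d → ℂ) → T.toLin θ = ∫ x,
    (θ : ℝ^d → ℂ) x * g x) : HasCompactSupport g ∧ ∀ θ : smoothSpace d, T.toLin θ = ∫ x,
      (θ : ℝ^d → ℂ) x * g x := by
  obtain ⟨K, hK, hloc⟩ := T.exists_local
  have h1 : ∀ᵐ x, x ∈ Kᶜ → g x = 0 := by
    refine hK.isClosed.isOpen_compl.ae_eq_zero_of_integral_contDiff_smul_eq_zero
      (hg.locallyIntegrable.locallyIntegrableOn _) fun χ hχ hc hs => ?_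
    have h2 := h (ofRealSmooth hχ) (hasCompactSupport_ofRealSmooth hχ hc)
    have h3 := hloc (ofRealSmooth hχ) 0 fun x hx => by
      have h4 : x ∉ tsupport χ := fun hm => hs hm hx
      filter_upwards [(isClosed_tsupport χ).isOpen_compl.mem_nhds h4] with y hy
      change ((χ y : ℝ) : ℂ) = 0
      rw [image_eq_zero_of_notMem_tsupport hy, Complex.ofReal_zero]
    rw [map_zero, h2] at h3
    rw [← h3]
    congr 1
  have h2 : Set.EqOn g (fun _ => 0) Kᶜ :=
    Measure.eqOn_open_of_ae_eq ((ae_restrict_iff' hK.isClosed.isOpen_compl.measurableSet).2 h1)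
      hK.isClosed.isOpen_compl hg.continuousOn continuousOn_const
  have hc : HasCompactSupport g := HasCompactSupport.intro hK fun x hx => h2 hx
  refine ⟨hc, fun θ => ?_⟩
  obtain ⟨ρ, hρ⟩ := hK.isBounded.exists_norm_le
  obtain ⟨χ, hχc, hχ⟩ := exists_cutoff (d := d) ρ
  let η : smoothSpace d := ⟨fun x => (χ : ℝ^d → ℂ) x * (θ : ℝ^d → ℂ) x,
    (contDiff_coe χ).mul (contDiff_coe θ)⟩
  rw [← hloc η θ fun x hx => by
    filter_upwards [hχ x (hρ x hx)] with y hy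
    change (χ : ℝ^d → ℂ) y * _ = _
    rw [hy, one_mul], h η hχc.mul_right]
  congr 1
  funext x
  by_cases hx : x ∈ K
  · change (χ : ℝ^d → ℂ) x * _ * _ = _
    rw [(hχ x (hρ x hx)).self_of_nhds, one_mul]
  · rw [h2 hx, mul_zero, mul_zero]

theorem exists_vanishesOutside (hg : ∀ j, HasCompactSupport (g j)) : ∃ R, SuppCube R g := by
  have h1 : ∀ j, ∃ ρ : ℝ, ∀ x ∈ tsupport (g j), ‖x‖ ≤ ρ := fun j =>
    (hg j).isCompact.isBounded.exists_norm_le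
  choose ρ hρ using h1
  obtain ⟨R, hR⟩ := exists_nat_ge (∑ j, |ρ j|)
  refine ⟨R, fun j x i hx => ?_⟩
  by_contra hne
  have h2 := hρ j x (subset_tsupport _ hne)
  have h3 : |ρ j| ≤ ∑ j, |ρ j| :=
    single_le_sum (f := fun j => |ρ j|) (fun j _ => abs_nonneg _) (mem_univ j)
  have h4 := norm_le_pi_norm x i
  rw [Real.norm_eq_abs] at h4
  linarith [le_abs_self (ρ j)]

/-! ### Refinable functions -/

theorem integral_expo_cascade [NeZero lam] (a : Filt d r r) (hg : ∀ j, Continuous (g j))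
    (hc : ∀ j, HasCompactSupport (g j)) (ξ : ℝ^d) (i : Fin r) : ∫ x, expo x ((lam : ℝ) • ξ) *
      cascade lam a g i x = ∑ j, fourierSeries a ξ i j * ∫ x, expo x ξ * g j x := by
  have h0 : (lam : ℝ) ≠ 0 := by exact_mod_cast NeZero.ne lam
  have hterm : ∀ (k : ℤ^d) (j : Fin r),
      ∫ x, expo x ((lam : ℝ) • ξ) * g j ((lam : ℝ) • x - toR k) =
        ((lam : ℂ) ^ d)⁻¹ * (expo (toR k) ξ * ∫ x, expo x ξ * g j x) := fun k j => by
    have h1 := Measure.integral_comp_smul (volume : Measure ℝ^d)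
      (fun y => expo y ξ * g j (y - toR k)) (lam : ℝ)
    simp only [expo_smul] at h1
    rw [h1, ← integral_add_right_eq_self _ (toR k)]
    simp only [add_sub_cancel_right, expo_add_left]
    rw [Module.finrank_fintype_fun_eq_card, Fintype.card_fin, abs_of_nonneg (by positivity),
      Complex.real_smul]
    push_cast
    rw [← integral_const_mul, ← integral_const_mul, ← integral_const_mul]
    exact integral_congr_ae (Eventually.of_forall fun x => by ring)
  have hint : ∀ (k : ℤ^d) (j : Fin r),
      Integrable fun x => expo x ((lam : ℝ) • ξ) * g j ((lam : ℝ) • x - toR k) := fun k j => by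
    have h2 : Integrable fun y => expo y ξ * g j (y - toR k) := by
      refine ((continuous_expo ξ).mul ((hg j).comp (continuous_sub_right _))
        ).integrable_of_hasCompactSupport (HasCompactSupport.mul_left ?_)
      exact (hc j).comp_homeomorph (Homeomorph.subRight (toR k))
    have h3 := h2.comp_smul h0
    simpa only [expo_smul] using h3
  simp only [cascade_apply_eq_sum, mul_sum]
  rw [integral_finsetSum]
  · rw [Finset.sum_product_right]
    refine sum_congr rfl fun j _ => ?_
    rw [fourierSeries, Finsupp.sum, Matrix.sum_apply, sum_mul]
    refine sum_congr rfl fun k _ => ?_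
    simp only [mul_left_comm (expo _ _), Matrix.smul_apply, smul_eq_mul]
    rw [integral_const_mul, hterm]
    have : (lam : ℂ) ^ d ≠ 0 := pow_ne_zero _ (by exact_mod_cast NeZero.ne lam)
    field_simp
  · intro s _
    simp only [mul_left_comm (expo _ _)]
    exact (hint s.1 s.2).const_mul _

theorem sum_integral_eq_of_moment (hg : SuppCube R g) (hi : ∀ j, Integrable (g j)) {c : ℂ}
    (h : ∀ x, moment υ (samp g x) (fun _ => 1) = c) : ∑ j, fourierSeries υ 0 0 j * ∫ x, g j x =
      c := by
  have h1 : ∀ x ∈ unitCube d, ∑ j, fourierSeries υ 0 0 j *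
      ∑ k ∈ box d (R + 1), g j (x + toR k) = c := fun x hx => by
    have h3 := h x
    rw [moment_samp hg υ x (F := box d (R + 1)) fun j k hk => hg.mem_box (fun i => ?_) hk] at h3
    · rw [← h3, sum_comm]
      refine sum_congr rfl fun j _ => ?_
      rw [fourierSeries_zero_eq, pairing_def, Matrix.sum_apply, sum_mul]
      refine sum_congr rfl fun z _ => ?_
      rw [Matrix.mul_one, mul_sum]
      simp
    · have := mem_unitCube.1 hx i
      rw [abs_of_nonneg this.1]
      push_cast
      linarith
  have h2 : ∀ j, ∫ x, g j x = ∫ x in unitCube d, ∑ k ∈ box d (R + 1), g j (x + toR k) := fun j =>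
    integral_eq_setIntegral_unitCube (hi j) fun x i hx => hg j x i hx
  simp only [h2, ← integral_const_mul]
  rw [← integral_finsetSum, setIntegral_congr_fun measurableSet_unitCube h1]
  · simp [Measure.real, volume_unitCube]
  · intro j _
    refine (integrable_finsetSum _ fun k _ => ?_).const_mul _
    exact ((hi j).comp_add_right (toR k)).integrableOn

theorem Reproduces.integral_eq_one {N : ℕ} (hN : 0 < N) (hg : SuppCube R g)
    (hi : ∀ j, Integrable (g j)) (h : Reproduces N υ g) : ∑ j, fourierSeries υ 0 0 j * ∫ x, g j x =
      1 :=
  sum_integral_eq_of_moment hg hi fun x => h x _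
    (mono_zero_index (d := d) ▸ mono_mem (by simpa [deg] using hN))

/-- A refinable vector of continuous functions with the right normalization represents the
standard refinable vector of distributions. -/
theorem IsStandardRefinable.isCmRepresentative [NeZero lam] (hlam : 2 ≤ lam)
    (ha : EigenCondition lam m a) (hυ : IsMatchingFilter lam (m + 1) a υ)
    (hφ : IsStandardRefinable lam a υ φ) (hg : SuppCube R g) (hgs : ∀ j, ContDiff ℝ m (g j))
    (hgc : cascade lam a g = g) (hgr : Reproduces (m + 1) υ g) : IsCmRepresentative m φ g := by
  have hcont : ∀ j, Continuous (g j) := fun j => (hgs j).continuous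
  have hcs : ∀ j, HasCompactSupport (g j) := hg.hasCompactSupport
  have h1 : IsStandardRefinable lam a υ fun j => CompactDistribution.ofFun (hcont j) (hcs j) := by
    refine ⟨fun ξ => ?_, ?_⟩
    · ext i j
      rw [Matrix.mul_apply]
      have := integral_expo_cascade (lam := lam) a hcont hcs ξ i
      rw [hgc] at this
      exact this
    · have := hgr.integral_eq_one (Nat.succ_pos m) hg fun j =>
        (hcont j).integrable_of_hasCompactSupport (hcs j)
      ext i j
      rw [Subsingleton.elim i 0, Subsingleton.elim j 0, Matrix.one_apply_eq, ← this,
        Matrix.mul_apply]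
      refine sum_congr rfl fun k _ => ?_
      congr 1
      change ∫ x, expo x 0 * g k x = _
      simp only [expo_zero_right, one_mul]
  have h2 := hφ.unique hlam ha hυ h1
  intro j
  refine ⟨hgs j, fun θ _ => ?_⟩
  rw [h2]
  rfl

theorem IsCmRepresentative.exists_vanishesOutside (hg : IsCmRepresentative m φ g) :
    ∃ R, SuppCube R g :=
  VectorSubdivision.exists_vanishesOutside fun j =>
    ((φ j).eq_integral (hg j).1.continuous (hg j).2).1

theorem IsCmRepresentative.toLin_eq (hg : IsCmRepresentative m φ g) (j : Fin r)
    (θ : smoothSpace d) : (φ j).toLin θ = ∫ x, (θ : ℝ^d → ℂ) x * g j x :=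
  ((φ j).eq_integral (hg j).1.continuous (hg j).2).2 θ

theorem IsCmRepresentative.cascade_eq [NeZero lam] (hlam : 2 ≤ lam)
    (hφ : IsStandardRefinable lam a υ φ) (hg : IsCmRepresentative m φ g) : cascade lam a g = g := by
  have h0 : (lam : ℝ) ≠ 0 := by exact_mod_cast NeZero.ne lam
  have hcont : ∀ j, Continuous (g j) := fun j => (hg j).1.continuous
  obtain ⟨R, hR⟩ := hg.exists_vanishesOutside
  obtain ⟨A, hA⟩ := exists_suppIn a
  have hR' := hR.mono (le_max_left R A)
  have hRc := hR'.cascade hlam hA (le_max_right R A)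
  have hcs := hR'.hasCompactSupport
  have hcs' := hRc.hasCompactSupport
  have hcont' : ∀ j, Continuous (cascade lam a g j) := fun j =>
    (contDiff_cascade lam a (n := 0) (fun j => contDiff_zero.2 (hcont j)) j).continuous
  funext i
  have h1 : CompactDistribution.ofFun (hcont' i) (hcs' i) =
      CompactDistribution.ofFun (hcont i) (hcs i) := by
    refine CompactDistribution.eq_of_expo fun ξ => ?_
    have h2 := integral_expo_cascade (lam := lam) a hcont hcs ((lam : ℝ)⁻¹ • ξ) i
    have h3 := congrFun (congrFun (hφ.1 ((lam : ℝ)⁻¹ • ξ)) i) 0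
    rw [Matrix.mul_apply] at h3
    simp only [distFourier, Matrix.of_apply, smul_inv_smul₀ h0, hg.toLin_eq] at h2 h3
    exact h2.trans h3.symm
  refine eq_of_forall_integral_smooth_mul_eq (hcont' i) (hcont i) fun θ _ => ?_
  rw [← CompactDistribution.ofFun_apply (hcont' i) (hcs' i), h1, CompactDistribution.ofFun_apply]

end

section

/-! ### Convergence of subdivision schemes -/

variable {d r s q t lam m : ℕ} {a : Filt d r r} {υ : Filt d 1 r} {g : Fin r → ℝ^d → ℂ}
  {μ : Fin d → ℕ} {u w : Filt d r 1} {ρ : ℝ} {φ : Fin r → CompactDistribution d}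

theorem conv_apply_eq_sum (v : Filt d s q) (w : Filt d q t) (k : ℤ^d) : conv v w k =
      ∑ j ∈ w.support, v (k - j) * w j := by
  have h1 : conv v w k = pairing (conv v w) fun l =>
      (if l = k then (1 : ℂ) else 0) • (1 : Mat t t) := by
    rw [← pairing_pi_single (conv v w) k]
    congr 1
    funext l
    by_cases hl : l = k
    · subst hl
      simp
    · simp [hl]
  rw [h1, pairing_conv, pairing_swap]
  refine sum_congr rfl fun j _ => ?_
  congr 1
  rw [← pairing_pi_single v (k - j)]
  congr 1
  funext l
  by_cases hl : l = k - j
  · subst hl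
    simp
  · have : l + j ≠ k := fun h => hl (by rw [← h]; abel)
    simp [hl, this]

theorem filterConverges_iff : FilterConverges lam a υ g μ u ↔ ∀ ε > 0, ∀ᶠ n in atTop, ∀ k i,
      ‖(lam : ℂ) ^ (deg μ * n) * conv (mask lam a n) u k i 0 - beta υ u μ *
      mderiv μ (g i) (((lam : ℝ) ^ n)⁻¹ • toR k)‖ ≤ ε := by
  rw [FilterConverges, tendsto_supNorm_iff]
  refine forall₂_congr fun ε _ => eventually_congr (Eventually.of_forall fun n => ?_)
  refine forall₂_congr fun k i => ?_
  constructor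
  · intro h
    exact h 0
  · intro h j
    rw [Subsingleton.elim j 0]
    exact h

theorem exists_deg_eq (hd : 1 ≤ d) (m : ℕ) : ∃ μ : Fin d → ℕ, deg μ = m :=
  ⟨Pi.single ⟨0, hd⟩ m, by simp [deg]⟩

theorem moment_mono_eq_beta (υ : Filt d 1 r) (u : Filt d r 1) (μ : Fin d → ℕ) :
    moment υ u (mono μ) = (-1) ^ deg μ * ((∏ i, (μ i).factorial : ℕ) : ℂ) * beta υ u μ := by
  rw [beta_eq]
  have h1 := factorial_prod_ne_zero μ
  have h2 : ((-1 : ℂ) ^ deg μ) * (-1) ^ deg μ = 1 := by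
    rw [← mul_pow]
    simp
  field_simp
  rw [sq, h2, mul_one]

theorem vanishingSpace_subset_momentSpace : vanishingSpace (deg μ + 1) υ ⊆ momentSpace υ μ :=
  fun w hw =>
  mem_momentSpace_iff.2 fun ν hν _ => mem_vanishingSpace_iff_mono.1 hw ν (by omega)

theorem beta_eq_zero (hw : w ∈ vanishingSpace (deg μ + 1) υ) : beta υ w μ = 0 := by
  rw [beta_eq, mem_vanishingSpace_iff_mono.1 hw μ (Nat.lt_succ_self _)]
  simp

theorem sub_beta_smul_mem (hu : u ∈ momentSpace υ μ) (hw : w ∈ momentSpace υ μ)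
    (hβ : beta υ w μ = 1) : u - beta υ u μ • w ∈ vanishingSpace (deg μ + 1) υ := by
  rw [mem_vanishingSpace_iff_mono]
  intro ν hν
  rw [moment_sub_right, moment_smul_right]
  by_cases h : ν = μ
  · subst h
    rw [moment_mono_eq_beta, moment_mono_eq_beta, hβ]
    ring
  · rw [mem_momentSpace_iff.1 hu ν (by omega) h, mem_momentSpace_iff.1 hw ν (by omega) h]
    simp

theorem mono_neg (ν : Fin d → ℕ) (x : ℝ^d) : mono ν (-x) = (-1) ^ deg ν * mono ν x := by
  have := mono_smul (-1) ν x
  rw [neg_one_smul] at this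
  rw [this]
  simp

/-- The samples of a partial derivative `∂^μ ψ` of a reproducing function have moments like
`∂^μ δ`. -/
theorem Reproduces.samp_dirDeriv_mem {R : ℕ} {ψ : Fin r → ℝ^d → ℂ} (hψ : SuppCube R ψ)
    (hψs : ∀ j, ContDiff ℝ ∞ (ψ j)) (h : Reproduces (m + 1) υ ψ) (hμ : deg μ ≤ m) :
    samp (dirDeriv (deg μ) (dirs μ) ψ) 0 ∈ momentSpace υ μ ∧
      beta υ (samp (dirDeriv (deg μ) (dirs μ) ψ) 0) μ = 1 := by
  have hm : ∀ ν : Fin d → ℕ, deg ν ≤ deg μ →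
      moment υ (samp (dirDeriv (deg μ) (dirs μ) ψ) 0) (mono ν) =
        if ν = μ then (-1) ^ deg ν * ((∏ i, (μ i).factorial : ℕ) : ℂ) else 0 := fun ν hν => by
    rw [moment_samp_dirDeriv hψ (fun j => (hψs j).of_le (by exact_mod_cast le_top))]
    have h1 : (fun y => moment υ (samp ψ y) (mono ν)) =
        fun y => (-1 : ℂ) ^ deg ν * mono ν y := by
      funext y
      rw [h y _ (mono_mem (by omega)), mono_neg]
    have h2 : ContDiff ℝ (deg μ : ℕ) fun y : ℝ^d => (-1 : ℂ) ^ deg ν * mono ν y := by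
      refine contDiff_const.mul ?_
      change ContDiff ℝ (deg μ : ℕ) fun y : ℝ^d => ∏ i, ((y i : ℝ) : ℂ) ^ ν i
      exact contDiff_prod fun i _ => (Complex.ofRealCLM.contDiff.comp (contDiff_apply ℝ ℝ i)).pow _
    rw [h1, ← mderiv_eq_iteratedFDeriv h2, mderiv_const_mul_mono]
  refine ⟨mem_momentSpace_iff.2 fun ν hν hne => by rw [hm ν hν, if_neg hne], ?_⟩
  rw [beta_eq, hm μ le_rfl, if_pos rfl, ← mul_assoc, ← mul_pow]
  rw [neg_one_mul, neg_neg, one_pow, one_mul, div_self (factorial_prod_ne_zero μ)]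

theorem exists_rate (hlam : 2 ≤ lam) (hq : q ≤ m) (hρm : ρ < ((lam : ℝ) ^ m)⁻¹) : ∃ ρ' : ℝ, ρ ≤ ρ' ∧
      ((lam : ℝ)⁻¹) ^ (q + 1) < ρ' ∧ (lam : ℝ) ^ q * ρ' < 1 := by
  have hlam2 : (2 : ℝ) ≤ lam := by exact_mod_cast hlam
  have hpos : (0 : ℝ) < (lam : ℝ) ^ q := by positivity
  have h1 : ((lam : ℝ)⁻¹) ^ (q + 1) < ((lam : ℝ) ^ q)⁻¹ := by
    rw [← inv_pow]
    exact pow_lt_pow_right_of_lt_one₀ (by positivity) (inv_lt_one_of_one_lt₀ (by linarith))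
      (Nat.lt_succ_self q)
  have h2 : ρ < ((lam : ℝ) ^ q)⁻¹ := lt_of_lt_of_le hρm
    (inv_anti₀ hpos (pow_le_pow_right₀ (by linarith) hq))
  obtain ⟨ρ', h3, h4⟩ := exists_between (max_lt h2 h1)
  refine ⟨ρ', ((le_max_left _ _).trans_lt h3).le, (le_max_right _ _).trans_lt h3, ?_⟩
  calc (lam : ℝ) ^ q * ρ' < (lam : ℝ) ^ q * ((lam : ℝ) ^ q)⁻¹ := by gcongr
    _ = 1 := mul_inv_cancel₀ hpos.ne'

theorem IsStandardRefinable.convergesAllOrders [NeZero lam] (hlam : 2 ≤ lam)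
    (ha : EigenCondition lam m a) (hυ : IsMatchingFilter lam (m + 1) a υ)
    (hφ : IsStandardRefinable lam a υ φ) (hρ : 0 < ρ) (hρm : ρ < ((lam : ℝ) ^ m)⁻¹)
    (hD : Decays lam a (vanishingSpace (m + 1) υ) ρ) :
    ConvergesAllOrders lam m a υ φ (momentSpace υ) := by
  obtain ⟨R, ψ, g, hψ, hψs, hψr, hg, hgs, hgc, hgr, hconv⟩ := exists_cascade_limit hlam hυ hρ hρm hD
  refine ⟨g, hφ.isCmRepresentative hlam ha hυ hg hgs hgc hgr, fun μ hμ u hu => ?_⟩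
  obtain ⟨hw, hβ⟩ := hψr.samp_dirDeriv_mem hψ hψs hμ
  set w := samp (dirDeriv (deg μ) (dirs μ) ψ) 0 with hwdef
  obtain ⟨ρ', hρ', hlt, hlt1⟩ := exists_rate hlam hμ hρm
  have hρ'0 : 0 ≤ ρ' := hρ.le.trans hρ'
  have hD' : Decays lam a (vanishingSpace (deg μ + 1) υ) ρ' :=
    hD.descend_le hlam (Nat.succ_le_succ hμ) hυ hρ.le hρ' hlt
  obtain ⟨C, hC⟩ := hD' _ (sub_beta_smul_mem hu hw hβ)
  rw [filterConverges_iff]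
  intro ε hε
  have hb : 0 < ε / 2 / (‖beta υ u μ‖ + 1) := by positivity
  have hsmall : ∀ᶠ n : ℕ in atTop, C * ((lam : ℝ) ^ deg μ * ρ') ^ n ≤ ε / 2 := by
    have h1 : Tendsto (fun n : ℕ => C * ((lam : ℝ) ^ deg μ * ρ') ^ n) atTop (𝓝 (C * 0)) :=
      (tendsto_pow_atTop_nhds_zero_of_lt_one (by positivity) hlt1).const_mul C
    rw [mul_zero] at h1
    exact h1.eventually (eventually_le_nhds (by positivity))
  filter_upwards [hsmall, hconv (deg μ) hμ _ hb] with n hn1 hn2 k i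
  have h1 : conv (mask lam a n) u k i 0 =
      conv (mask lam a n) (u - beta υ u μ • w) k i 0 +
        beta υ u μ * conv (mask lam a n) w k i 0 := by
    rw [conv_sub_right, conv_smul_right]
    simp
  have hψq : ∀ j, ContDiff ℝ (deg μ : ℕ) (ψ j) := fun j => (hψs j).of_le (by exact_mod_cast le_top)
  have h2 : (lam : ℂ) ^ (deg μ * n) * conv (mask lam a n) w k i 0 =
      iteratedFDeriv ℝ (deg μ) ((cascade lam a)^[n] ψ i) (((lam : ℝ) ^ n)⁻¹ • toR k) (dirs μ) := by
    rw [hwdef, conv_mask_samp a (hψ.dirDeriv _ _), zero_add]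
    have h3 := congrFun (congrFun (dirDeriv_cascade_iterate lam a hψq (dirs μ) n) i)
      (((lam : ℝ) ^ n)⁻¹ • toR k)
    exact h3.symm
  have hgq : ContDiff ℝ (deg μ : ℕ) (g i) := (hgs i).of_le (by exact_mod_cast hμ)
  rw [h1, mderiv_eq_iteratedFDeriv hgq, mul_add, mul_left_comm _ (beta υ u μ), h2, add_sub_assoc,
    ← mul_sub]
  refine (norm_add_le _ _).trans ?_
  have h4 : ‖(lam : ℂ) ^ (deg μ * n) * conv (mask lam a n) (u - beta υ u μ • w) k i 0‖ ≤ ε / 2 := by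
    rw [norm_mul, norm_pow, Complex.norm_natCast, pow_mul]
    refine le_trans ?_ hn1
    calc _ ≤ ((lam : ℝ) ^ deg μ) ^ n * (C * ρ' ^ n) :=
          mul_le_mul_of_nonneg_left (hC n k i) (by positivity)
      _ = _ := by rw [mul_pow]; ring
  have h5 : ‖beta υ u μ * (iteratedFDeriv ℝ (deg μ) ((cascade lam a)^[n] ψ i)
      (((lam : ℝ) ^ n)⁻¹ • toR k) (dirs μ) - iteratedFDeriv ℝ (deg μ) (g i)
      (((lam : ℝ) ^ n)⁻¹ • toR k) (dirs μ))‖ ≤ ε / 2 := by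
    rw [norm_mul, ← sub_apply]
    have h6 := (ContinuousMultilinearMap.le_opNorm (iteratedFDeriv ℝ (deg μ)
      ((cascade lam a)^[n] ψ i) (((lam : ℝ) ^ n)⁻¹ • toR k) - iteratedFDeriv ℝ (deg μ) (g i)
      (((lam : ℝ) ^ n)⁻¹ • toR k)) (dirs μ)).trans (mul_le_mul (hn2 i _)
        (Finset.prod_le_one (fun _ _ => norm_nonneg _) fun l _ => norm_dirs_le μ l)
        (Finset.prod_nonneg fun _ _ => norm_nonneg _) hb.le)
    rw [mul_one] at h6
    calc _ ≤ (‖beta υ u μ‖ + 1) * (ε / 2 / (‖beta υ u μ‖ + 1)) :=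
          mul_le_mul (by linarith) h6 (norm_nonneg _) (by positivity)
      _ = ε / 2 := by field_simp
  linarith

theorem conv_subdiv_iterate_apply (lam : ℕ) (a : Filt d r r) (n : ℕ) (v : Filt d s r)
    (u : Filt d r t) (k : ℤ^d) : conv ((subdiv lam a)^[n] v) u k = pairing v fun z =>
      conv (mask lam a n) u (k - lam ^ n • z) := by
  rw [conv_apply, pairing_subdiv_iterate]
  simp only [conv_apply, sub_sub]

theorem ConvergesAllOrders.subdivisionCmConvergent [NeZero lam]
    (h : ConvergesAllOrders lam m a υ φ (momentSpace υ)) : SubdivisionCmConvergent lam m a υ := by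
  obtain ⟨g, hg, hconv⟩ := h
  have h0 : (lam : ℝ) ≠ 0 := by exact_mod_cast NeZero.ne lam
  intro v
  let S : Finset (ℤ^d × Fin r) := v.support ×ˢ univ
  let η : ℝ^d → ℂ := fun x => ∑ s ∈ S, v s.1 0 s.2 * g s.2 ((1 : ℝ) • x - toR s.1)
  have hterm : ∀ s : ℤ^d × Fin r, ∀ q : ℕ, q ≤ m →
      ContDiff ℝ q fun x => g s.2 ((1 : ℝ) • x - toR s.1) := fun s q hq =>
    ((hg s.2).1.of_le (by exact_mod_cast hq)).comp
      (ContDiff.sub (contDiff_const_smul (1 : ℝ)) contDiff_const)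
  refine ⟨η, ContDiff.sum fun s _ => contDiff_const.mul (hterm s m le_rfl), fun μ hμ u hu => ?_⟩
  have hη : ∀ x, mderiv μ η x = ∑ s ∈ S, v s.1 0 s.2 * mderiv μ (g s.2) (x - toR s.1) := fun x => by
    rw [mderiv_eq_iteratedFDeriv (ContDiff.sum fun s _ => contDiff_const.mul (hterm s _ hμ)),
      iteratedFDeriv_sum_mul S _ fun s _ => hterm s _ hμ]
    refine sum_congr rfl fun s _ => ?_
    have hs : ContDiff ℝ (deg μ : ℕ) (g s.2) := (hg s.2).1.of_le (by exact_mod_cast hμ)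
    rw [iteratedFDeriv_comp_smul_sub hs, mderiv_eq_iteratedFDeriv hs]
    simp
  have hc := filterConverges_iff.1 (hconv μ hμ u hu)
  rw [tendsto_supNorm_iff]
  intro ε hε
  have hM : 0 < ∑ s ∈ S, ‖v s.1 0 s.2‖ + 1 :=
    add_pos_of_nonneg_of_pos (sum_nonneg fun _ _ => norm_nonneg _) one_pos
  filter_upwards [hc (ε / (∑ s ∈ S, ‖v s.1 0 s.2‖ + 1)) (by positivity)] with n hn k i j
  rw [Subsingleton.elim i 0, Subsingleton.elim j 0]
  have h1 : conv ((subdiv lam a)^[n] v) u k 0 0 =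
      ∑ s ∈ S, v s.1 0 s.2 * conv (mask lam a n) u (k - lam ^ n • s.1) s.2 0 := by
    rw [conv_subdiv_iterate_apply, pairing_def, Matrix.sum_apply, sum_product]
    exact sum_congr rfl fun z _ => Matrix.mul_apply
  have h2 : ∀ z : ℤ^d, ((lam : ℝ) ^ n)⁻¹ • toR (k - lam ^ n • z) =
      ((lam : ℝ) ^ n)⁻¹ • toR k - toR z := fun z => by
    rw [toR_sub, toR_nsmul, smul_sub]
    push_cast
    rw [inv_smul_smul₀ (pow_ne_zero _ h0)]
  have h3 : ((lam : ℂ) ^ (deg μ * n) • conv ((subdiv lam a)^[n] v) u k -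
      beta υ u μ • Matrix.of fun (_ _ : Fin 1) =>
        mderiv μ η (((lam : ℝ) ^ n)⁻¹ • toR k)) 0 0 = ∑ s ∈ S, v s.1 0 s.2 *
      ((lam : ℂ) ^ (deg μ * n) * conv (mask lam a n) u (k - lam ^ n • s.1) s.2 0 -
        beta υ u μ * mderiv μ (g s.2) (((lam : ℝ) ^ n)⁻¹ • toR (k - lam ^ n • s.1))) := by
    rw [Matrix.sub_apply, Matrix.smul_apply, Matrix.smul_apply, Matrix.of_apply, h1, hη,
      smul_eq_mul, smul_eq_mul, mul_sum, mul_sum, ← sum_sub_distrib]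
    refine sum_congr rfl fun s _ => ?_
    rw [h2]
    ring
  rw [h3]
  refine (norm_sum_le _ _).trans ?_
  calc _ ≤ ∑ s ∈ S, ‖v s.1 0 s.2‖ * (ε / (∑ s ∈ S, ‖v s.1 0 s.2‖ + 1)) :=
        sum_le_sum fun s _ => by
          rw [norm_mul]
          exact mul_le_mul_of_nonneg_left (hn _ _) (norm_nonneg _)
    _ ≤ (∑ s ∈ S, ‖v s.1 0 s.2‖ + 1) * (ε / (∑ s ∈ S, ‖v s.1 0 s.2‖ + 1)) := by
        rw [← sum_mul]
        gcongr
        exact le_add_of_nonneg_right zero_le_one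
    _ = ε := by field_simp

theorem FilterConverges.add (hu : FilterConverges lam a υ g μ u)
    (hw : FilterConverges lam a υ g μ w) : FilterConverges lam a υ g μ (u + w) := by
  rw [filterConverges_iff] at *
  intro ε hε
  filter_upwards [hu (ε / 2) (by positivity), hw (ε / 2) (by positivity)] with n h1 h2 k i
  have hβ : beta υ (u + w) μ = beta υ u μ + beta υ w μ := by
    simp only [beta_eq, moment_add_right]
    ring
  rw [hβ, conv_add_right, Finsupp.add_apply, Matrix.add_apply]
  calc _ = ‖((lam : ℂ) ^ (deg μ * n) * conv (mask lam a n) u k i 0 -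
        beta υ u μ * mderiv μ (g i) (((lam : ℝ) ^ n)⁻¹ • toR k)) +
        ((lam : ℂ) ^ (deg μ * n) * conv (mask lam a n) w k i 0 -
        beta υ w μ * mderiv μ (g i) (((lam : ℝ) ^ n)⁻¹ • toR k))‖ := by congr 1; ring
    _ ≤ ε / 2 + ε / 2 := (norm_add_le _ _).trans (add_le_add (h1 k i) (h2 k i))
    _ = ε := add_halves ε

theorem FilterConverges.zero : FilterConverges lam a υ g μ (0 : Filt d r 1) := by
  rw [filterConverges_iff]
  intro ε hε
  have hβ : beta υ (0 : Filt d r 1) μ = 0 := beta_eq_zero vanishingSpace_zero_mem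
  simp [hβ, conv_zero_right, hε.le]

theorem FilterConverges.sum {ι : Type*} (S : Finset ι) {u : ι → Filt d r 1}
    (hu : ∀ i ∈ S, FilterConverges lam a υ g μ (u i)) : FilterConverges lam a υ g μ (∑ i ∈ S,
      u i) := by
  classical
  induction S using Finset.induction_on with
  | empty => simpa using FilterConverges.zero
  | insert i S hi ih =>
    rw [Finset.sum_insert hi]
    exact (hu i (Finset.mem_insert_self i S)).add
      (ih fun j hj => hu j (Finset.mem_insert_of_mem hj))

theorem moment_conv (υ : Filt d 1 r) (u : Filt d r 1) (c : Filt d 1 1) (p : ℝ^d → ℂ) :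
    moment υ (conv u c) p = ∑ z ∈ c.support, moment υ u (fun x => p (x + toR z)) * c z 0 0 := by
  have h1 : moment υ (conv u c) p = pairing (conv (conv υ u) c)
      (fun k => p (toR k) • (1 : Mat 1 1)) 0 0 := by
    rw [conv_assoc]
    rfl
  rw [h1, pairing_conv, pairing_swap (conv υ u) c fun z k => p (toR (z + k)), Matrix.sum_apply]
  refine sum_congr rfl fun z _ => ?_
  rw [Matrix.mul_apply, Fin.sum_univ_one]
  simp only [toR_add]
  rfl

theorem beta_conv (hu : u ∈ momentSpace υ μ) (c : Filt d 1 1) : beta υ (conv u c) μ =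
      beta υ u μ * ∑ z ∈ c.support, c z 0 0 := by
  have h1 : ∀ z : ℤ^d, moment υ u (fun x => mono μ (x + toR z)) = moment υ u (mono μ) := fun z => by
    have h2 : moment υ u (fun x => mono μ (x + toR z) - mono μ x) = 0 :=
      moment_eq_zero_of_mono (N := deg μ) (fun ν hν => mem_momentSpace_iff.1 hu ν hν.le
        (by rintro rfl; exact lt_irrefl _ hν)) (translate_mono_sub_mem (toR z) μ)
    have h3 := moment_add υ u (fun x => mono μ (x + toR z) - mono μ x) (mono μ)
    rw [h2, zero_add] at h3
    rw [← h3]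
    congr 1
    funext x
    simp
  rw [beta_eq, beta_eq, moment_conv]
  simp only [h1]
  rw [← mul_sum]
  ring

theorem FilterConverges.conv_right [NeZero lam] (hlam : 2 ≤ lam)
    (hg : ∀ i, UniformContinuous (mderiv μ (g i))) (hu : u ∈ momentSpace υ μ)
    (h : FilterConverges lam a υ g μ u) (c : Filt d 1 1) :
    FilterConverges lam a υ g μ (conv u c) := by
  rw [filterConverges_iff] at *
  intro ε hε
  have hlam2 : (2 : ℝ) ≤ lam := by exact_mod_cast hlam
  set M : ℝ := ∑ z ∈ c.support, ‖c z 0 0‖ with hM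
  have hM0 : 0 ≤ M := sum_nonneg fun _ _ => norm_nonneg _
  set δ : ℝ := ε / 2 / ((‖beta υ u μ‖ + 1) * (M + 1)) with hδ
  have hδ0 : 0 < δ := by positivity
  have huc : ∀ᶠ n : ℕ in atTop, ∀ z ∈ c.support, ∀ (k : ℤ^d) (i : Fin r),
      ‖mderiv μ (g i) (((lam : ℝ) ^ n)⁻¹ • toR (k - z)) -
        mderiv μ (g i) (((lam : ℝ) ^ n)⁻¹ • toR k)‖ ≤ δ := by
    rw [Finset.eventually_all]
    intro z _
    have h1 : Tendsto (fun n : ℕ => ((lam : ℝ)⁻¹) ^ n * ‖toR z‖) atTop (𝓝 (0 * ‖toR z‖)) :=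
      (tendsto_pow_atTop_nhds_zero_of_lt_one (by positivity)
        (inv_lt_one_of_one_lt₀ (by linarith))).mul_const _
    rw [zero_mul] at h1
    have h2 : ∀ i, ∃ η > 0, ∀ x y : ℝ^d, dist x y < η →
        dist (mderiv μ (g i) x) (mderiv μ (g i) y) < δ := fun i =>
      Metric.uniformContinuous_iff.1 (hg i) δ hδ0 |>.imp fun η hη => ⟨hη.1, fun x y h => hη.2 h⟩
    choose η hη0 hη using h2
    have h3 : ∀ᶠ n : ℕ in atTop, ∀ i, ((lam : ℝ)⁻¹) ^ n * ‖toR z‖ < η i := by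
      rw [eventually_all]
      exact fun i => h1.eventually (eventually_lt_nhds (hη0 i))
    filter_upwards [h3] with n hn k i
    have h4 := hη i (((lam : ℝ) ^ n)⁻¹ • toR (k - z)) (((lam : ℝ) ^ n)⁻¹ • toR k) (by
      rw [dist_eq_norm, ← smul_sub, toR_sub, sub_sub_cancel_left, norm_smul, norm_neg, norm_inv,
        norm_pow, Real.norm_natCast, ← inv_pow]
      exact hn i)
    rw [dist_eq_norm] at h4
    exact h4.le
  filter_upwards [huc, h (ε / 2 / (M + 1)) (by positivity)] with n h1 h2 k i
  rw [beta_conv hu, ← conv_assoc, conv_apply_eq_sum, Matrix.sum_apply]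
  have h3 : (lam : ℂ) ^ (deg μ * n) * ∑ z ∈ c.support,
        (conv (mask lam a n) u (k - z) * c z) i 0 -
      (beta υ u μ * ∑ z ∈ c.support, c z 0 0) * mderiv μ (g i) (((lam : ℝ) ^ n)⁻¹ • toR k) =
      ∑ z ∈ c.support, (((lam : ℂ) ^ (deg μ * n) * conv (mask lam a n) u (k - z) i 0 -
        beta υ u μ * mderiv μ (g i) (((lam : ℝ) ^ n)⁻¹ • toR (k - z))) +
        beta υ u μ * (mderiv μ (g i) (((lam : ℝ) ^ n)⁻¹ • toR (k - z)) -
        mderiv μ (g i) (((lam : ℝ) ^ n)⁻¹ • toR k))) * c z 0 0 := by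
    rw [mul_sum, mul_sum, sum_mul, ← sum_sub_distrib]
    refine sum_congr rfl fun z _ => ?_
    rw [Matrix.mul_apply, Fin.sum_univ_one]
    ring
  rw [h3]
  refine (norm_sum_le _ _).trans ?_
  have h4 : ∀ z ∈ c.support, ‖(((lam : ℂ) ^ (deg μ * n) * conv (mask lam a n) u (k - z) i 0 -
        beta υ u μ * mderiv μ (g i) (((lam : ℝ) ^ n)⁻¹ • toR (k - z))) +
        beta υ u μ * (mderiv μ (g i) (((lam : ℝ) ^ n)⁻¹ • toR (k - z)) -
        mderiv μ (g i) (((lam : ℝ) ^ n)⁻¹ • toR k))) * c z 0 0‖ ≤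
      (ε / (M + 1)) * ‖c z 0 0‖ := fun z hz => by
    rw [norm_mul]
    refine mul_le_mul_of_nonneg_right ?_ (norm_nonneg _)
    refine (norm_add_le _ _).trans ((add_le_add (h2 _ _) ?_).trans_eq
      (b := ε / 2 / (M + 1) + ε / 2 / (M + 1)) (by ring))
    rw [norm_mul]
    calc _ ≤ (‖beta υ u μ‖ + 1) * δ :=
          mul_le_mul (by linarith) (h1 z hz k i) (norm_nonneg _) (by positivity)
      _ = ε / 2 / (M + 1) := by
          rw [hδ]
          field_simp
  refine (sum_le_sum h4).trans ?_
  rw [← mul_sum, div_mul_eq_mul_div, div_le_iff₀ (by positivity)]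
  nlinarith

theorem decays_of_filterConverges [NeZero lam] (hlam : 2 ≤ lam)
    (hυ : IsMatchingFilter lam (m + 1) a υ) (hg : IsCmRepresentative m φ g) (hμ : deg μ = m)
    {G : Set (Filt d r 1)} (hG : Generates υ μ G) (h : ∀ u ∈ G, FilterConverges lam a υ g μ u) :
    ∃ ρ : ℝ, 0 < ρ ∧ ρ < ((lam : ℝ) ^ m)⁻¹ ∧ Decays lam a (vanishingSpace (m + 1) υ) ρ := by
  refine decays_of_tendsto hlam hυ fun w hw => ?_
  obtain ⟨R, hR⟩ := hg.exists_vanishesOutside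
  have huc : ∀ i, UniformContinuous (mderiv μ (g i)) := fun i => by
    have hs : ContDiff ℝ (deg μ : ℕ) (g i) := by
      rw [hμ]
      exact (hg i).1
    have h1 : mderiv μ (g i) = dirDeriv (deg μ) (dirs μ) g i :=
      funext fun x => mderiv_eq_iteratedFDeriv hs x
    rw [h1]
    refine ((hR.dirDeriv _ _).hasCompactSupport i).uniformContinuous_of_continuous ?_
    exact (ContinuousMultilinearMap.apply ℝ (fun _ : Fin (deg μ) => ℝ^d) ℂ
      (dirs μ)).continuous.comp (hs.continuous_iteratedFDeriv le_rfl)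
  have hw' : w ∈ vanishingSpace (deg μ + 1) υ := by rwa [hμ]
  obtain ⟨t, ws, cs, hws, hsum⟩ := hG.2 w (vanishingSpace_subset_momentSpace hw')
  have hc : FilterConverges lam a υ g μ w := by
    rw [hsum]
    exact FilterConverges.sum _ fun j _ => (h _ (hws j)).conv_right hlam huc (hG.1 (hws j)) (cs j)
  rw [filterConverges_iff, beta_eq_zero hw'] at hc
  intro ε hε
  filter_upwards [hc ε hε] with n hn k i
  have := hn k i
  rw [zero_mul, sub_zero, norm_mul, norm_pow, Complex.norm_natCast, hμ] at this
  exact this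

theorem SubdivisionCmConvergent.decays [NeZero lam] (hlam : 2 ≤ lam) (hd : 1 ≤ d)
    (hυ : IsMatchingFilter lam (m + 1) a υ) (h : SubdivisionCmConvergent lam m a υ) : ∃ ρ : ℝ, 0 <
      ρ ∧ ρ < ((lam : ℝ) ^ m)⁻¹ ∧ Decays lam a (vanishingSpace (m + 1) υ) ρ := by
  refine decays_of_tendsto hlam hυ fun w hw ε hε => ?_
  obtain ⟨μ, hμ⟩ := exists_deg_eq hd m
  have hw' : w ∈ vanishingSpace (deg μ + 1) υ := by rwa [hμ]
  have hi : ∀ i : Fin r, ∀ᶠ n in atTop, ∀ k,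
      (lam : ℝ) ^ (m * n) * ‖conv (mask lam a n) w k i 0‖ ≤ ε := fun i => by
    obtain ⟨η, -, hη⟩ := h (Finsupp.single 0 (Matrix.of fun _ => Pi.single i 1))
    have h1 := (tendsto_supNorm_iff _).1 (hη μ hμ.le w (vanishingSpace_subset_momentSpace hw')) ε hε
    filter_upwards [h1] with n hn k
    have h2 := hn k 0 0
    rw [beta_eq_zero hw', zero_smul, sub_zero, conv_subdiv_iterate_apply, pairing_single,
      smul_zero, sub_zero, Matrix.smul_apply, norm_smul, norm_pow, Complex.norm_natCast, hμ,
      Matrix.mul_apply] at h2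
    simpa [Pi.single_apply] using h2
  filter_upwards [eventually_all.2 hi] with n hn k i
  exact hn i k

theorem smInfty_tfae [NeZero lam] (hlam : 2 ≤ lam) (hd : 1 ≤ d) (ha : EigenCondition lam m a)
    (hυ : IsMatchingFilter lam (m + 1) a υ) (hφ : IsStandardRefinable lam a υ φ)
    {G H : (Fin d → ℕ) → Set (Filt d r 1)} (hG : ∀ μ, deg μ ≤ m → Generates υ μ (G μ))
    (hH : ∀ μ, deg μ = m → Generates υ μ (H μ)) : List.TFAE [ (m : EReal) < smInfty lam a,
      ConvergesAllOrders lam m a υ φ (momentSpace υ), ConvergesAllOrders lam m a υ φ G,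
      ConvergesTopOrder lam m a υ φ H, SubdivisionCmConvergent lam m a υ] := by
  obtain ⟨μ₀, hμ₀⟩ := exists_deg_eq hd m
  rw [lt_smInfty_iff_decays hlam ha hυ]
  tfae_have 1 → 2 := fun ⟨ρ, hρ, hρm, hD⟩ => hφ.convergesAllOrders hlam ha hυ hρ hρm hD
  tfae_have 2 → 3 := fun ⟨g, hg, h⟩ => ⟨g, hg, fun μ hμ u hu => h μ hμ u ((hG μ hμ).1 hu)⟩
  tfae_have 2 → 4 := fun ⟨g, hg, h⟩ =>
    ⟨g, hg, μ₀, hμ₀, fun u hu => h μ₀ hμ₀.le u ((hH μ₀ hμ₀).1 hu)⟩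
  tfae_have 2 → 5 := fun h => h.subdivisionCmConvergent
  tfae_have 3 → 1 := fun ⟨g, hg, h⟩ =>
    decays_of_filterConverges hlam hυ hg hμ₀ (hG μ₀ hμ₀.le) (h μ₀ hμ₀.le)
  tfae_have 4 → 1 := fun ⟨g, hg, μ, hμ, h⟩ => decays_of_filterConverges hlam hυ hg hμ (hH μ hμ) h
  tfae_have 5 → 1 := fun h => h.decays hlam hd hυ
  tfae_finish

end

section

/-! ### Periodization and Fourier coefficients -/

variable {d r R S : ℕ} {x : ℝ^d} {k : ℤ^d} {f P : ℝ^d → ℂ}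

/-- The periodization `∑_l f(x + l)`. -/
def periodization (f : ℝ^d → ℂ) (x : ℝ^d) : ℂ := ∑ᶠ l : ℤ^d, f (x + toR l)

theorem mem_box_of_abs_le (hx : ∀ i, |x i| + R ≤ S) (hk : ∀ i, |(x + toR k) i| ≤ R) :
    k ∈ box d S := by
  rw [mem_box]
  intro i
  have h1 : |((k i : ℤ) : ℝ)| ≤ |(x + toR k) i| + |x i| := by
    have := abs_sub (x i + k i) (x i)
    rw [add_sub_cancel_left] at this
    exact this
  have h2 : |((k i : ℤ) : ℝ)| ≤ S := by linarith [hx i, hk i]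
  exact_mod_cast h2

theorem periodization_eq_sum (hf : ∀ x i, (R : ℝ) < |x i| → f x = 0) (hx : ∀ i, |x i| + R ≤ S) :
    periodization f x = ∑ l ∈ box d S, f (x + toR l) := by
  refine finsum_eq_sum_of_support_subset _ fun k hk => ?_
  refine mem_box_of_abs_le hx fun i => ?_
  by_contra hcon
  exact hk (hf _ i (not_le.1 hcon))

theorem periodization_add_toR (f : ℝ^d → ℂ) (x : ℝ^d) (k : ℤ^d) : periodization f (x + toR k) =
      periodization f x := by
  rw [periodization, periodization,
    ← finsum_comp_equiv (Equiv.addLeft k) (f := fun l => f (x + toR l))]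
  simp only [Equiv.coe_addLeft, toR_add, add_assoc]

theorem exists_bound_nhds (x : ℝ^d) (R : ℕ) : ∃ S : ℕ, ∀ y ∈ ball x 1, ∀ i, |y i| + R ≤ S := by
  obtain ⟨S, hS⟩ := exists_nat_ge (‖x‖ + 1 + R)
  refine ⟨S, fun y hy i => ?_⟩
  have h1 : |y i| ≤ ‖y‖ := norm_le_pi_norm y i
  have h2 : ‖y‖ ≤ ‖x‖ + 1 := by
    have := norm_le_norm_add_norm_sub' y x
    rw [mem_ball_iff_norm] at hy
    linarith
  linarith

theorem continuous_periodization (hf : ∀ x i, (R : ℝ) < |x i| → f x = 0) (hc : Continuous f) :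
    Continuous (periodization f) := by
  rw [continuous_iff_continuousAt]
  intro x
  obtain ⟨S, hS⟩ := exists_bound_nhds x R
  have h1 : periodization f =ᶠ[𝓝 x] fun y => ∑ l ∈ box d S, f (y + toR l) := by
    filter_upwards [Metric.ball_mem_nhds x one_pos] with y hy
    exact periodization_eq_sum hf (hS y hy)
  refine (ContinuousAt.congr ?_ h1.symm)
  exact (continuous_finsetSum _ fun l _ => hc.comp (continuous_add_const _)).continuousAt

theorem locallyIntegrable_periodization (hf : ∀ x i, (R : ℝ) < |x i| → f x = 0)
    (hi : Integrable f) : LocallyIntegrable (periodization f) := fun x => by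
  obtain ⟨S, hS⟩ := exists_bound_nhds x R
  refine ⟨ball x 1, Metric.ball_mem_nhds x one_pos, ?_⟩
  have h1 : IntegrableOn (fun y => ∑ l ∈ box d S, f (y + toR l)) (ball x 1) :=
    (integrable_finsetSum _ fun l _ => hi.comp_add_right (toR l)).integrableOn
  exact h1.congr_fun (fun y hy => (periodization_eq_sum hf (hS y hy)).symm) measurableSet_ball

theorem expo_toR_two_pi (l k : ℤ^d) : expo (toR l) ((2 * π) • toR k) = 1 := by
  simpa using expo_lattice_eq_one 1 l k

theorem expo_add_toR_two_pi (x : ℝ^d) (l k : ℤ^d) : expo (x + toR l) ((2 * π) • toR k) =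
      expo x ((2 * π) • toR k) := by
  rw [expo_add_left, expo_toR_two_pi, mul_one]

theorem exists_trigonometric_approx (hP : Continuous P) (hper : ∀ x k, P (x + toR k) = P x) {ε : ℝ}
    (hε : 0 < ε) : ∃ p ∈ span ℂ (Set.range fun k : ℤ^d => fun x : ℝ^d => expo x ((2 * π) • toR k)),
      ∀ x, ‖P x - p x‖ ≤ ε := by
  let τ : ℝ^d → UnitAddTorus (Fin d) :=
    Pi.map fun _ (t : ℝ) => (QuotientAddGroup.mk t : UnitAddCircle)
  have hτ : IsOpenQuotientMap τ :=
    IsOpenQuotientMap.piMap fun _ => QuotientAddGroup.isOpenQuotientMap_mk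
  have hlift : ∀ x y, τ x = τ y → P x = P y := fun x y hxy => by
    have h1 : ∀ i, ∃ n : ℤ, y i = x i + n := fun i => by
      have h2 : (QuotientAddGroup.mk (x i) : UnitAddCircle) = QuotientAddGroup.mk (y i) :=
        congrFun hxy i
      rw [QuotientAddGroup.eq, AddSubgroup.mem_zmultiples_iff] at h2
      obtain ⟨n, hn⟩ := h2
      refine ⟨n, ?_⟩
      rw [zsmul_eq_mul, mul_one] at hn
      rw [hn]
      ring
    choose n hn using h1
    have : y = x + toR n := funext hn
    rw [this, hper]
  let Q : UnitAddTorus (Fin d) → ℂ := fun t => P (Function.surjInv hτ.surjective t)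
  have hQ : ∀ x, Q (τ x) = P x := fun x => hlift _ _ (Function.surjInv_eq hτ.surjective (τ x))
  have hQc : Continuous Q := by
    rw [← hτ.continuous_comp_iff]
    exact hP.congr fun x => (hQ x).symm
  let Qc : C(UnitAddTorus (Fin d), ℂ) := ⟨Q, hQc⟩
  have hmem : Qc ∈ (span ℂ
      (Set.range (UnitAddTorus.mFourier (d := Fin d)))).topologicalClosure := by
    rw [UnitAddTorus.span_mFourier_closure_eq_top]
    trivial
  obtain ⟨q, hq, hdist⟩ := Metric.mem_closure_iff.1 hmem ε hε
  refine ⟨fun x => q (τ x), ?_, fun x => ?_⟩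
  · refine span_induction (p := fun q _ => (fun x => q (τ x)) ∈ span ℂ
      (Set.range fun k : ℤ^d => fun x : ℝ^d => expo x ((2 * π) • toR k)))
      ?_ ?_ ?_ ?_ hq
    · rintro _ ⟨n, rfl⟩
      refine subset_span ⟨-n, ?_⟩
      funext x
      change expo x ((2 * π) • toR (-n)) = ∏ i, fourier (n i) ((x i : ℝ) : UnitAddCircle)
      simp only [fourier_coe_apply]
      rw [← Complex.exp_sum, expo]
      congr 1
      push_cast
      rw [mul_sum]
      refine sum_congr rfl fun i _ => ?_
      simp only [Pi.smul_apply, toR, Pi.neg_apply, smul_eq_mul]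
      push_cast
      ring
    · exact Submodule.zero_mem _
    · intro f g _ _ hf hg
      exact Submodule.add_mem _ hf hg
    · intro c f _ hf
      exact Submodule.smul_mem _ c hf
  · rw [← hQ x]
    have h1 := ContinuousMap.norm_coe_le_norm (Qc - q) (τ x)
    rw [dist_eq_norm] at hdist
    exact h1.trans hdist.le

theorem integrable_expo_mul (hf : Integrable f) (ξ : ℝ^d) : Integrable fun x => expo x ξ * f x :=
  hf.bdd_mul (continuous_expo ξ).aestronglyMeasurable
    (Eventually.of_forall fun x => (norm_expo x ξ).le)

theorem integral_mul_eq_zero_of_periodic (hf : Integrable f)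
    (h : ∀ k : ℤ^d, ∫ x, expo x ((2 * π) • toR k) * f x = 0) (hP : Continuous P)
    (hper : ∀ x k, P (x + toR k) = P x) : ∫ x, P x * f x = 0 := by
  have hspan : ∀ p ∈ span ℂ (Set.range fun k : ℤ^d => fun x : ℝ^d =>
      expo x ((2 * π) • toR k)), Integrable (fun x => p x * f x) ∧ ∫ x, p x * f x = 0 := by
    intro p hp
    induction hp using span_induction with
    | mem p hp =>
      obtain ⟨k, rfl⟩ := hp
      exact ⟨integrable_expo_mul hf _, h k⟩
    | zero => simp
    | add p q _ _ hp hq =>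
      simp only [Pi.add_apply, add_mul]
      exact ⟨hp.1.add hq.1, by rw [integral_add hp.1 hq.1, hp.2, hq.2, add_zero]⟩
    | smul c p _ hp =>
      simp only [Pi.smul_apply, smul_eq_mul, mul_assoc]
      exact ⟨hp.1.const_mul c, by rw [integral_const_mul, hp.2, mul_zero]⟩
  have hle : ∀ ε > 0, ‖∫ x, P x * f x‖ ≤ ε * ∫ x, ‖f x‖ := fun ε hε => by
    obtain ⟨p, hp, hPp⟩ := exists_trigonometric_approx hP hper hε
    obtain ⟨h1, h2⟩ := hspan p hp
    have hmul : ∀ x, P x * f x = p x * f x + (P x - p x) * f x := fun x => by ring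
    have hpc : Continuous p := by
      refine span_induction (p := fun p _ => Continuous p) ?_ ?_ ?_ ?_ hp
      · rintro _ ⟨k, rfl⟩
        exact continuous_expo _
      · exact continuous_const
      · exact fun f g _ _ hf hg => hf.add hg
      · exact fun c f _ hf => hf.const_smul c
    have h3 : Integrable fun x => (P x - p x) * f x :=
      hf.bdd_mul (hP.sub hpc).aestronglyMeasurable (Eventually.of_forall hPp)
    simp only [hmul]
    rw [integral_add h1 h3, h2, zero_add, ← integral_const_mul]
    refine norm_integral_le_of_norm_le (hf.norm.const_mul ε) (Eventually.of_forall fun x => ?_)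
    rw [norm_mul]
    exact mul_le_mul_of_nonneg_right (hPp x) (norm_nonneg _)
  by_contra hne
  have hpos : 0 < ‖∫ x, P x * f x‖ := norm_pos_iff.2 hne
  set I := ∫ x, ‖f x‖
  have hI : 0 ≤ I := integral_nonneg fun x => norm_nonneg _
  have h1 := hle (‖∫ x, P x * f x‖ / (2 * (I + 1))) (by positivity)
  rw [div_mul_eq_mul_div, le_div_iff₀ (by positivity)] at h1
  nlinarith

theorem periodization_ae_eq_zero (hi : Integrable f) (hf : ∀ x i, (R : ℝ) < |x i| → f x = 0)
    (h : ∀ k : ℤ^d, ∫ x, expo x ((2 * π) • toR k) * f x = 0) : ∀ᵐ x, periodization f x = 0 := by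
  refine ae_eq_zero_of_integral_contDiff_smul_eq_zero (locallyIntegrable_periodization hf hi)
    fun χ hχ hc => ?_
  let θ : ℝ^d → ℂ := fun x => (χ x : ℂ)
  have hθc : Continuous θ := Complex.continuous_ofReal.comp hχ.continuous
  obtain ⟨T, hT⟩ : ∃ T : ℕ, ∀ x i, (T : ℝ) < |x i| → θ x = 0 := by
    obtain ⟨T, hT⟩ := exists_vanishesOutside (r := 1) (g := fun _ => θ)
      fun _ => hasCompactSupport_ofRealSmooth hχ hc
    exact ⟨T, fun x i hx => hT 0 x i hx⟩
  have hint : ∀ l : ℤ^d, Integrable fun x => θ (x + toR (-l)) * f x := fun l => by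
    obtain ⟨C, hC⟩ := (hasCompactSupport_ofRealSmooth hχ hc).exists_bound_of_continuous hθc
    exact hi.bdd_mul (hθc.comp (continuous_add_const _)).aestronglyMeasurable
      (Eventually.of_forall fun x => hC _)
  have h1 : ∀ x, χ x • periodization f x = ∑ l ∈ box d (T + R), θ x * f (x + toR l) := fun x => by
    rw [← mul_sum, Complex.real_smul]
    by_cases hx : ∀ i, |x i| ≤ T
    · rw [periodization_eq_sum hf (S := T + R) fun i => by push_cast; linarith [hx i]]
    · push Not at hx
      obtain ⟨i, hi⟩ := hx
      have h0 : θ x = 0 := hT x i hi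
      change θ x * _ = _
      rw [h0, zero_mul, zero_mul]
  have h2 : ∀ l : ℤ^d, ∫ x, θ x * f (x + toR l) = ∫ x, θ (x + toR (-l)) * f x := fun l => by
    rw [← integral_add_right_eq_self _ (toR (-l))]
    simp only [add_assoc, ← toR_add, neg_add_cancel, toR_zero, add_zero]
  have h3 : ∀ x, periodization θ x * f x = ∑ l ∈ box d (T + R), θ (x + toR (-l)) * f x := by
    intro x
    rw [← sum_mul]
    by_cases hx : ∀ i, |x i| ≤ R
    · rw [periodization_eq_sum hT (S := T + R) fun i => by push_cast; linarith [hx i]]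
      congr 1
      refine Finset.sum_equiv (Equiv.neg _) (fun l => ?_) fun l _ => ?_
      · simp [mem_box]
      · simp
    · push Not at hx
      obtain ⟨i, hi⟩ := hx
      rw [hf x i hi, mul_zero, mul_zero]
  simp only [h1]
  rw [integral_finsetSum]
  · simp only [h2]
    rw [← integral_finsetSum _ fun l _ => hint l]
    simp only [← h3]
    exact integral_mul_eq_zero_of_periodic hi h (continuous_periodization hT hθc)
      (periodization_add_toR θ)
  · intro l _
    have := (hint l).comp_add_right (toR l)
    simpa only [add_assoc, ← toR_add, add_neg_cancel, toR_zero, add_zero] using this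

theorem integral_expo_mul_eq_unitCube {b : ℝ^d → ℂ} (hi : Integrable b)
    (hb : ∀ x i, (R : ℝ) < |x i| → b x = 0) (h1 : ∀ x ∈ unitCube d, ∑ l ∈ box d (R + 1), b (x + toR
    l) = 1) (k : ℤ^d) : ∫ x, expo x ((2 * π) • toR k) * b x = ∫ x in unitCube d,
      expo x ((2 * π) • toR k) := by
  rw [integral_eq_setIntegral_unitCube (integrable_expo_mul hi _)
    fun x i hx => by rw [hb x i hx, mul_zero]]
  refine setIntegral_congr_fun measurableSet_unitCube fun x hx => ?_
  simp only [expo_add_toR_two_pi]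
  rw [← mul_sum, h1 x hx, mul_one]

theorem sum_box_tensorSpline_zero (hx : ∀ i, |x i| + 2 ≤ R) : ∑ l ∈ box d R,
      tensorSpline d 0 (x + toR l) = 1 := by
  have h1 : (fun _ => 1 : ℝ^d → ℂ) ∈ polySpace d (0 + 1) := by
    rw [← mono_zero_index]
    exact mono_mem (by simp [deg])
  have := sum_box_tensorSpline (m := 0) (R := R) (x := x)
    (fun i => by push_cast; linarith [hx i]) h1
  simpa using this

theorem integrable_tensorSpline (m : ℕ) : Integrable (tensorSpline d m) := by
  have h1 : SuppCube (r := 1) (m + 2) fun _ => tensorSpline d m := fun _ x i hx =>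
    tensorSpline_eq_zero i (by exact_mod_cast hx)
  exact (contDiff_tensorSpline m).continuous.integrable_of_hasCompactSupport
    (h1.hasCompactSupport 0)

theorem integral_unitCube_expo (hk : k ≠ 0) : ∫ x in unitCube d, expo x ((2 * π) • toR k) = 0 := by
  obtain ⟨i, hi⟩ := Function.ne_iff.1 hk
  have hi' : (k i : ℝ) ≠ 0 := by exact_mod_cast hi
  set s : ℝ^d := Pi.single i (2 * (k i : ℝ))⁻¹ with hs
  have hE : expo s ((2 * π) • toR k) = -1 := by
    rw [expo]
    have h3 : ∑ j, s j * ((2 * π) • toR k) j = π := by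
      rw [sum_eq_single i (fun j _ hj => by simp [hs, hj]) (by simp)]
      simp only [hs, Pi.single_eq_same, Pi.smul_apply, toR, smul_eq_mul]
      field_simp
    rw [h3, neg_mul, Complex.exp_neg, mul_comm, Complex.exp_pi_mul_I]
    norm_num
  have hsabs : ∀ j, |s j| ≤ 1 := fun j => by
    by_cases hj : j = i
    · subst hj
      have h1 : (1 : ℝ) ≤ |(k j : ℝ)| := by
        have : 1 ≤ |k j| := Int.one_le_abs hi
        exact_mod_cast this
      rw [hs, Pi.single_eq_same, abs_inv, abs_mul, abs_two]
      exact inv_le_one_of_one_le₀ (by linarith)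
    · simp [hs, hj]
  have hB := integrable_tensorSpline (d := d) 0
  have hb0 : ∀ x i, ((3 : ℕ) : ℝ) < |x i| → tensorSpline d 0 x = 0 := fun x i hx =>
    tensorSpline_eq_zero i (by push_cast at hx ⊢; linarith)
  have h1 := integral_expo_mul_eq_unitCube hB hb0 (fun x hx => sum_box_tensorSpline_zero
    fun i => by
      have := mem_unitCube.1 hx i
      rw [abs_of_nonneg this.1]
      push_cast
      linarith) k
  have h2 := integral_expo_mul_eq_unitCube (R := 3) (hB.comp_add_right s) (fun x i hx =>
      tensorSpline_eq_zero i (by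
        have := abs_sub (x i + s i) (s i)
        rw [add_sub_cancel_right] at this
        have h3 := hsabs i
        push_cast at hx ⊢
        change (0 : ℝ) + 2 < |x i + s i|
        linarith)) (fun x hx => by
      simp only [add_right_comm _ _ s]
      refine sum_box_tensorSpline_zero fun i => ?_
      have := mem_unitCube.1 hx i
      have h3 := hsabs i
      have h4 : |(x + s) i| ≤ |x i| + |s i| := abs_add_le _ _
      rw [abs_of_nonneg this.1] at h4
      push_cast
      linarith) k
  have h3 : ∫ x, expo x ((2 * π) • toR k) * tensorSpline d 0 x =
      -∫ x, expo x ((2 * π) • toR k) * tensorSpline d 0 (x + s) := by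
    rw [← integral_add_right_eq_self _ s, ← integral_neg]
    refine integral_congr_ae (Eventually.of_forall fun x => ?_)
    simp only [expo_add_left, hE]
    ring
  rw [h2, h1] at h3
  exact self_eq_neg.1 h3

/-- A compactly supported function whose Fourier transform vanishes on `2πℤ^d \ {0}` has a
constant periodization. -/
theorem periodization_ae_eq_integral (hi : Integrable f) (hf : ∀ x i, (R : ℝ) < |x i| → f x = 0)
    (h : ∀ k : ℤ^d, k ≠ 0 → ∫ x, expo x ((2 * π) • toR k) * f x = 0) : ∀ᵐ x, periodization f x =
      ∫ y, f y := by
  set c := ∫ y, f y with hc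
  have hB := integrable_tensorSpline (d := d) 0
  have hb0 : ∀ x i, ((R + 2 : ℕ) : ℝ) < |x i| → tensorSpline d 0 x = 0 := fun x i hx =>
    tensorSpline_eq_zero i (by push_cast at hx ⊢; linarith [(Nat.cast_nonneg R : (0 : ℝ) ≤ R)])
  have hcoef : ∀ k, ∫ x, expo x ((2 * π) • toR k) * tensorSpline d 0 x =
      ∫ x in unitCube d, expo x ((2 * π) • toR k) := fun k =>
    integral_expo_mul_eq_unitCube hB hb0 (fun x hx => sum_box_tensorSpline_zero fun i => by
      have := mem_unitCube.1 hx i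
      rw [abs_of_nonneg this.1]
      push_cast
      linarith [(Nat.cast_nonneg R : (0 : ℝ) ≤ R)]) k
  have hf' : ∀ x i, ((R + 2 : ℕ) : ℝ) < |x i| → f x - c * tensorSpline d 0 x = 0 := fun x i hx => by
    rw [hb0 x i hx, hf x i (by push_cast at hx; linarith), mul_zero, sub_zero]
  have h1 := periodization_ae_eq_zero (hi.sub (hB.const_mul c)) hf' fun k => by
    simp only [Pi.sub_apply, mul_sub, mul_left_comm _ c]
    rw [integral_sub (integrable_expo_mul hi _) ((integrable_expo_mul hB _).const_mul c),
      integral_const_mul, hcoef]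
    by_cases hk : k = 0
    · subst hk
      have h2 : toR (0 : ℤ^d) = 0 := toR_zero
      simp [h2, expo_zero_right, Measure.real, volume_unitCube, hc]
    · rw [h k hk, integral_unitCube_expo hk]
      simp
  filter_upwards [h1] with x hx
  obtain ⟨S, hS⟩ := exists_abs_add_le x (R + 2)
  change periodization (fun x => f x - c * tensorSpline d 0 x) x = 0 at hx
  rw [periodization_eq_sum hf' hS] at hx
  rw [periodization_eq_sum (S := S) hf fun i => by have := hS i; push_cast at this; linarith]
  have h3 := sum_box_tensorSpline_zero (R := S) (x := x) fun i => by
    have := hS i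
    push_cast at this
    linarith [(Nat.cast_nonneg R : (0 : ℝ) ≤ R)]
  rw [sum_sub_distrib, ← mul_sum, h3, mul_one] at hx
  exact sub_eq_zero.1 hx

end

section

/-! ### Fourier jets of compactly supported functions -/

variable {d r R A : ℕ} {q : ℝ^d → ℂ} {υ : Filt d 1 r} {ψ : Fin r → ℝ^d → ℂ}

theorem hasDerivAt_expo_line (y ξ η : ℝ^d) (j : Fin d) (t : ℝ) :
    HasDerivAt (fun t : ℝ => expo y (ξ + t • Pi.single j 1 + η)) (-I * y j *
      expo y (ξ + t • Pi.single j 1 + η)) t := by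
  have h2 : HasDerivAt (fun s : ℝ => expo y (ξ + t • Pi.single j 1 + η + s • Pi.single j 1))
      (-I * y j * expo y (ξ + t • Pi.single j 1 + η)) 0 :=
    hasLineDerivAt_expo y (ξ + t • Pi.single j 1 + η) j
  have h4 := HasDerivAt.comp_sub_const t t
    (f := fun s => expo y (ξ + t • Pi.single j 1 + η + s • Pi.single j 1))
    (by rw [sub_self]; exact h2)
  refine h4.congr_of_eventuallyEq (Eventually.of_forall fun t' => ?_)
  have h5 : ξ + t' • (Pi.single j 1 : ℝ^d) + η =
      ξ + t • Pi.single j 1 + η + (t' - t) • Pi.single j 1 := by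
    rw [sub_smul]
    abel
  simp only [h5]

theorem hasDerivAt_integral_of_bound {F F' : ℝ → ℝ^d → ℂ} {bound : ℝ^d → ℝ}
    (hF : ∀ t, AEStronglyMeasurable (F t) volume) (hi : Integrable (F 0))
    (hF' : AEStronglyMeasurable (F' 0) volume) (hb : ∀ y t, ‖F' t y‖ ≤ bound y)
    (hbi : Integrable bound) (hd : ∀ y t, HasDerivAt (fun t => F t y) (F' t y) t) :
    HasDerivAt (fun t => ∫ y, F t y) (∫ y, F' 0 y) 0 :=
  (hasDerivAt_integral_of_dominated_loc_of_deriv_le Filter.univ_mem (Eventually.of_forall hF) hi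
    hF' (Eventually.of_forall fun y t _ => hb y t) hbi
    (Eventually.of_forall fun y t _ => hd y t)).2

theorem pderiv_integral_expo (hi : Integrable q) (hq : ∀ x i, (R : ℝ) < |x i| → q x = 0) (η : ℝ^d)
    (j : Fin d) : pderiv j (fun ξ => ∫ y, q y * expo y (ξ + η)) = fun ξ => ∫ y,
      (-I * (y j : ℂ) * q y) * expo y (ξ + η) := by
  funext ξ
  have hmeas : ∀ ζ : ℝ^d, AEStronglyMeasurable (fun y => q y * expo y ζ) volume := fun ζ =>
    hi.aestronglyMeasurable.mul (continuous_expo ζ).aestronglyMeasurable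
  have hcoord : Continuous fun y : ℝ^d => -I * (y j : ℂ) :=
    continuous_const.mul (Complex.continuous_ofReal.comp (continuous_apply j))
  have hderiv : ∀ (y : ℝ^d) (t : ℝ), HasDerivAt
      (fun t : ℝ => q y * expo y (ξ + t • Pi.single j 1 + η))
      ((-I * (y j : ℂ) * q y) * expo y (ξ + t • Pi.single j 1 + η)) t := fun y t =>
    ((hasDerivAt_expo_line y ξ η j t).const_mul (q y)).congr_deriv (by ring)
  have hbound : ∀ (y : ℝ^d) (t : ℝ),
      ‖(-I * (y j : ℂ) * q y) * expo y (ξ + t • Pi.single j 1 + η)‖ ≤ R * ‖q y‖ := fun y t => by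
    rw [norm_mul, norm_mul, norm_mul, norm_expo, mul_one, norm_neg, Complex.norm_I, one_mul,
      Complex.norm_real]
    by_cases hy : |y j| ≤ R
    · exact mul_le_mul_of_nonneg_right hy (norm_nonneg _)
    · rw [hq y j (not_le.1 hy)]
      simp
  have hmeas' : AEStronglyMeasurable (fun y => (-I * (y j : ℂ) * q y) *
      expo y (ξ + (0 : ℝ) • Pi.single j 1 + η)) volume :=
    (hcoord.aestronglyMeasurable.mul hi.aestronglyMeasurable).mul
      (continuous_expo _).aestronglyMeasurable
  have hint : Integrable (fun y => q y * expo y (ξ + (0 : ℝ) • Pi.single j 1 + η)) :=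
    hi.mul_bdd (continuous_expo _).aestronglyMeasurable
      (Eventually.of_forall fun y => (norm_expo _ _).le)
  have h1 := hasDerivAt_integral_of_bound
    (F := fun t y => q y * expo y (ξ + t • (Pi.single j 1 : ℝ^d) + η))
    (F' := fun t y => (-I * (y j : ℂ) * q y) * expo y (ξ + t • (Pi.single j 1 : ℝ^d) + η))
    (fun t => hmeas _) hint hmeas' (fun y t => hbound y t) (hi.norm.const_mul _)
    fun y t => hderiv y t
  rw [zero_smul, add_zero] at h1
  have h5 : HasLineDerivAt ℝ (fun ξ => ∫ y, q y * expo y (ξ + η))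
      (∫ y, (-I * (y j : ℂ) * q y) * expo y (ξ + η)) ξ (Pi.single j 1) := by
    unfold HasLineDerivAt
    exact h1
  exact h5.lineDeriv

theorem integrable_continuous_mul {f : ℝ^d → ℂ} (hf : Continuous f) (hi : Integrable q)
    (hq : ∀ x i, (R : ℝ) < |x i| → q x = 0) : Integrable fun x => f x * q x := by
  obtain ⟨χ, hχc, hχ⟩ := exists_cutoff (d := d) R
  have hc : HasCompactSupport fun x => f x * (χ : ℝ^d → ℂ) x := hχc.mul_left
  have hcont : Continuous fun x => f x * (χ : ℝ^d → ℂ) x := hf.mul (contDiff_coe χ).continuous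
  obtain ⟨C, hC⟩ := hc.exists_bound_of_continuous hcont
  refine (hi.bdd_mul hcont.aestronglyMeasurable (Eventually.of_forall hC)).congr
    (Eventually.of_forall fun x => ?_)
  by_cases hx : ∀ i, |x i| ≤ R
  · have h1 : ‖x‖ ≤ R := (pi_norm_le_iff_of_nonneg (Nat.cast_nonneg R)).2 hx
    simp only [(hχ x h1).self_of_nhds, mul_one]
  · push Not at hx
    obtain ⟨i, hi⟩ := hx
    simp only [hq x i hi, mul_zero]

theorem mderiv_integral_expo (hi : Integrable q) (hq : ∀ x i, (R : ℝ) < |x i| → q x = 0) (η : ℝ^d)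
    (ν : Fin d → ℕ) : mderiv ν (fun ξ => ∫ y, q y * expo y (ξ + η)) 0 = (-I) ^ deg ν * ∫ y,
      expo y η * (mono ν y * q y) := by
  have h1 := mderiv_eq_of_multiplier (fun (j : Fin d) (y : ℝ^d) => -I * (y j : ℂ))
    (fun q ξ => ∫ y, q y * expo y (ξ + η))
    (Q := {q | Integrable q ∧ ∀ x i, (R : ℝ) < |x i| → q x = 0})
    (fun q hq j => ⟨integrable_continuous_mul (continuous_const.mul
      (Complex.continuous_ofReal.comp (continuous_apply j))) hq.1 hq.2,
      fun x i hx => by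
        have := hq.2 x i hx
        simp only [this, mul_zero]⟩)
    (fun q hq j => pderiv_integral_expo hq.1 hq.2 η j) ν (q := q) ⟨hi, hq⟩
  rw [h1, ← integral_const_mul]
  refine integral_congr_ae (Eventually.of_forall fun y => ?_)
  simp only [zero_add, mul_pow, Finset.prod_mul_distrib, Finset.prod_pow_eq_pow_sum, mono, deg]
  ring

/-- The function `∑_z υ(z) ψ(· - z)`. -/
def rowSum (υ : Filt d 1 r) (ψ : Fin r → ℝ^d → ℂ) (y : ℝ^d) : ℂ :=
  ∑ s ∈ υ.support ×ˢ (univ : Finset (Fin r)), υ s.1 0 s.2 * ψ s.2 (y - toR s.1)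

theorem rowSum_eq_zero (hA : SuppIn A υ) (hψ : SuppCube R ψ) (y : ℝ^d) (i : Fin d)
    (hy : ((R + A : ℕ) : ℝ) < |y i|) : rowSum υ ψ y = 0 := by
  refine sum_eq_zero fun s hs => ?_
  have h1 : |((s.1 i : ℤ) : ℝ)| ≤ A := by
    exact_mod_cast hA s.1 (Finsupp.mem_support_iff.1 (Finset.mem_product.1 hs).1) i
  rw [hψ s.2 _ i, mul_zero]
  change (R : ℝ) < |y i - s.1 i|
  have := abs_sub_abs_le_abs_sub (y i) (s.1 i)
  push_cast at hy
  linarith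

theorem integrable_rowSum (υ : Filt d 1 r) (hi : ∀ j, Integrable (ψ j)) : Integrable (rowSum υ ψ) :=
  integrable_finsetSum _ fun s _ => ((hi s.2).comp_sub_right (toR s.1)).const_mul _

theorem integral_rowSum_mul_expo (υ : Filt d 1 r) (hi : ∀ j, Integrable (ψ j)) (ξ : ℝ^d) :
    ∫ y, rowSum υ ψ y * expo y ξ = (fourierSeries υ ξ * vecFourier ψ ξ) 0 0 := by
  have hint : ∀ s : ℤ^d × Fin r, Integrable fun y =>
      (υ s.1 0 s.2 * ψ s.2 (y - toR s.1)) * expo y ξ := fun s =>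
    (((hi s.2).comp_sub_right (toR s.1)).const_mul _).mul_bdd
      (continuous_expo ξ).aestronglyMeasurable (Eventually.of_forall fun y => (norm_expo _ _).le)
  simp only [rowSum, sum_mul]
  rw [integral_finsetSum _ fun s _ => hint s, Finset.sum_product_right, Matrix.mul_apply]
  refine sum_congr rfl fun j _ => ?_
  rw [fourierSeries, Finsupp.sum, Matrix.sum_apply, sum_mul]
  refine sum_congr rfl fun z _ => ?_
  rw [← integral_add_right_eq_self _ (toR z)]
  simp only [add_sub_cancel_right, expo_add_left, vecFourier, Matrix.of_apply, Matrix.smul_apply,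
    smul_eq_mul]
  rw [← integral_const_mul]
  exact integral_congr_ae (Eventually.of_forall fun y => by ring)

theorem fourierSeries_add_two_pi {s t : ℕ} (v : Filt d s t) (ξ : ℝ^d) (k : ℤ^d) :
    fourierSeries v (ξ + (2 * π) • toR k) = fourierSeries v ξ := by
  rw [fourierSeries, fourierSeries]
  refine sum_congr rfl fun z _ => ?_
  change expo _ _ • _ = expo _ _ • _
  rw [expo_add_right, expo_toR_two_pi, mul_one]

theorem sum_box_sub {S : ℕ} {f : ℤ^d → ℂ} (hf : ∀ k, f k ≠ 0 → k ∈ box d S) {z : ℤ^d}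
    (hz : ∀ i, |z i| ≤ A) : ∑ l ∈ box d (S + A), f (l - z) = ∑ k ∈ box d S, f k := by
  rw [← finsum_eq_sum_of_support_subset _ fun k hk => hf k hk, ← finsum_eq_sum_of_support_subset]
  · exact finsum_comp_equiv (Equiv.subRight z) (f := f)
  · intro l hl
    have h1 := mem_box.1 (hf _ hl)
    refine mem_box.2 fun i => ?_
    have h2 : |l i| ≤ |(l - z) i| + |z i| := by
      have := abs_add_le (l i - z i) (z i)
      rwa [sub_add_cancel] at this
    push_cast
    linarith [h1 i, hz i]

theorem moment_samp_eq_periodization (hψ : SuppCube R ψ) (p : ℝ^d → ℂ) (x : ℝ^d) :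
    moment υ (samp ψ x) p = periodization (fun y => p (y - x) * rowSum υ ψ y) x := by
  obtain ⟨A, hA⟩ := exists_suppIn υ
  obtain ⟨S, hS⟩ := exists_abs_add_le x R
  rw [moment_samp hψ υ x (F := box d S) fun j k hk => hψ.mem_box hS hk,
    periodization_eq_sum (R := R + A) (S := S + A) (fun y i hy => by
      rw [rowSum_eq_zero hA hψ y i hy, mul_zero]) (fun i => by have := hS i; push_cast; linarith)]
  simp only [rowSum, add_sub_cancel_left, mul_sum]
  rw [sum_comm (s := box d (S + A)), sum_product]
  refine sum_congr rfl fun z hz => sum_congr rfl fun j _ => ?_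
  rw [← sum_box_sub (z := z) (A := A)]
  · refine sum_congr rfl fun l _ => ?_
    rw [← toR_add, add_sub_cancel, toR_sub, add_sub_assoc]
    ring
  · exact fun k hk => hψ.mem_box hS (right_ne_zero_of_mul hk)
  · exact hA z (Finsupp.mem_support_iff.1 hz)

/-- The samples of an admissible function have the moments of a distribution concentrated at a
point, almost everywhere. -/
theorem Admissible.exists_moment_samp {N : ℕ} (hψ : SuppCube R ψ) (hi : ∀ j, Integrable (ψ j))
    (h : Admissible N υ ψ) : ∃ Λ : polySpace d N →ₗ[ℂ] ℂ, (∀ q : polySpace d N, (q : ℝ^d → ℂ) =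
      (fun _ => 1) → Λ q = 1) ∧ ∀ᵐ x, ∀ p ∈ polySpace d N, ∀ q : polySpace d N,
      (∀ y, (q : ℝ^d → ℂ) y = p (y - x)) → moment υ (samp ψ x) p = Λ q := by
  obtain ⟨A, hA⟩ := exists_suppIn υ
  have hv := rowSum_eq_zero hA hψ
  have hH := integrable_rowSum υ hi
  have hint : ∀ q ∈ polySpace d N, Integrable fun y => q y * rowSum υ ψ y := fun q hq =>
    integrable_continuous_mul (continuous_of_mem_polySpace hq) hH hv
  let Λ : polySpace d N →ₗ[ℂ] ℂ :=
    { toFun := fun q => ∫ y, (q : ℝ^d → ℂ) y * rowSum υ ψ y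
      map_add' := fun p q => by
        rw [← integral_add (hint p p.2) (hint q q.2)]
        simp only [Submodule.coe_add, Pi.add_apply, add_mul]
      map_smul' := fun c q => by
        rw [RingHom.id_apply, smul_eq_mul, ← integral_const_mul]
        simp only [Submodule.coe_smul, Pi.smul_apply, smul_eq_mul, mul_assoc] }
  refine ⟨Λ, fun q hq => ?_, ?_⟩
  · change ∫ y, (q : ℝ^d → ℂ) y * rowSum υ ψ y = 1
    have h1 := integral_rowSum_mul_expo υ hi 0
    rw [h.1, Matrix.one_apply_eq] at h1
    rw [hq]
    simpa only [expo_zero_right, one_mul, mul_one] using h1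
  have hcoef : ∀ ν : Fin d → ℕ, deg ν < N → ∀ k : ℤ^d, k ≠ 0 →
      ∫ y, expo y ((2 * π) • toR k) * (mono ν y * rowSum υ ψ y) = 0 := fun ν hν k hk => by
    have h1 := mderiv_integral_expo hH hv ((2 * π) • toR k) ν
    have h2 := h.2 k hk ν hν 0 0
    have h3 : (fun ξ => (fourierSeries υ ξ * vecFourier ψ (ξ + (2 * π) • toR k)) 0 0) =
        fun ξ => ∫ y, rowSum υ ψ y * expo y (ξ + (2 * π) • toR k) := by
      funext ξ
      rw [integral_rowSum_mul_expo υ hi, fourierSeries_add_two_pi]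
    rw [h3, h1] at h2
    have h4 : mderiv ν (fun ξ => (0 : ℝ^d → Mat 1 1) ξ 0 0) 0 = 0 := mderiv_zero_fun ν
    rw [h4] at h2
    exact (mul_eq_zero.1 h2).resolve_left (neg_I_pow_ne_zero _)
  have hae : ∀ᵐ x, ∀ ν ∈ {ν : Fin d → ℕ | deg ν < N},
      periodization (fun y => mono ν y * rowSum υ ψ y) x = ∫ y, mono ν y * rowSum υ ψ y := by
    rw [ae_ball_iff (finite_deg_lt N).countable]
    intro ν hν
    exact periodization_ae_eq_integral (hint _ (mono_mem hν))
      (fun x i hx => by rw [hv x i hx, mul_zero]) (hcoef ν hν)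
  filter_upwards [hae] with x hx p hp q hq
  rw [moment_samp_eq_periodization hψ]
  simp only [← hq]
  obtain ⟨S, hS⟩ := exists_abs_add_le x (R + A)
  have hsum : ∀ f : ℝ^d → ℂ, periodization (fun y => f y * rowSum υ ψ y) x =
      ∑ l ∈ box d S, f (x + toR l) * rowSum υ ψ (x + toR l) := fun f =>
    periodization_eq_sum (fun y i hy => by rw [hv y i hy, mul_zero]) hS
  let W : Submodule ℂ (ℝ^d → ℂ) :=
    { carrier := {f | Integrable (fun y => f y * rowSum υ ψ y) ∧
        periodization (fun y => f y * rowSum υ ψ y) x = ∫ y, f y * rowSum υ ψ y}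
      add_mem' := fun {f g} hf hg => by
        rw [Set.mem_ofPred_eq, hsum] at hf hg ⊢
        simp only [Pi.add_apply, add_mul, sum_add_distrib]
        exact ⟨hf.1.add hg.1, by rw [integral_add hf.1 hg.1, hf.2, hg.2]⟩
      zero_mem' := by
        rw [Set.mem_ofPred_eq, hsum]
        simp
      smul_mem' := fun c f hf => by
        rw [Set.mem_ofPred_eq, hsum] at hf ⊢
        simp only [Pi.smul_apply, smul_eq_mul, mul_assoc, ← mul_sum]
        exact ⟨hf.1.const_mul c, by rw [integral_const_mul, hf.2]⟩ }
  have hW : polySpace d N ≤ W := polySpace_le fun ν hν => ⟨hint _ (mono_mem hν), hx ν hν⟩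
  exact (hW q.2).2

end

section

/-! ### Weak derivatives -/

variable {d r R : ℕ} {f θ h : ℝ^d → ℂ} {μ : Fin d → ℕ} {L : ℝ}

theorem foldr_replicate_pderiv (n : ℕ) (j : Fin d) (f : ℝ^d → ℂ) :
    (List.replicate n j).foldr pderiv f = (pderiv j)^[n] f := by
  induction n with
  | zero => rfl
  | succ n ih => rw [List.replicate_succ, List.foldr_cons, ih, Function.iterate_succ_apply']

theorem exists_mderiv_eq_wderiv (μ : Fin d → ℕ) : ∃ l : List (Fin d), l.length = deg μ ∧ ∀ f,
      mderiv μ f = wderiv l f := by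
  refine ⟨(List.finRange d).flatMap fun j => List.replicate (μ j) j, ?_, fun f => ?_⟩
  · simp [List.length_flatMap, deg, Fin.sum_univ_def]
  · simp only [wderiv, List.foldr_flatMap, foldr_replicate_pderiv, mderiv]

theorem contDiff_wderiv_of_add {n : ℕ} (l : List (Fin d)) (hf : ContDiff ℝ (n + l.length : ℕ) f) :
    ContDiff ℝ n (wderiv l f) := by
  induction l generalizing n with
  | nil => exact hf
  | cons j l ih =>
    have h : ContDiff ℝ (n + 1 : ℕ) (wderiv l f) :=
      ih (by rw [List.length_cons] at hf; rwa [add_right_comm, add_assoc])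
    have h1 : wderiv (j :: l) f = fun x => fderiv ℝ (wderiv l f) x (Pi.single j 1) :=
        funext fun x =>
      (h.differentiable (by simp)).differentiableAt.lineDeriv_eq_fderiv
    rw [h1]
    exact (h.fderiv_right (m := n) (by simp)).clm_apply contDiff_const

theorem pderiv_comm (hf : ContDiff ℝ ∞ f) (i j : Fin d) : pderiv i (pderiv j f) =
      pderiv j (pderiv i f) := by
  have h : ∀ i j, pderiv i (pderiv j f) =
      fun x => fderiv ℝ (fderiv ℝ f) x (Pi.single i 1) (Pi.single j 1) := fun i j => by
    rw [pderiv_eq_fderiv (contDiff_pderiv hf j), pderiv_eq_fderiv hf]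
    funext x
    rw [fderiv_clm_apply (((hf.fderiv_right (m := ∞) (by simp)).differentiable (by simp)) x)
      (differentiableAt_const _)]
    simp
  rw [h, h]
  funext x
  exact (hf.contDiffAt.isSymmSndFDerivAt (by
    rw [minSmoothness_of_isRCLikeNormedField]
    exact WithTop.coe_le_coe.2 (le_top (a := (2 : ℕ∞))))) _ _

theorem wderiv_pderiv (hf : ContDiff ℝ ∞ f) (l : List (Fin d)) (j : Fin d) : wderiv l (pderiv j f) =
      pderiv j (wderiv l f) := by
  induction l with
  | nil => rfl
  | cons i l ih =>
    change pderiv i (wderiv l (pderiv j f)) = pderiv j (pderiv i (wderiv l f))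
    rw [ih, pderiv_comm (contDiff_wderiv hf l)]

theorem integral_mul_wderiv (l : List (Fin d)) (hf : ContDiff ℝ (l.length : ℕ) f)
    (hθ : ContDiff ℝ ∞ θ) (hc : HasCompactSupport θ) : ∫ x, f x * wderiv l θ x = (-1) ^ l.length *
      ∫ x, wderiv l f x * θ x := by
  induction l generalizing θ with
  | nil => simp [wderiv]
  | cons j l ih =>
    have hl : ContDiff ℝ (1 : ℕ) (wderiv l f) := contDiff_wderiv_of_add l
      (by rwa [List.length_cons, add_comm] at hf)
    have hd := hl.differentiable (by simp)
    have h1 : wderiv (j :: l) f = fun x => fderiv ℝ (wderiv l f) x (Pi.single j 1) :=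
        funext fun x =>
      (hd x).lineDeriv_eq_fderiv
    have h2 : Continuous fun x => fderiv ℝ (wderiv l f) x (Pi.single j 1) :=
      (hl.continuous_fderiv (by simp)).clm_apply continuous_const
    have h3 : wderiv (j :: l) θ = wderiv l (pderiv j θ) := (wderiv_pderiv hθ l j).symm
    have hjc : HasCompactSupport (pderiv j θ) := hasCompactSupport_wderiv hθ hc [j]
    have hjd := contDiff_pderiv hθ j
    rw [h3, ih (hf.of_le (by simp)) hjd hjc, h1, pderiv_eq_fderiv hθ,
      integral_mul_fderiv_eq_neg_fderiv_mul_of_integrable, List.length_cons, pow_succ]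
    · ring
    · exact (h2.mul hθ.continuous).integrable_of_hasCompactSupport hc.mul_left
    · have := congrFun (pderiv_eq_fderiv hθ j)
      simp only [← this]
      exact (hl.continuous.mul hjd.continuous).integrable_of_hasCompactSupport hjc.mul_left
    · exact (hl.continuous.mul hθ.continuous).integrable_of_hasCompactSupport hc.mul_left
    · exact fun x _ => hd x
    · exact fun x _ => hθ.differentiable (by simp) x

theorem isWeakDeriv_mderiv (hf : ContDiff ℝ (deg μ : ℕ) f) : IsWeakDeriv μ f (mderiv μ f) :=
  fun θ hθ hc => by
  obtain ⟨l, hl, h⟩ := exists_mderiv_eq_wderiv μ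
  rw [h, h, ← hl]
  exact integral_mul_wderiv l (by rwa [hl]) hθ hc

theorem contDiff_mderiv (hf : ContDiff ℝ ∞ f) (μ : Fin d → ℕ) : ContDiff ℝ ∞ (mderiv μ f) := by
  obtain ⟨l, -, h⟩ := exists_mderiv_eq_wderiv μ
  exact h f ▸ contDiff_wderiv hf l

theorem hasCompactSupport_mderiv (hf : ContDiff ℝ ∞ f) (hc : HasCompactSupport f) (μ : Fin d → ℕ) :
    HasCompactSupport (mderiv μ f) := by
  obtain ⟨l, -, h⟩ := exists_mderiv_eq_wderiv μ
  exact h f ▸ hasCompactSupport_wderiv hf hc l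

theorem integrable_mul_of_hasCompactSupport (hf : Integrable f) (hθ : Continuous θ)
    (hc : HasCompactSupport θ) : Integrable fun x => f x * θ x := by
  obtain ⟨C, hC⟩ := hc.exists_bound_of_continuous hθ
  exact hf.mul_bdd hθ.aestronglyMeasurable (Eventually.of_forall hC)

theorem IsWeakDeriv.sum {ι : Type*} (S : Finset ι) (c : ι → ℂ) {f h : ι → ℝ^d → ℂ}
    (hf : ∀ s ∈ S, Integrable (f s)) (hh : ∀ s ∈ S, Integrable (h s))
    (hw : ∀ s ∈ S, IsWeakDeriv μ (f s) (h s)) : IsWeakDeriv μ (fun x => ∑ s ∈ S, c s * f s x)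
      (fun x => ∑ s ∈ S, c s * h s x) := fun θ hθ hc => by
  have key : ∀ (F : ι → ℝ^d → ℂ) (η : ℝ^d → ℂ), (∀ s ∈ S, Integrable (F s)) →
      Continuous η → HasCompactSupport η →
      ∫ x, (∑ s ∈ S, c s * F s x) * η x = ∑ s ∈ S, c s * ∫ x, F s x * η x := fun F η hF hη hηc => by
    simp only [sum_mul, mul_assoc]
    rw [integral_finsetSum _ fun s hs =>
      (integrable_mul_of_hasCompactSupport (hF s hs) hη hηc).const_mul _]
    simp only [integral_const_mul]
  rw [key f _ hf (contDiff_mderiv hθ μ).continuous (hasCompactSupport_mderiv hθ hc μ),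
    key h _ hh hθ.continuous hc, mul_sum]
  exact sum_congr rfl fun s hs => by rw [hw s hs θ hθ hc, mul_left_comm]

theorem integral_comp_smul_add (hL : 0 < L) (t : ℝ^d) (f : ℝ^d → ℂ) : ∫ x, f (L • x + t) =
      ((L ^ d)⁻¹ : ℝ) • ∫ x, f x := by
  rw [Measure.integral_comp_smul volume (fun y => f (y + t)) L, integral_add_right_eq_self f t]
  rw [Module.finrank_fin_fun, abs_of_pos (by positivity)]

theorem IsWeakDeriv.comp_smul_add (hw : IsWeakDeriv μ f h) (hL : 0 < L) (t : ℝ^d) :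
    IsWeakDeriv μ (fun x => f (L • x + t)) (fun x => (L : ℂ) ^ deg μ * h (L • x + t)) :=
  fun θ hθ hc => by
  set η : ℝ^d → ℂ := fun y => θ (L⁻¹ • y - L⁻¹ • t)
  have hηd : ContDiff ℝ ∞ η := hθ.comp ((contDiff_id.const_smul _).sub contDiff_const)
  have hinv : ∀ x, L⁻¹ • (L • x + t) - L⁻¹ • t = x := fun x => by
    rw [smul_add, add_sub_cancel_right, smul_smul, inv_mul_cancel₀ hL.ne', one_smul]
  have hηc : HasCompactSupport η := by
    have := hc.comp_homeomorph ((Homeomorph.smulOfNeZero L⁻¹ (inv_pos.2 hL).ne').trans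
      (Homeomorph.addRight (-(L⁻¹ • t))))
    exact (funext fun y => congrArg θ (sub_eq_add_neg _ _) : η = _) ▸ this
  have hη : ∀ x, η (L • x + t) = θ x := fun x => congrArg θ (hinv x)
  have hdη : ∀ x, mderiv μ θ x = (L : ℂ) ^ deg μ * mderiv μ η (L • x + t) := fun x => by
    rw [mderiv_eq_iteratedFDeriv (hηd.of_le (by exact_mod_cast le_top)),
      iteratedFDeriv_comp_smul_sub (hθ.of_le (by exact_mod_cast le_top)), hinv,
      mderiv_eq_iteratedFDeriv (hθ.of_le (by exact_mod_cast le_top)), ← mul_assoc, ← mul_pow,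
      Complex.ofReal_inv, mul_inv_cancel₀ (by exact_mod_cast hL.ne'), one_pow, one_mul]
  have h1 : ∀ x, f (L • x + t) * mderiv μ θ x =
      (L : ℂ) ^ deg μ * (fun y => f y * mderiv μ η y) (L • x + t) := fun x => by rw [hdη]; ring
  have h2 : ∀ x, (L : ℂ) ^ deg μ * h (L • x + t) * θ x =
      (L : ℂ) ^ deg μ * (fun y => h y * η y) (L • x + t) := fun x => by
    beta_reduce
    rw [hη, mul_assoc]
  rw [integral_congr_ae (ae_of_all _ h1), integral_congr_ae (ae_of_all _ h2), integral_const_mul,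
    integral_const_mul, integral_comp_smul_add hL t fun y => f y * mderiv μ η y,
    integral_comp_smul_add hL t fun y => h y * η y, hw η hηd hηc,
    Complex.real_smul, Complex.real_smul]
  ring

theorem IsWeakDeriv.ae_eq_zero (hw : IsWeakDeriv μ f h) (hh : LocallyIntegrable h) {U : Set ℝ^d}
    (hU : IsOpen U) (hf : ∀ᵐ x, x ∈ U → f x = 0) : ∀ᵐ x, x ∈ U → h x = 0 := by
  refine hU.ae_eq_zero_of_integral_contDiff_smul_eq_zero (hh.locallyIntegrableOn U)
    fun χ hχ hχc hχU => ?_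
  have hc := hasCompactSupport_ofRealSmooth hχ hχc
  have h1 := hw _ (contDiff_coe (ofRealSmooth hχ)) hc
  have h2 : ∫ x, f x * mderiv μ (ofRealSmooth hχ : ℝ^d → ℂ) x = 0 := by
    refine integral_eq_zero_of_ae ?_
    filter_upwards [hf] with x hx
    by_cases hxU : x ∈ U
    · rw [hx hxU, zero_mul, Pi.zero_apply]
    · obtain ⟨l, -, hl⟩ := exists_mderiv_eq_wderiv μ
      have h3 : (ofRealSmooth hχ : ℝ^d → ℂ) =ᶠ[𝓝 x] fun _ => 0 := by
        have := notMem_tsupport_iff_eventuallyEq.1 fun hx' => hxU (hχU hx')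
        filter_upwards [this] with y hy
        change ((χ y : ℝ) : ℂ) = 0
        rw [hy]
        simp
      rw [hl, wderiv_eq_zero (contDiff_coe _) l h3, mul_zero, Pi.zero_apply]
  rw [h2] at h1
  have h4 := (mul_eq_zero.1 h1.symm).resolve_left (pow_ne_zero _ (by norm_num))
  rw [← h4]
  refine integral_congr_ae (Eventually.of_forall fun x => ?_)
  change χ x • h x = h x * ((χ x : ℝ) : ℂ)
  rw [Complex.real_smul, mul_comm]

theorem integrable_of_bound (hm : AEStronglyMeasurable h volume) {M : ℝ} (hM : ∀ᵐ x, ‖h x‖ ≤ M)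
    (hR : ∀ x i, (R : ℝ) < |x i| → h x = 0) : Integrable h := by
  have hs : Function.support h ⊆ closedBall 0 (R : ℝ) := fun x hx => by
    rw [mem_closedBall_zero_iff, pi_norm_le_iff_of_nonneg (by positivity)]
    exact fun i => not_lt.1 fun hi => hx (hR x i hi)
  rw [← integrableOn_iff_integrable_of_support_subset hs]
  exact Measure.integrableOn_of_bounded (measure_closedBall_lt_top.ne) hm (ae_restrict_of_ae hM)

theorem _root_.MeasureTheory.MemLp.ae_norm_le_toReal (hh : MemLp h ⊤ volume) : ∀ᵐ x, ‖h x‖ ≤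
      (eLpNorm h ⊤ volume).toReal := by
  have h1 := ae_le_eLpNormEssSup (f := h) (μ := volume)
  rw [← eLpNorm_exponent_top] at h1
  filter_upwards [h1] with x hx
  rw [← toReal_enorm]
  exact ENNReal.toReal_mono hh.2.ne hx

theorem IsWeakDeriv.exists_bounded (hw : IsWeakDeriv μ f h) (hh : MemLp h ⊤ volume)
    (hf : ∀ x i, (R : ℝ) < |x i| → f x = 0) : ∃ (h' : ℝ^d → ℂ) (M : ℝ), 0 ≤ M ∧ Measurable h' ∧
      (∀ x, ‖h' x‖ ≤ M) ∧ (∀ x i, (R : ℝ) < |x i| → h' x = 0) ∧ IsWeakDeriv μ f h' := by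
  set M := (eLpNorm h ⊤ volume).toReal
  set k := hh.1.mk h
  set E : Set ℝ^d := {x | ‖k x‖ ≤ M} ∩ {x | ∀ i, |x i| ≤ (R : ℝ)}
  have hk : Measurable k := hh.1.stronglyMeasurable_mk.measurable
  have hcl : IsClosed {x : ℝ^d | ∀ i, |x i| ≤ (R : ℝ)} := by
    simp only [Set.ofPred_forall]
    exact isClosed_iInter fun i => isClosed_le (continuous_apply i).abs continuous_const
  have hE : MeasurableSet E := (measurableSet_le hk.norm measurable_const).inter hcl.measurableSet
  have hz : ∀ᵐ x, x ∈ {x : ℝ^d | ∀ i, |x i| ≤ (R : ℝ)}ᶜ → h x = 0 := by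
    refine hw.ae_eq_zero (hh.locallyIntegrable le_top) hcl.isOpen_compl
      (Eventually.of_forall fun x hx => ?_)
    simp only [Set.mem_compl_iff, Set.mem_ofPred_eq, not_forall, not_le] at hx
    exact hf x _ hx.choose_spec
  have hae : h =ᵐ[volume] E.indicator k := by
    filter_upwards [hh.1.ae_eq_mk, hh.ae_norm_le_toReal, hz] with x h1 h2 h3
    by_cases hx : x ∈ {x : ℝ^d | ∀ i, |x i| ≤ (R : ℝ)}
    · rw [Set.indicator_of_mem (show x ∈ E from ⟨by
        rw [h1] at h2
        exact h2, hx⟩), h1]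
    · rw [Set.indicator_of_notMem (fun h => hx h.2), h3 hx]
  refine ⟨E.indicator k, M, ENNReal.toReal_nonneg, hk.indicator hE, fun x => ?_,
    fun x i hx => Set.indicator_of_notMem (fun h => not_lt.2 (h.2 i) hx) _, fun θ hθ hc => ?_⟩
  · by_cases hx : x ∈ E
    · rw [Set.indicator_of_mem hx]
      exact hx.1
    · rw [Set.indicator_of_notMem hx, norm_zero]
      exact ENNReal.toReal_nonneg
  · rw [hw θ hθ hc]
    congr 1
    refine integral_congr_ae ?_
    filter_upwards [hae] with x hx
    rw [hx]

theorem ae_comp_smul_add (hL : 0 < L) (t : ℝ^d) {P : ℝ^d → Prop} (h : ∀ᵐ x, P x) : ∀ᵐ x : ℝ^d,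
      P (L • x + t) := by
  have h1 : ∀ᵐ x : ℝ^d, P (x + t) :=
    (measurePreserving_add_right volume t).quasiMeasurePreserving.ae h
  rw [ae_iff] at h1 ⊢
  have := Measure.addHaar_preimage_smul volume hL.ne' {a : ℝ^d | ¬P (a + t)}
  rw [h1, mul_zero] at this
  exact this

end

section

/-! ### Cascade iterations of bounded functions -/

variable {d r lam n R N : ℕ} {f g F H : Fin r → ℝ^d → ℂ} {μ : Fin d → ℕ} {ε : ℝ} {a : Filt d r r}

theorem cascade_iterate_apply_eq_sum (lam : ℕ) (a : Filt d r r) (f : Fin r → ℝ^d → ℂ) (n : ℕ)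
    (i : Fin r) (x : ℝ^d) : (cascade lam a)^[n] f i x = ∑ s ∈ (mask lam a n).support ×ˢ univ,
      mask lam a n s.1 i s.2 * f s.2 (((lam : ℝ) ^ n) • x + -toR s.1) := by
  have h := congrFun (congrFun (col_cascade_iterate lam a f n x) i) 0
  rw [pairing_def, Matrix.sum_apply] at h
  rw [sum_product]
  simpa [col, Matrix.mul_apply, sub_eq_add_neg] using h

/-- The combination `∑ᵢ cᵢ f(· - tᵢ)` of translates of `f`. -/
def translates {n : ℕ} (c : Fin n → ℂ) (t : Fin n → ℝ^d) (f : Fin r → ℝ^d → ℂ) : Fin r → ℝ^d → ℂ :=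
  fun j x => ∑ i, c i * f j (x - t i)

theorem cascade_iterate_translates [NeZero lam] (a : Filt d r r) (c : Fin n → ℂ) (t : Fin n → ℝ^d)
    (f : Fin r → ℝ^d → ℂ) (k : ℕ) : (cascade lam a)^[k] (translates c t f) =
      translates c (fun i => ((lam : ℝ) ^ k)⁻¹ • t i) ((cascade lam a)^[k] f) := by
  have hl : (lam : ℝ) ^ k ≠ 0 := pow_ne_zero _ (by exact_mod_cast NeZero.ne lam)
  funext j x
  simp only [translates, cascade_iterate_apply_eq_sum, mul_sum]
  rw [sum_comm]
  refine sum_congr rfl fun i _ => sum_congr rfl fun s _ => ?_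
  rw [smul_sub, smul_smul, mul_inv_cancel₀ hl, one_smul, mul_left_comm, sub_add_eq_add_sub]

theorem SuppCube.translates (hf : SuppCube R f) (c : Fin n → ℂ) (t : Fin n → ℝ^d) :
    ∃ R', SuppCube R' (translates c t f) := by
  obtain ⟨T, hT⟩ := exists_nat_ge ‖t‖
  refine ⟨R + T, fun j x l hx => sum_eq_zero fun i _ => ?_⟩
  rw [hf j _ l, mul_zero]
  have h1 : |t i l| ≤ T := ((norm_le_pi_norm (t i) l).trans (norm_le_pi_norm t i)).trans hT
  have h2 := abs_sub_abs_le_abs_sub (x l) (t i l)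
  push_cast at hx
  change _ < |x l - t i l|
  linarith

theorem contDiff_translates (c : Fin n → ℂ) (t : Fin n → ℝ^d) {k : ℕ∞ω}
    (hf : ∀ j, ContDiff ℝ k (f j)) (j : Fin r) : ContDiff ℝ k (translates c t f j) :=
  ContDiff.sum fun _ _ => contDiff_const.mul ((hf j).comp (contDiff_id.sub contDiff_const))

theorem moment_samp_translates (hf : SuppCube R f) (c : Fin n → ℂ) (t : Fin n → ℝ^d)
    (υ : Filt d 1 r) (x : ℝ^d) (p : ℝ^d → ℂ) : moment υ (samp (translates c t f) x) p = ∑ i,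
      c i * moment υ (samp f (x - t i)) p := by
  obtain ⟨R', hR'⟩ := hf.translates c t
  obtain ⟨S, hS⟩ := exists_abs_add_le x R'
  choose S' hS' using fun i => exists_abs_add_le (x - t i) R
  let F := box d S ∪ Finset.univ.biUnion fun i => box d (S' i)
  rw [moment_samp hR' υ x (F := F) fun j k hk => Finset.mem_union_left _ (hR'.mem_box hS hk)]
  have h : ∀ i, moment υ (samp f (x - t i)) p = ∑ z ∈ υ.support, ∑ j, ∑ k ∈ F,
      (υ z 0 j * p (toR z + toR k)) * f j (x - t i + toR k) := fun i =>
    moment_samp hf υ _ (fun j k hk => Finset.mem_union_right _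
      (Finset.mem_biUnion.2 ⟨i, mem_univ _, hf.mem_box (hS' i) hk⟩)) p
  simp only [h, translates, mul_sum]
  conv_rhs => rw [sum_comm]
  refine sum_congr rfl fun z _ => ?_
  conv_rhs => rw [sum_comm]
  refine sum_congr rfl fun j _ => ?_
  conv_rhs => rw [sum_comm]
  refine sum_congr rfl fun k _ => sum_congr rfl fun i _ => ?_
  rw [mul_left_comm, sub_add_eq_add_sub]

theorem norm_iteratedFDeriv_dirs_sub_le {f g : ℝ^d → ℂ} {x : ℝ^d}
    (h : ‖iteratedFDeriv ℝ (deg μ) f x - iteratedFDeriv ℝ (deg μ) g x‖ ≤ ε) :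
    ‖iteratedFDeriv ℝ (deg μ) f x (dirs μ) - iteratedFDeriv ℝ (deg μ) g x (dirs μ)‖ ≤ ε := by
  rw [← sub_apply]
  exact (ContinuousMultilinearMap.unit_le_opNorm _
    ((pi_norm_le_iff_of_nonneg zero_le_one).2 (norm_dirs_le μ))).trans h

theorem SuppCube.uniformContinuous_dirDeriv {q : ℕ} (hg : SuppCube R g)
    (hgs : ∀ j, ContDiff ℝ q (g j)) (v : Fin q → ℝ^d) (j : Fin r) :
    UniformContinuous (VectorSubdivision.dirDeriv q v g j) := by
  refine ((hg.dirDeriv _ _).hasCompactSupport j).uniformContinuous_of_continuous ?_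
  exact (ContinuousMultilinearMap.apply ℝ (fun _ : Fin q => ℝ^d) ℂ v).continuous.comp
    ((hgs j).continuous_iteratedFDeriv le_rfl)

theorem mderiv_cascade_translates_tendsto {m : ℕ} [NeZero lam] (hlam : 2 ≤ lam)
    {ψ : Fin r → ℝ^d → ℂ} (hψ : ∀ j, ContDiff ℝ ∞ (ψ j)) (hg : SuppCube R g)
    (hgs : ∀ j, ContDiff ℝ m (g j)) (h : ∀ q ≤ m, ∀ ε > 0, ∀ᶠ n in atTop, ∀ j x, ‖iteratedFDeriv ℝ q
    ((cascade lam a)^[n] ψ j) x - iteratedFDeriv ℝ q (g j) x‖ ≤ ε) {k : ℕ} {c : Fin k → ℂ}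
    (hc : ∑ i, c i = 1) (t : Fin k → ℝ^d) (hμ : deg μ ≤ m) (hε : 0 < ε) : ∀ᶠ n in atTop, ∀ j x,
      ‖mderiv μ ((cascade lam a)^[n] (translates c t ψ) j - g j) x‖ ≤ ε := by
  set K := ∑ i, ‖c i‖
  have hK : 0 ≤ K := by positivity
  have hδ : 0 < ε / (2 * (K + 1)) := by positivity
  set δ := ε / (2 * (K + 1))
  have hgq : ∀ j, ContDiff ℝ (deg μ : ℕ) (g j) := fun j => (hgs j).of_le (by exact_mod_cast hμ)
  have huc : ∃ η > 0, ∀ j x y, dist x y < η →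
      ‖iteratedFDeriv ℝ (deg μ) (g j) x (dirs μ) - iteratedFDeriv ℝ (deg μ) (g j) y (dirs μ)‖
        ≤ δ := by
    have h1 := fun j => Metric.uniformContinuous_iff.1
      (hg.uniformContinuous_dirDeriv hgq (dirs μ) j) δ hδ
    choose η hη hη' using h1
    rcases isEmpty_or_nonempty (Fin r) with hr | hr
    · exact ⟨1, one_pos, fun j => isEmptyElim j⟩
    refine ⟨Finset.univ.inf' Finset.univ_nonempty η, (Finset.lt_inf'_iff _).2 fun j _ => hη j,
      fun j x y hxy => ?_⟩
    rw [← dist_eq_norm]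
    exact (hη' j (hxy.trans_le (Finset.inf'_le _ (mem_univ j)))).le
  obtain ⟨η, hη, huc⟩ := huc
  have hsmall : ∀ᶠ n in atTop, ((lam : ℝ) ^ n)⁻¹ * ‖t‖ < η := by
    have h1 : Tendsto (fun n : ℕ => ((lam : ℝ)⁻¹) ^ n * ‖t‖) atTop (𝓝 (0 * ‖t‖)) :=
      (tendsto_pow_atTop_nhds_zero_of_lt_one (by positivity)
        (inv_lt_one_of_one_lt₀ (by exact_mod_cast hlam))).mul_const _
    rw [zero_mul] at h1
    filter_upwards [h1.eventually_lt_const hη] with n hn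
    rwa [← inv_pow]
  filter_upwards [h (deg μ) hμ δ hδ, hsmall] with n h1 h2 j x
  have hRs : ∀ j, ContDiff ℝ (deg μ : ℕ) ((cascade lam a)^[n] ψ j) := fun j =>
    (contDiff_cascade_iterate lam a hψ n j).of_le (by exact_mod_cast le_top)
  have hTs := contDiff_translates c (fun i => ((lam : ℝ) ^ n)⁻¹ • t i) hRs j
  have e1 : iteratedFDeriv ℝ (deg μ)
      (translates c (fun i => ((lam : ℝ) ^ n)⁻¹ • t i) ((cascade lam a)^[n] ψ) j) x (dirs μ) =
      ∑ i, c i * iteratedFDeriv ℝ (deg μ) ((cascade lam a)^[n] ψ j)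
        (x - ((lam : ℝ) ^ n)⁻¹ • t i) (dirs μ) := by
    change iteratedFDeriv ℝ (deg μ) (fun y => ∑ i, c i * (fun z => (cascade lam a)^[n] ψ j
      (z - ((lam : ℝ) ^ n)⁻¹ • t i)) y) x (dirs μ) = _
    rw [iteratedFDeriv_sum_mul _ _ (g := fun i z => (cascade lam a)^[n] ψ j
      (z - ((lam : ℝ) ^ n)⁻¹ • t i)) fun i _ => (hRs j).comp (contDiff_id.sub contDiff_const)]
    refine sum_congr rfl fun i _ => ?_
    have := iteratedFDeriv_comp_smul_sub (hRs j) 1 (((lam : ℝ) ^ n)⁻¹ • t i) x (dirs μ)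
    simp only [one_smul, Complex.ofReal_one, one_pow, one_mul] at this
    rw [this]
  have hsub : ContDiff ℝ (deg μ : ℕ) (translates c (fun i => ((lam : ℝ) ^ n)⁻¹ • t i)
      ((cascade lam a)^[n] ψ) j - g j) := hTs.sub (hgq j)
  rw [cascade_iterate_translates, mderiv_eq_iteratedFDeriv hsub,
    iteratedFDeriv_sub_apply hTs.contDiffAt (hgq j).contDiffAt, sub_apply,
    e1, ← one_mul (iteratedFDeriv ℝ (deg μ) (g j) x (dirs μ)), ← hc, sum_mul,
    ← sum_sub_distrib]
  have e2 : ∀ i, ‖c i * iteratedFDeriv ℝ (deg μ) ((cascade lam a)^[n] ψ j)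
        (x - ((lam : ℝ) ^ n)⁻¹ • t i) (dirs μ) - c i * iteratedFDeriv ℝ (deg μ) (g j) x (dirs μ)‖ ≤
      ‖c i‖ * (2 * δ) := fun i => by
    rw [← mul_sub, norm_mul]
    refine mul_le_mul_of_nonneg_left ?_ (norm_nonneg _)
    refine (norm_sub_le_norm_sub_add_norm_sub _ (iteratedFDeriv ℝ (deg μ) (g j)
      (x - ((lam : ℝ) ^ n)⁻¹ • t i) (dirs μ)) _).trans ?_
    rw [two_mul]
    refine add_le_add (norm_iteratedFDeriv_dirs_sub_le (h1 j _)) (huc j _ _ ?_)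
    rw [dist_eq_norm, sub_sub_cancel_left, norm_neg, norm_smul, norm_inv, norm_pow,
      Real.norm_natCast]
    exact (mul_le_mul_of_nonneg_left (norm_le_pi_norm t i) (by positivity)).trans_lt h2
  refine (norm_sum_le_of_le _ fun i _ => e2 i).trans ?_
  rw [← sum_mul]
  change K * (2 * (ε / (2 * (K + 1)))) ≤ ε
  rw [show K * (2 * (ε / (2 * (K + 1)))) = ε * (K / (K + 1)) by field_simp]
  exact mul_le_of_le_one_right hε.le ((div_le_one (by positivity)).2 (by linarith))

theorem ae_samp_mem_vanishingSpace {υ : Filt d 1 r} (hF : SuppCube R F) (hH : SuppCube R H)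
    (hFi : ∀ j, Integrable (F j)) (hHi : ∀ j, Integrable (H j))
    (hw : ∀ j, IsWeakDeriv μ (F j) (H j)) (h : ∀ᵐ x, samp F x ∈ vanishingSpace N υ) :
    ∀ᵐ x, samp H x ∈ vanishingSpace N υ := by
  have key : ∀ ν : Fin d → ℕ, ∀ S : ℕ, ∀ᵐ x : ℝ^d, deg ν < N → x ∈ ball 0 (S : ℝ) →
      moment υ (samp H x) (mono ν) = 0 := fun ν S => by
    by_cases hν : deg ν < N
    swap
    · exact Eventually.of_forall fun x h => absurd h hν
    let c : (ℤ^d × Fin r × ℤ^d) → ℂ := fun s => υ s.1 0 s.2.1 * mono ν (toR s.1 + toR s.2.2)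
    let T : Finset (ℤ^d × Fin r × ℤ^d) := υ.support ×ˢ univ ×ˢ box d (S + R)
    have hm : ∀ G : Fin r → ℝ^d → ℂ, SuppCube R G → ∀ x ∈ ball 0 (S : ℝ),
        moment υ (samp G x) (mono ν) = ∑ s ∈ T, c s * G s.2.1 (x + toR s.2.2) := fun G hG x hx => by
      rw [moment_samp hG υ x (F := box d (S + R)) fun j k hk => hG.mem_box (fun i => ?_) hk]
      · simp only [T, sum_product, c]
      · push_cast
        exact add_le_add_left ((norm_le_pi_norm x i).trans (mem_ball_zero_iff.1 hx).le) _
    have hsh : ∀ j k, IsWeakDeriv μ (fun x => F j (x + toR k)) (fun x => H j (x + toR k)) :=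
      fun j k => by simpa using (hw j).comp_smul_add one_pos (toR k)
    have hws := IsWeakDeriv.sum T c (fun s _ => (hFi s.2.1).comp_add_right (toR s.2.2))
      (fun s _ => (hHi s.2.1).comp_add_right (toR s.2.2)) fun s _ => hsh s.2.1 s.2.2
    have := hws.ae_eq_zero (integrable_finsetSum _ fun s _ =>
      ((hHi s.2.1).comp_add_right (toR s.2.2)).const_mul _).locallyIntegrable Metric.isOpen_ball
      (U := ball 0 (S : ℝ)) (by
        filter_upwards [h] with x hx hxS
        rw [← hm F hF x hxS]
        exact mem_vanishingSpace_iff.1 hx _ (mono_mem hν))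
    filter_upwards [this] with x hx _ hxS
    rw [hm H hH x hxS, hx hxS]
  filter_upwards [ae_all_iff.2 fun ν => ae_all_iff.2 (key ν)] with x hx
  rw [mem_vanishingSpace_iff_mono]
  obtain ⟨S, hS⟩ := exists_nat_gt ‖x‖
  exact fun ν hν => hx ν S hν (mem_ball_zero_iff.2 hS)

theorem Decays.ae_cascade_le [NeZero lam] {y : Filt d 1 r} {ρ : ℝ} (hρ : 0 ≤ ρ)
    (h : Decays lam a (vanishingSpace N y) ρ) (hH : SuppCube R H) {M : ℝ} (hM : ∀ j x, ‖H j x‖ ≤ M)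
    (hy : ∀ᵐ x, samp H x ∈ vanishingSpace N y) : ∃ C : ℝ, ∀ n, ∀ᵐ x, ∀ j,
      ‖(cascade lam a)^[n] H j x‖ ≤ C * ρ ^ n := by
  obtain ⟨C, -, hC⟩ := h.cascade_le hρ R
  have hl : ∀ n, 0 < (lam : ℝ) ^ n := fun n => pow_pos (by exact_mod_cast NeZero.pos lam) _
  refine ⟨C * max M 0, fun n => ?_⟩
  filter_upwards [ae_comp_smul_add (hl n) 0 hy] with x hx j
  have := hC H hH _ hx (max M 0) (le_max_right _ _)
    (fun j k => (hM j _).trans (le_max_left _ _)) n j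
  rwa [add_zero, smul_smul, inv_mul_cancel₀ (hl n).ne', one_smul] at this

theorem IsWeakDeriv.add {f f' h h' : ℝ^d → ℂ} (hf : Integrable f) (hf' : Integrable f')
    (hh : Integrable h) (hh' : Integrable h') (hw : IsWeakDeriv μ f h) (hw' : IsWeakDeriv μ f' h') :
    IsWeakDeriv μ (f + f') (h + h') := by
  have := IsWeakDeriv.sum (μ := μ) univ ![1, 1] (f := ![f, f']) (h := ![h, h'])
    (by simp [Fin.forall_fin_two, hf, hf']) (by simp [Fin.forall_fin_two, hh, hh'])
    (by simp [Fin.forall_fin_two, hw, hw'])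
  simp only [Fin.sum_univ_two, Matrix.cons_val_zero, Matrix.cons_val_one, one_mul] at this
  exact this

theorem isWeakDeriv_cascade_iterate [NeZero lam] (a : Filt d r r) (hFi : ∀ j, Integrable (F j))
    (hHi : ∀ j, Integrable (H j)) (hw : ∀ j, IsWeakDeriv μ (F j) (H j)) (n : ℕ) (j : Fin r) :
    Integrable ((cascade lam a)^[n] F j) ∧ IsWeakDeriv μ ((cascade lam a)^[n] F j) (fun x =>
      ((lam : ℂ) ^ n) ^ deg μ * (cascade lam a)^[n] H j x) := by
  have hl : 0 < (lam : ℝ) ^ n := pow_pos (by exact_mod_cast NeZero.pos lam) _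
  have hc : ∀ G : ℝ^d → ℂ, Integrable G → ∀ k : ℤ^d,
      Integrable fun x => G (((lam : ℝ) ^ n) • x + -toR k) := fun G hG k =>
    (hG.comp_add_right (-toR k)).comp_smul hl.ne'
  have e : ∀ G : Fin r → ℝ^d → ℂ, (cascade lam a)^[n] G j = fun x => _ := fun G =>
    funext fun x => cascade_iterate_apply_eq_sum lam a G n j x
  rw [e F, e H]
  refine ⟨integrable_finsetSum _ fun s _ => (hc _ (hFi s.2) s.1).const_mul _, ?_⟩
  have := IsWeakDeriv.sum ((mask lam a n).support ×ˢ (univ : Finset (Fin r)))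
    (fun s => mask lam a n s.1 j s.2) (fun s _ => hc _ (hFi s.2) s.1)
    (fun s _ => (hc _ (hHi s.2) s.1).const_mul _) fun s _ => (hw s.2).comp_smul_add hl (-toR s.1)
  simpa only [mul_sum, mul_left_comm, Complex.ofReal_pow, Complex.ofReal_natCast] using this

end

section

/-! ### Convergence of the cascade algorithm -/

variable {d r R : ℕ} {υ : Filt d 1 r} {f : Fin r → ℝ^d → ℂ}

theorem Admissible.exists_translates {N : ℕ} (hN : 0 < N) {ψ : Fin r → ℝ^d → ℂ} (hψ : SuppCube R ψ)
    (hi : ∀ j, Integrable (ψ j)) (h : Admissible N υ ψ) (hf : SuppCube R f)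
    (hr : Reproduces N υ f) : ∃ (n : ℕ) (c : Fin n → ℂ) (t : Fin n → ℝ^d), ∑ i, c i = 1 ∧ ∀ᵐ x,
      samp (ψ - translates c t f) x ∈ vanishingSpace N υ := by
  obtain ⟨Λ, hΛ, hae⟩ := h.exists_moment_samp hψ hi
  obtain ⟨n, c, t, hct⟩ := exists_eval_combination Λ
  obtain ⟨R', hR'⟩ := hf.translates c t
  refine ⟨n, c, t, ?_, ?_⟩
  · have h1 : (fun _ : ℝ^d => (1 : ℂ)) ∈ polySpace d N :=
      mono_zero_index (d := d) ▸ mono_mem (by simpa [deg] using hN)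
    have := hct ⟨_, h1⟩
    rw [hΛ _ rfl] at this
    simpa using this.symm
  · filter_upwards [hae] with x hx
    rw [mem_vanishingSpace_iff]
    intro p hp
    rw [samp_sub (hψ.mono (le_max_left R R')) (hR'.mono (le_max_right R R')), moment_sub_right,
      moment_samp_translates hf, hx p hp ⟨fun y => p (y - x), ?_⟩ fun _ => rfl, hct, sub_eq_zero]
    · refine sum_congr rfl fun i _ => ?_
      rw [hr _ p hp, neg_sub]
    · simpa only [sub_eq_add_neg] using translate_mem hp (-x)

theorem exists_bounded_weakDeriv {μ : Fin d → ℕ} (hf : SuppCube R f)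
    (h : ∀ j, ∃ h, MemLp h ⊤ volume ∧ IsWeakDeriv μ (f j) h) : ∃ (H : Fin r → ℝ^d → ℂ) (M : ℝ),
      (∀ j, Measurable (H j)) ∧ (∀ j x, ‖H j x‖ ≤ M) ∧ SuppCube R H ∧ ∀ j,
      IsWeakDeriv μ (f j) (H j) := by
  choose h hh hw using h
  choose H M hM0 hm hM hR hw' using fun j => (hw j).exists_bounded (hh j) (hf j)
  exact ⟨H, ∑ j, M j, hm, fun j x => (hM j x).trans
    (single_le_sum (fun j _ => hM0 j) (mem_univ j)), hR, hw'⟩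

theorem Decays.cascadeCmConvergent {lam m : ℕ} [NeZero lam] (hlam : 2 ≤ lam) {a : Filt d r r}
    (ha : EigenCondition lam m a) (hυ : IsMatchingFilter lam (m + 1) a υ)
    {φ : Fin r → CompactDistribution d} (hφ : IsStandardRefinable lam a υ φ) {ρ : ℝ} (hρ : 0 < ρ)
    (hρm : ρ < ((lam : ℝ) ^ m)⁻¹) (hD : Decays lam a (vanishingSpace (m + 1) υ) ρ) :
    CascadeCmConvergent lam m a υ φ := by
  obtain ⟨R₀, ψ₀, g, hψ₀, hψ₀s, hψ₀r, hg, hgs, hgc, hgr, hconv⟩ :=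
    exists_cascade_limit hlam hυ hρ hρm hD
  refine ⟨g, hφ.isCmRepresentative hlam ha hυ hg hgs hgc hgr, fun ψ hψ hadm => ?_⟩
  have hl1 : (1 : ℝ) < lam := by exact_mod_cast hlam
  obtain ⟨R₁, hR₁⟩ := exists_vanishesOutside fun j => (hψ j).1
  have hψi : ∀ j, Integrable (ψ j) := fun j =>
    integrable_of_bound (hψ j).2.1.1 (hψ j).2.1.ae_norm_le_toReal (hR₁ j)
  obtain ⟨k, c, t, hc, hnull⟩ := hadm.exists_translates m.succ_pos
    (hR₁.mono (le_max_left R₁ R₀)) hψi (hψ₀.mono (le_max_right R₁ R₀)) hψ₀r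
  set ψ' := translates c t ψ₀
  have hψ's : ∀ j, ContDiff ℝ ∞ (ψ' j) := contDiff_translates c t hψ₀s
  obtain ⟨R₂, hR₂⟩ := hψ₀.translates c t
  obtain ⟨A, hA⟩ := exists_suppIn a
  set R := max (max R₁ R₂) (max R₀ A)
  have hψR : SuppCube R ψ := hR₁.mono ((le_max_left _ _).trans (le_max_left _ _))
  have hψ'R : SuppCube R ψ' := hR₂.mono ((le_max_right _ _).trans (le_max_left _ _))
  have hgR : SuppCube R g := hg.mono ((le_max_left _ _).trans (le_max_right _ _))
  have hcR : ∀ n, SuppCube R ((cascade lam a)^[n] ψ') := fun n =>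
    hψ'R.cascade_iterate hlam hA ((le_max_right _ _).trans (le_max_right _ _)) n
  have hint : ∀ f : Fin r → ℝ^d → ℂ, SuppCube R f → (∀ j, Continuous (f j)) →
      ∀ j, Integrable (f j) := fun f hf hfc j =>
    (hfc j).integrable_of_hasCompactSupport (hf.hasCompactSupport j)
  have hsubR : ∀ f f' : Fin r → ℝ^d → ℂ, SuppCube R f → SuppCube R f' →
      SuppCube R (f - f') := fun f f' hf hf' j x i hx => by
    rw [Pi.sub_apply, Pi.sub_apply, hf j x i hx, hf' j x i hx, sub_zero]
  have hψ'i := hint ψ' hψ'R fun j => (hψ's j).continuous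
  rw [← Finset.sum_const_zero (s := (univ : Finset (Fin r))) (M := ℝ≥0∞)]
  refine tendsto_finsetSum _ fun j _ => ?_
  unfold sobolevNorm
  rw [← Finset.sum_const_zero (s := Finset.range (m + 1)) (M := ℝ≥0∞)]
  refine tendsto_finsetSum _ fun q hq => ?_
  rw [← Finset.sum_const_zero (s := Finset.piAntidiag (univ : Finset (Fin d)) q) (M := ℝ≥0∞)]
  refine tendsto_finsetSum _ fun μ hμ => ?_
  have hμm : deg μ ≤ m := by
    rw [deg, (Finset.mem_piAntidiag.1 hμ).1]
    exact Nat.lt_succ_iff.1 (Finset.mem_range.1 hq)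
  have hle : ∀ {f : ℝ^d → ℂ}, ContDiff ℝ ∞ f → ContDiff ℝ (deg μ : ℕ) f := fun hf =>
    hf.of_le (by exact_mod_cast le_top)
  have hgμ : ∀ j, ContDiff ℝ (deg μ : ℕ) (g j) := fun j => (hgs j).of_le (by exact_mod_cast hμm)
  obtain ⟨H₀, M, hHm, hHM, hHR, hHw⟩ := exists_bounded_weakDeriv hψR fun j => (hψ j).2.2 μ hμm
  have hH₀i : ∀ j, Integrable (H₀ j) := fun j =>
    integrable_of_bound (hHm j).aestronglyMeasurable (ae_of_all _ (hHM j)) (hHR j)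
  set D := dirDeriv (deg μ) (dirs μ) ψ'
  have hDR : SuppCube R D := hψ'R.dirDeriv _ _
  have hDe : ∀ j, D j = mderiv μ (ψ' j) := fun j => funext fun x =>
    (mderiv_eq_iteratedFDeriv (hle (hψ's j)) x).symm
  have hDc : ∀ j, Continuous (D j) := fun j => hDe j ▸ (contDiff_mderiv (hψ's j) μ).continuous
  have hDi := hint D hDR hDc
  obtain ⟨MD, -, hMD⟩ := hψ'R.exists_iteratedFDeriv_le fun j => hle (hψ's j)
  have hHb : ∀ j x, ‖(H₀ - D) j x‖ ≤ M + MD := fun j x =>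
    (norm_sub_le _ _).trans (add_le_add (hHM j x) ((ContinuousMultilinearMap.unit_le_opNorm _
      ((pi_norm_le_iff_of_nonneg zero_le_one).2 (norm_dirs_le μ))).trans (hMD j x)))
  have hneg : ∀ {f h : ℝ^d → ℂ}, IsWeakDeriv μ f h → IsWeakDeriv μ (-f) (-h) :=
    fun hw θ hθ hc => by simp only [Pi.neg_apply, neg_mul, integral_neg, mul_neg, hw θ hθ hc]
  have hFw : ∀ j, IsWeakDeriv μ ((ψ - ψ') j) ((H₀ - D) j) := fun j => by
    rw [sub_eq_add_neg, sub_eq_add_neg]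
    exact (hHw j).add (hψi j) (hψ'i j).neg (hH₀i j) (hDi j).neg
      (hneg (hDe j ▸ isWeakDeriv_mderiv (hle (hψ's j))))
  have hFi : ∀ j, Integrable ((ψ - ψ') j) := fun j => (hψi j).sub (hψ'i j)
  have hHi : ∀ j, Integrable ((H₀ - D) j) := fun j => (hH₀i j).sub (hDi j)
  have hHRD := hsubR _ _ hHR hDR
  obtain ⟨C, hC⟩ := hD.ae_cascade_le hρ.le hHRD hHb
    (ae_samp_mem_vanishingSpace (hsubR _ _ hψR hψ'R) hHRD hFi hHi hFw hnull)
  have hrate : Tendsto (fun n : ℕ => C * ((lam : ℝ) ^ deg μ * ρ) ^ n) atTop (𝓝 0) := by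
    have h1 : (lam : ℝ) ^ deg μ * ρ < 1 := by
      refine (mul_le_mul_of_nonneg_right (pow_le_pow_right₀ hl1.le hμm) hρ.le).trans_lt ?_
      rwa [← lt_inv_mul_iff₀ (by positivity), mul_one]
    simpa using (tendsto_pow_atTop_nhds_zero_of_lt_one (by positivity) h1).const_mul C
  rw [ENNReal.tendsto_nhds_zero]
  intro ε hε
  obtain ⟨ε', hε', hεε⟩ : ∃ ε' : ℝ, 0 < ε' ∧ ENNReal.ofReal (ε' + ε') ≤ ε := by
    obtain ⟨b, hb, hbε⟩ := ENNReal.lt_iff_exists_nnreal_btwn.1 hε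
    refine ⟨b / 2, by simpa using hb, ?_⟩
    rw [add_halves, ENNReal.ofReal_coe_nnreal]
    exact hbε.le
  filter_upwards [hrate.eventually_le_const hε', mderiv_cascade_translates_tendsto hlam
    (a := a) hψ₀s hg hgs
    hconv hc t hμm hε'] with n h1 h2
  set E := (cascade lam a)^[n] ψ' j - g j
  have hEs : ContDiff ℝ (deg μ : ℕ) E := (hle (contDiff_cascade_iterate lam a hψ's n j)).sub (hgμ j)
  have hE'c : Continuous (mderiv μ E) := by
    have : mderiv μ E = fun x => iteratedFDeriv ℝ (deg μ) E x (dirs μ) :=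
      funext fun x => mderiv_eq_iteratedFDeriv hEs x
    rw [this]
    exact (ContinuousMultilinearMap.apply ℝ (fun _ => ℝ^d) ℂ (dirs μ)).continuous.comp
      (hEs.continuous_iteratedFDeriv le_rfl)
  have hER : ∀ x i, (R : ℝ) < |x i| → E x = 0 := (hsubR _ _ (hcR n) hgR) j
  have hE'i : Integrable (mderiv μ E) := by
    have h3 := SuppCube.dirDeriv (r := 1) (f := fun _ => E) (fun _ => hER) (deg μ) (dirs μ)
    refine hE'c.integrable_of_hasCompactSupport ?_
    rw [show mderiv μ E = dirDeriv (deg μ) (dirs μ) (fun _ : Fin 1 => E) 0 from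
      funext fun x => mderiv_eq_iteratedFDeriv hEs x]
    exact h3.hasCompactSupport 0
  have hEi : Integrable E := hEs.continuous.integrable_of_hasCompactSupport
    ((SuppCube.hasCompactSupport (r := 1) (f := fun _ => E) fun _ => hER) 0)
  obtain ⟨hRFi, hRFw⟩ := isWeakDeriv_cascade_iterate (lam := lam) a hFi hHi hFw n j
  set K : ℝ^d → ℂ := fun x => ((lam : ℂ) ^ n) ^ deg μ * (cascade lam a)^[n] (H₀ - D) j x
  have hKi : Integrable K := (isWeakDeriv_cascade_iterate (lam := lam) a hHi hHi (μ := 0)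
    (fun j θ _ _ => by simp [deg, mderiv]) n j).1.const_mul _
  have hw := hRFw.add hRFi hEi hKi hE'i (isWeakDeriv_mderiv hEs)
  have hsplit : (cascade lam a)^[n] (ψ - ψ') j + E = (cascade lam a)^[n] ψ j - g j := by
    simp only [E, cascade_iterate_sub, Pi.sub_apply]
    abel
  rw [hsplit] at hw
  have hbd : ∀ᵐ x, ‖(K + mderiv μ E) x‖ ≤ ε' + ε' := by
    filter_upwards [hC n] with x hx
    refine (norm_add_le _ _).trans (add_le_add (le_trans ?_ h1) (h2 j x))
    · rw [norm_mul, norm_pow, norm_pow, Complex.norm_natCast, mul_pow, pow_right_comm,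
        mul_left_comm]
      exact mul_le_mul_of_nonneg_left (hx j) (by positivity)
  refine (iInf₂_le (K + mderiv μ E) ⟨memLp_top_of_bound
    (hKi.aestronglyMeasurable.add hE'i.aestronglyMeasurable) _ hbd, hw⟩).trans (le_trans ?_ hεε)
  rw [eLpNorm_exponent_top]
  exact eLpNormEssSup_le_of_ae_bound hbd

end

section

/-! ### Polynomial reproduction and Taylor approximation -/

variable {d r R : ℕ} {υ : Filt d 1 r} {g : Fin r → ℝ^d → ℂ}

theorem exists_moment_samp_bound (hg : SuppCube R g) (hc : ∀ j, Continuous (g j)) (p : ℝ^d → ℂ) :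
    ∃ B : ℝ, ∀ x ∈ unitCube d, ‖moment υ (samp g x) p‖ ≤ B := by
  choose M hM using fun j => (hg.hasCompactSupport j).exists_bound_of_continuous (hc j)
  refine ⟨∑ z ∈ υ.support, ∑ j, ∑ k ∈ box d (R + 1), ‖υ z 0 j * p (toR z + toR k)‖ * M j,
    fun x hx => ?_⟩
  rw [moment_samp hg υ x (F := box d (R + 1)) fun j k hk => hg.mem_box (fun i => ?_) hk]
  · refine norm_sum_le_of_le _ fun z _ => norm_sum_le_of_le _ fun j _ => norm_sum_le_of_le _
      fun k _ => ?_
    rw [norm_mul]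
    exact mul_le_mul_of_nonneg_left (hM j _) (norm_nonneg _)
  · have := mem_unitCube.1 hx i
    rw [abs_of_nonneg this.1]
    push_cast
    linarith

/-- A continuous compactly supported refinable vector function with the right normalization
reproduces polynomials. -/
theorem reproduces_of_cascade_eq {lam N : ℕ} [NeZero lam] (hlam : 2 ≤ lam) {a : Filt d r r}
    (hυ : IsMatchingFilter lam N a υ) (hg : SuppCube R g) (hc : ∀ j, Continuous (g j))
    (hgc : cascade lam a g = g) (h1 : ∑ j, fourierSeries υ 0 0 j * ∫ x, g j x = 1) :
    Reproduces N υ g := by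
  have hl0 : (lam : ℝ) ≠ 0 := by exact_mod_cast NeZero.ne lam
  have hl1 : (1 : ℝ) < lam := by exact_mod_cast hlam
  have hi : ∀ j, Integrable (g j) := fun j =>
    (hc j).integrable_of_hasCompactSupport (hg.hasCompactSupport j)
  have hscale : ∀ p ∈ polySpace d N, ∀ x, moment υ (samp g x) p =
      moment υ (samp g ((lam : ℝ) • x)) fun y => p ((lam : ℝ)⁻¹ • y) := fun p hp x => by
    have h2 := samp_cascade hg (R' := R) (by rwa [hgc]) x (a := a) (lam := lam)
    rw [hgc] at h2
    rw [h2, moment_trans hυ _ _ hp]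
    simp only [toR_zero, sub_zero]
  have hshift : ∀ p x k, moment υ (samp g (x + toR k)) p =
      moment υ (samp g x) fun y => p (y + -toR k) := fun p x k => by
    rw [samp_add_toR hg, moment_shift, toR_neg]
  suffices H : ∀ n ≤ N, ∀ x, ∀ p ∈ polySpace d n, moment υ (samp g x) p = p (-x) from
    fun x p hp => H N le_rfl x p hp
  intro n
  induction n with
  | zero =>
    intro _ x p hp
    rw [polySpace_zero, Submodule.mem_bot] at hp
    have := moment_smul υ (samp g x) 0 (0 : ℝ^d → ℂ)
    rw [smul_zero, zero_mul] at this
    rw [hp, this, Pi.zero_apply]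
  | succ n ih =>
    intro hn x p hp
    suffices hle : polySpace d (n + 1) ≤
        LinearMap.eqLocus (momentLin υ (samp g x)) (LinearMap.proj (-x)) from hle hp
    refine polySpace_le fun ν hν => ?_
    rw [LinearMap.mem_eqLocus]
    change moment υ (samp g x) (mono ν) = mono ν (-x)
    rcases (Nat.lt_succ_iff.1 hν).lt_or_eq with hlt | hdeg
    · exact ih (by omega) x _ (mono_mem hlt)
    have hmem : mono ν ∈ polySpace d N := mono_mem (hν.trans_le hn)
    let e : ℝ^d → ℂ := fun x => moment υ (samp g x) (mono ν) - mono ν (-x)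
    have hper : ∀ x k, e (x + toR k) = e x := fun x k => by
      have h2 : moment υ (samp g x) (fun y => mono ν (y + -toR k) - mono ν y) =
          mono ν (-x + -toR k) - mono ν (-x) :=
        ih (by omega) x _ (translate_sub_mem (mono_mem hν) (-toR k))
      have h3 : (fun y => mono ν (y + -toR k)) =
          (fun y => mono ν (y + -toR k) - mono ν y) + mono ν := by
        funext y
        simp
      change moment υ _ _ - _ = moment υ _ _ - _
      rw [hshift, h3, moment_add, h2, neg_add]
      ring
    have hsc : ∀ j x, e x = ((lam : ℂ)⁻¹) ^ (n * j) * e (((lam : ℝ) ^ j) • x) := by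
      have h2 : ∀ x, e x = ((lam : ℂ)⁻¹) ^ n * e ((lam : ℝ) • x) := fun x => by
        have h3 : (fun y => mono ν ((lam : ℝ)⁻¹ • y)) = (((lam : ℂ)⁻¹) ^ n) • mono ν :=
          funext fun y => by
            rw [mono_smul, hdeg, Complex.ofReal_inv, Complex.ofReal_natCast]
            rfl
        have h4 : mono ν (-x) = ((lam : ℂ)⁻¹) ^ n * mono ν (-((lam : ℝ) • x)) := by
          have := congrFun h3 (-((lam : ℝ) • x))
          rwa [← smul_neg, smul_smul, inv_mul_cancel₀ hl0, one_smul, smul_neg] at this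
        change moment υ _ _ - _ = _ * (moment υ _ _ - _)
        rw [hscale _ hmem, h3, moment_smul, h4]
        ring
      intro j
      induction j with
      | zero => simp
      | succ j ihj =>
        intro x
        rw [ihj, h2, smul_smul, ← pow_succ', ← mul_assoc, ← pow_add, Nat.mul_succ]
    have hcube : ∀ x, ∃ y ∈ unitCube d, e x = e y := fun x =>
      ⟨x - toR fun i => ⌊x i⌋, sub_toR_mem_unitCube_iff.2 rfl, by
        rw [sub_eq_add_neg, ← toR_neg, hper]⟩
    suffices he : e x = 0 from sub_eq_zero.1 he
    rcases Nat.eq_zero_or_pos n with hn0 | hn0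
    · have hν0 : ν = 0 := funext fun i => by
        have := single_le_sum (f := ν) (fun _ _ => Nat.zero_le _) (mem_univ i)
        change ν i = 0
        rw [deg] at hdeg
        omega
      have he : ∀ x, e x = moment υ (samp g x) (fun _ => 1) - 1 := fun x => by
        simp only [e, hν0, mono_zero_index]
      have hcont : Continuous e := by
        obtain ⟨A, hA⟩ := exists_suppIn υ
        have : e = fun x => periodization (rowSum υ g) x - 1 := funext fun x => by
          rw [he, moment_samp_eq_periodization hg]
          simp only [one_mul]
        rw [this]
        refine (continuous_periodization (fun x i => rowSum_eq_zero hA hg x i) ?_).sub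
          continuous_const
        exact continuous_finsetSum _ fun z _ =>
          continuous_const.mul ((hc z.2).comp (continuous_id.sub continuous_const))
      have hconst : ∀ x, e x = e 0 := fun x => by
        have h2 : Tendsto (fun j : ℕ => ((lam : ℝ) ^ j)⁻¹ • toR fun i => ⌊(lam : ℝ) ^ j * x i⌋)
            atTop (𝓝 x) := tendsto_pi_nhds.2 fun i => by
          have h3 : Tendsto (fun j : ℕ => (lam : ℝ) ^ j) atTop atTop :=
            tendsto_pow_atTop_atTop_of_one_lt hl1
          refine tendsto_of_tendsto_of_tendsto_of_le_of_le (g := fun j => x i - ((lam : ℝ) ^ j)⁻¹)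
            (h := fun _ => x i) ?_ tendsto_const_nhds (fun j => ?_) fun j => ?_
          · simpa using (tendsto_const_nhds (x := x i)).sub (tendsto_inv_atTop_zero.comp h3)
          all_goals
            have hp : 0 < (lam : ℝ) ^ j := by positivity
            change _ ≤ _
            simp only [Pi.smul_apply, toR, smul_eq_mul]
          · rw [← sub_nonneg, ← mul_nonneg_iff_of_pos_left hp]
            have := (Int.sub_one_lt_floor ((lam : ℝ) ^ j * x i)).le
            have h4 := mul_inv_cancel₀ hp.ne'
            calc (0 : ℝ) ≤ ⌊(lam : ℝ) ^ j * x i⌋ - ((lam : ℝ) ^ j * x i - 1) := by linarith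
              _ = _ := by rw [mul_sub, mul_sub, ← mul_assoc, h4, one_mul]
          · rw [inv_mul_le_iff₀ hp]
            exact Int.floor_le _
        have h3 : ∀ j : ℕ, e (((lam : ℝ) ^ j)⁻¹ • toR fun i => ⌊(lam : ℝ) ^ j * x i⌋) = e 0 :=
          fun j => by
            rw [hsc j, smul_smul, mul_inv_cancel₀ (pow_ne_zero _ hl0), one_smul, hn0, zero_mul,
              pow_zero, one_mul]
            simpa using hper 0 fun i => ⌊(lam : ℝ) ^ j * x i⌋
        have h4 := (hcont.tendsto x).comp h2
        simp only [Function.comp_def, h3] at h4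
        exact tendsto_nhds_unique h4 tendsto_const_nhds |>.symm ▸ rfl
      have h2 := sum_integral_eq_of_moment hg hi (υ := υ) (c := e 0 + 1) fun x => by
        rw [← hconst x, he, sub_add_cancel]
      rw [h1] at h2
      rw [hconst]
      linear_combination -h2
    · obtain ⟨B, hB⟩ := exists_moment_samp_bound (υ := υ) hg hc (mono ν)
      have hb : ∀ y ∈ unitCube d, ‖e y‖ ≤ B + 1 := fun y hy => by
        refine (norm_sub_le _ _).trans (add_le_add (hB y hy) ?_)
        rw [mono, norm_prod]
        refine Finset.prod_le_one (fun _ _ => norm_nonneg _) fun i _ => ?_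
        rw [norm_pow, Complex.norm_real, Pi.neg_apply, norm_neg, Real.norm_eq_abs]
        have := mem_unitCube.1 hy i
        exact pow_le_one₀ (abs_nonneg _) (by rw [abs_of_nonneg this.1]; exact this.2.le)
      have h2 : ∀ j : ℕ, ‖e x‖ ≤ (((lam : ℝ)⁻¹) ^ n) ^ j * (B + 1) := fun j => by
        obtain ⟨y, hy, hxy⟩ := hcube (((lam : ℝ) ^ j) • x)
        rw [hsc j, hxy, norm_mul, norm_pow, norm_inv, Complex.norm_natCast, pow_mul]
        exact mul_le_mul_of_nonneg_left (hb y hy) (by positivity)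
      have h3 : Tendsto (fun j : ℕ => (((lam : ℝ)⁻¹) ^ n) ^ j * (B + 1)) atTop (𝓝 (0 * (B + 1))) :=
        (tendsto_pow_atTop_nhds_zero_of_lt_one (by positivity)
          (pow_lt_one₀ (by positivity) (inv_lt_one_of_one_lt₀ hl1) hn0.ne')).mul_const _
      rw [zero_mul] at h3
      exact norm_le_zero_iff.1 (ge_of_tendsto' h3 h2)

theorem norm_sub_taylor_le (m : ℕ) {u : ℕ → ℝ → ℂ}
    (hu : ∀ k < m, ∀ t, HasDerivAt (u k) (u (k + 1) t) t) {E : ℝ} (hE : 0 ≤ E)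
    (h : ∀ t ∈ Set.Icc (0 : ℝ) 1, ‖u m t - u m 0‖ ≤ E) : ∀ t ∈ Set.Icc (0 : ℝ) 1,
      ‖u 0 t - ∑ k ∈ Finset.range (m + 1), ((t : ℂ) ^ k / k.factorial) * u k 0‖ ≤ E := by
  induction m generalizing u with
  | zero => simpa using h
  | succ m ih =>
    intro t ht
    have ih' := ih (u := fun k => u (k + 1)) (fun k hk => hu _ (by omega)) h
    let F : ℝ → ℂ := fun t =>
      u 0 t - ∑ k ∈ Finset.range (m + 2), ((t : ℂ) ^ k / k.factorial) * u k 0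
    have hF : ∀ t, HasDerivAt F
        (u 1 t - ∑ k ∈ Finset.range (m + 1), ((t : ℂ) ^ k / k.factorial) * u (k + 1) 0) t := by
      intro t
      have h1 : F = fun t => u 0 t - (∑ k ∈ Finset.range (m + 1),
          ((t : ℂ) ^ (k + 1) / (k + 1).factorial) * u (k + 1) 0 + u 0 0) := funext fun t => by
        simp [F, Finset.sum_range_succ' _ (m + 1)]
      rw [h1]
      refine (hu 0 (by omega) t).sub ((HasDerivAt.fun_sum fun k _ => ?_).add_const _)
      have h2 : HasDerivAt (fun t : ℝ => (t : ℂ) ^ (k + 1)) (((k : ℂ) + 1) * (t : ℂ) ^ k) t := by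
        simpa using (hasDerivAt_pow (k + 1) (t : ℂ)).comp_ofReal
      refine ((h2.div_const _).mul_const _).congr_deriv ?_
      rw [Nat.factorial_succ]
      have h3 : (k.factorial : ℂ) ≠ 0 := by exact_mod_cast k.factorial_ne_zero
      have h4 : (k : ℂ) + 1 ≠ 0 := by exact_mod_cast k.succ_ne_zero
      push_cast
      field_simp
    have h5 := norm_image_sub_le_of_norm_deriv_le_segment' (f := F) (a := 0) (b := 1) (C := E)
      (fun t _ => (hF t).hasDerivWithinAt) (fun t ht => ih' t ⟨ht.1, ht.2.le⟩) t ht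
    have h6 : F 0 = 0 := by simp [F, Finset.sum_range_succ' _ (m + 1)]
    rw [h6, sub_zero, sub_zero] at h5
    exact h5.trans (mul_le_of_le_one_right hE ht.2)

theorem multilinear_diagonal_mem (k : ℕ) (M : ContinuousMultilinearMap ℝ (fun _ : Fin k => ℝ^d) ℂ) :
    (fun h => M fun _ => h) ∈ polySpace d (k + 1) := by
  induction k with
  | zero =>
    have h1 : (fun h : ℝ^d => M fun _ => h) = M 0 • mono 0 := by
      funext h
      rw [mono_zero_index, Pi.smul_apply, smul_eq_mul, mul_one]
      exact congrArg M (Subsingleton.elim _ _)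
    rw [h1]
    exact Submodule.smul_mem _ _ (mono_mem (by simp [deg]))
  | succ k ih =>
    have h1 : (fun h : ℝ^d => M fun _ => h) = ∑ i, fun h : ℝ^d =>
        (h i : ℂ) * (M.curryLeft (Pi.single i 1)) fun _ => h := by
      funext h
      have h2 : M (fun _ => h) = M.curryLeft h fun _ => h :=
        congrArg M (funext fun i => by cases i using Fin.cases <;> rfl)
      rw [h2]
      conv_lhs => rw [pi_eq_sum_univ' h, map_sum]
      rw [sum_apply, Finset.sum_apply]
      refine sum_congr rfl fun i _ => ?_
      rw [map_smul, smul_apply, Complex.real_smul, ← pi_eq_sum_univ' h]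
    rw [h1]
    exact Submodule.sum_mem _ fun i _ => mul_coord_mem (ih _) i

theorem exists_taylor_approx {m : ℕ} {f : ℝ^d → ℂ} (hf : ContDiff ℝ m f) (y : ℝ^d) :
    ∃ p ∈ polySpace d (m + 1), ∀ (h : ℝ^d) (ε : ℝ), 0 ≤ ε →
      (∀ z, ‖z - y‖ ≤ ‖h‖ → ‖iteratedFDeriv ℝ m f z - iteratedFDeriv ℝ m f y‖ ≤ ε) →
      ‖f (y + h) - p h‖ ≤ ε * ‖h‖ ^ m := by
  refine ⟨∑ k ∈ Finset.range (m + 1), ((k.factorial : ℂ)⁻¹) •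
    fun h => iteratedFDeriv ℝ k f y fun _ => h, Submodule.sum_mem _ fun k hk =>
      Submodule.smul_mem _ _ (polySpace_mono (by simpa using hk) (multilinear_diagonal_mem k _)),
    fun h ε hε hh => ?_⟩
  have hd : ∀ k < m, ∀ t : ℝ, HasDerivAt (fun t : ℝ => iteratedFDeriv ℝ k f (y + t • h) fun _ => h)
      (iteratedFDeriv ℝ (k + 1) f (y + t • h) fun _ => h) t := fun k hk t => by
    have h1 := ((hf.differentiable_iteratedFDeriv (m := k)
      (by exact_mod_cast hk)) (y + t • h)).hasFDerivAt
    have h2 : HasDerivAt (fun t : ℝ => y + t • h) h t := by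
      simpa using ((hasDerivAt_id t).smul_const h).const_add y
    exact (ContinuousMultilinearMap.apply ℝ (fun _ : Fin k => ℝ^d) ℂ
      fun _ => h).hasFDerivAt.comp_hasDerivAt t (h1.comp_hasDerivAt t h2)
  have := norm_sub_taylor_le m hd (E := ε * ‖h‖ ^ m) (by positivity) (fun t ht => ?_) 1
    ⟨zero_le_one, le_rfl⟩
  · convert this using 3
    · simp
    · rw [Finset.sum_apply]
      refine sum_congr rfl fun k _ => ?_
      simp
  · rw [zero_smul, add_zero, ← sub_apply]
    refine (ContinuousMultilinearMap.le_opNorm _ _).trans ?_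
    rw [Finset.prod_const, Finset.card_univ, Fintype.card_fin]
    refine mul_le_mul_of_nonneg_right (hh _ ?_) (by positivity)
    rw [add_sub_cancel_left, norm_smul, Real.norm_of_nonneg ht.1]
    exact mul_le_of_le_one_left (norm_nonneg _) ht.2

end

section

/-! ### Laurent polynomials and bounded multiplication -/

variable {d r : ℕ} {B : ℝ}

/-- Laurent polynomials in `d` variables, as convolution algebra of scalar filters. -/
abbrev Laurent (d : ℕ) : Type := AddMonoidAlgebra ℂ ℤ^d

/-- The trigonometric polynomial `ξ ↦ ∑ₖ v(k) e^{-ik·ξ}` at the point `ξ`. -/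
def symbol (ξ : ℝ^d) : Laurent d →ₐ[ℂ] ℂ :=
  AddMonoidAlgebra.lift ℂ ℂ ℤ^d
    { toFun := fun k => expo (toR k.toAdd) ξ
      map_one' := by simp [expo, toR]
      map_mul' := fun k l => by rw [toAdd_mul, toR_add, expo_add_left] }

theorem symbol_single (ξ : ℝ^d) (k : ℤ^d) (c : ℂ) : symbol ξ (AddMonoidAlgebra.single k c) =
      c * expo (toR k) ξ :=
  AddMonoidAlgebra.lift_single _ _ _

theorem symbol_eq_sum (ξ : ℝ^d) (v : Laurent d) : symbol ξ v = ∑ k ∈ v.coeff.support,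
      v.coeff k * expo (toR k) ξ :=
  AddMonoidAlgebra.lift_apply _ _

theorem conj_expo (x ξ : ℝ^d) : (starRingEnd ℂ) (expo x ξ) = expo (-x) ξ := by
  rw [expo, expo, ← Complex.exp_conj]
  simp [Finset.sum_neg_distrib]

theorem continuous_symbol (v : Laurent d) : Continuous fun ξ => symbol ξ v := by
  simp only [symbol_eq_sum]
  refine continuous_finsetSum _ fun k _ => continuous_const.mul (expo_contDiff (toR k)).continuous

theorem norm_coeff_le_of_symbol {v : Laurent d} (h : ∀ x ∈ unitCube d, ‖symbol ((2 * π) • x) v‖ ≤ B)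
    (k : ℤ^d) : ‖v.coeff k‖ ≤ B := by
  have hc : ∀ l : ℤ^d, IntegrableOn (fun x => expo x ((2 * π) • toR l)) (unitCube d) :=
    fun l => Measure.integrableOn_of_bounded (M := 1) (by simp [volume_unitCube])
      (continuous_expo _).aestronglyMeasurable (ae_of_all _ fun x => (norm_expo _ _).le)
  have h1 : ∫ x in unitCube d, symbol ((2 * π) • x) v * expo x ((2 * π) • toR (-k)) =
      v.coeff k := by
    have h2 : ∀ x : ℝ^d, symbol ((2 * π) • x) v * expo x ((2 * π) • toR (-k)) =
        ∑ l ∈ v.coeff.support, v.coeff l * expo x ((2 * π) • toR (l - k)) := fun x => by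
      rw [symbol_eq_sum, sum_mul]
      refine sum_congr rfl fun l _ => ?_
      rw [expo_comm, expo_smul, mul_assoc, ← expo_add_right, ← smul_add, ← toR_add, sub_eq_add_neg]
    simp only [h2]
    rw [integral_finsetSum _ fun l _ => (hc _).const_mul _]
    simp only [integral_const_mul]
    by_cases hk : k ∈ v.coeff.support
    · rw [Finset.sum_eq_single_of_mem k hk fun l _ hl => by
        rw [integral_unitCube_expo (sub_ne_zero.2 hl), mul_zero]]
      simp [toR_zero, expo_zero_right, Measure.real, volume_unitCube]
    · rw [Finsupp.notMem_support_iff.1 hk]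
      refine sum_eq_zero fun l hl => ?_
      rw [integral_unitCube_expo (sub_ne_zero.2 ?_), mul_zero]
      rintro rfl
      exact hk hl
  rw [← h1]
  refine (norm_setIntegral_le_of_norm_le_const (by simp [volume_unitCube]) fun x hx => ?_).trans
    (b := B * volume.real (unitCube d)) (by simp [Measure.real, volume_unitCube])
  rw [norm_mul, norm_expo, mul_one]
  exact h x hx

theorem norm_coeff_mul_le (v F : Laurent d) (hF : ∀ k, ‖F.coeff k‖ ≤ B) (k : ℤ^d) :
    ‖(v * F).coeff k‖ ≤ (∑ l ∈ v.coeff.support, ‖v.coeff l‖) * B := by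
  rw [AddMonoidAlgebra.coeff_mul_apply_left, sum_mul]
  refine norm_sum_le_of_le _ fun l _ => ?_
  rw [norm_mul]
  exact mul_le_mul_of_nonneg_left (hF _) (norm_nonneg _)

theorem support_pow_subset {R : ℕ} {u : Laurent d} (hu : u.coeff.support ⊆ box d R) (n : ℕ) :
    (u ^ n).coeff.support ⊆ box d (n * R) := by
  induction n with
  | zero =>
    intro k hk
    rw [pow_zero, AddMonoidAlgebra.one_def, AddMonoidAlgebra.coeff_single] at hk
    have := Finset.mem_singleton.1 (Finsupp.support_single_subset hk)
    simp [this, mem_box]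
  | succ n ih =>
    intro k hk
    rw [pow_succ', Finsupp.mem_support_iff, AddMonoidAlgebra.coeff_mul_apply_left] at hk
    obtain ⟨l, hl, hlk⟩ := Finset.exists_ne_zero_of_sum_ne_zero hk
    have h1 := mem_box.1 (hu hl)
    have h2 := mem_box.1 (ih (Finsupp.mem_support_iff.2 (right_ne_zero_of_mul hlk)))
    refine mem_box.2 fun i => ?_
    have h3 := abs_add_le (l i) ((-l + k) i)
    have h4 : l i + (-l + k) i = k i := by simp
    rw [h4] at h3
    have := h1 i
    have := h2 i
    push_cast at *
    linarith

theorem exists_pow_small {u : Laurent d} {θ : ℝ} (hθ0 : 0 ≤ θ) (hθ1 : θ < 1)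
    (h : ∀ x ∈ unitCube d, ‖symbol ((2 * π) • x) u‖ ≤ θ) : ∃ n, ∑ l ∈ (u ^ n).coeff.support,
      ‖(u ^ n).coeff l‖ ≤ 1 / 2 := by
  obtain ⟨R, hR⟩ : ∃ R, u.coeff.support ⊆ box d R := by
    obtain ⟨R, hR⟩ := exists_suppIn (d := d) (s := 1) (r := 1)
      (u.coeff.mapRange (fun c => Matrix.of fun _ _ => c) rfl)
    refine ⟨R, fun k hk => mem_box.2 fun i => hR k (fun h => Finsupp.mem_support_iff.1 hk ?_) i⟩
    exact congrFun (congrFun h 0) 0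
  have h1 : Tendsto (fun n : ℕ => (2 * (R : ℝ) + 1) ^ d * ((n : ℝ) ^ d * θ ^ n)) atTop
      (𝓝 ((2 * (R : ℝ) + 1) ^ d * 0)) :=
    (tendsto_pow_const_mul_const_pow_of_abs_lt_one d (by rwa [abs_of_nonneg hθ0])).const_mul _
  rw [mul_zero] at h1
  obtain ⟨n, hn, hn1⟩ := ((h1.eventually_le_const (one_half_pos (α := ℝ))).and
    (eventually_ge_atTop 1)).exists
  refine ⟨n, le_trans ?_ hn⟩
  have h2 : ∀ l, ‖(u ^ n).coeff l‖ ≤ θ ^ n := norm_coeff_le_of_symbol fun x hx => by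
    rw [map_pow, norm_pow]
    exact pow_le_pow_left₀ (norm_nonneg _) (h x hx) n
  have h3 : ((u ^ n).coeff.support.card : ℝ) ≤ ((2 * (R : ℝ) + 1) * n) ^ d := by
    have h4 := Finset.card_le_card (support_pow_subset hR n)
    have h5 : (box d (n * R)).card = (2 * (n * R) + 1) ^ d := by
      rw [box, Fintype.card_piFinset_const, Int.card_Icc]
      congr 1
      omega
    rw [h5] at h4
    refine (Nat.cast_le (α := ℝ).2 h4).trans ?_
    have h6 : (1 : ℝ) ≤ n := by exact_mod_cast hn1
    push_cast
    refine pow_le_pow_left₀ (by positivity) ?_ _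
    nlinarith
  calc _ ≤ ∑ l ∈ (u ^ n).coeff.support, θ ^ n := sum_le_sum fun l _ => h2 l
    _ = (u ^ n).coeff.support.card * θ ^ n := by rw [Finset.sum_const, nsmul_eq_mul]
    _ ≤ ((2 * (R : ℝ) + 1) * n) ^ d * θ ^ n := mul_le_mul_of_nonneg_right h3 (by positivity)
    _ = _ := by rw [mul_pow, mul_assoc]

/-- A Laurent polynomial without zeros on the torus has a multiple that is invertible for the
supremum norm of finitely supported sequences. -/
theorem exists_multiple_bounded_below {p : Laurent d} (hp : ∀ ξ, symbol ξ p ≠ 0) :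
    ∃ (q : Laurent d) (C : ℝ), ∀ (F : Laurent d) (B : ℝ), (∀ k, ‖((p * q) * F).coeff k‖ ≤ B) → ∀ k,
      ‖F.coeff k‖ ≤ C * B := by
  let q : Laurent d := ∑ k ∈ p.coeff.support,
    AddMonoidAlgebra.single (-k) ((starRingEnd ℂ) (p.coeff k))
  have hq : ∀ ξ, symbol ξ (p * q) = ((‖symbol ξ p‖ ^ 2 : ℝ) : ℂ) := fun ξ => by
    have h1 : symbol ξ q = (starRingEnd ℂ) (symbol ξ p) := by
      rw [map_sum, symbol_eq_sum, map_sum]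
      refine sum_congr rfl fun k _ => ?_
      rw [symbol_single, map_mul, conj_expo, toR_neg]
    rw [map_mul, h1, Complex.mul_conj, Complex.normSq_eq_norm_sq]
  have hcont : Continuous fun x : ℝ^d => ‖symbol ((2 * π) • x) p‖ ^ 2 :=
    ((continuous_symbol p).comp (continuous_const_smul _)).norm.pow 2
  have hne : (Set.Icc (0 : ℝ^d) 1).Nonempty := ⟨0, le_rfl, zero_le_one⟩
  obtain ⟨x₀, -, hmin⟩ := isCompact_Icc.exists_isMinOn hne hcont.continuousOn
  obtain ⟨x₁, hx₁, hmax⟩ := isCompact_Icc.exists_isMaxOn hne hcont.continuousOn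
  set δ := ‖symbol ((2 * π) • x₀) p‖ ^ 2
  set c := ‖symbol ((2 * π) • x₁) p‖ ^ 2
  have hδ : 0 < δ := by have := norm_pos_iff.2 (hp ((2 * π) • x₀)); positivity
  have hc : 0 < c := by have := norm_pos_iff.2 (hp ((2 * π) • x₁)); positivity
  have hδc : δ ≤ c := hmin hx₁
  let u : Laurent d := 1 - (c : ℂ)⁻¹ • (p * q)
  have hu : ∀ x ∈ unitCube d, ‖symbol ((2 * π) • x) u‖ ≤ 1 - δ / c := fun x hx => by
    have hx' : x ∈ Set.Icc (0 : ℝ^d) 1 :=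
      ⟨fun i => (mem_unitCube.1 hx i).1, fun i => (mem_unitCube.1 hx i).2.le⟩
    have h1 : δ ≤ ‖symbol ((2 * π) • x) p‖ ^ 2 := hmin hx'
    have h2 : ‖symbol ((2 * π) • x) p‖ ^ 2 ≤ c := hmax hx'
    rw [map_sub, map_one, map_smul, hq, smul_eq_mul, ← Complex.ofReal_inv, ← Complex.ofReal_mul,
      ← Complex.ofReal_one, ← Complex.ofReal_sub, Complex.norm_real, Real.norm_of_nonneg,
      inv_mul_eq_div]
    · gcongr
    · rw [inv_mul_eq_div, sub_nonneg, div_le_one hc]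
      exact h2
  obtain ⟨n, hn⟩ := exists_pow_small (sub_nonneg.2 ((div_le_one hc).2 hδc))
    (sub_lt_self _ (div_pos hδ hc)) hu
  let S : Laurent d := (c : ℂ)⁻¹ • ∑ i ∈ Finset.range n, u ^ i
  have hS : ∀ F : Laurent d, F = S * ((p * q) * F) + u ^ n * F := fun F => by
    have h1 : S * (p * q) = 1 - u ^ n := by
      rw [← geom_sum_mul_neg u n, smul_mul_assoc, ← mul_smul_comm]
      simp [u]
    rw [← mul_assoc, h1]
    ring
  refine ⟨q, 2 * ∑ l ∈ S.coeff.support, ‖S.coeff l‖, fun F B hB => ?_⟩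
  obtain ⟨k₀, hk₀⟩ : ∃ k₀, ∀ k, ‖F.coeff k‖ ≤ ‖F.coeff k₀‖ := by
    obtain ⟨k₀, -, h⟩ := Finset.exists_max_image (insert 0 F.coeff.support)
      (fun k => ‖F.coeff k‖) (Finset.insert_nonempty _ _)
    refine ⟨k₀, fun k => ?_⟩
    by_cases hk : F.coeff k = 0
    · simp [hk]
    · exact h k (Finset.mem_insert_of_mem (Finsupp.mem_support_iff.2 hk))
  have h1 := norm_coeff_mul_le S ((p * q) * F) hB k₀
  have h2 := norm_coeff_mul_le (u ^ n) F hk₀ k₀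
  have h3 : ‖F.coeff k₀‖ ≤ ‖(S * ((p * q) * F)).coeff k₀‖ + ‖(u ^ n * F).coeff k₀‖ := by
    conv_lhs => rw [hS F]
    exact norm_add_le _ _
  have h4 := mul_le_mul_of_nonneg_right hn (norm_nonneg (F.coeff k₀))
  intro k
  linarith [hk₀ k]

end

section

/-! ### Gram symbols and stable shifts -/

variable {d r R : ℕ} {g : Fin r → ℝ^d → ℂ}

/-- The matrix of the correlations `∑ₗ (∫ gᵢ(x + l) conj (gⱼ(x)) dx) δₗ`. -/
def gram (R : ℕ) (g : Fin r → ℝ^d → ℂ) : Matrix (Fin r) (Fin r) (Laurent d) :=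
  Matrix.of fun i j => ∑ l ∈ box d (R + R),
    AddMonoidAlgebra.single l (∫ x, g i (x + toR l) * (starRingEnd ℂ) (g j x))

theorem SuppCube.mem_box_add (hg : SuppCube R g) {x : ℝ^d} {i j : Fin r} {l : ℤ^d} (hx : g j x ≠ 0)
    (hl : g i (x + toR l) ≠ 0) : l ∈ box d (R + R) :=
  hg.mem_box (fun n => by
    push_cast
    exact add_le_add_left (not_lt.1 fun h => hx (hg j x n h)) _) hl

theorem coeff_gram (hg : SuppCube R g) (i j : Fin r) (l : ℤ^d) : (gram R g i j).coeff l = ∫ x,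
      g i (x + toR l) * (starRingEnd ℂ) (g j x) := by
  classical
  simp only [gram, Matrix.of_apply, AddMonoidAlgebra.coeff_sum, AddMonoidAlgebra.coeff_single,
    Finsupp.finsetSum_apply, Finsupp.single_apply, Finset.sum_ite_eq']
  split_ifs with h
  · rfl
  · refine (integral_eq_zero_of_ae (ae_of_all _ fun x => ?_)).symm
    by_contra hne
    obtain ⟨h1, h2⟩ := ne_zero_and_ne_zero_of_mul hne
    exact h (hg.mem_box_add (fun h => h2 (by rw [h, map_zero])) h1)

/-- The sum `∑ₗ ∫ F(x + l) conj (F(x)) dx` vanishes only if the periodization of `F` does. -/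
theorem integral_expo_mul_eq_zero_of_gram {F : ℝ^d → ℂ} (hc : Continuous F)
    (hR : ∀ x i, (R : ℝ) < |x i| → F x = 0) (h : ∑ l ∈ box d (R + R), ∫ x, F (x + toR l) *
    (starRingEnd ℂ) (F x) = 0) (k : ℤ^d) : ∫ x, expo x ((2 * π) • toR k) * F x = 0 := by
  have hcs : HasCompactSupport F :=
    SuppCube.hasCompactSupport (r := 1) (f := fun _ => F) (fun _ => hR) 0
  have hi : Integrable F := hc.integrable_of_hasCompactSupport hcs
  have hPc := continuous_periodization hR hc
  have hcube : ∀ x ∈ unitCube d, ∀ i, |x i| + R ≤ (R + 1 : ℕ) := fun x hx i => by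
    have := mem_unitCube.1 hx i
    rw [abs_of_nonneg this.1]
    push_cast
    linarith
  have h1 : ∫ x, periodization F x * (starRingEnd ℂ) (F x) = 0 := by
    rw [← h, ← integral_finsetSum]
    · refine integral_congr_ae (ae_of_all _ fun x => ?_)
      by_cases hx : F x = 0
      · simp [hx]
      · dsimp only
        rw [← sum_mul, periodization_eq_sum hR fun i => ?_]
        push_cast
        exact add_le_add_left (not_lt.1 fun h => hx (hR x i h)) _
    · exact fun l _ => ((hc.comp (continuous_id.add continuous_const)).mul
        (Complex.continuous_conj.comp hc)).integrable_of_hasCompactSupport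
          (hcs.comp_left (g := starRingEnd ℂ) (map_zero _)).mul_left
  have hPi : Integrable fun x => periodization F x * (starRingEnd ℂ) (F x) :=
    (hPc.mul (Complex.continuous_conj.comp hc)).integrable_of_hasCompactSupport
      (hcs.comp_left (g := starRingEnd ℂ) (map_zero _)).mul_left
  have h2 : ∫ x in unitCube d, ‖periodization F x‖ ^ 2 = 0 := by
    rw [integral_eq_setIntegral_unitCube (R := R) hPi fun x i hx => by simp [hR x i hx]] at h1
    rw [setIntegral_congr_fun (g := fun x => ((‖periodization F x‖ ^ 2 : ℝ) : ℂ))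
      measurableSet_unitCube fun x hx => ?_] at h1
    · exact Complex.ofReal_eq_zero.1 (integral_ofReal.symm.trans h1)
    · simp only [periodization_add_toR]
      rw [← mul_sum, ← map_sum, ← periodization_eq_sum hR (hcube x hx), Complex.mul_conj,
        Complex.normSq_eq_norm_sq]
  have h3 := (setIntegral_eq_zero_iff_of_nonneg_ae (ae_of_all _ fun x => sq_nonneg _)
    (((hPc.norm.pow 2).integrableOn_Icc (a := 0) (b := 1)).mono_set fun x hx =>
      ⟨fun i => (mem_unitCube.1 hx i).1, fun i => (mem_unitCube.1 hx i).2.le⟩)).1 h2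
  rw [integral_eq_setIntegral_unitCube (integrable_expo_mul hi _) fun x i hx => by
    rw [hR x i hx, mul_zero]]
  refine integral_eq_zero_of_ae ?_
  filter_upwards [h3, ae_restrict_mem measurableSet_unitCube] with x hx hxc
  simp only [expo_add_toR_two_pi]
  rw [← mul_sum, ← periodization_eq_sum hR (hcube x hxc)]
  have : periodization F x = 0 := by simpa using hx
  rw [this, mul_zero, Pi.zero_apply]

theorem symbol_det_gram_ne_zero (hg : SuppCube R g) (hc : ∀ j, Continuous (g j)) {ξ : ℝ^d}
    (hs : span ℂ (Set.range fun k : ℤ^d => (Matrix.of fun j _ => ∫ x, expo x (ξ + (2 * π) • toR k) *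
    g j x : Mat r 1)) = ⊤) : symbol ξ (gram R g).det ≠ 0 := fun hdet => by
  rw [AlgHom.map_det, ← Matrix.exists_mulVec_eq_zero_iff] at hdet
  obtain ⟨c, hc0, hcz⟩ := hdet
  have hgi : ∀ j, Integrable (g j) := fun j =>
    (hc j).integrable_of_hasCompactSupport (hg.hasCompactSupport j)
  let F : ℝ^d → ℂ := fun x => expo x ξ * ∑ i, (starRingEnd ℂ) (c i) * g i x
  have hFc : Continuous F := (continuous_expo ξ).mul
    (continuous_finsetSum _ fun i _ => continuous_const.mul (hc i))
  have hFR : ∀ x i, (R : ℝ) < |x i| → F x = 0 := fun x i hx => by simp [F, fun j => hg j x i hx]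
  have hprod : ∀ l x, F (x + toR l) * (starRingEnd ℂ) (F x) = ∑ i, ∑ j,
      ((starRingEnd ℂ) (c i) * expo (toR l) ξ * c j) *
        (g i (x + toR l) * (starRingEnd ℂ) (g j x)) := fun l x => by
    have h1 : expo (x + toR l) ξ * (starRingEnd ℂ) (expo x ξ) = expo (toR l) ξ := by
      rw [conj_expo, ← expo_add_left, add_right_comm, add_neg_cancel, zero_add]
    simp only [F, map_mul, map_sum, Complex.conj_conj]
    rw [mul_mul_mul_comm, h1, Finset.sum_mul_sum, mul_sum]
    refine sum_congr rfl fun i _ => ?_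
    rw [mul_sum]
    exact sum_congr rfl fun j _ => by ring
  have hint : ∀ i j l, Integrable fun x => g i (x + toR l) * (starRingEnd ℂ) (g j x) :=
    fun i j l => (((hc i).comp (continuous_id.add continuous_const)).mul
      (Complex.continuous_conj.comp (hc j))).integrable_of_hasCompactSupport
        ((hg.hasCompactSupport j).comp_left (g := starRingEnd ℂ) (map_zero _)).mul_left
  have hzero : ∑ l ∈ box d (R + R), ∫ x, F (x + toR l) * (starRingEnd ℂ) (F x) = 0 := by
    have h1 : ∀ l, ∫ x, F (x + toR l) * (starRingEnd ℂ) (F x) = ∑ i, ∑ j,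
        ((starRingEnd ℂ) (c i) * expo (toR l) ξ * c j) *
          ∫ x, g i (x + toR l) * (starRingEnd ℂ) (g j x) := fun l => by
      simp only [hprod]
      rw [integral_finsetSum _ fun i _ => integrable_finsetSum _ fun j _ =>
        (hint i j l).const_mul _]
      refine sum_congr rfl fun i _ => ?_
      rw [integral_finsetSum _ fun j _ => (hint i j l).const_mul _]
      simp only [integral_const_mul]
    simp only [h1]
    rw [sum_comm]
    refine sum_eq_zero fun i _ => ?_
    have h2 := congrFun hcz i
    rw [Matrix.mulVec, dotProduct, Pi.zero_apply] at h2
    rw [sum_comm, ← mul_zero ((starRingEnd ℂ) (c i)), ← h2, mul_sum]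
    refine sum_congr rfl fun j _ => ?_
    rw [AlgHom.mapMatrix_apply, Matrix.map_apply, gram, Matrix.of_apply, map_sum, sum_mul, mul_sum]
    refine sum_congr rfl fun l _ => ?_
    rw [symbol_single]
    ring
  have hfun : ∀ k : ℤ^d, ∑ i, (starRingEnd ℂ) (c i) *
      ∫ x, expo x (ξ + (2 * π) • toR k) * g i x = 0 := fun k => by
    rw [← integral_expo_mul_eq_zero_of_gram hFc hFR hzero k]
    simp only [← integral_const_mul]
    rw [← integral_finsetSum _ fun i _ => (integrable_expo_mul (hgi i) _).const_mul _]
    refine integral_congr_ae (ae_of_all _ fun x => ?_)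
    simp only [F, mul_sum, expo_add_right]
    exact sum_congr rfl fun i _ => by ring
  let L : Mat r 1 →ₗ[ℂ] ℂ :=
    { toFun := fun M => ∑ i, (starRingEnd ℂ) (c i) * M i 0
      map_add' := fun M N => by simp [mul_add, sum_add_distrib]
      map_smul' := fun a M => by simp [mul_sum, mul_left_comm] }
  have hL : (⊤ : Submodule ℂ (Mat r 1)) ≤ LinearMap.ker L := by
    rw [← hs, Submodule.span_le]
    rintro _ ⟨k, rfl⟩
    exact hfun k
  have h1 : ∑ i, (starRingEnd ℂ) (c i) * c i = 0 :=
    hL (Submodule.mem_top (x := Matrix.of fun i _ => c i))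
  have h2 : ∑ i, ‖c i‖ ^ 2 = 0 := by
    have : ((∑ i, ‖c i‖ ^ 2 : ℝ) : ℂ) = 0 := by
      rw [← h1, Complex.ofReal_sum]
      refine sum_congr rfl fun i _ => ?_
      rw [mul_comm, Complex.mul_conj, Complex.normSq_eq_norm_sq]
    exact_mod_cast this
  refine hc0 (funext fun i => ?_)
  have := (Finset.sum_eq_zero_iff_of_nonneg fun i _ => by positivity).1 h2 i (mem_univ i)
  simpa using this

end

section

/-! ### Decay of the iterated masks for stable shifts -/

variable {d r S R lam m : ℕ} {θ f : ℝ^d → ℂ} {υ : Filt d 1 r} {g : Fin r → ℝ^d → ℂ} {W : Filt d r 1}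
  {a : Filt d r r}

/-- The filter `W` consists of the integrals of the shifts of `g` against `θ`. -/
def IsCorrelation (g : Fin r → ℝ^d → ℂ) (θ : ℝ^d → ℂ) (W : Filt d r 1) : Prop :=
  ∀ k i, W k i 0 = ∫ x, g i (x + toR k) * θ x

theorem hasCompactSupport_of_abs_le (hθ : ∀ x i, (S : ℝ) < |x i| → θ x = 0) : HasCompactSupport θ :=
  SuppCube.hasCompactSupport (r := 1) (f := fun _ => θ) (fun _ => hθ) 0

theorem integrable_shift_mul (hf : Continuous f) (hθ : Continuous θ)
    (hS : ∀ x i, (S : ℝ) < |x i| → θ x = 0) : Integrable fun x => f x * θ x :=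
  (hf.mul hθ).integrable_of_hasCompactSupport (hasCompactSupport_of_abs_le hS).mul_left

theorem IsCorrelation.moment_eq {N : ℕ} (hW : IsCorrelation g θ W) (hg : SuppCube R g)
    (hc : ∀ j, Continuous (g j)) (hr : Reproduces N υ g) (hθ : Continuous θ)
    (hS : ∀ x i, (S : ℝ) < |x i| → θ x = 0) {p : ℝ^d → ℂ} (hp : p ∈ polySpace d N) : moment υ W p =
      ∫ x, p (-x) * θ x := by
  have hbox : ∀ x j k, θ x ≠ 0 → g j (x + toR k) ≠ 0 → k ∈ box d (S + R) := fun x j k hx hk =>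
    hg.mem_box (fun i => by
      push_cast
      exact add_le_add_left (not_lt.1 fun h => hx (hS x i h)) _) hk
  rw [moment_eq_sum_sum υ W (F := box d (S + R)) fun k hk => ?_]
  · have h1 : ∀ x, p (-x) * θ x = ∑ z ∈ υ.support, ∑ j, ∑ k ∈ box d (S + R),
        (υ z 0 j * p (toR z + toR k)) * (g j (x + toR k) * θ x) := fun x => by
      by_cases hx : θ x = 0
      · simp [hx]
      · rw [← hr x p hp, moment_samp hg υ x (F := box d (S + R)) fun j k hk => hbox x j k hx hk]
        simp only [sum_mul, mul_assoc]
    have hi : ∀ z j k, Integrable fun x =>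
        (υ z 0 j * p (toR z + toR k)) * (g j (x + toR k) * θ x) := fun z j k =>
      (integrable_shift_mul ((hc j).comp (continuous_id.add continuous_const)) hθ hS).const_mul _
    simp only [h1]
    rw [integral_finsetSum _ fun z _ => integrable_finsetSum _ fun j _ =>
      integrable_finsetSum _ fun k _ => hi z j k]
    refine sum_congr rfl fun z _ => ?_
    rw [integral_finsetSum _ fun j _ => integrable_finsetSum _ fun k _ => hi z j k]
    refine sum_congr rfl fun j _ => ?_
    rw [integral_finsetSum _ fun k _ => hi z j k]
    refine sum_congr rfl fun k _ => ?_
    rw [integral_const_mul, hW]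
  · by_contra hb
    refine hk (Matrix.ext fun i j => ?_)
    rw [Subsingleton.elim j 0, hW, Matrix.zero_apply]
    refine integral_eq_zero_of_ae (ae_of_all _ fun x => ?_)
    by_contra hne
    obtain ⟨h1, h2⟩ := ne_zero_and_ne_zero_of_mul hne
    exact hb (hbox x i k h2 h1)

theorem IsCorrelation.conv_mask_apply [NeZero lam] (hW : IsCorrelation g θ W) (hg : SuppCube R g)
    (hc : ∀ j, Continuous (g j)) (hgc : cascade lam a g = g) (hθ : Continuous θ)
    (hS : ∀ x i, (S : ℝ) < |x i| → θ x = 0) (n : ℕ) (k : ℤ^d) (i : Fin r) :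
    conv (mask lam a n) W k i 0 = ∫ x, g i (((lam : ℝ) ^ n)⁻¹ • (x + toR k)) * θ x := by
  have h1 : ∀ x, g i (((lam : ℝ) ^ n)⁻¹ • (x + toR k)) * θ x =
      ∑ z ∈ (mask lam a n).support, ∑ j, mask lam a n z i j *
        (g j (x + toR (k - z)) * θ x) := fun x => by
    have h2 := congrFun (congrFun (conv_mask_samp (lam := lam) a hg n x k) i) 0
    rw [Function.iterate_fixed hgc, conv_apply, pairing_def, Matrix.sum_apply] at h2
    rw [show g i (((lam : ℝ) ^ n)⁻¹ • (x + toR k)) =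
      col g (((lam : ℝ) ^ n)⁻¹ • (x + toR k)) i 0 from rfl, ← h2, sum_mul]
    refine sum_congr rfl fun z _ => ?_
    rw [samp_apply hg, Matrix.mul_apply, sum_mul]
    exact sum_congr rfl fun j _ => mul_assoc _ _ _
  have hi : ∀ z j, Integrable fun x => mask lam a n z i j * (g j (x + toR (k - z)) * θ x) :=
    fun z j =>
      (integrable_shift_mul ((hc j).comp (continuous_id.add continuous_const)) hθ hS).const_mul _
  simp only [h1]
  rw [conv_apply, pairing_def, Matrix.sum_apply,
    integral_finsetSum _ fun z _ => integrable_finsetSum _ fun j _ => hi z j]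
  refine sum_congr rfl fun z _ => ?_
  rw [Matrix.mul_apply, integral_finsetSum _ fun j _ => hi z j]
  refine sum_congr rfl fun j _ => ?_
  rw [integral_const_mul, hW]

/-- Integrating the dilates of a `C^m` function against a function with `m + 1` vanishing moments
gives `o(λ^{-mn})`. -/
theorem eventually_integral_dilate_mul_le (hlam : 2 ≤ lam) (hf : ContDiff ℝ m f)
    (hfc : HasCompactSupport f) (hθ : Continuous θ) (hS : ∀ x i, (S : ℝ) < |x i| → θ x = 0)
    (h0 : ∀ p ∈ polySpace d (m + 1), ∫ x, p (-x) * θ x = 0) {ε : ℝ} (hε : 0 < ε) :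
    ∀ᶠ n : ℕ in atTop, ∀ k : ℤ^d, (lam : ℝ) ^ (m * n) * ‖∫ x, f (((lam : ℝ) ^ n)⁻¹ • (x + toR k)) *
      θ x‖ ≤ ε := by
  have hl0 : (0 : ℝ) < lam := by exact_mod_cast (by omega : 0 < lam)
  have hθi : Integrable θ := hθ.integrable_of_hasCompactSupport (hasCompactSupport_of_abs_le hS)
  set K : ℝ := (S : ℝ) ^ m * ∫ x, ‖θ x‖ with hK
  have hK0 : 0 ≤ K := mul_nonneg (by positivity) (integral_nonneg fun x => norm_nonneg _)
  have huc : UniformContinuous (iteratedFDeriv ℝ m f) :=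
    (hfc.iteratedFDeriv m).uniformContinuous_of_continuous (hf.continuous_iteratedFDeriv le_rfl)
  have hε' : 0 < ε / (K + 1) := by positivity
  obtain ⟨δ, hδ, hδε⟩ := Metric.uniformContinuous_iff.1 huc _ hε'
  have hlim : Tendsto (fun n : ℕ => ((lam : ℝ) ^ n)⁻¹ * S) atTop (𝓝 0) := by
    have := (tendsto_inv_atTop_zero.comp (tendsto_pow_atTop_atTop_of_one_lt
      (show (1 : ℝ) < lam by exact_mod_cast hlam))).mul_const (S : ℝ)
    rwa [zero_mul] at this
  filter_upwards [hlim.eventually_lt_const hδ] with n hn k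
  set c : ℝ := ((lam : ℝ) ^ n)⁻¹ with hc
  have hc0 : 0 < c := by positivity
  obtain ⟨p, hp, hpf⟩ := exists_taylor_approx hf (c • toR k)
  have hp0 : ∫ x, p (c • x) * θ x = 0 := by
    rw [← h0 _ (dilate_mem hp (-c))]
    simp
  have hpc : Continuous fun x : ℝ^d => p (c • x) :=
    (continuous_of_mem_polySpace hp).comp (continuous_const_smul c)
  have hfcont : Continuous fun x => f (c • (x + toR k)) :=
    hf.continuous.comp ((continuous_id.add continuous_const).const_smul c)
  have h1 : ∫ x, f (c • (x + toR k)) * θ x = ∫ x, (f (c • (x + toR k)) - p (c • x)) * θ x := by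
    simp only [sub_mul]
    rw [integral_sub (integrable_shift_mul hfcont hθ hS) (integrable_shift_mul hpc hθ hS), hp0,
      sub_zero]
  have h2 : ‖∫ x, f (c • (x + toR k)) * θ x‖ ≤
      ∫ x, (ε / (K + 1) * (c * S) ^ m) * ‖θ x‖ := by
    rw [h1]
    refine norm_integral_le_of_norm_le (hθi.norm.const_mul _) (ae_of_all _ fun x => ?_)
    rw [norm_mul]
    by_cases hx : θ x = 0
    · simp [hx]
    refine mul_le_mul_of_nonneg_right ?_ (norm_nonneg _)
    have hxS : ‖c • x‖ ≤ c * S := by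
      rw [norm_smul, Real.norm_of_nonneg hc0.le]
      refine mul_le_mul_of_nonneg_left ?_ hc0.le
      exact (pi_norm_le_iff_of_nonneg (by positivity)).2 fun i => not_lt.1 fun h => hx (hS x i h)
    have h3 := hpf (c • x) _ hε'.le fun z hz => by
      rw [← dist_eq_norm]
      exact (hδε (by rw [dist_eq_norm]; exact (hz.trans hxS).trans_lt hn)).le
    rw [← smul_add, add_comm (toR k)] at h3
    exact h3.trans (mul_le_mul_of_nonneg_left (pow_le_pow_left₀ (norm_nonneg _) hxS m) hε'.le)
  rw [integral_const_mul] at h2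
  have h4 : (lam : ℝ) ^ (m * n) * c ^ m = 1 := by
    rw [hc, mul_comm m, pow_mul, ← mul_pow, mul_inv_cancel₀ (by positivity), one_pow]
  calc (lam : ℝ) ^ (m * n) * ‖∫ x, f (c • (x + toR k)) * θ x‖
      ≤ (lam : ℝ) ^ (m * n) * ((ε / (K + 1) * (c * S) ^ m) * ∫ x, ‖θ x‖) :=
        mul_le_mul_of_nonneg_left h2 (by positivity)
    _ = ((lam : ℝ) ^ (m * n) * c ^ m) * (ε / (K + 1) * K) := by rw [hK]; ring
    _ = ε * (K / (K + 1)) := by rw [h4]; ring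
    _ ≤ ε * 1 := mul_le_mul_of_nonneg_left ((div_le_one (by positivity)).2 (by linarith)) hε.le
    _ = ε := mul_one ε

/-- Every filter in the ideal of the determinant of the correlation matrix is a correlation. -/
theorem exists_isCorrelation (hg : SuppCube R g) (hc : ∀ j, Continuous (g j)) {q : Laurent d}
    {F : Fin r → Laurent d} (hW : ∀ k i, W k i 0 = (((gram R g).det * q) * F i).coeff k) :
    ∃ (S : ℕ) (θ : ℝ^d → ℂ), Continuous θ ∧ (∀ x i, (S : ℝ) < |x i| → θ x = 0) ∧
      IsCorrelation g θ W := by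
  let b : Fin r → Laurent d := Matrix.mulVec (gram R g).adjugate fun j => q * F j
  have hb : ∀ i, ∑ j, gram R g i j * b j = ((gram R g).det * q) * F i := fun i => by
    have h1 : Matrix.mulVec (gram R g) b = (gram R g).det • fun j => q * F j := by
      rw [Matrix.mulVec_mulVec, Matrix.mul_adjugate, Matrix.smul_mulVec, Matrix.one_mulVec]
    have h2 := congrFun h1 i
    rw [Pi.smul_apply, smul_eq_mul, ← mul_assoc] at h2
    exact h2
  let θ : ℝ^d → ℂ := fun x => ∑ j, ∑ t ∈ (b j).coeff.support,
    (b j).coeff t * (starRingEnd ℂ) (g j (x + toR t))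
  have hterm : ∀ j (t : ℤ^d), HasCompactSupport fun x => g j (x + toR t) := fun j t =>
    (hg.hasCompactSupport j).comp_homeomorph (Homeomorph.addRight (toR t))
  have hθc : Continuous θ := continuous_finsetSum _ fun j _ => continuous_finsetSum _ fun t _ =>
    continuous_const.mul
      (Complex.continuous_conj.comp ((hc j).comp (continuous_id.add continuous_const)))
  have hθs : HasCompactSupport θ := by
    have h1 : θ = ∑ j, ∑ t ∈ (b j).coeff.support, fun x =>
        (b j).coeff t * (starRingEnd ℂ) (g j (x + toR t)) := by
      funext x
      simp only [θ, Finset.sum_apply]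
    rw [h1]
    exact Finset.sum_induction _ HasCompactSupport (fun _ _ => .add) .zero fun j _ =>
      Finset.sum_induction _ HasCompactSupport (fun _ _ => .add) .zero fun t _ =>
        ((hterm j t).comp_left (g := starRingEnd ℂ) (map_zero _)).mul_left
  obtain ⟨S, hS⟩ := exists_vanishesOutside (r := 1) (g := fun _ => θ) fun _ => hθs
  refine ⟨S, θ, hθc, hS 0, fun k i => ?_⟩
  have hint : ∀ j t, Integrable fun x => (b j).coeff t *
      (g i (x + toR k) * (starRingEnd ℂ) (g j (x + toR t))) := fun j t =>
    ((((hc i).comp (continuous_id.add continuous_const)).mul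
      (Complex.continuous_conj.comp ((hc j).comp
        (continuous_id.add continuous_const)))).integrable_of_hasCompactSupport
          ((hterm j t).comp_left (g := starRingEnd ℂ) (map_zero _)).mul_left).const_mul _
  have h1 : ∀ x, g i (x + toR k) * θ x = ∑ j, ∑ t ∈ (b j).coeff.support, (b j).coeff t *
      (g i (x + toR k) * (starRingEnd ℂ) (g j (x + toR t))) := fun x => by
    simp only [θ, mul_sum]
    exact sum_congr rfl fun j _ => sum_congr rfl fun t _ => mul_left_comm _ _ _
  simp only [h1]
  rw [integral_finsetSum _ fun j _ => integrable_finsetSum _ fun t _ => hint j t, hW, ← hb,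
    AddMonoidAlgebra.coeff_sum, Finsupp.finsetSum_apply]
  refine sum_congr rfl fun j _ => ?_
  rw [integral_finsetSum _ fun t _ => hint j t, AddMonoidAlgebra.coeff_mul_apply_right, Finsupp.sum]
  refine sum_congr rfl fun t _ => ?_
  rw [integral_const_mul, coeff_gram hg, mul_comm, ← integral_add_right_eq_self _ (toR t)]
  refine congrArg _ (integral_congr_ae (ae_of_all _ fun x => ?_))
  simp only [toR_add, toR_neg]
  rw [add_assoc, add_comm (toR t), neg_add_cancel_right]

theorem IsCmRepresentative.decays_of_hasStableShifts [NeZero lam] (hlam : 2 ≤ lam)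
    (hυ : IsMatchingFilter lam (m + 1) a υ) {φ : Fin r → CompactDistribution d}
    (hφ : IsStandardRefinable lam a υ φ) (hgφ : IsCmRepresentative m φ g)
    (hst : HasStableShifts φ) : ∃ ρ : ℝ, 0 < ρ ∧ ρ < ((lam : ℝ) ^ m)⁻¹ ∧
      Decays lam a (vanishingSpace (m + 1) υ) ρ := by
  obtain ⟨R, hg⟩ := hgφ.exists_vanishesOutside
  have hgs : ∀ j, ContDiff ℝ m (g j) := fun j => (hgφ j).1
  have hc : ∀ j, Continuous (g j) := fun j => (hgs j).continuous
  have hgc := hgφ.cascade_eq hlam hφ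
  have hF : ∀ ξ j, distFourier φ ξ j 0 = ∫ x, expo x ξ * g j x := fun ξ j =>
    hgφ.toLin_eq j (expoSmooth ξ)
  have h1 : ∑ j, fourierSeries υ 0 0 j * ∫ x, g j x = 1 := by
    have := congrFun (congrFun hφ.2 0) 0
    simpa only [Matrix.mul_apply, hF, expo_zero_right, one_mul, Matrix.one_apply_eq] using this
  have hr := reproduces_of_cascade_eq hlam hυ hg hc hgc h1
  obtain ⟨q, C, hqC⟩ := exists_multiple_bounded_below (p := (gram R g).det) fun ξ =>
    symbol_det_gram_ne_zero hg hc (ξ := ξ) (by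
      rw [← hst ξ]
      congr 2
      funext k
      ext j l
      rw [Subsingleton.elim l 0, hF]
      rfl)
  refine decays_of_tendsto hlam hυ fun w hw ε hε => ?_
  let e : Filt d r 1 → Fin r → Laurent d := fun u i =>
    AddMonoidAlgebra.ofCoeff (u.mapRange (fun M => M i 0) rfl)
  have he : ∀ u i k, (e u i).coeff k = u k i 0 := fun u i k => rfl
  set P : Laurent d := (gram R g).det * q
  let W : Filt d r 1 := ∑ z ∈ P.coeff.support, P.coeff z • shift z w
  have hWmem : W ∈ vanishingSpace (m + 1) υ :=
    Finset.sum_induction _ (· ∈ vanishingSpace (m + 1) υ) (fun _ _ => vanishingSpace_add)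
      vanishingSpace_zero_mem fun z _ => vanishingSpace_smul _ (shift_mem_vanishingSpace z hw)
  have hWu : ∀ u : Filt d r 1, ∀ k i,
      (∑ z ∈ P.coeff.support, P.coeff z • shift z u) k i 0 = (P * e u i).coeff k := fun u k i => by
    rw [AddMonoidAlgebra.coeff_mul_apply_left, Finsupp.finsetSum_apply, Matrix.sum_apply]
    refine sum_congr rfl fun z _ => ?_
    rw [Finsupp.smul_apply, Matrix.smul_apply, shift_apply, smul_eq_mul, sub_eq_neg_add]
    exact congrArg _ (he u i _).symm
  have hconv : ∀ n k i, conv (mask lam a n) W k i 0 =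
      (P * e (conv (mask lam a n) w) i).coeff k := fun n k i => by
    rw [← hWu, conv_sum_right]
    simp only [conv_smul_right, conv_shift]
  obtain ⟨S, θ, hθ, hS, hcor⟩ := exists_isCorrelation hg hc (hWu w)
  have h0 : ∀ p ∈ polySpace d (m + 1), ∫ x, p (-x) * θ x = 0 := fun p hp => by
    rw [← hcor.moment_eq hg hc hr hθ hS hp]
    exact mem_vanishingSpace_iff.1 hWmem p hp
  have hev := eventually_all.2 fun i => eventually_integral_dilate_mul_le hlam (hgs i)
    (hg.hasCompactSupport i) hθ hS h0 (ε := ε / (|C| + 1)) (by positivity)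
  filter_upwards [hev] with n hn k i
  have hL : (0 : ℝ) < (lam : ℝ) ^ (m * n) := by
    have : (0 : ℝ) < lam := by exact_mod_cast (by omega : 0 < lam)
    positivity
  have h2 := hqC (e (conv (mask lam a n) w) i) (((lam : ℝ) ^ (m * n))⁻¹ * (ε / (|C| + 1)))
    (fun l => by
      rw [← hconv, hcor.conv_mask_apply hg hc hgc hθ hS, ← div_eq_inv_mul, le_div_iff₀' hL]
      exact hn i l) k
  rw [he] at h2
  calc (lam : ℝ) ^ (m * n) * ‖conv (mask lam a n) w k i 0‖
      ≤ (lam : ℝ) ^ (m * n) * (C * (((lam : ℝ) ^ (m * n))⁻¹ * (ε / (|C| + 1)))) :=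
        mul_le_mul_of_nonneg_left h2 hL.le
    _ = C / (|C| + 1) * ε := by field_simp
    _ ≤ 1 * ε := mul_le_mul_of_nonneg_right
        ((div_le_one (by positivity)).2 ((le_abs_self C).trans (by linarith))) hε.le
    _ = ε := one_mul ε

end

end VectorSubdivision

end

theorem theorem1p2 (d r lam m : ℕ) (hd : 1 ≤ d) (hlam : 2 ≤ lam)
    (a : Filt d r r) (υ : Filt d 1 r)
    (hυ : IsMatchingFilter lam (m + 1) a υ)
    (ha : EigenCondition lam m a) :
    (∃! φ : Fin r → CompactDistribution d, IsStandardRefinable lam a υ φ) ∧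
    ∀ φ : Fin r → CompactDistribution d, IsStandardRefinable lam a υ φ →
      (∀ G H : (Fin d → ℕ) → Set (Filt d r 1),
        (∀ μ, deg μ ≤ m → Generates υ μ (G μ)) →
        (∀ μ, deg μ = m → Generates υ μ (H μ)) →
        List.TFAE [
          (m : EReal) < smInfty lam a,
          ConvergesAllOrders lam m a υ φ (momentSpace υ),
          ConvergesAllOrders lam m a υ φ G,
          ConvergesTopOrder lam m a υ φ H,
          SubdivisionCmConvergent lam m a υ] ∧
        ((∃ g, IsCmRepresentative m φ g) → HasStableShifts φ →
          (m : EReal) < smInfty lam a ∧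
          ConvergesAllOrders lam m a υ φ (momentSpace υ) ∧
          ConvergesAllOrders lam m a υ φ G ∧
          ConvergesTopOrder lam m a υ φ H ∧
          SubdivisionCmConvergent lam m a υ)) ∧
      ((m : EReal) < smInfty lam a → CascadeCmConvergent lam m a υ φ) := by
  have : NeZero lam := ⟨by omega⟩
  refine ⟨?_, fun φ hφ => ⟨fun G H hG hH => ?_, fun h => ?_⟩⟩
  · obtain ⟨φ, hφ⟩ := exists_isStandardRefinable hlam ha hυ
    exact ⟨φ, hφ, fun φ' hφ' => hφ'.unique hlam ha hυ hφ⟩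
  · have key := smInfty_tfae hlam hd ha hυ hφ hG hH
    refine ⟨key, fun ⟨g, hg⟩ hst => ?_⟩
    have h := (lt_smInfty_iff_decays hlam ha hυ).2 (hg.decays_of_hasStableShifts hlam hυ hφ hst)
    exact ⟨h, (key.out 0 1).1 h, (key.out 0 2).1 h, (key.out 0 3).1 h, (key.out 0 4).1 h⟩
  · obtain ⟨ρ, hρ, hρm, hD⟩ := (lt_smInfty_iff_decays hlam ha hυ).1 h
    exact hD.cascadeCmConvergent hlam ha hυ hφ hρ hρm
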